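/- **Setting.** Let $k\ge 0$. Let $\mathcal T_h=\mathcal T_h^1\cup\mathcal T_h^2$ be a conforming triangulation in the plane, fitted to an interface: $\mathcal T_h^i$ triangulates $\overline{\Omega_i}$ (that is, $\Omega_i$ is the interior of the union of the closed triangles of $\mathcal T_h^i$), and $\Gamma_h$ is the set of edges shared by a triangle of $\mathcal T_h^1$ and one of $\mathcal T_h^2$; these edges make up the interface $\Gamma$. Let $h$ be the largest diameter $h_K$ of a triangle $K$. The mesh is shape regular with parameter $\sigma$: every $K$ contains a disc of radius $r_K>0$ with $h_K\le\sigma r_K$. The (not necessarily symmetric) $2\times2$ tensors $A_1,A_2$ satisfy $A_i\xi\cdot\xi\ge\alpha|\xi|^2$ with $\alpha>0$, and on the interior of every $K\in\mathcal T_h^i$ the tensor $A_i$ is $C^{k+1}$ with derivatives of order at most $k+1$ bounded by $B$ (for example, $A_i$ constant on each element and bounded by $B$). Let $u\in H^{k+2}(\Omega_1)$, $v\in H^{k+2}(\Omega_2)$ solve the interface problem $$-\nabla\cdot A_1\nabla u=f_1\ \text{in }\Omega_1,\qquad -\nabla\cdot A_2\nabla v=f_2\ \text{in }\Omega_2,\qquad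 u=g_1\ \text{on }\partial\Omega_1\setminus\Gamma,\qquad v=g_2\ \text{on }\partial\Omega_2\setminus\Gamma,$$ $$u-v=\phi,\qquad A_1\nabla u\cdot\mathbf n_1+A_2\nabla v\cdot\mathbf n_2=\psi\quad\text{on }\Gamma,$$ with $f_i\in L^2(\Omega_i)$ and $\mathbf n_i$ the outward unit normal of $\Omega_i$; the equations hold in the sense of distributions, and the boundary and interface conditions in the sense of traces. **Scheme.** $U_h$ consists of the pairs $w=\{w_0,w_b\}$ with $w_0|_K\in P_k(K)$ for each $K\in\mathcal T_h^1$ and $w_b|_e\in P_k(e)$ for each edge $e$ of $\mathcal T_h^1$ (one value on each edge); $U_h^0$ is the subspace with $w_b=0$ on $\partial\Omega_1\setminus\Gamma$. $V_h,V_h^0$ are defined likewise from $\mathcal T_h^2$ and $\Omega_2$, and $\Lambda_h=\{\mu:\mu|_e\in P_k(e),\ e\in\Gamma_h\}$. With $RT_k=P_k^2+\widetilde P_k\,\mathbf x$, where $\widetilde P_k$ denotes the homogeneous polynomials of degree $k$, the discrete gradient $\nabla_d w|_K\in RT_k$ is defined by $$\int_K\nabla_d w\cdot q=-\int_K w_0\,\nabla\cdot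 q+\int_{\partial K}w_b\,(q\cdot\mathbf n)\,ds\qquad\forall q\in RT_k .$$ Let $(u_h,v_h,\lambda_h)\in U_h\times V_h\times\Lambda_h$, $u_h=\{u_0,u_b\}$, $v_h=\{v_0,v_b\}$, be a solution of the weak Galerkin scheme: $u_b=Q_bg_1$ on $\partial\Omega_1\setminus\Gamma$, $v_b=Q_bg_2$ on $\partial\Omega_2\setminus\Gamma$, and $$(A_1\nabla_du_h,\nabla_dw)-\langle\lambda_h,w_b\rangle_\Gamma=(f_1,w_0)\quad\forall w\in U_h^0,$$ $$(A_2\nabla_dv_h,\nabla_d\rho)+\langle\lambda_h,\rho_b\rangle_\Gamma=(f_2,\rho_0)+\langle\psi,\rho_b\rangle_\Gamma\quad\forall\rho\in V_h^0,$$ $$\langle u_b-v_b,\mu\rangle_\Gamma=\langle\phi,\mu\rangle_\Gamma\quad\forall\mu\in\Lambda_h.$$ Here $Q_h=\{Q_0,Q_b\}$ denotes the $L^2$ projections onto $P_k(K)$ on each triangle and onto $P_k(e)$ on each edge ($Q_b$ acts on traces). **Theorem.** There is a constant $C>0$ depending only on $k,\sigma,\alpha,B$ (in particular not on $h$, the mesh,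 the data or the solution) such that in this setting $$\|\nabla_d(Q_hu-u_h)\|+\|\nabla_d(Q_hv-v_h)\|\le C\,h^{k+1}\bigl(\|u\|_{H^{k+2}(\Omega_1)}+\|v\|_{H^{k+2}(\Omega_2)}\bigr),$$ where $\|\cdot\|$ is the $L^2$ norm over the triangles of $\mathcal T_h^1$ and of $\mathcal T_h^2$, respectively. If moreover $h\le\sigma h_K$ for every $K\in\mathcal T_h^1$ with an edge on $\Gamma$ (for example, if the mesh is quasi-uniform), then $$\|A_1\nabla u\cdot\mathbf n_1-\lambda_h\|_{L^2(\Gamma)}\le C\,h^{k+\frac12}\bigl(\|u\|_{H^{k+2}(\Omega_1)}+\|v\|_{H^{k+2}(\Omega_2)}\bigr).$$ -/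

import Mathlib

open Filter Topology MeasureTheory
open scoped ContDiff RealInnerProductSpace Classical

namespace WGInterface

noncomputable section

/-- The Euclidean plane. -/
abbrev Plane : Type := EuclideanSpace ℝ (Fin 2)

/-! ### Sobolev spaces through weak derivatives -/

/-- The classical partial derivative in the `i`-th coordinate direction. -/
def partialD (i : Fin 2) (φ : Plane → ℝ) : Plane → ℝ :=
  fun x => fderiv ℝ φ x (EuclideanSpace.single i 1)

/-- The classical derivative of multi-index `α = (α₁, α₂)`. -/
def multiD (α : ℕ × ℕ) (φ : Plane → ℝ) : Plane → ℝ :=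
  (partialD 0)^[α.1] ((partialD 1)^[α.2] φ)

/-- `g'` is the weak derivative of multi-index `α` of `g` in the open set `U`, tested against
smooth functions with compact support in `U`. -/
def IsWeakDeriv (U : Set Plane) (α : ℕ × ℕ) (g g' : Plane → ℝ) : Prop :=
  ∀ φ : Plane → ℝ, ContDiff ℝ ∞ φ → HasCompactSupport φ → tsupport φ ⊆ U →
    ∫ x in U, g x * multiD α φ x = (-1) ^ (α.1 + α.2) * ∫ x in U, g' x * φ x

/-- `g ∈ H^m(U)`. -/
def MemSobolev (U : Set Plane) (m : ℕ) (g : Plane → ℝ) : Prop :=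
  MemLp g 2 (volume.restrict U) ∧
    ∀ α : ℕ × ℕ, α.1 + α.2 ≤ m →
      ∃ g' : Plane → ℝ, MemLp g' 2 (volume.restrict U) ∧ IsWeakDeriv U α g g'

/-- The square-integrable weak derivative of multi-index `α` in `U` (unique almost everywhere
in `U` when it exists; an arbitrary function otherwise). -/
def weakD (U : Set Plane) (α : ℕ × ℕ) (g : Plane → ℝ) : Plane → ℝ :=
  Classical.epsilon fun g' => MemLp g' 2 (volume.restrict U) ∧ IsWeakDeriv U α g g'

/-- The norm of `H^m(U)`: the square root of the sum, over all multi-indices of order at most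
`m`, of the squared `L²(U)` norms of the weak derivatives. -/
def sobolevNorm (U : Set Plane) (m : ℕ) (g : Plane → ℝ) : ℝ :=
  Real.sqrt (∑ j ∈ Finset.range (m + 1), ∑ α ∈ Finset.HasAntidiagonal.antidiagonal j,
    ∫ x in U, (weakD U α g x) ^ 2)

/-- The weak gradient. -/
def weakGrad (U : Set Plane) (g : Plane → ℝ) : Plane → Plane :=
  fun x => !₂[weakD U (1, 0) g x, weakD U (0, 1) g x]

/-! ### Triangles and edges, given by their sets of vertices -/

/-- The closed triangle or segment with the given vertices. -/
def hull (s : Finset Plane) : Set Plane := convexHull ℝ (s : Set Plane)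

/-- The open triangle with the given vertices. -/
def openTri (t : Finset Plane) : Set Plane := interior (hull t)

/-- The three edges of a triangle. -/
def triEdges (t : Finset Plane) : Finset (Finset Plane) := t.powersetCard 2

/-- All edges of a set of triangles. -/
def meshEdges (T : Finset (Finset Plane)) : Finset (Finset Plane) := T.biUnion triEdges

/-- Arc length on an edge. -/
def edgeMeasure (e : Finset Plane) : Measure Plane :=
  (Measure.hausdorffMeasure 1).restrict (hull e)

/-- The unit normal to the edge `e` that points out of every triangle of `T` with edge `e`
(used when there is exactly one such triangle). -/
def outwardNormal (T : Finset (Finset Plane)) (e : Finset Plane) : Plane :=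
  Classical.epsilon fun n : Plane => ‖n‖ = 1 ∧ (∀ a ∈ e, ∀ b ∈ e, ⟪n, b - a⟫ = 0) ∧
    ∀ t ∈ T, e ⊆ t → ∀ a ∈ e, ∀ c ∈ t, c ∉ e → ⟪n, c - a⟫ < 0

/-- `τ` is the trace on the edge `e` of the `H¹` function `g` on the triangle `t`: smooth
functions that converge to `g` in `H¹` of the triangle have restrictions to `e` that
converge to `τ` in `L²(e)`. -/
def IsTraceFrom (t e : Finset Plane) (g τ : Plane → ℝ) : Prop :=
  ∃ φ : ℕ → Plane → ℝ, (∀ n, ContDiff ℝ ∞ (φ n)) ∧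
    Tendsto (fun n => eLpNorm (fun x => φ n x - g x) 2 (volume.restrict (openTri t)))
      atTop (𝓝 0) ∧
    Tendsto (fun n => eLpNorm (fun x => partialD 0 (φ n) x - weakD (openTri t) (1, 0) g x) 2
      (volume.restrict (openTri t))) atTop (𝓝 0) ∧
    Tendsto (fun n => eLpNorm (fun x => partialD 1 (φ n) x - weakD (openTri t) (0, 1) g x) 2
      (volume.restrict (openTri t))) atTop (𝓝 0) ∧
    Tendsto (fun n => eLpNorm (fun x => φ n x - τ x) 2 (edgeMeasure e)) atTop (𝓝 0)

/-- The trace on `e` of `g`, taken from the triangles of `T` with edge `e` (unique almost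
everywhere on `e`). -/
def trace (T : Finset (Finset Plane)) (e : Finset Plane) (g : Plane → ℝ) : Plane → ℝ :=
  Classical.epsilon fun τ => MemLp τ 2 (edgeMeasure e) ∧ ∀ t ∈ T, e ⊆ t → IsTraceFrom t e g τ

/-- The normal trace `F · n` on `e`, where `n` is the outward normal of the triangle of `T`
with edge `e`. -/
def normalTrace (T : Finset (Finset Plane)) (e : Finset Plane) (F : Plane → Plane) :
    Plane → ℝ :=
  fun x => ∑ i : Fin 2, outwardNormal T e i * trace T e (fun y => F y i) x

/-! ### Interface-fitted meshes -/

/-- A conforming triangulation of the closure of `Ω₁ ∪ Ω₂` by triangles each of which lies in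
one of the two closed subdomains. -/
structure InterfaceMesh (Ω₁ Ω₂ : Set Plane) where
  /-- the triangles of the first subdomain -/
  T₁ : Finset (Finset Plane)
  /-- the triangles of the second subdomain -/
  T₂ : Finset (Finset Plane)
  disj : Disjoint T₁ T₂
  card_eq : ∀ t ∈ T₁ ∪ T₂, t.card = 3
  indep : ∀ t ∈ T₁ ∪ T₂, AffineIndependent ℝ ((↑) : t → Plane)
  conforming : ∀ s ∈ T₁ ∪ T₂, ∀ t ∈ T₁ ∪ T₂, hull s ∩ hull t ⊆ hull (s ∩ t)
  fits₁ : Ω₁ = interior (⋃ t ∈ T₁, hull t)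
  fits₂ : Ω₂ = interior (⋃ t ∈ T₂, hull t)

namespace InterfaceMesh

variable {Ω₁ Ω₂ : Set Plane}

/-- The edges of the interface `Γ`: those shared by the two subdomains. -/
def gammaEdges (𝒯 : InterfaceMesh Ω₁ Ω₂) : Finset (Finset Plane) :=
  meshEdges 𝒯.T₁ ∩ meshEdges 𝒯.T₂

/-- The edges on `∂Ω₁ \ Γ`: those that belong to just one triangle of the first subdomain and
are not on `Γ`. -/
def bdryEdges₁ (𝒯 : InterfaceMesh Ω₁ Ω₂) : Finset (Finset Plane) :=
  (meshEdges 𝒯.T₁).filter fun e => e ∉ 𝒯.gammaEdges ∧ (𝒯.T₁.filter (e ⊆ ·)).card = 1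

/-- The edges on `∂Ω₂ \ Γ`. -/
def bdryEdges₂ (𝒯 : InterfaceMesh Ω₁ Ω₂) : Finset (Finset Plane) :=
  (meshEdges 𝒯.T₂).filter fun e => e ∉ 𝒯.gammaEdges ∧ (𝒯.T₂.filter (e ⊆ ·)).card = 1

/-- The mesh size `h`: the largest diameter of a triangle. -/
def size (𝒯 : InterfaceMesh Ω₁ Ω₂) : ℝ :=
  sSup ((fun t : Finset Plane => Metric.diam (hull t)) '' ((𝒯.T₁ ∪ 𝒯.T₂ : Finset _) : Set _))

/-- Shape regularity: every triangle contains a disc of radius comparable to its diameter. -/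
def ShapeRegular (𝒯 : InterfaceMesh Ω₁ Ω₂) (σ : ℝ) : Prop :=
  ∀ t ∈ 𝒯.T₁ ∪ 𝒯.T₂, ∃ (c : Plane) (r : ℝ), 0 < r ∧ Metric.closedBall c r ⊆ hull t ∧
    Metric.diam (hull t) ≤ σ * r

/-- The triangles of the first subdomain with an edge on `Γ` have diameter comparable to `h`
(in particular, this holds on quasi-uniform meshes). -/
def QuasiUniformAtGamma (𝒯 : InterfaceMesh Ω₁ Ω₂) (σ : ℝ) : Prop :=
  ∀ t ∈ 𝒯.T₁, (∃ e ∈ triEdges t, e ∈ 𝒯.gammaEdges) → 𝒯.size ≤ σ * Metric.diam (hull t)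

end InterfaceMesh

/-! ### The interface problem -/

/-- The data of the interface problem: tensors `A₁`, `A₂`, sources `f₁`, `f₂`, Dirichlet data
`g₁`, `g₂`, and jumps `φ` of the solution and `ψ` of the flux. -/
structure Data where
  A₁ : Plane → Plane →L[ℝ] Plane
  A₂ : Plane → Plane →L[ℝ] Plane
  f₁ : Plane → ℝ
  f₂ : Plane → ℝ
  g₁ : Plane → ℝ
  g₂ : Plane → ℝ
  φ : Plane → ℝ
  ψ : Plane → ℝ

/-- The coefficient is uniformly elliptic with constant `α`, and on each open triangle of `T`
it is `C^{k+1}` with derivatives of order at most `k + 1` bounded by `B`. This covers tensors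
that are constant on each element and tensors that vary smoothly over the subdomain. -/
def Admissible (T : Finset (Finset Plane)) (k : ℕ) (α B : ℝ)
    (A : Plane → Plane →L[ℝ] Plane) : Prop :=
  ∀ t ∈ T, ContDiffOn ℝ ((k + 1 : ℕ) : WithTop ℕ∞) A (openTri t) ∧
    ∀ x ∈ openTri t, (∀ ξ : Plane, α * ‖ξ‖ ^ 2 ≤ ⟪A x ξ, ξ⟫) ∧
      ∀ m ≤ k + 1, ‖iteratedFDeriv ℝ m A x‖ ≤ B

/-- `-∇ · (A ∇ u) = f` in `U`, in the sense of distributions. -/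
def SolvesPDE (U : Set Plane) (A : Plane → Plane →L[ℝ] Plane) (f u : Plane → ℝ) : Prop :=
  ∀ η : Plane → ℝ, ContDiff ℝ ∞ η → HasCompactSupport η → tsupport η ⊆ U →
    ∫ x in U, ⟪A x (weakGrad U u x), !₂[partialD 0 η x, partialD 1 η x]⟫
      = ∫ x in U, f x * η x

/-- The flux `A ∇ u`. -/
def flux (U : Set Plane) (A : Plane → Plane →L[ℝ] Plane) (u : Plane → ℝ) : Plane → Plane :=
  fun x => A x (weakGrad U u x)

/-- `(u, v)` solves the interface problem with data `d`; boundary and interface conditions hold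
almost everywhere in the sense of traces. -/
structure SolvesInterfaceProblem {Ω₁ Ω₂ : Set Plane} (𝒯 : InterfaceMesh Ω₁ Ω₂) (d : Data)
    (u v : Plane → ℝ) : Prop where
  eq₁ : SolvesPDE Ω₁ d.A₁ d.f₁ u
  eq₂ : SolvesPDE Ω₂ d.A₂ d.f₂ v
  bc₁ : ∀ e ∈ 𝒯.bdryEdges₁, trace 𝒯.T₁ e u =ᵐ[edgeMeasure e] d.g₁
  bc₂ : ∀ e ∈ 𝒯.bdryEdges₂, trace 𝒯.T₂ e v =ᵐ[edgeMeasure e] d.g₂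
  jump : ∀ e ∈ 𝒯.gammaEdges,
    (fun x => trace 𝒯.T₁ e u x - trace 𝒯.T₂ e v x) =ᵐ[edgeMeasure e] d.φ
  fluxJump : ∀ e ∈ 𝒯.gammaEdges,
    (fun x => normalTrace 𝒯.T₁ e (flux Ω₁ d.A₁ u) x + normalTrace 𝒯.T₂ e (flux Ω₂ d.A₂ v) x)
      =ᵐ[edgeMeasure e] d.ψ

/-! ### The weak Galerkin spaces, the discrete gradient and the scheme -/

/-- The polynomial functions of degree at most `k`. Their restrictions to a triangle `K` form
`P_k(K)`, and their restrictions to an edge `e` form `P_k(e)`. -/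
def polyFun (k : ℕ) : Submodule ℝ (Plane → ℝ) :=
  (MvPolynomial.restrictTotalDegree (Fin 2) ℝ k).map
    (MvPolynomial.aeval fun (i : Fin 2) (x : Plane) => x i).toLinearMap

/-- The homogeneous polynomial functions of degree `k`. -/
def homPolyFun (k : ℕ) : Submodule ℝ (Plane → ℝ) :=
  (MvPolynomial.homogeneousSubmodule (Fin 2) ℝ k).map
    (MvPolynomial.aeval fun (i : Fin 2) (x : Plane) => x i).toLinearMap

/-- The Raviart–Thomas fields `RT_k = P_k² + P̃_k x`. -/
def RT (k : ℕ) : Set (Plane → Plane) :=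
  {q | ∃ p₀ ∈ polyFun k, ∃ p₁ ∈ polyFun k, ∃ r ∈ homPolyFun k,
    ∀ x, q x = !₂[p₀ x, p₁ x] + r x • x}

/-- The divergence. -/
def divergence (q : Plane → Plane) : Plane → ℝ :=
  fun x => ∑ i : Fin 2, partialD i (fun y => q y i) x

/-- A pair `w = {w₀, w_b}` of a component `w.1 t` on each triangle `t` and a component `w.2 e`
on each edge `e`. -/
abbrev WeakFun : Type := (Finset Plane → Plane → ℝ) × (Finset Plane → Plane → ℝ)

/-- The space `U_h` (or `V_h`) over the triangles `T`. -/
def WGSpace (k : ℕ) (T : Finset (Finset Plane)) : Set WeakFun :=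
  {w | (∀ t ∈ T, w.1 t ∈ polyFun k) ∧ ∀ e ∈ meshEdges T, w.2 e ∈ polyFun k}

/-- The test space `U_h⁰` (or `V_h⁰`): the edge component vanishes on the edges in `S`. -/
def WGTestSpace (k : ℕ) (T S : Finset (Finset Plane)) : Set WeakFun :=
  {w | w ∈ WGSpace k T ∧ ∀ e ∈ S, ∀ x ∈ hull e, w.2 e x = 0}

/-- The discrete gradient of `w` on the triangle `t`: the field `G` of `RT_k` with
`∫_K G · q = -∫_K w₀ ∇ · q + ∫_{∂K} w_b (q · n)` for all `q` in `RT_k`. -/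
def discGrad (k : ℕ) (w : WeakFun) (t : Finset Plane) : Plane → Plane :=
  Classical.epsilon fun G => G ∈ RT k ∧ ∀ q ∈ RT k,
    ∫ x in hull t, ⟪G x, q x⟫ = -(∫ x in hull t, w.1 t x * divergence q x)
      + ∑ e ∈ triEdges t, ∫ x, w.2 e x * ⟪q x, outwardNormal {t} e⟫ ∂edgeMeasure e

/-- The `L²(μ)` projection of `g` onto the polynomials of degree at most `k`. -/
def l2Proj (k : ℕ) (μ : Measure Plane) (g : Plane → ℝ) : Plane → ℝ :=
  Classical.epsilon fun p => p ∈ polyFun k ∧ ∀ q ∈ polyFun k,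
    ∫ x, p x * q x ∂μ = ∫ x, g x * q x ∂μ

/-- The projection `Q_h g = {Q₀ g, Q_b g}` of an `H¹` function. -/
def Qh (k : ℕ) (T : Finset (Finset Plane)) (g : Plane → ℝ) : WeakFun :=
  (fun t => l2Proj k (volume.restrict (hull t)) g,
   fun e => l2Proj k (edgeMeasure e) (trace T e g))

/-- The form `(A ∇_d w, ∇_d z)`, summed over the triangles of `T`. -/
def gradForm (k : ℕ) (T : Finset (Finset Plane)) (A : Plane → Plane →L[ℝ] Plane)
    (w z : WeakFun) : ℝ :=
  ∑ t ∈ T, ∫ x in hull t, ⟪A x (discGrad k w t x), discGrad k z t x⟫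

/-- The pairing `⟨μ, ν⟩` over a set `S` of edges. -/
def edgePairing (S : Finset (Finset Plane)) (μ ν : Finset Plane → Plane → ℝ) : ℝ :=
  ∑ e ∈ S, ∫ x, μ e x * ν e x ∂edgeMeasure e

/-- The pairing `(f, w₀)` over the triangles of `T`. -/
def load (T : Finset (Finset Plane)) (f : Plane → ℝ) (w : WeakFun) : ℝ :=
  ∑ t ∈ T, ∫ x in hull t, f x * w.1 t x

/-- `(u_h, v_h, λ_h)` solves the weak Galerkin scheme with data `d`. -/
structure SolvesWG {Ω₁ Ω₂ : Set Plane} (𝒯 : InterfaceMesh Ω₁ Ω₂) (k : ℕ) (d : Data)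
    (uh vh : WeakFun) (lam : Finset Plane → Plane → ℝ) : Prop where
  mem_U : uh ∈ WGSpace k 𝒯.T₁
  mem_V : vh ∈ WGSpace k 𝒯.T₂
  mem_Lambda : ∀ e ∈ 𝒯.gammaEdges, lam e ∈ polyFun k
  bc₁ : ∀ e ∈ 𝒯.bdryEdges₁, ∀ x ∈ hull e, uh.2 e x = l2Proj k (edgeMeasure e) d.g₁ x
  bc₂ : ∀ e ∈ 𝒯.bdryEdges₂, ∀ x ∈ hull e, vh.2 e x = l2Proj k (edgeMeasure e) d.g₂ x
  wg₁ : ∀ w ∈ WGTestSpace k 𝒯.T₁ 𝒯.bdryEdges₁,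
    gradForm k 𝒯.T₁ d.A₁ uh w - edgePairing 𝒯.gammaEdges lam w.2 = load 𝒯.T₁ d.f₁ w
  wg₂ : ∀ ρ ∈ WGTestSpace k 𝒯.T₂ 𝒯.bdryEdges₂,
    gradForm k 𝒯.T₂ d.A₂ vh ρ + edgePairing 𝒯.gammaEdges lam ρ.2
      = load 𝒯.T₂ d.f₂ ρ + edgePairing 𝒯.gammaEdges (fun _ => d.ψ) ρ.2
  wg₃ : ∀ μ : Finset Plane → Plane → ℝ, (∀ e ∈ 𝒯.gammaEdges, μ e ∈ polyFun k) →
    edgePairing 𝒯.gammaEdges (uh.2 - vh.2) μ = edgePairing 𝒯.gammaEdges (fun _ => d.φ) μ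

/-- `‖∇_d w‖` over the triangles of `T`. -/
def gradNorm (k : ℕ) (T : Finset (Finset Plane)) (w : WeakFun) : ℝ :=
  Real.sqrt (∑ t ∈ T, ∫ x in hull t, ‖discGrad k w t x‖ ^ 2)

/-- The `L²` norm over a set `S` of edges. -/
def edgeNorm (S : Finset (Finset Plane)) (μ : Finset Plane → Plane → ℝ) : ℝ :=
  Real.sqrt (∑ e ∈ S, ∫ x, (μ e x) ^ 2 ∂edgeMeasure e)

end

end WGInterface

/-!
Optimal order convergence of the weak Galerkin method for the interface problem.

The argument rests on a commuting property. Integration by parts on a triangle shows that the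
discrete gradient of `Q_h u` has the same moments as `∇u` against `RT_k`, so that it is the best
approximation of `∇u` in `RT_k` (`integral_inner_discGrad_of_proj`, `nrm_sub_discGrad_le`). For a
test function `w` with discrete gradient `∇_d w`, the defect of `Q_h u` in the scheme is a
sum over the triangles of
`(f, w₀) + ⟨A∇u · n, w_b⟩ - (A ∇_d Q_h u, ∇_d w)`. If `P` is a polynomial approximation of the flux
`A∇u`, then `(P, ∇_d w)` is known exactly, and the defect becomes
`(A∇u - P, ∇w₀) + ⟨(A∇u - P) · n, w_b - w₀⟩ + (P - A ∇_d Q_h u, ∇_d w)` (`consistency_identity`).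
Three facts bound it by `h^{k+1}` times the Sobolev norm times the norm of `∇_d w`
(`exists_local_consistency`, `exists_solution_consistency`):

* the Bramble–Hilbert estimate `SobolevBound.exists_polyFun_approx`. On a convex set a Sobolev
  function is a limit of smooth functions (`exists_smooth_approx`: the set is shrunk towards a disc
  before mollifying), and a smooth function is approximated by its Taylor polynomial at a point
  chosen by averaging (`exists_center_lintegral_segment_le`), with a constant that does not depend
  on the set;
* the trace inequality `IsTri.H1Trace.nrm_sq_le`, from Green's formula with the field `x - c`, where
  `c` is the centre of the inscribed disc;
* stability: `∇_d w` controls `∇w₀` and the jump `w_b - w₀` (`exists_grad_stability`,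
  `exists_jump_stability`). Both follow by testing with suitable Raviart–Thomas fields, for the
  first one with a field whose normal component vanishes on the whole boundary.

Summed over a subdomain, the terms `⟨A∇u · n, w_b⟩` leave only the integral over `Γ`
(`Side.sum_normal_flux`), because the normal fluxes from the two sides of an interior edge cancel
(`IsMesh.flux_ae_eq`). Traces on `Γ` are well defined because the two sides of an edge give the same
values (`IsMesh.trace_ae_eq`).

For the energy estimate `gradNorm_error_le` the two error equations are tested with the errors
`Q_h u - u_h` and `Q_h v - v_h`. Their edge components have the same moments on `Γ`, hence agree
there, so the multiplier drops out and the two fluxes combine to `ψ`. The coercivity of the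
coefficients then gives the first bound.

For the multiplier (`size_mul_edgeNorm_sq_le`), let `p` be the projection of the normal flux on `Γ`.
The error equation is tested with `w₀ = 0`, `w_b = p - λ_h` on `Γ` and `w_b = 0` on the other edges.
Then `‖p - λ_h‖²` is bounded by the energy error times the norm of `∇_d w`, and the norm of `∇_d w`
is at most `C h^{-1/2} ‖p - λ_h‖` (`exists_lifting_bound`, `exists_side_lifting`). Half a power of
`h` is lost here, and also in the trace inequality that bounds the distance of the flux from `p`.
-/

open Filter Topology MeasureTheory
open scoped ContDiff RealInnerProductSpace Classical
namespace WGInterface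

/-! ### Polynomial functions on the plane -/

/-- The monomial function `x₀ᵃ x₁ᵇ`. -/
def mon (a b : ℕ) : Plane → ℝ := fun x => x 0 ^ a * x 1 ^ b

/-- The algebra homomorphism that turns a polynomial in two variables into a function. -/
noncomputable def polyEval : MvPolynomial (Fin 2) ℝ →ₐ[ℝ] (Plane → ℝ) :=
  MvPolynomial.aeval fun (i : Fin 2) (x : Plane) => x i

lemma polyEval_apply (p : MvPolynomial (Fin 2) ℝ) (x : Plane) :
    polyEval p x = MvPolynomial.eval (fun i => x i) p := by
  have := congrArg (fun f : MvPolynomial (Fin 2) ℝ →ₐ[ℝ] ℝ => f p)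
    (show (Pi.evalAlgHom ℝ (fun _ : Plane => ℝ) x).comp polyEval
      = MvPolynomial.aeval (fun i => x i) from by
        apply MvPolynomial.algHom_ext
        intro i
        simp [polyEval])
  simpa [MvPolynomial.aeval_eq_eval] using this

lemma mem_polyFun_iff {k : ℕ} {p : Plane → ℝ} :
    p ∈ polyFun k ↔ ∃ P : MvPolynomial (Fin 2) ℝ, P.totalDegree ≤ k ∧ polyEval P = p := by
  unfold polyFun
  simp only [Submodule.mem_map, MvPolynomial.mem_restrictTotalDegree]
  rfl

lemma mem_homPolyFun_iff {k : ℕ} {p : Plane → ℝ} :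
    p ∈ homPolyFun k ↔ ∃ P : MvPolynomial (Fin 2) ℝ, P.IsHomogeneous k ∧ polyEval P = p := by
  unfold homPolyFun
  simp only [Submodule.mem_map, MvPolynomial.mem_homogeneousSubmodule]
  rfl

lemma polyFun_eq_span (k : ℕ) :
    polyFun k = Submodule.span ℝ {f | ∃ a b : ℕ, a + b ≤ k ∧ f = mon a b} := by
  unfold polyFun
  rw [MvPolynomial.restrictTotalDegree, MvPolynomial.restrictSupport_eq_span, Submodule.map_span]
  congr 1
  ext f
  simp only [Set.mem_image, Set.mem_ofPred_eq]
  have key : ∀ n : Fin 2 →₀ ℕ, polyEval (MvPolynomial.monomial n 1) = mon (n 0) (n 1) := by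
    intro n
    ext x
    rw [polyEval_apply, MvPolynomial.eval_monomial, Finsupp.prod_fintype _ _ (by simp)]
    simp [mon, Fin.prod_univ_two]
  constructor
  · rintro ⟨_, ⟨n, hn, rfl⟩, rfl⟩
    refine ⟨n 0, n 1, ?_, key n⟩
    rw [Finsupp.sum_fintype _ _ (by simp)] at hn
    simpa [Fin.sum_univ_two] using hn
  · rintro ⟨a, b, hab, rfl⟩
    refine ⟨_, ⟨Finsupp.equivFunOnFinite.symm ![a, b], ?_, rfl⟩, ?_⟩
    · rw [Finsupp.sum_fintype _ _ (by simp)]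
      simpa [Fin.sum_univ_two] using hab
    · exact (key _).trans (by simp)

lemma mon_mem {a b k : ℕ} (h : a + b ≤ k) : mon a b ∈ polyFun k := by
  rw [polyFun_eq_span]
  exact Submodule.subset_span ⟨a, b, h, rfl⟩

lemma polyFun_induction {k : ℕ} {S : Submodule ℝ (Plane → ℝ)}
    (h : ∀ a b, a + b ≤ k → mon a b ∈ S) : polyFun k ≤ S := by
  rw [polyFun_eq_span, Submodule.span_le]
  rintro _ ⟨a, b, hab, rfl⟩
  exact h a b hab

lemma polyFun_mono {j k : ℕ} (h : j ≤ k) : polyFun j ≤ polyFun k :=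
  polyFun_induction fun _ _ hab => mon_mem (hab.trans h)

lemma polyFun_const (k : ℕ) (c : ℝ) : (fun _ => c) ∈ polyFun k := by
  have := (polyFun k).smul_mem c (mon_mem (a := 0) (b := 0) (Nat.zero_le k))
  convert this using 1
  ext x
  simp [mon]

lemma polyFun_coord (i : Fin 2) : (fun x : Plane => x i) ∈ polyFun 1 := by
  fin_cases i
  · convert mon_mem (a := 1) (b := 0) le_rfl using 1
    ext x; simp [mon]
  · convert mon_mem (a := 0) (b := 1) le_rfl using 1
    ext x; simp [mon]

lemma polyFun_mul {j k : ℕ} {p q : Plane → ℝ} (hp : p ∈ polyFun j) (hq : q ∈ polyFun k) :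
    (fun x => p x * q x) ∈ polyFun (j + k) := by
  rw [mem_polyFun_iff] at *
  obtain ⟨P, hP, rfl⟩ := hp
  obtain ⟨Q, hQ, rfl⟩ := hq
  exact ⟨P * Q, (MvPolynomial.totalDegree_mul _ _).trans (add_le_add hP hQ), by
    rw [map_mul]; rfl⟩

lemma polyFun_pow {p : Plane → ℝ} (hp : p ∈ polyFun 1) (n : ℕ) :
    (fun x => p x ^ n) ∈ polyFun n := by
  induction n with
  | zero => simpa using polyFun_const 0 1
  | succ n ih =>
    simp only [pow_succ]
    exact polyFun_mul ih hp

/-- Polynomial functions are stable under affine substitutions. -/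
lemma polyFun_comp {k : ℕ} {p f g : Plane → ℝ} (hp : p ∈ polyFun k) (hf : f ∈ polyFun 1)
    (hg : g ∈ polyFun 1) : (fun x => p !₂[f x, g x]) ∈ polyFun k := by
  let S : Submodule ℝ (Plane → ℝ) :=
    (polyFun k).comap (LinearMap.funLeft ℝ ℝ fun x : Plane => (!₂[f x, g x] : Plane))
  refine (polyFun_induction (S := S) (k := k) ?_) hp
  intro a b hab
  refine polyFun_mono hab ?_
  have := polyFun_mul (polyFun_pow hf a) (polyFun_pow hg b)
  convert this using 1
  ext x
  simp [LinearMap.funLeft, mon]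

lemma polyFun_contDiff {k : ℕ} {p : Plane → ℝ} (hp : p ∈ polyFun k) {n : WithTop ℕ∞} :
    ContDiff ℝ n p := by
  rw [polyFun_eq_span] at hp
  induction hp using Submodule.span_induction with
  | mem f h =>
    obtain ⟨a, b, -, rfl⟩ := h
    unfold mon
    fun_prop
  | zero => exact contDiff_const
  | add f g _ _ hf hg => exact hf.add hg
  | smul c f _ hf => exact contDiff_const.smul hf

lemma hasFDerivAt_coord (i : Fin 2) (x : Plane) :
    HasFDerivAt (fun x : Plane => x i) (EuclideanSpace.proj i : Plane →L[ℝ] ℝ) x :=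
  (EuclideanSpace.proj i : Plane →L[ℝ] ℝ).hasFDerivAt

lemma partialD_mon (a b : ℕ) : partialD 0 (mon a b) = (a : ℝ) • mon (a - 1) b ∧
    partialD 1 (mon a b) = (b : ℝ) • mon a (b - 1) := by
  have hd (x : Plane) := ((hasFDerivAt_coord 0 x).pow a).mul ((hasFDerivAt_coord 1 x).pow b)
  constructor <;> ext x
  · have := (hd x).fderiv
    change fderiv ℝ (mon a b) x _ = _
    rw [show mon a b = (fun x : Plane => x 0 ^ a) * (fun x : Plane => x 1 ^ b) from rfl, this]
    simp [mon]
    ring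
  · have := (hd x).fderiv
    change fderiv ℝ (mon a b) x _ = _
    rw [show mon a b = (fun x : Plane => x 0 ^ a) * (fun x : Plane => x 1 ^ b) from rfl, this]
    simp [mon]
    ring

lemma partialD_add {i : Fin 2} {f g : Plane → ℝ} {x : Plane} (hf : DifferentiableAt ℝ f x)
    (hg : DifferentiableAt ℝ g x) :
    partialD i (f + g) x = partialD i f x + partialD i g x := by
  simp [partialD, fderiv_add hf hg]

lemma partialD_smul {i : Fin 2} {f : Plane → ℝ} {x : Plane} (c : ℝ)
    (hf : DifferentiableAt ℝ f x) : partialD i (c • f) x = c * partialD i f x := by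
  simp [partialD, fderiv_const_smul hf]

lemma partialD_mul {i : Fin 2} {f g : Plane → ℝ} {x : Plane} (hf : DifferentiableAt ℝ f x)
    (hg : DifferentiableAt ℝ g x) :
    partialD i (fun x => f x * g x) x = partialD i f x * g x + f x * partialD i g x := by
  simp [partialD, fderiv_fun_mul hf hg]
  ring

/-- An affine function times a partial derivative of `p ∈ P_k` is again in `P_k`. -/
lemma polyFun_mul_partialD {k : ℕ} {p l : Plane → ℝ} (hp : p ∈ polyFun k) (hl : l ∈ polyFun 1)
    (i : Fin 2) : (fun x => l x * partialD i p x) ∈ polyFun k := by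
  rw [polyFun_eq_span] at hp
  induction hp using Submodule.span_induction with
  | mem f h =>
    obtain ⟨a, b, hab, rfl⟩ := h
    fin_cases i
    · simp only [Fin.zero_eta, (partialD_mon a b).1]
      rcases a with _ | a
      · simpa using polyFun_const k 0
      · have := (polyFun k).smul_mem ((a + 1 : ℕ) : ℝ) (polyFun_mono (by omega)
          (polyFun_mul hl (mon_mem (a := a) (b := b) le_rfl)))
        convert this using 1
        ext x; simp; ring
    · simp only [Fin.mk_one, (partialD_mon a b).2]
      rcases b with _ | b
      · simpa using polyFun_const k 0
      · have := (polyFun k).smul_mem ((b + 1 : ℕ) : ℝ) (polyFun_mono (by omega)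
          (polyFun_mul hl (mon_mem (a := a) (b := b) le_rfl)))
        convert this using 1
        ext x; simp; ring
  | zero =>
    have : partialD i (0 : Plane → ℝ) = 0 := by
      ext x
      simp [partialD]
    simpa [this] using polyFun_const k 0
  | add f g hf' hg' hf hg =>
    rw [← polyFun_eq_span] at hf' hg'
    convert (polyFun k).add_mem hf hg using 1
    ext x
    rw [partialD_add ((polyFun_contDiff hf' (n := 1)).differentiable (by simp) x)
      ((polyFun_contDiff hg' (n := 1)).differentiable (by simp) x)]
    simp; ring
  | smul c f hf' hf =>
    rw [← polyFun_eq_span] at hf'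
    convert (polyFun k).smul_mem c hf using 1
    ext x
    rw [partialD_smul c ((polyFun_contDiff hf' (n := 1)).differentiable (by simp) x)]
    simp; ring

lemma polyFun_partialD {k : ℕ} {p : Plane → ℝ} (hp : p ∈ polyFun k) (i : Fin 2) :
    partialD i p ∈ polyFun k := by
  simpa using polyFun_mul_partialD hp (polyFun_const 1 1) i

instance (k : ℕ) : FiniteDimensional ℝ (polyFun k) := by
  unfold polyFun
  infer_instance

/-- A polynomial function that vanishes on a nonempty open set is zero. -/
lemma polyFun_eq_zero_of_open {k : ℕ} {p : Plane → ℝ} (hp : p ∈ polyFun k) {U : Set Plane}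
    (hU : IsOpen U) {c : Plane} (hc : c ∈ U) (h : ∀ x ∈ U, p x = 0) : p = 0 := by
  have h1 : AnalyticOnNhd ℝ p Set.univ := (polyFun_contDiff hp (n := ω)).analyticOnNhd
  exact h1.eq_of_eventuallyEq (analyticOnNhd_const (v := 0))
    (z₀ := c) (by filter_upwards [hU.mem_nhds hc] with x hx using h x hx)

/-! ### Raviart–Thomas fields -/

/-- A polynomial of degree at most `k` splits into a homogeneous part of degree `k` and a part
whose products with affine functions stay in `P_k`. -/
lemma polyFun_split {k : ℕ} {p : Plane → ℝ} (hp : p ∈ polyFun k) :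
    ∃ r ∈ homPolyFun k, ∃ l ∈ polyFun k, p = r + l ∧
      ∀ m ∈ polyFun 1, (fun x => l x * m x) ∈ polyFun k := by
  obtain ⟨P, hP, rfl⟩ := mem_polyFun_iff.1 hp
  refine ⟨polyEval (MvPolynomial.homogeneousComponent k P),
    mem_homPolyFun_iff.2 ⟨_, MvPolynomial.homogeneousComponent_isHomogeneous _ _, rfl⟩,
    polyEval (P - MvPolynomial.homogeneousComponent k P), ?_, ?_, ?_⟩
  · exact mem_polyFun_iff.2 ⟨_, (MvPolynomial.totalDegree_sub _ _).trans (max_le hP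
      (MvPolynomial.homogeneousComponent_isHomogeneous k P).totalDegree_le), rfl⟩
  · rw [← map_add]; simp
  · intro m hm
    rcases k with _ | k
    · have : P - MvPolynomial.homogeneousComponent 0 P = 0 := by
        rw [MvPolynomial.homogeneousComponent_zero,
          ← MvPolynomial.totalDegree_eq_zero_iff_eq_C.1 (Nat.le_zero.1 hP), sub_self]
      rw [this]
      simpa using polyFun_const 0 0
    · have h2 : P - MvPolynomial.homogeneousComponent (k + 1) P
          = ∑ i ∈ Finset.range (k + 1), MvPolynomial.homogeneousComponent i P := by
        rw [sub_eq_iff_eq_add, ← Finset.sum_range_succ]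
        conv_lhs => rw [← MvPolynomial.sum_homogeneousComponent P]
        refine Finset.sum_subset (Finset.range_mono (by omega)) fun i _ hi => ?_
        exact MvPolynomial.homogeneousComponent_eq_zero _ _ (by simpa using hi)
      refine polyFun_mul (j := k) (mem_polyFun_iff.2 ⟨_, ?_, rfl⟩) hm
      rw [h2]
      refine (MvPolynomial.totalDegree_finsetSum_le fun i hi => ?_)
      exact (MvPolynomial.homogeneousComponent_isHomogeneous i P).totalDegree_le.trans
        (by simp at hi; omega)

lemma homPolyFun_le (k : ℕ) : homPolyFun k ≤ polyFun k := by
  intro p hp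
  obtain ⟨P, hP, rfl⟩ := mem_homPolyFun_iff.1 hp
  exact mem_polyFun_iff.2 ⟨P, hP.totalDegree_le, rfl⟩

/-- The fields with components in `P_k`, as a linear image of `P_k × P_k × P̃_k`. -/
noncomputable def rtMap (k : ℕ) :
    (polyFun k × polyFun k × homPolyFun k) →ₗ[ℝ] (Plane → Plane) where
  toFun z := fun x => !₂[(z.1 : Plane → ℝ) x, (z.2.1 : Plane → ℝ) x] + (z.2.2 : Plane → ℝ) x • x
  map_add' z w := by
    ext x i
    fin_cases i <;> simp <;> ring
  map_smul' c z := by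
    ext x i
    fin_cases i <;> simp <;> ring

/-- The space `RT_k` as a submodule. -/
noncomputable def rtSub (k : ℕ) : Submodule ℝ (Plane → Plane) := LinearMap.range (rtMap k)

lemma mem_rtSub {k : ℕ} {q : Plane → Plane} : q ∈ rtSub k ↔ q ∈ RT k := by
  constructor
  · rintro ⟨⟨p₀, p₁, r⟩, rfl⟩
    exact ⟨p₀, p₀.2, p₁, p₁.2, r, r.2, fun x => rfl⟩
  · rintro ⟨p₀, h₀, p₁, h₁, r, hr, h⟩
    exact ⟨⟨⟨p₀, h₀⟩, ⟨p₁, h₁⟩, ⟨r, hr⟩⟩, by ext1 x; exact (h x).symm⟩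

instance (k : ℕ) : FiniteDimensional ℝ (homPolyFun k) :=
  Submodule.finiteDimensional_of_le (homPolyFun_le k)

instance (k : ℕ) : FiniteDimensional ℝ (rtSub k) := by
  unfold rtSub
  infer_instance

lemma RT_comp {k : ℕ} {q : Plane → Plane} (hq : q ∈ RT k) (i : Fin 2) :
    (fun x => q x i) ∈ polyFun (k + 1) := by
  obtain ⟨p₀, h₀, p₁, h₁, r, hr, h⟩ := hq
  have hrx := polyFun_mul (homPolyFun_le k hr) (polyFun_coord i)
  fin_cases i
  · convert (polyFun (k + 1)).add_mem (polyFun_mono (Nat.le_succ k) h₀) hrx using 1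
    ext x; simp [h]
  · convert (polyFun (k + 1)).add_mem (polyFun_mono (Nat.le_succ k) h₁) hrx using 1
    ext x; simp [h]

lemma RT_of_polyFun {k : ℕ} {p₀ p₁ : Plane → ℝ} (h₀ : p₀ ∈ polyFun k) (h₁ : p₁ ∈ polyFun k) :
    (fun x => !₂[p₀ x, p₁ x]) ∈ RT k :=
  ⟨p₀, h₀, p₁, h₁, 0, zero_mem _, fun x => by simp⟩

/-- The fields `r (x - a)` with `r ∈ P_k` are in `RT_k`. -/
lemma RT_smul_sub {k : ℕ} {r : Plane → ℝ} (hr : r ∈ polyFun k) (a : Plane) :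
    (fun x => r x • (x - a)) ∈ RT k := by
  obtain ⟨s, hs, l, hl, rfl, hm⟩ := polyFun_split hr
  refine ⟨fun x => l x * x 0 - a 0 * (s + l) x, ?_, fun x => l x * x 1 - a 1 * (s + l) x, ?_,
    s, hs, fun x => ?_⟩
  · exact (polyFun k).sub_mem (hm _ (polyFun_coord 0)) ((polyFun k).smul_mem (a 0) hr)
  · exact (polyFun k).sub_mem (hm _ (polyFun_coord 1)) ((polyFun k).smul_mem (a 1) hr)
  · ext i
    fin_cases i <;> simp <;> ring

lemma differentiableAt_polyFun {k : ℕ} {p : Plane → ℝ} (hp : p ∈ polyFun k) (x : Plane) :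
    DifferentiableAt ℝ p x :=
  (polyFun_contDiff hp (n := 1)).differentiable (by simp) x

lemma partialD_coord (i j : Fin 2) (x : Plane) :
    partialD i (fun y : Plane => y j) x = if i = j then 1 else 0 := by
  simp [partialD, (hasFDerivAt_coord j x).fderiv, eq_comm]

lemma RT_divergence {k : ℕ} {q : Plane → Plane} (hq : q ∈ RT k) :
    divergence q ∈ polyFun k := by
  obtain ⟨p₀, h₀, p₁, h₁, r, hr, h⟩ := hq
  have hr := homPolyFun_le k hr
  have key : divergence q = partialD 0 p₀ + partialD 1 p₁ + (2 : ℝ) • r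
      + (fun x => x 0 * partialD 0 r x) + fun x => x 1 * partialD 1 r x := by
    ext x
    have e0 : (fun y => q y 0) = p₀ + fun y => r y * y 0 := by ext y; simp [h]
    have e1 : (fun y => q y 1) = p₁ + fun y => r y * y 1 := by ext y; simp [h]
    have hd (i : Fin 2) : DifferentiableAt ℝ (fun y : Plane => y i) x := by fun_prop
    simp only [divergence, Fin.sum_univ_two, e0, e1]
    rw [partialD_add (differentiableAt_polyFun h₀ x)
        ((differentiableAt_polyFun hr x).fun_mul (hd 0)),
      partialD_add (differentiableAt_polyFun h₁ x) ((differentiableAt_polyFun hr x).fun_mul (hd 1)),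
      partialD_mul (differentiableAt_polyFun hr x) (hd 0),
      partialD_mul (differentiableAt_polyFun hr x) (hd 1), partialD_coord, partialD_coord]
    simp
    ring
  rw [key]
  exact add_mem (add_mem (add_mem (add_mem (polyFun_partialD h₀ 0) (polyFun_partialD h₁ 1))
    (Submodule.smul_mem _ _ hr)) (polyFun_mul_partialD hr (polyFun_coord 0) 0))
    (polyFun_mul_partialD hr (polyFun_coord 1) 1)

/-- The normal component of a Raviart–Thomas field on a line is a polynomial of degree `k`. -/
lemma RT_normal {k : ℕ} {q : Plane → Plane} (hq : q ∈ RT k) (n : Plane) (s : ℝ) :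
    ∃ p ∈ polyFun k, ∀ x : Plane, ⟪x, n⟫ = s → ⟪q x, n⟫ = p x := by
  obtain ⟨p₀, h₀, p₁, h₁, r, hr, h⟩ := hq
  refine ⟨n 0 • p₀ + n 1 • p₁ + s • r, add_mem (add_mem (Submodule.smul_mem _ _ h₀)
    (Submodule.smul_mem _ _ h₁)) (Submodule.smul_mem _ _ (homPolyFun_le k hr)), fun x hx => ?_⟩
  rw [h, inner_add_left, inner_smul_left, hx]
  simp [PiLp.inner_apply, Fin.sum_univ_two]
  ring

lemma RT_continuous {k : ℕ} {q : Plane → Plane} (hq : q ∈ RT k) : Continuous q := by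
  rw [show q = fun x => !₂[q x 0, q x 1] by ext x i; fin_cases i <;> rfl]
  have h0 := (polyFun_contDiff (RT_comp hq 0) (n := 0)).continuous
  have h1 := (polyFun_contDiff (RT_comp hq 1) (n := 0)).continuous
  refine (PiLp.continuous_toLp 2 _).comp (continuous_pi fun i => ?_)
  fin_cases i
  · exact h0
  · exact h1

/-! ### Square-integrable fields -/

section L2

variable {X : Type*} [MeasurableSpace X] {μ : Measure X}
  {E : Type*} [NormedAddCommGroup E]

/-- The `L²(μ)` norm as a real number. -/
noncomputable def nrm (μ : Measure X) (F : X → E) : ℝ := (eLpNorm F 2 μ).toReal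

lemma nrm_nonneg (F : X → E) : 0 ≤ nrm μ F := ENNReal.toReal_nonneg

lemma nrm_sq {F : X → E} (hF : MemLp F 2 μ) : nrm μ F ^ 2 = ∫ x, ‖F x‖ ^ 2 ∂μ := by
  unfold nrm
  rw [hF.eLpNorm_eq_integral_rpow_norm (by simp) (by simp), ENNReal.toReal_ofReal (by positivity)]
  simp only [ENNReal.toReal_ofNat, Real.rpow_ofNat]
  rw [← Real.rpow_natCast, ← Real.rpow_mul (integral_nonneg fun x => by positivity)]
  simp

lemma nrm_eq_sqrt {F : X → E} (hF : MemLp F 2 μ) : nrm μ F = √(∫ x, ‖F x‖ ^ 2 ∂μ) := by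
  rw [← nrm_sq hF, Real.sqrt_sq (nrm_nonneg F)]

lemma nrm_add_le {F G : X → E} (hF : MemLp F 2 μ) (hG : MemLp G 2 μ) :
    nrm μ (fun x => F x + G x) ≤ nrm μ F + nrm μ G := by
  unfold nrm
  rw [← ENNReal.toReal_add hF.eLpNorm_ne_top hG.eLpNorm_ne_top]
  exact ENNReal.toReal_mono (ENNReal.add_ne_top.2 ⟨hF.eLpNorm_ne_top, hG.eLpNorm_ne_top⟩)
    (eLpNorm_add_le hF.1 hG.1 (by norm_num))

lemma nrm_sub_le {F G : X → E} (hF : MemLp F 2 μ) (hG : MemLp G 2 μ) :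
    nrm μ (fun x => F x - G x) ≤ nrm μ F + nrm μ G := by
  have := nrm_add_le hF hG.neg
  simpa [nrm, sub_eq_add_neg, eLpNorm_neg] using this

lemma nrm_mono {E' : Type*} [NormedAddCommGroup E'] {F : X → E} {G : X → E'} {c : ℝ}
    (hG : MemLp G 2 μ) (hc : 0 ≤ c) (h : ∀ᵐ x ∂μ, ‖F x‖ ≤ c * ‖G x‖) :
    nrm μ F ≤ c * nrm μ G := by
  unfold nrm
  rw [← ENNReal.toReal_ofReal hc, ← ENNReal.toReal_mul]
  exact ENNReal.toReal_mono (ENNReal.mul_ne_top (by simp) hG.eLpNorm_ne_top)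
    (eLpNorm_le_mul_eLpNorm_of_ae_le_mul h 2)

lemma nrm_congr {F G : X → E} (h : F =ᵐ[μ] G) : nrm μ F = nrm μ G := by
  unfold nrm
  rw [eLpNorm_congr_ae h]

variable [InnerProductSpace ℝ E]

lemma integrable_inner_of_memLp {F G : X → E} (hF : MemLp F 2 μ) (hG : MemLp G 2 μ) :
    Integrable (fun x => ⟪F x, G x⟫) μ := by
  refine ((hF.norm).integrable_mul hG.norm).mono (hF.1.inner hG.1) (ae_of_all _ fun x => ?_)
  simpa using norm_inner_le_norm (𝕜 := ℝ) (F x) (G x)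

lemma abs_integral_inner_le {F G : X → E} (hF : MemLp F 2 μ) (hG : MemLp G 2 μ) :
    |∫ x, ⟪F x, G x⟫ ∂μ| ≤ nrm μ F * nrm μ G := by
  have h1 := L2.inner_def (𝕜 := ℝ) (hF.toLp F) (hG.toLp G)
  have h2 := abs_real_inner_le_norm (hF.toLp F) (hG.toLp G)
  rw [h1, Lp.norm_toLp, Lp.norm_toLp] at h2
  refine le_trans (le_of_eq ?_) h2
  congr 1
  refine integral_congr_ae ?_
  filter_upwards [hF.coeFn_toLp, hG.coeFn_toLp] with x hx hy
  rw [hx, hy]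

lemma abs_integral_mul_le {F G : X → ℝ} (hF : MemLp F 2 μ) (hG : MemLp G 2 μ) :
    |∫ x, F x * G x ∂μ| ≤ nrm μ F * nrm μ G := by
  simpa [mul_comm] using abs_integral_inner_le hF hG

end L2

/-! ### Finite-dimensional tools: Riesz representation and equivalence of norms -/

/-- In finite dimension, a functional that vanishes on the null vectors of a bilinear form is
represented by the form. -/
lemma exists_bilin_eq {V : Type*} [AddCommGroup V] [Module ℝ V] [FiniteDimensional ℝ V]
    (b : V →ₗ[ℝ] V →ₗ[ℝ] ℝ) (l : V →ₗ[ℝ] ℝ) (h : ∀ v, b v v = 0 → l v = 0) :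
    ∃ u, ∀ v, b u v = l v := by
  have h1 : l ∈ (LinearMap.range b).dualCoannihilator.dualAnnihilator := by
    rw [Submodule.mem_dualAnnihilator]
    intro v hv
    rw [Submodule.mem_dualCoannihilator] at hv
    exact h v (hv (b v) ⟨v, rfl⟩)
  rw [Subspace.dualCoannihilator_dualAnnihilator_eq] at h1
  obtain ⟨u, hu⟩ := h1
  exact ⟨u, fun v => by rw [hu]⟩

section FiniteDim

variable {X : Type*} [MeasurableSpace X] {μ : Measure X}
  {E : Type*} [NormedAddCommGroup E] [InnerProductSpace ℝ E]

/-- Riesz representation in a finite-dimensional space of square-integrable fields, for a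
functional that depends only on almost everywhere classes. -/
lemma exists_integral_inner_eq (V : Submodule ℝ (X → E)) [FiniteDimensional ℝ V]
    (hV : ∀ v ∈ V, MemLp v 2 μ) (l : V →ₗ[ℝ] ℝ)
    (hl : ∀ v : V, (v : X → E) =ᵐ[μ] 0 → l v = 0) :
    ∃ u ∈ V, ∀ (v) (hv : v ∈ V), ∫ x, ⟪u x, v x⟫ ∂μ = l ⟨v, hv⟩ := by
  have hI (u v : V) : Integrable (fun x => ⟪(u : X → E) x, (v : X → E) x⟫) μ :=
    integrable_inner_of_memLp (hV u u.2) (hV v v.2)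
  let b : V →ₗ[ℝ] V →ₗ[ℝ] ℝ := LinearMap.mk₂ ℝ
    (fun u v => ∫ x, ⟪(u : X → E) x, (v : X → E) x⟫ ∂μ)
    (fun u u' v => by
      rw [← integral_add (hI u v) (hI u' v)]
      exact integral_congr_ae (ae_of_all _ fun x => by simp [inner_add_left]))
    (fun c u v => by
      rw [← integral_smul]
      exact integral_congr_ae (ae_of_all _ fun x => by simp [inner_smul_left]))
    (fun u v v' => by
      rw [← integral_add (hI u v) (hI u v')]
      exact integral_congr_ae (ae_of_all _ fun x => by simp [inner_add_right]))
    (fun c u v => by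
      rw [← integral_smul]
      exact integral_congr_ae (ae_of_all _ fun x => by simp [inner_smul_right]))
  obtain ⟨u, hu⟩ := exists_bilin_eq b l fun v hv => by
    refine hl v ?_
    have h1 : (fun x => ⟪(v : X → E) x, (v : X → E) x⟫) =ᵐ[μ] 0 :=
      (integral_eq_zero_iff_of_nonneg (fun x => real_inner_self_nonneg) (hI v v)).1 hv
    filter_upwards [h1] with x hx
    simpa using hx
  exact ⟨u, u.2, fun v hv => hu ⟨v, hv⟩⟩

/-- In a finite-dimensional space of functions whose `L²(μ)` seminorm is a norm, point values are
bounded by the `L²(μ)` norm, uniformly over a set on which all functions are bounded. -/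
lemma exists_sq_le_integral (V : Submodule ℝ (X → ℝ)) [FiniteDimensional ℝ V]
    (hV : ∀ v ∈ V, MemLp v 2 μ) (hdef : ∀ v ∈ V, v =ᵐ[μ] 0 → v = 0) (S : Set X)
    (hS : ∀ v ∈ V, ∃ M, ∀ x ∈ S, |v x| ≤ M) :
    ∃ C : ℝ, 0 < C ∧ ∀ v ∈ V, ∀ x ∈ S, v x ^ 2 ≤ C * ∫ y, v y ^ 2 ∂μ := by
  let n := Module.finrank ℝ V
  let b := Module.finBasis ℝ V
  let e := b.equivFun
  let T : (Fin n → ℝ) →ₗ[ℝ] Lp ℝ 2 μ :=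
    { toFun := fun c => (hV (e.symm c) (e.symm c).2).toLp _
      map_add' := fun c d => by
        simp only [map_add]
        exact (MemLp.toLp_add (hV _ (e.symm c).2) (hV _ (e.symm d).2))
      map_smul' := fun a c => by
        simp only [map_smul]
        exact (MemLp.toLp_const_smul a (hV _ (e.symm c).2)) }
  have hT : LinearMap.ker T = ⊥ := by
    rw [LinearMap.ker_eq_bot']
    intro c hc
    have h1 : ((e.symm c : V) : X → ℝ) =ᵐ[μ] 0 := by
      have h2 := (hV (e.symm c) (e.symm c).2).coeFn_toLp
      have h3 : (hV (e.symm c) (e.symm c).2).toLp _ = 0 := hc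
      rw [h3] at h2
      exact h2.symm.trans (Lp.coeFn_zero _ _ _)
    have h4 := hdef _ (e.symm c).2 h1
    have h5 : e.symm c = 0 := Subtype.ext h4
    simpa using h5
  obtain ⟨K, -, hK⟩ := T.exists_antilipschitzWith hT
  choose M hM using fun i => hS (b i) (b i).2
  set A : ℝ := ∑ i, |M i| with hA
  have hA0 : 0 ≤ A := Finset.sum_nonneg fun i _ => abs_nonneg _
  refine ⟨(K * A) ^ 2 + 1, by positivity, fun v hv x hx => ?_⟩
  set c := e ⟨v, hv⟩ with hc
  have hvc : e.symm c = ⟨v, hv⟩ := by simp [hc]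
  have hn : ‖c‖ ≤ K * nrm μ v := by
    have := hK.le_mul_dist c 0
    simp only [map_zero, dist_zero_right] at this
    refine this.trans (le_of_eq ?_)
    congr 1
    change ‖(hV (e.symm c) (e.symm c).2).toLp _‖ = _
    rw [Lp.norm_toLp]
    simp [nrm, hvc]
  have hvx : |v x| ≤ A * ‖c‖ := by
    have h1 : v = ∑ i, c i • (b i : X → ℝ) := by
      have := b.sum_equivFun ⟨v, hv⟩
      have h2 := congrArg (Submodule.subtype V) this
      rw [map_sum] at h2
      exact h2.symm
    rw [h1, Finset.sum_apply, hA, Finset.sum_mul]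
    refine (Finset.abs_sum_le_sum_abs _ _).trans (Finset.sum_le_sum fun i _ => ?_)
    rw [Pi.smul_apply, smul_eq_mul, abs_mul, mul_comm]
    exact mul_le_mul ((hM i x hx).trans (le_abs_self _)) (norm_le_pi_norm c i) (abs_nonneg _)
      (abs_nonneg _)
  have h6 : |v x| ≤ (K * A) * nrm μ v := by
    calc |v x| ≤ A * ‖c‖ := hvx
      _ ≤ A * (K * nrm μ v) := mul_le_mul_of_nonneg_left hn hA0
      _ = _ := by ring
  have h7 : nrm μ v ^ 2 = ∫ y, v y ^ 2 ∂μ := by simpa using nrm_sq (hV v hv)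
  calc v x ^ 2 = |v x| ^ 2 := (sq_abs _).symm
    _ ≤ ((K * A) * nrm μ v) ^ 2 := pow_le_pow_left₀ (abs_nonneg _) h6 2
    _ = (K * A) ^ 2 * ∫ y, v y ^ 2 ∂μ := by rw [mul_pow, h7]
    _ ≤ _ := by
      refine mul_le_mul_of_nonneg_right (by linarith) (integral_nonneg fun y => by positivity)

end FiniteDim

/-! ### Inverse estimates for polynomials -/

lemma memLp_of_continuous {E : Type*} [NormedAddCommGroup E] {X : Type*} [MeasurableSpace X]
    [TopologicalSpace X] [OpensMeasurableSpace X] [SecondCountableTopologyEither X E]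
    {μ : Measure X} [IsFiniteMeasure μ]
    {F : X → E} (hF : Continuous F) {K : Set X} (hK : IsCompact K) (hμ : ∀ᵐ x ∂μ, x ∈ K) :
    MemLp F 2 μ := by
  obtain ⟨M, hM⟩ := hK.exists_bound_of_continuousOn hF.continuousOn
  exact MemLp.of_bound hF.aestronglyMeasurable M (by filter_upwards [hμ] with x hx using hM x hx)

lemma integral_ball_comp_homothety (f : Plane → ℝ) (c : Plane) {r : ℝ} (hr : 0 < r) (R : ℝ) :
    ∫ x in Metric.ball c (r * R), f x = r ^ 2 * ∫ y in Metric.ball (0 : Plane) R, f (c + r • y) := by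
  have h1 := Measure.setIntegral_comp_smul_of_pos (volume : Measure Plane) (fun x => f (c + x))
    (Metric.ball (0 : Plane) R) hr
  rw [h1, smul_ball hr.ne', smul_zero, Real.norm_eq_abs, abs_of_pos hr]
  have h2 := (measurePreserving_add_left (volume : Measure Plane) c).setIntegral_preimage_emb
    (measurableEmbedding_addLeft c) f (Metric.ball c (r * R))
  rw [← h2]
  have h3 : (fun x => c + x) ⁻¹' Metric.ball c (r * R) = Metric.ball 0 (r * R) := by
    ext x; simp
  rw [h3]
  simp only [finrank_euclideanSpace, Fintype.card_fin, smul_eq_mul]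
  rw [← mul_assoc, mul_inv_cancel₀ (by positivity), one_mul]

/-- Point values of a polynomial on a ball are controlled by its mean square over a concentric
smaller ball. -/
lemma polyFun_inverse_ball (k : ℕ) (R : ℝ) : ∃ C : ℝ, 0 < C ∧ ∀ (c : Plane) (r : ℝ), 0 < r →
    ∀ p ∈ polyFun k, ∀ x ∈ Metric.closedBall c (r * R),
      p x ^ 2 ≤ C / r ^ 2 * ∫ y in Metric.ball c (r * (1 / 2)), p y ^ 2 := by
  obtain ⟨C, hC, h⟩ := exists_sq_le_integral (μ := volume.restrict (Metric.ball (0 : Plane) (1 / 2)))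
    (polyFun k)
    (fun v hv => by
      have : IsFiniteMeasure (volume.restrict (Metric.ball (0 : Plane) (1 / 2))) :=
        ⟨by rw [Measure.restrict_apply_univ]; exact measure_ball_lt_top⟩
      exact memLp_of_continuous (polyFun_contDiff hv (n := 0)).continuous
        (isCompact_closedBall (0 : Plane) (1 / 2))
        ((ae_restrict_mem measurableSet_ball).mono fun x hx => Metric.ball_subset_closedBall hx))
    (fun v hv h0 => by
      refine polyFun_eq_zero_of_open hv Metric.isOpen_ball
        (Metric.mem_ball_self (x := (0 : Plane)) (by norm_num : (0 : ℝ) < 1 / 2)) ?_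
      exact Measure.eqOn_open_of_ae_eq h0 Metric.isOpen_ball
        (polyFun_contDiff hv (n := 0)).continuous.continuousOn continuousOn_const)
    (Metric.closedBall 0 R)
    (fun v hv => (isCompact_closedBall (0 : Plane) R).exists_bound_of_continuousOn
      (polyFun_contDiff hv (n := 0)).continuous.continuousOn)
  refine ⟨C, hC, fun c r hr p hp x hx => ?_⟩
  have hq : (fun y : Plane => p (c + r • y)) ∈ polyFun k := by
    have h1 (i : Fin 2) : (fun y : Plane => c i + r * y i) ∈ polyFun 1 :=
      add_mem (polyFun_const 1 (c i)) ((polyFun 1).smul_mem r (polyFun_coord i))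
    convert polyFun_comp hp (h1 0) (h1 1) using 2 with y
    congr 1
    ext i
    fin_cases i <;> simp
  have h2 := h _ hq (r⁻¹ • (x - c)) (by
    rw [mem_closedBall_zero_iff, norm_smul, norm_inv, Real.norm_eq_abs, abs_of_pos hr,
      inv_mul_le_iff₀ hr]
    simpa [dist_eq_norm] using hx)
  have h3 : c + r • r⁻¹ • (x - c) = x := by
    rw [smul_smul, mul_inv_cancel₀ hr.ne', one_smul, add_sub_cancel]
  simp only [h3] at h2
  rw [integral_ball_comp_homothety _ c hr]
  refine h2.trans (le_of_eq ?_)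
  field_simp

/-- Point values of a polynomial on a segment are controlled by its mean square there. -/
lemma polyFun_inverse_segment (k : ℕ) : ∃ C : ℝ, 0 < C ∧ ∀ (a b : Plane), ∀ p ∈ polyFun k,
    ∀ t ∈ Set.Icc (0 : ℝ) 1,
      p (a + t • (b - a)) ^ 2 ≤ C * ∫ s in Set.Icc (0 : ℝ) 1, p (a + s • (b - a)) ^ 2 := by
  let ρ : (Plane → ℝ) →ₗ[ℝ] (ℝ → ℝ) := LinearMap.funLeft ℝ ℝ fun s : ℝ => (!₂[s, 0] : Plane)
  have hc : ContDiff ℝ ω fun s : ℝ => (!₂[s, 0] : Plane) := by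
    rw [contDiff_euclidean]
    intro i
    fin_cases i
    · exact contDiff_id
    · exact contDiff_const
  have hV : ∀ v ∈ (polyFun k).map ρ, ContDiff ℝ ω v := by
    rintro _ ⟨p, hp, rfl⟩
    exact (polyFun_contDiff hp).comp hc
  obtain ⟨C, hC, h⟩ := exists_sq_le_integral (μ := volume.restrict (Set.Icc (0 : ℝ) 1))
    ((polyFun k).map ρ)
    (fun v hv => memLp_of_continuous (hV v hv).continuous isCompact_Icc
      (ae_restrict_mem measurableSet_Icc))
    (fun v hv h0 => by
      have h1 : Set.EqOn v 0 (Set.Ioo (0 : ℝ) 1) := Measure.eqOn_open_of_ae_eq (μ := volume)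
        (ae_restrict_of_ae_restrict_of_subset Set.Ioo_subset_Icc_self h0) isOpen_Ioo
        (hV v hv).continuous.continuousOn continuousOn_const
      refine (hV v hv).analyticOnNhd.eq_of_eventuallyEq (g := 0) (analyticOnNhd_const (v := (0 : ℝ)))
        (z₀ := 1 / 2) ?_
      filter_upwards [isOpen_Ioo.mem_nhds (show (1 / 2 : ℝ) ∈ Set.Ioo (0 : ℝ) 1 by norm_num)]
        with x hx using h1 hx)
    (Set.Icc 0 1)
    (fun v hv => isCompact_Icc.exists_bound_of_continuousOn (hV v hv).continuous.continuousOn)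
  refine ⟨C, hC, fun a b p hp t ht => ?_⟩
  have hq : (fun y : Plane => p (a + y 0 • (b - a))) ∈ polyFun k := by
    have h1 (i : Fin 2) : (fun y : Plane => a i + (b i - a i) * y 0) ∈ polyFun 1 :=
      add_mem (polyFun_const 1 (a i)) ((polyFun 1).smul_mem (b i - a i) (polyFun_coord 0))
    convert polyFun_comp hp (h1 0) (h1 1) using 2 with y
    congr 1
    ext i
    fin_cases i <;> simp <;> ring
  simpa [ρ, LinearMap.funLeft] using h _ ⟨_, hq, rfl⟩ t ht

/-- The defining property of the `L²` projection onto polynomials. -/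
lemma l2Proj_spec (k : ℕ) {μ : Measure Plane} [IsFiniteMeasure μ] {K : Set Plane}
    (hK : IsCompact K) (hμ : ∀ᵐ x ∂μ, x ∈ K) {g : Plane → ℝ} (hg : MemLp g 2 μ) :
    l2Proj k μ g ∈ polyFun k ∧
      ∀ q ∈ polyFun k, ∫ x, l2Proj k μ g x * q x ∂μ = ∫ x, g x * q x ∂μ := by
  have hV : ∀ v ∈ polyFun k, MemLp v 2 μ := fun v hv =>
    memLp_of_continuous (polyFun_contDiff hv (n := 0)).continuous hK hμ
  have hI (v : polyFun k) : Integrable (fun x => g x * (v : Plane → ℝ) x) μ :=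
    hg.integrable_mul (hV v v.2)
  obtain ⟨u, hu, h⟩ := exists_integral_inner_eq (μ := μ) (polyFun k) hV
    { toFun := fun v => ∫ x, g x * (v : Plane → ℝ) x ∂μ
      map_add' := fun v w => by
        rw [← integral_add (hI v) (hI w)]
        exact integral_congr_ae (ae_of_all _ fun x => by simp [mul_add])
      map_smul' := fun c v => by
        rw [RingHom.id_apply, ← integral_smul]
        exact integral_congr_ae (ae_of_all _ fun x => by simp; ring) }
    (fun v hv => by
      refine integral_eq_zero_of_ae ?_
      filter_upwards [hv] with x hx
      simp [hx])
  exact Classical.epsilon_spec (p := fun p => p ∈ polyFun k ∧ ∀ q ∈ polyFun k,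
    ∫ x, p x * q x ∂μ = ∫ x, g x * q x ∂μ) ⟨u, hu, fun q hq => by
      have := h q hq
      simpa [mul_comm] using this⟩

/-! ### Arc length on edges -/

lemma hull_pair (a b : Plane) : hull {a, b} = segment ℝ a b := by
  simp [hull, convexHull_pair]

lemma mem_segment_iff_param {a b x : Plane} :
    x ∈ segment ℝ a b ↔ ∃ s ∈ Set.Icc (0 : ℝ) 1, a + s • (b - a) = x := by
  rw [segment_eq_image']
  simp

lemma isCompact_hull (t : Finset Plane) : IsCompact (hull t) :=
  t.finite_toSet.isCompact_convexHull (𝕜 := ℝ)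

lemma convex_hull (t : Finset Plane) : Convex ℝ (hull t) := convex_convexHull ℝ _

lemma hull_mono {s t : Finset Plane} (h : s ⊆ t) : hull s ⊆ hull t :=
  convexHull_mono (by exact_mod_cast h)

lemma subset_hull (t : Finset Plane) : (t : Set Plane) ⊆ hull t := subset_convexHull ℝ _

lemma measurableSet_hull (t : Finset Plane) : MeasurableSet (hull t) :=
  (isCompact_hull t).isClosed.measurableSet

lemma ae_edgeMeasure_mem (e : Finset Plane) : ∀ᵐ x ∂edgeMeasure e, x ∈ hull e :=
  ae_restrict_mem (measurableSet_hull e)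

/-- Arc length on a segment is the image of Lebesgue measure under a parametrization. -/
lemma edgeMeasure_pair {a b : Plane} (hab : a ≠ b) :
    edgeMeasure {a, b} = ENNReal.ofReal ‖b - a‖ •
      (volume.restrict (Set.Icc (0 : ℝ) 1)).map (fun s => a + s • (b - a)) := by
  set l := ‖b - a‖ with hl
  have hl0 : 0 < l := norm_pos_iff.2 (sub_ne_zero.2 hab.symm)
  set w := l⁻¹ • (b - a) with hw
  have hlw : l • w = b - a := by rw [hw, smul_smul, mul_inv_cancel₀ hl0.ne', one_smul]
  have hw1 : ‖w‖ = 1 := by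
    rw [hw, norm_smul, norm_inv, Real.norm_eq_abs, abs_of_pos hl0, ← hl, inv_mul_cancel₀ hl0.ne']
  set ι : ℝ → Plane := fun s => a + s • w with hι
  have hiso : Isometry ι := Isometry.of_dist_eq fun s t => by
    simp only [hι, dist_add_left]
    rw [dist_eq_norm, ← sub_smul, norm_smul, hw1, mul_one, Real.dist_eq, Real.norm_eq_abs]
  have hγ : (fun s : ℝ => a + s • (b - a)) = ι ∘ (l * ·) := by
    ext1 s
    simp only [hι, Function.comp, ← hlw, smul_smul, mul_comm]
  have hγm : Measurable (fun s : ℝ => a + s • (b - a)) := by fun_prop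
  have hS : MeasurableSet (segment ℝ a b) := by
    rw [← hull_pair]; exact measurableSet_hull _
  have hpre : (fun s : ℝ => a + s • (b - a)) ⁻¹' segment ℝ a b = Set.Icc 0 1 := by
    ext s
    rw [Set.mem_preimage, mem_segment_iff_param]
    constructor
    · rintro ⟨t, ht, h⟩
      have h1 : (t - s) • (b - a) = 0 := by
        rw [sub_smul, sub_eq_zero]; exact add_left_cancel h
      rcases smul_eq_zero.1 h1 with h2 | h2
      · rwa [← sub_eq_zero.1 h2]
      · exact absurd (sub_eq_zero.1 h2).symm hab
    · exact fun h => ⟨s, h, rfl⟩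
  have h1 : ENNReal.ofReal l • (volume : Measure ℝ).map (fun s => a + s • (b - a))
      = (Measure.hausdorffMeasure 1 : Measure Plane).restrict (Set.range ι) := by
    rw [hγ, ← Measure.map_map hiso.continuous.measurable (measurable_const_mul l),
      ← Measure.map_smul]
    have h2 := Real.smul_map_volume_mul_left hl0.ne'
    rw [abs_of_pos hl0] at h2
    rw [h2, ← hausdorffMeasure_real, hiso.map_hausdorffMeasure (Or.inl zero_le_one)]
  have h3 := congrArg (fun m : Measure Plane => m.restrict (segment ℝ a b)) h1
  simp only [Measure.restrict_smul, Measure.restrict_map hγm hS, hpre] at h3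
  rw [h3, Measure.restrict_restrict hS, edgeMeasure, hull_pair, Set.inter_eq_left.2]
  rintro x hx
  obtain ⟨s, -, rfl⟩ := mem_segment_iff_param.1 hx
  exact ⟨l * s, by simp only [hι, ← hlw, smul_smul, mul_comm]⟩

lemma exists_pair_of_card {e : Finset Plane} (he : e.card = 2) :
    ∃ a b : Plane, a ≠ b ∧ e = {a, b} := Finset.card_eq_two.1 he

lemma isFiniteMeasure_edge {e : Finset Plane} (he : e.card = 2) :
    IsFiniteMeasure (edgeMeasure e) := by
  obtain ⟨a, b, hab, rfl⟩ := exists_pair_of_card he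
  rw [edgeMeasure_pair hab]
  exact ⟨by simp [Measure.map_apply (show Measurable (fun s : ℝ => a + s • (b - a)) by fun_prop)]⟩

lemma integral_edge {a b : Plane} (hab : a ≠ b) (f : Plane → ℝ) :
    ∫ x, f x ∂edgeMeasure {a, b}
      = ‖b - a‖ * ∫ s in Set.Icc (0 : ℝ) 1, f (a + s • (b - a)) := by
  have hemb : MeasurableEmbedding (fun s : ℝ => a + s • (b - a)) := by
    refine Continuous.measurableEmbedding (by fun_prop) fun s t h => ?_
    have h1 : (s - t) • (b - a) = 0 := by
      rw [sub_smul, sub_eq_zero]; exact add_left_cancel h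
    rcases smul_eq_zero.1 h1 with h2 | h2
    · exact sub_eq_zero.1 h2
    · exact absurd (sub_eq_zero.1 h2).symm hab
  rw [edgeMeasure_pair hab, integral_smul_measure, hemb.integral_map]
  simp

lemma memLp_edge {e : Finset Plane} (he : e.card = 2) {E : Type*} [NormedAddCommGroup E]
    [SecondCountableTopology E] {f : Plane → E}
    (hf : Continuous f) : MemLp f 2 (edgeMeasure e) := by
  have := isFiniteMeasure_edge he
  exact memLp_of_continuous hf (isCompact_hull e) (ae_edgeMeasure_mem e)

lemma edgeMeasure_singleton (e : Finset Plane) (x : Plane) :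
    edgeMeasure e {x} = 0 := by
  have h : (Measure.hausdorffMeasure 1 : Measure Plane) {x} = 0 := by
    have := Measure.nullSingletonClass_hausdorff Plane (d := 1) one_pos
    exact measure_singleton x
  exact le_antisymm ((Measure.restrict_apply_le _ _).trans h.le) bot_le

/-! ### Triangles -/

/-- A finite set of vertices of a nondegenerate triangle. -/
structure IsTri (t : Finset Plane) : Prop where
  card : t.card = 3
  indep : AffineIndependent ℝ ((↑) : t → Plane)

namespace IsTri

variable {t : Finset Plane} (h : IsTri t)

/-- The vertices of a triangle as an affine basis of the plane. -/
noncomputable def basis : AffineBasis t ℝ Plane where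
  toFun := (↑)
  ind' := h.indep
  tot' := by
    rw [h.indep.affineSpan_eq_top_iff_card_eq_finrank_add_one]
    simp [h.card]

/-- The barycentric coordinate of the vertex `i`. -/
noncomputable def bary (i : t) : Plane → ℝ := h.basis.coord i

include h

lemma bary_vertex (i j : t) : h.bary i (j : Plane) = if i = j then 1 else 0 :=
  h.basis.coord_apply i j

lemma sum_bary (x : Plane) : ∑ i, h.bary i x = 1 := h.basis.sum_coord_apply_eq_one x

lemma sum_bary_smul (x : Plane) : ∑ i, h.bary i x • (i : Plane) = x :=
  h.basis.linear_combination_coord_eq_self x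

lemma range_basis : Set.range h.basis = (t : Set Plane) := by
  ext x
  constructor
  · rintro ⟨i, rfl⟩; exact i.2
  · exact fun hx => ⟨⟨x, hx⟩, rfl⟩

lemma mem_hull_iff {x : Plane} : x ∈ hull t ↔ ∀ i, 0 ≤ h.bary i x := by
  have := h.basis.convexHull_eq_nonneg_coord
  rw [h.range_basis] at this
  rw [hull, this]
  rfl

lemma mem_openTri_iff {x : Plane} : x ∈ openTri t ↔ ∀ i, 0 < h.bary i x := by
  have := h.basis.interior_convexHull
  rw [h.range_basis] at this
  rw [openTri, hull, this]
  rfl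

omit h in
lemma isOpen_openTri : IsOpen (openTri t) := isOpen_interior

omit h in
lemma openTri_subset : openTri t ⊆ hull t := interior_subset

omit h in
lemma convex_openTri : Convex ℝ (openTri t) := (convex_hull t).interior

omit h in
lemma restrict_openTri : (volume : Measure Plane).restrict (openTri t) = volume.restrict (hull t) := by
  refine Measure.restrict_congr_set ?_
  exact interior_ae_eq_of_null_frontier ((convex_hull t).addHaar_frontier _)

lemma openTri_nonempty : (openTri t).Nonempty := by
  have := h.basis.centroid_mem_interior_convexHull
  rw [h.range_basis] at this
  exact ⟨_, this⟩

lemma bary_mem_polyFun (i : t) : h.bary i ∈ polyFun 1 := by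
  have h1 : h.bary i = (fun _ => h.bary i 0) + ((h.basis.coord i).linear (EuclideanSpace.single 0 1))
      • (fun x : Plane => x 0) + ((h.basis.coord i).linear (EuclideanSpace.single 1 1))
      • (fun x : Plane => x 1) := by
    ext x
    have hx : x = x 0 • EuclideanSpace.single (0 : Fin 2) (1 : ℝ)
        + x 1 • EuclideanSpace.single (1 : Fin 2) (1 : ℝ) := by
      ext j; fin_cases j <;> simp
    have h2 := (h.basis.coord i).map_vadd 0 x
    simp only [vadd_eq_add, add_zero] at h2
    simp only [bary, Pi.add_apply, Pi.smul_apply, smul_eq_mul]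
    rw [h2]
    conv_lhs => rw [hx, map_add, map_smul, map_smul]
    simp only [smul_eq_mul]
    ring
  rw [h1]
  exact add_mem (add_mem (polyFun_const _ _) (Submodule.smul_mem _ _ (polyFun_coord 0)))
    (Submodule.smul_mem _ _ (polyFun_coord 1))

/-- The gradient of a barycentric coordinate. -/
noncomputable def gradBary (i : t) : Plane :=
  (InnerProductSpace.toDual ℝ Plane).symm
    (LinearMap.toContinuousLinearMap (h.basis.coord i).linear)

lemma inner_gradBary (i : t) (x y : Plane) : ⟪h.gradBary i, x - y⟫ = h.bary i x - h.bary i y := by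
  rw [gradBary, InnerProductSpace.toDual_symm_apply]
  exact (h.basis.coord i).linearMap_vsub x y

lemma exists_ne_vertex (i : t) : ∃ j : t, j ≠ i := by
  have : 1 < Fintype.card t := by simp [h.card]
  obtain ⟨j, hj⟩ := Fintype.exists_ne_of_one_lt_card this i
  exact ⟨j, hj⟩

lemma gradBary_ne_zero (i : t) : h.gradBary i ≠ 0 := by
  intro h0
  obtain ⟨j, hj⟩ := h.exists_ne_vertex i
  have := h.inner_gradBary i i j
  rw [h0, inner_zero_left, h.bary_vertex, h.bary_vertex, if_pos rfl, if_neg hj.symm] at this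
  norm_num at this

lemma triEdges_eq : triEdges t = (Finset.univ : Finset t).image fun c : t => t.erase (c : Plane) := by
  ext e
  simp only [triEdges, Finset.mem_powersetCard, Finset.mem_image, Finset.mem_univ, true_and,
    Subtype.exists]
  constructor
  · rintro ⟨h1, h2⟩
    have h3 : (t \ e).card = 1 := by rw [Finset.card_sdiff_of_subset h1, h.card, h2]
    obtain ⟨c, hc⟩ := Finset.card_eq_one.1 h3
    have hct : c ∈ t \ e := by rw [hc]; simp
    refine ⟨c, (Finset.mem_sdiff.1 hct).1, ?_⟩
    rw [Finset.erase_eq, ← hc, Finset.sdiff_sdiff_eq_self h1]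
  · rintro ⟨c, hc, rfl⟩
    exact ⟨Finset.erase_subset _ _, by rw [Finset.card_erase_of_mem hc, h.card]⟩

lemma sum_triEdges (F : Finset Plane → ℝ) : ∑ e ∈ triEdges t, F e = ∑ c : t, F (t.erase (c : Plane)) := by
  rw [h.triEdges_eq, Finset.sum_image]
  · intro c _ d _ hcd
    have h1 := congrArg (fun s => t \ s) hcd
    simp only [Finset.erase_eq] at h1
    rw [Finset.sdiff_sdiff_eq_self (by simp), Finset.sdiff_sdiff_eq_self (by simp)] at h1
    exact Subtype.ext (Finset.singleton_injective h1)

lemma card_edge (c : t) : (t.erase (c : Plane)).card = 2 := by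
  rw [Finset.card_erase_of_mem c.2, h.card]

/-- The vertices of a triangle, starting from a given one. -/
lemma exists_vertices (c : t) : ∃ a b : t, a ≠ b ∧ a ≠ c ∧ b ≠ c ∧
    t.erase (c : Plane) = {(a : Plane), (b : Plane)} ∧ t = {(a : Plane), (b : Plane), (c : Plane)} ∧
    (Finset.univ : Finset t) = {a, b, c} := by
  obtain ⟨a, b, hab, he⟩ := Finset.card_eq_two.1 (h.card_edge c)
  have ha : a ∈ t.erase (c : Plane) := by rw [he]; simp
  have hb : b ∈ t.erase (c : Plane) := by rw [he]; simp
  rw [Finset.mem_erase] at ha hb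
  have ht : t = {a, b, (c : Plane)} := by
    refine (Finset.insert_erase c.2).symm.trans ?_
    rw [he]
    ext x; simp; tauto
  refine ⟨⟨a, ha.2⟩, ⟨b, hb.2⟩, fun h => hab (congrArg Subtype.val h),
    fun h => ha.1 (congrArg Subtype.val h), fun h => hb.1 (congrArg Subtype.val h), he, ht, ?_⟩
  ext ⟨x, hx⟩
  have h2 : x ∈ ({a, b, (c : Plane)} : Finset Plane) := ht ▸ hx
  simpa [Subtype.ext_iff] using h2

lemma mem_edge_iff {c : t} {x : Plane} :
    x ∈ hull (t.erase (c : Plane)) ↔ x ∈ hull t ∧ h.bary c x = 0 := by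
  obtain ⟨a, b, hab, hac, hbc, he, -, hu⟩ := h.exists_vertices c
  constructor
  · intro hx
    refine ⟨hull_mono (Finset.erase_subset _ _) hx, ?_⟩
    rw [he, hull_pair, mem_segment_iff_param] at hx
    obtain ⟨s, -, rfl⟩ := hx
    have h1 := h.inner_gradBary c ((a : Plane) + s • ((b : Plane) - a)) a
    have h2 := h.inner_gradBary c b a
    rw [add_sub_cancel_left, inner_smul_right, h2] at h1
    simp only [h.bary_vertex, hac.symm, hbc.symm, if_false] at h1
    linarith
  · rintro ⟨h1, h2⟩
    have h3 := h.sum_bary x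
    have h4 := h.sum_bary_smul x
    rw [hu] at h3 h4
    rw [Finset.sum_insert (by simp [hab, hac]), Finset.sum_insert (by simp [hbc]),
      Finset.sum_singleton, h2] at h3 h4
    rw [he, hull_pair]
    refine ⟨_, _, h.mem_hull_iff.1 h1 a, h.mem_hull_iff.1 h1 b, by linarith, ?_⟩
    rw [zero_smul, add_zero] at h4
    exact h4

/-- The outward unit normal is the normalized negative gradient of the barycentric coordinate of
the opposite vertex. -/
lemma outwardNormal_spec (c : t) :
    ‖outwardNormal {t} (t.erase (c : Plane))‖ = 1 ∧ ∃ d : ℝ, 0 < d ∧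
      h.gradBary c = -(d⁻¹ • outwardNormal {t} (t.erase (c : Plane))) := by
  obtain ⟨a, b, hab, hac, hbc, he, ht, hu⟩ := h.exists_vertices c
  set g := h.gradBary c with hg
  have hg0 : 0 < ‖g‖ := norm_pos_iff.2 (h.gradBary_ne_zero c)
  have hz : ∀ x ∈ t.erase (c : Plane), h.bary c x = 0 := fun x hx =>
    (h.mem_edge_iff.1 (subset_hull _ hx)).2
  have hex : ∃ n : Plane, ‖n‖ = 1 ∧ (∀ a ∈ t.erase (c : Plane), ∀ b ∈ t.erase (c : Plane),
      ⟪n, b - a⟫ = 0) ∧ ∀ s ∈ ({t} : Finset (Finset Plane)), t.erase (c : Plane) ⊆ s →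
        ∀ a ∈ t.erase (c : Plane), ∀ z ∈ s, z ∉ t.erase (c : Plane) → ⟪n, z - a⟫ < 0 := by
    refine ⟨-(‖g‖⁻¹ • g), ?_, ?_, ?_⟩
    · rw [norm_neg, norm_smul, norm_inv, norm_norm, inv_mul_cancel₀ hg0.ne']
    · intro x hx y hy
      rw [inner_neg_left, inner_smul_left, h.inner_gradBary, hz x hx, hz y hy]
      simp
    · intro s hs _ x hx z hz' hz''
      rw [Finset.mem_singleton.1 hs] at hz'
      have hzc : z = c := by
        by_contra hne
        exact hz'' (Finset.mem_erase.2 ⟨hne, hz'⟩)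
      rw [inner_neg_left, inner_smul_left, h.inner_gradBary, hz x hx, hzc, h.bary_vertex]
      simpa using hg0
  obtain ⟨h1, h2, h3⟩ := Classical.epsilon_spec hex
  change ‖outwardNormal {t} (t.erase (c : Plane))‖ = 1 at h1
  refine ⟨h1, ?_⟩
  set n := outwardNormal {t} (t.erase (c : Plane)) with hn
  have hae : (a : Plane) ∈ t.erase (c : Plane) := by rw [he]; simp
  have hbe : (b : Plane) ∈ t.erase (c : Plane) := by rw [he]; simp
  have hna : ⟪n, (b : Plane) - a⟫ = 0 := h2 a hae b hbe
  have hnc : ⟪n, (c : Plane) - a⟫ < 0 := h3 t (by simp) (Finset.erase_subset _ _) a hae c c.2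
    (by simp)
  set d := -⟪n, (c : Plane) - a⟫ with hd
  have hd0 : 0 < d := by simp [hd, hnc]
  refine ⟨d, hd0, ?_⟩
  -- both sides have the same inner products with `b - a` and `c - a`, which span the plane
  have hsub : ∀ x : Plane, ⟪g + d⁻¹ • n, x - a⟫ = 0 := by
    intro x
    have h4 := h.sum_bary_smul x
    have h5 := h.sum_bary x
    rw [hu] at h4 h5
    rw [Finset.sum_insert (by simp [hab, hac]), Finset.sum_insert (by simp [hbc]),
      Finset.sum_singleton] at h4 h5
    have h6 : x - a = h.bary b x • ((b : Plane) - a) + h.bary c x • ((c : Plane) - a) := by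
      have h7 : h.bary a x = 1 - h.bary b x - h.bary c x := by linarith
      rw [h7] at h4
      conv_lhs => rw [← h4]
      module
    rw [h6, inner_add_right, inner_smul_right, inner_smul_right, inner_add_left, inner_add_left,
      inner_smul_left, inner_smul_left, h.inner_gradBary, h.inner_gradBary, hna,
      h.bary_vertex, h.bary_vertex, h.bary_vertex, if_neg hbc.symm, if_neg hac.symm, if_pos rfl]
    have : ⟪n, (c : Plane) - a⟫ = -d := by simp [hd]
    rw [this]
    simp [hd0.ne']
  have h8 := hsub ((a : Plane) + (g + d⁻¹ • n))
  rw [add_sub_cancel_left, inner_self_eq_zero] at h8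
  exact eq_neg_of_add_eq_zero_left h8

/-- The height of the triangle over the edge opposite to `c`. -/
noncomputable def height (c : t) : ℝ := ‖h.gradBary c‖⁻¹

lemma height_pos (c : t) : 0 < h.height c := inv_pos.2 (norm_pos_iff.2 (h.gradBary_ne_zero c))

lemma norm_normal (c : t) : ‖outwardNormal {t} (t.erase (c : Plane))‖ = 1 :=
  (h.outwardNormal_spec c).1

lemma gradBary_eq (c : t) :
    h.gradBary c = -((h.height c)⁻¹ • outwardNormal {t} (t.erase (c : Plane))) := by
  obtain ⟨h1, d, hd, h2⟩ := h.outwardNormal_spec c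
  have h3 : ‖h.gradBary c‖ = d⁻¹ := by
    rw [h2, norm_neg, norm_smul, h1, mul_one, norm_inv, Real.norm_eq_abs, abs_of_pos hd]
  rw [height, h3, inv_inv, h2]

/-- On the edge opposite to `c`, the outward normal component of `x - y` is the height times the
barycentric coordinate of `y`. -/
lemma inner_normal_sub (c : t) (x y : Plane) :
    ⟪outwardNormal {t} (t.erase (c : Plane)), x - y⟫
      = h.height c * (h.bary c y - h.bary c x) := by
  have h1 := h.inner_gradBary c x y
  rw [h.gradBary_eq, inner_neg_left, inner_smul_left] at h1
  have h2 := (h.height_pos c).ne'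
  simp only [conj_trivial] at h1
  field_simp at h1
  linarith

end IsTri

/-! ### Green's formula on a triangle -/

/-- The determinant of two plane vectors. -/
def cross (p q : Plane) : ℝ := p 0 * q 1 - p 1 * q 0

lemma inner_plane (x y : Plane) : ⟪x, y⟫ = x 0 * y 0 + x 1 * y 1 := by
  simp [PiLp.inner_apply, Fin.sum_univ_two, mul_comm]

lemma normSq_plane (x : Plane) : ‖x‖ ^ 2 = x 0 ^ 2 + x 1 ^ 2 := by
  rw [← real_inner_self_eq_norm_sq, inner_plane]; ring

lemma abs_cross_eq {n u w : Plane} (hn : ‖n‖ = 1) (hw : ⟪n, w⟫ = 0) :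
    |cross u w| = |⟪n, u⟫| * ‖w‖ := by
  have h1 : n 0 ^ 2 + n 1 ^ 2 = 1 := by rw [← normSq_plane, hn]; norm_num
  rw [inner_plane] at hw
  rw [← abs_of_nonneg (norm_nonneg w), ← abs_mul, ← sq_eq_sq_iff_abs_eq_abs, mul_pow, normSq_plane,
    inner_plane, cross]
  set s := n 0 * w 1 - n 1 * w 0 with hs
  have hw0 : w 0 = -(n 1) * s := by rw [hs]; linear_combination (-w 0) * h1 + n 0 * hw
  have hw1 : w 1 = n 0 * s := by rw [hs]; linear_combination (-w 1) * h1 + n 1 * hw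
  rw [hw0, hw1]
  linear_combination (-(u 0 * n 0 * s + u 1 * n 1 * s) ^ 2) * h1

/-- The linear map with columns `p` and `q`. -/
noncomputable def colMap (p q : Plane) : Plane →L[ℝ] Plane :=
  (EuclideanSpace.proj 0 : Plane →L[ℝ] ℝ).smulRight p
    + (EuclideanSpace.proj 1 : Plane →L[ℝ] ℝ).smulRight q

lemma colMap_apply (p q y : Plane) : colMap p q y = y 0 • p + y 1 • q := rfl

lemma det_colMap (p q : Plane) : (colMap p q).det = cross p q := by
  rw [ContinuousLinearMap.det,
    ← LinearMap.det_toMatrix (EuclideanSpace.basisFun (Fin 2) ℝ).toBasis, Matrix.det_fin_two]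
  simp [LinearMap.toMatrix_apply, colMap_apply, cross]
  ring

/-- The reference triangle. -/
def refTri : Set (ℝ × ℝ) := {z | 0 ≤ z.1 ∧ 0 ≤ z.2 ∧ z.1 + z.2 ≤ 1}

lemma isCompact_refTri : IsCompact refTri := by
  refine (isCompact_Icc.prod isCompact_Icc : IsCompact (Set.Icc (0 : ℝ) 1 ×ˢ Set.Icc (0 : ℝ) 1)).of_isClosed_subset ?_ ?_
  · exact (isClosed_le continuous_const continuous_fst).inter
      ((isClosed_le continuous_const continuous_snd).inter
        (isClosed_le (continuous_fst.add continuous_snd) continuous_const))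
  · rintro ⟨x, y⟩ ⟨h1, h2, h3⟩
    simp only at h1 h2 h3
    exact ⟨⟨h1, by linarith⟩, ⟨h2, by linarith⟩⟩

lemma integral_refTri {g : ℝ × ℝ → ℝ} (hg : Continuous g) :
    ∫ z in refTri, g z = ∫ x in Set.Icc (0 : ℝ) 1, ∫ y in (0 : ℝ)..(1 - x), g (x, y) := by
  have hm := isCompact_refTri.isClosed.measurableSet
  rw [← integral_indicator hm, Measure.volume_eq_prod, integral_prod, ← integral_indicator measurableSet_Icc]
  · refine integral_congr_ae (ae_of_all _ fun x => ?_)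
    by_cases hx : x ∈ Set.Icc (0 : ℝ) 1
    · simp only [Set.indicator_of_mem hx]
      rw [intervalIntegral.integral_of_le (by linarith [hx.2]), ← integral_Icc_eq_integral_Ioc,
        ← integral_indicator measurableSet_Icc]
      congr 1
      ext y
      by_cases hy : y ∈ Set.Icc (0 : ℝ) (1 - x)
      · rw [Set.indicator_of_mem hy, Set.indicator_of_mem]
        exact ⟨hx.1, hy.1, by have := hy.2; simp only; linarith⟩
      · rw [Set.indicator_of_notMem hy, Set.indicator_of_notMem]
        rintro ⟨h1, h2, h3⟩
        simp only at h1 h2 h3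
        exact hy ⟨h2, by linarith⟩
    · simp only [Set.indicator_of_notMem hx]
      refine integral_eq_zero_of_ae (ae_of_all _ fun y => ?_)
      refine Set.indicator_of_notMem ?_ _
      rintro ⟨h1, h2, h3⟩
      simp only at h1 h2 h3
      exact hx ⟨h1, by linarith⟩
  · exact (integrable_indicator_iff hm).2 (hg.continuousOn.integrableOn_compact isCompact_refTri)

/-- Coordinates on the plane as a measure preserving equivalence. -/
noncomputable def planeEquiv : Plane ≃ᵐ ℝ × ℝ :=
  (MeasurableEquiv.toLp 2 (Fin 2 → ℝ)).symm.trans MeasurableEquiv.finTwoArrow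

lemma planeEquiv_apply (x : Plane) : planeEquiv x = (x 0, x 1) := rfl

lemma measurePreserving_planeEquiv :
    MeasurePreserving planeEquiv (volume : Measure Plane) volume :=
  (volume_preserving_finTwoArrow ℝ).comp (PiLp.volume_preserving_ofLp (Fin 2))

namespace IsTri

variable {t : Finset Plane} (h : IsTri t)
include h

lemma sub_eq_of_vertices {a b c : t} (hab : a ≠ b) (hac : a ≠ c) (hbc : b ≠ c)
    (hu : (Finset.univ : Finset t) = {a, b, c}) (x : Plane) :
    x - a = h.bary b x • ((b : Plane) - a) + h.bary c x • ((c : Plane) - a) := by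
  have h4 := h.sum_bary_smul x
  have h5 := h.sum_bary x
  rw [hu] at h4 h5
  rw [Finset.sum_insert (by simp [hab, hac]), Finset.sum_insert (by simp [hbc]),
    Finset.sum_singleton] at h4 h5
  have h7 : h.bary a x = 1 - h.bary b x - h.bary c x := by linarith
  rw [h7] at h4
  conv_lhs => rw [← h4]
  module

lemma bary_of_coords {a b c : t} (hab : a ≠ b) (hac : a ≠ c) (hbc : b ≠ c) (x y : ℝ) :
    h.bary a ((a : Plane) + (x • ((b : Plane) - a) + y • ((c : Plane) - a))) = 1 - x - y ∧
    h.bary b ((a : Plane) + (x • ((b : Plane) - a) + y • ((c : Plane) - a))) = x ∧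
    h.bary c ((a : Plane) + (x • ((b : Plane) - a) + y • ((c : Plane) - a))) = y := by
  have key (i : t) : h.bary i ((a : Plane) + (x • ((b : Plane) - a) + y • ((c : Plane) - a)))
      = h.bary i a + x * (h.bary i b - h.bary i a) + y * (h.bary i c - h.bary i a) := by
    have h1 := h.inner_gradBary i
      ((a : Plane) + (x • ((b : Plane) - a) + y • ((c : Plane) - a))) a
    rw [add_sub_cancel_left, inner_add_right, inner_smul_right, inner_smul_right,
      h.inner_gradBary, h.inner_gradBary] at h1
    linarith
  refine ⟨?_, ?_, ?_⟩ <;> rw [key] <;>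
    simp [h.bary_vertex, hab, hac, hbc, hab.symm, hac.symm, hbc.symm]
  ring

lemma height_mul_norm {a b c : t} (hab : a ≠ b) (hac : a ≠ c) :
    h.height a * ‖(c : Plane) - b‖ = |cross ((b : Plane) - a) ((c : Plane) - a)| := by
  have h1 : ⟪outwardNormal {t} (t.erase (a : Plane)), (c : Plane) - b⟫ = 0 := by
    rw [h.inner_normal_sub]; simp [h.bary_vertex, hab, hac]
  have h2 : ⟪outwardNormal {t} (t.erase (a : Plane)), (b : Plane) - a⟫ = h.height a := by
    rw [h.inner_normal_sub]; simp [h.bary_vertex, hab]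
  have h3 := abs_cross_eq (u := (b : Plane) - a) (h.norm_normal a) h1
  rw [h2, abs_of_pos (h.height_pos a)] at h3
  rw [← h3]
  congr 1
  simp [cross]; ring

lemma integral_hull {a b c : t} (hab : a ≠ b) (hac : a ≠ c) (hbc : b ≠ c)
    (hu : (Finset.univ : Finset t) = {a, b, c}) {f : Plane → ℝ} (hf : Continuous f) :
    ∫ x in hull t, f x = |cross ((b : Plane) - a) ((c : Plane) - a)| *
      ∫ x in Set.Icc (0 : ℝ) 1, ∫ y in (0 : ℝ)..(1 - x),
        f ((a : Plane) + (x • ((b : Plane) - a) + y • ((c : Plane) - a))) := by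
  have hm : MeasurableSet (planeEquiv ⁻¹' refTri) :=
    planeEquiv.measurable isCompact_refTri.isClosed.measurableSet
  set L := colMap ((b : Plane) - a) ((c : Plane) - a) with hL
  have himg : hull t = (fun y : Plane => (a : Plane) + L y) '' (planeEquiv ⁻¹' refTri) := by
    ext x
    constructor
    · intro hx
      rw [h.mem_hull_iff] at hx
      refine ⟨!₂[h.bary b x, h.bary c x], ⟨hx b, hx c, ?_⟩, ?_⟩
      · have h5 := h.sum_bary x
        rw [hu, Finset.sum_insert (by simp [hab, hac]), Finset.sum_insert (by simp [hbc]),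
          Finset.sum_singleton] at h5
        have := hx a
        simp only [planeEquiv_apply]
        simp
        linarith
      · have := h.sub_eq_of_vertices hab hac hbc hu x
        simp only [hL, colMap_apply]
        simp only [Matrix.cons_val_zero, Matrix.cons_val_one]
        rw [← this]; abel
    · rintro ⟨y, ⟨h1, h2, h3⟩, rfl⟩
      simp only [planeEquiv_apply] at h1 h2 h3
      rw [h.mem_hull_iff]
      intro i
      obtain ⟨e1, e2, e3⟩ := h.bary_of_coords hab hac hbc (y 0) (y 1)
      simp only [hL, colMap_apply]
      have hi : i ∈ ({a, b, c} : Finset t) := hu ▸ Finset.mem_univ i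
      simp only [Finset.mem_insert, Finset.mem_singleton] at hi
      rcases hi with rfl | rfl | rfl
      · rw [e1]; linarith
      · rw [e2]; exact h1
      · rw [e3]; exact h2
  have hinj : Set.InjOn (fun y : Plane => (a : Plane) + L y) (planeEquiv ⁻¹' refTri) := by
    intro y _ z _ hyz
    obtain ⟨-, e2, e3⟩ := h.bary_of_coords hab hac hbc (y 0) (y 1)
    obtain ⟨-, f2, f3⟩ := h.bary_of_coords hab hac hbc (z 0) (z 1)
    simp only [hL, colMap_apply] at hyz
    rw [hyz] at e2 e3
    ext i
    fin_cases i
    · exact e2.symm.trans f2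
    · exact e3.symm.trans f3
  rw [himg, integral_image_eq_integral_abs_det_fderiv_smul volume hm
    (fun x _ => (L.hasFDerivAt.const_add (a : Plane)).hasFDerivWithinAt) hinj]
  simp only [hL, det_colMap, smul_eq_mul]
  rw [integral_const_mul]
  congr 1
  have h6 := measurePreserving_planeEquiv.setIntegral_preimage_emb
    planeEquiv.measurableEmbedding
    (fun z => f ((a : Plane) + (z.1 • ((b : Plane) - a) + z.2 • ((c : Plane) - a)))) refTri
  simp only [planeEquiv_apply] at h6
  simp only [colMap_apply]
  rw [h6, integral_refTri (by fun_prop)]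

lemma green_side {a b c : t} (hab : a ≠ b) (hac : a ≠ c) (hbc : b ≠ c)
    (hu : (Finset.univ : Finset t) = {a, b, c}) {φ : Plane → ℝ} (hφ : ContDiff ℝ 1 φ) :
    ∫ x in hull t, fderiv ℝ φ x ((c : Plane) - a) =
      |cross ((b : Plane) - a) ((c : Plane) - a)| *
        ((∫ x in Set.Icc (0 : ℝ) 1, φ ((c : Plane) + x • ((b : Plane) - c)))
          - ∫ x in Set.Icc (0 : ℝ) 1, φ ((a : Plane) + x • ((b : Plane) - a))) := by
  have hc : Continuous fun x => fderiv ℝ φ x ((c : Plane) - a) :=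
    (hφ.continuous_fderiv (by simp)).clm_apply continuous_const
  have hφc := hφ.continuous
  rw [h.integral_hull hab hac hbc hu hc]
  congr 1
  rw [← integral_sub]
  · refine setIntegral_congr_fun measurableSet_Icc fun x hx => ?_
    have hder : ∀ y : ℝ, HasDerivAt
        (fun y : ℝ => φ ((a : Plane) + (x • ((b : Plane) - a) + y • ((c : Plane) - a))))
        (fderiv ℝ φ ((a : Plane) + (x • ((b : Plane) - a) + y • ((c : Plane) - a)))
          ((c : Plane) - a)) y := by
      intro y
      have h1 := (hφ.differentiable (by simp)
        ((a : Plane) + (x • ((b : Plane) - a) + y • ((c : Plane) - a)))).hasFDerivAt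
      have h2 : HasDerivAt (fun y : ℝ => (a : Plane) + (x • ((b : Plane) - a)
          + y • ((c : Plane) - a))) ((c : Plane) - a) y := by
        have := (((hasDerivAt_id y).smul_const ((c : Plane) - a)).const_add
          (x • ((b : Plane) - a))).const_add (a : Plane)
        simpa using this
      exact h1.comp_hasDerivAt y h2
    rw [intervalIntegral.integral_eq_sub_of_hasDerivAt (fun y _ => hder y)
      (Continuous.intervalIntegrable (by fun_prop) _ _)]
    congr 2
    · module
    · module
  · exact Continuous.integrableOn_Icc (by fun_prop)
  · exact Continuous.integrableOn_Icc (by fun_prop)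

/-- Green's formula on a triangle, for functions that are `C¹` on the plane. -/
theorem green {φ : Plane → ℝ} (hφ : ContDiff ℝ 1 φ) (v : Plane) :
    ∫ x in hull t, fderiv ℝ φ x v = ∑ c : t,
      ⟪outwardNormal {t} (t.erase (c : Plane)), v⟫ *
        ∫ x, φ x ∂edgeMeasure (t.erase (c : Plane)) := by
  -- the case of an edge vector
  have side : ∀ a c : t, a ≠ c → ∫ x in hull t, fderiv ℝ φ x ((c : Plane) - a) = ∑ i : t,
      ⟪outwardNormal {t} (t.erase (i : Plane)), (c : Plane) - a⟫ *
        ∫ x, φ x ∂edgeMeasure (t.erase (i : Plane)) := by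
    intro a c hac
    have hb : ∃ b : t, b ≠ a ∧ b ≠ c := by
      by_contra! hb
      have h1 : (Finset.univ : Finset t) ⊆ {a, c} := fun b _ => by
        by_cases hba : b = a
        · simp [hba]
        · simp [hb b hba]
      have h2 := Finset.card_le_card h1
      have h3 := Finset.card_le_two (a := a) (b := c)
      simp [h.card] at h2
      omega
    obtain ⟨b, hba, hbc⟩ := hb
    have hu : (Finset.univ : Finset t) = {a, b, c} := by
      refine (Finset.eq_of_subset_of_card_le (Finset.subset_univ _) ?_).symm
      rw [Finset.card_insert_of_notMem (by simp [hba.symm, hac]), Finset.card_pair hbc]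
      simp [h.card]
    have er : ∀ (i : t) (j k : t), i ≠ j → i ≠ k → j ≠ k →
        t.erase (i : Plane) = {(j : Plane), (k : Plane)} := by
      intro i j k hij hik hjk
      refine (Finset.eq_of_subset_of_card_le ?_ ?_).symm
      · intro x hx
        simp only [Finset.mem_insert, Finset.mem_singleton] at hx
        rcases hx with rfl | rfl
        · exact Finset.mem_erase.2 ⟨fun hh => hij (Subtype.ext hh).symm, j.2⟩
        · exact Finset.mem_erase.2 ⟨fun hh => hik (Subtype.ext hh).symm, k.2⟩
      · rw [h.card_edge, Finset.card_pair (fun hh => hjk (Subtype.ext hh))]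
    rw [h.green_side hba.symm hac hbc hu hφ, hu, Finset.sum_insert (by simp [hba.symm, hac]),
      Finset.sum_insert (by simp [hbc]), Finset.sum_singleton]
    rw [h.inner_normal_sub, h.inner_normal_sub, h.inner_normal_sub]
    simp only [h.bary_vertex, hac, hba, hbc, hac.symm, if_true, if_false]
    rw [er a c b hac hba.symm hbc.symm, er c a b hac.symm hbc.symm hba.symm,
      integral_edge (fun hh => hbc (Subtype.ext hh).symm),
      integral_edge (fun hh => hba (Subtype.ext hh).symm)]
    have h1 := h.height_mul_norm hac hba.symm
    have h2 := h.height_mul_norm hac.symm hbc.symm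
    have h3 : |cross ((c : Plane) - a) ((b : Plane) - a)|
        = |cross ((b : Plane) - a) ((c : Plane) - a)| := by
      rw [← abs_neg]; congr 1; simp [cross]; ring
    have h4 : |cross ((a : Plane) - c) ((b : Plane) - c)|
        = |cross ((b : Plane) - a) ((c : Plane) - a)| := by
      congr 1; simp [cross]; ring
    rw [h3] at h1
    rw [h4] at h2
    linear_combination
      (-(∫ s in Set.Icc (0 : ℝ) 1, φ ((c : Plane) + s • ((b : Plane) - c)))) * h1
      + (∫ s in Set.Icc (0 : ℝ) 1, φ ((a : Plane) + s • ((b : Plane) - a))) * h2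
  obtain ⟨c0, hc0⟩ := Finset.card_pos.1 (by rw [h.card]; norm_num : 0 < t.card)
  obtain ⟨a, b, hab, hac, hbc, -, -, hu⟩ := h.exists_vertices ⟨c0, hc0⟩
  set c : t := ⟨c0, hc0⟩
  have hv := h.sub_eq_of_vertices hab hac hbc hu ((a : Plane) + v)
  rw [add_sub_cancel_left] at hv
  set β := h.bary b ((a : Plane) + v)
  set γ := h.bary c ((a : Plane) + v)
  have hI (w : Plane) : Integrable (fun x => fderiv ℝ φ x w) (volume.restrict (hull t)) :=
    ((hφ.continuous_fderiv (by simp)).clm_apply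
      continuous_const).continuousOn.integrableOn_compact (isCompact_hull t)
  calc ∫ x in hull t, fderiv ℝ φ x v
      = β * (∫ x in hull t, fderiv ℝ φ x ((b : Plane) - a))
        + γ * ∫ x in hull t, fderiv ℝ φ x ((c : Plane) - a) := by
        rw [← integral_const_mul, ← integral_const_mul, ← integral_add ((hI _).const_mul _)
          ((hI _).const_mul _)]
        refine integral_congr_ae (ae_of_all _ fun x => ?_)
        simp only
        conv_lhs => rw [hv]
        rw [map_add, map_smul, map_smul]
        rfl
    _ = _ := by
        rw [side a b hab, side a c hac, Finset.mul_sum, Finset.mul_sum, ← Finset.sum_add_distrib]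
        refine Finset.sum_congr rfl fun i _ => ?_
        conv_rhs => rw [hv]
        rw [inner_add_right, inner_smul_right, inner_smul_right]
        ring

end IsTri

/-! ### Calculus of iterated partial derivatives -/

lemma partialD_zero_fun (i : Fin 2) : partialD i (0 : Plane → ℝ) = 0 := by
  ext x
  simp [partialD]

lemma contDiff_partialD {φ : Plane → ℝ} (hφ : ContDiff ℝ ∞ φ) (i : Fin 2) :
    ContDiff ℝ ∞ (partialD i φ) :=
  (hφ.fderiv_right (m := ∞) (by simp)).clm_apply contDiff_const

lemma multiD_zero (φ : Plane → ℝ) : multiD (0, 0) φ = φ := rfl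

lemma multiD_succ_fst (a b : ℕ) (φ : Plane → ℝ) :
    multiD (a + 1, b) φ = partialD 0 (multiD (a, b) φ) :=
  Function.iterate_succ_apply' _ _ _

lemma multiD_succ_snd (b : ℕ) (φ : Plane → ℝ) :
    multiD (0, b + 1) φ = partialD 1 (multiD (0, b) φ) :=
  Function.iterate_succ_apply' _ _ _

/-- Induction over multi-indices that follows the definition of `multiD`. -/
lemma multiIndex_induction {P : ℕ × ℕ → Prop} (h0 : P (0, 0)) (h1 : ∀ b, P (0, b) → P (0, b + 1))
    (h2 : ∀ a b, P (a, b) → P (a + 1, b)) (β : ℕ × ℕ) : P β := by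
  obtain ⟨a, b⟩ := β
  induction a with
  | zero =>
    induction b with
    | zero => exact h0
    | succ b ih => exact h1 b ih
  | succ a ih => exact h2 a b ih

lemma contDiff_multiD {φ : Plane → ℝ} (hφ : ContDiff ℝ ∞ φ) (β : ℕ × ℕ) :
    ContDiff ℝ ∞ (multiD β φ) := by
  induction β using multiIndex_induction with
  | h0 => exact hφ
  | h1 b ih => rw [multiD_succ_snd]; exact contDiff_partialD ih 1
  | h2 a b ih => rw [multiD_succ_fst]; exact contDiff_partialD ih 0

lemma tsupport_partialD_subset (i : Fin 2) (φ : Plane → ℝ) :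
    tsupport (partialD i φ) ⊆ tsupport φ :=
  tsupport_fderiv_apply_subset ℝ (EuclideanSpace.single i 1)

lemma tsupport_multiD_subset (β : ℕ × ℕ) (φ : Plane → ℝ) :
    tsupport (multiD β φ) ⊆ tsupport φ := by
  induction β using multiIndex_induction with
  | h0 => exact subset_rfl
  | h1 b ih => rw [multiD_succ_snd]; exact (tsupport_partialD_subset 1 _).trans ih
  | h2 a b ih => rw [multiD_succ_fst]; exact (tsupport_partialD_subset 0 _).trans ih

lemma hasCompactSupport_multiD {φ : Plane → ℝ} (hφ : HasCompactSupport φ) (β : ℕ × ℕ) :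
    HasCompactSupport (multiD β φ) :=
  hφ.of_isClosed_subset (isClosed_tsupport _) (tsupport_multiD_subset β φ)

lemma partialD_comp_affine {φ : Plane → ℝ} (hφ : ContDiff ℝ ∞ φ) (i : Fin 2) (s : ℝ) (b : Plane) :
    partialD i (fun x => φ (s • x + b)) = fun x => s * partialD i φ (s • x + b) := by
  ext x
  have h1 := (hφ.differentiable (by simp) (s • x + b)).hasFDerivAt
  have h2 : HasFDerivAt (fun x : Plane => s • x + b) (s • ContinuousLinearMap.id ℝ Plane) x :=
    ((hasFDerivAt_id x).const_smul s).add_const b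
  have h3 := (h1.comp x h2).fderiv
  unfold partialD
  rw [show (fun x => φ (s • x + b)) = φ ∘ (fun x : Plane => s • x + b) from rfl, h3]
  simp

lemma partialD_const_mul {φ : Plane → ℝ} (hφ : ContDiff ℝ ∞ φ) (i : Fin 2) (c : ℝ) :
    partialD i (fun x => c * φ x) = fun x => c * partialD i φ x := by
  ext x
  exact partialD_smul c (hφ.differentiable (by simp) x)

lemma multiD_comp_affine {φ : Plane → ℝ} (hφ : ContDiff ℝ ∞ φ) (β : ℕ × ℕ) (s : ℝ) (b : Plane) :
    multiD β (fun x => φ (s • x + b)) = fun x => s ^ (β.1 + β.2) * multiD β φ (s • x + b) := by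
  have step (i : Fin 2) (γ : ℕ × ℕ) (m : ℕ) :
      partialD i (fun x => s ^ m * multiD γ φ (s • x + b))
        = fun x => s ^ (m + 1) * partialD i (multiD γ φ) (s • x + b) := by
    have hγ := contDiff_multiD hφ γ
    rw [partialD_const_mul (φ := fun x => multiD γ φ (s • x + b)) (hγ.comp (by fun_prop)),
      partialD_comp_affine hγ]
    ext x
    ring
  induction β using multiIndex_induction with
  | h0 => simp [multiD_zero]
  | h1 c ih => rw [multiD_succ_snd, ih, step, multiD_succ_snd]; rfl
  | h2 a c ih =>
    rw [multiD_succ_fst, ih, step, multiD_succ_fst]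
    ext x
    simp only
    congr 2
    omega

/-! ### Smoothing on a convex set -/

lemma partialD_convolution {f κ : Plane → ℝ} (hf : LocallyIntegrable f volume)
    (hκ : ContDiff ℝ ∞ κ) (hκc : HasCompactSupport κ) (i : Fin 2) :
    partialD i (fun x => ∫ w, f w * κ (x - w)) = fun x => ∫ w, f w * partialD i κ (x - w) := by
  ext x
  have h1 := hκc.hasFDerivAt_convolution_right (ContinuousLinearMap.mul ℝ ℝ) hf
    (hκ.of_le (by simp)) x
  change fderiv ℝ (MeasureTheory.convolution f κ (ContinuousLinearMap.mul ℝ ℝ) volume) x _ = _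
  rw [h1.fderiv, convolution_precompR_apply _ hf (hκc.fderiv ℝ)
    (hκ.continuous_fderiv (by simp))]
  rfl

lemma multiD_convolution {f κ : Plane → ℝ} (hf : LocallyIntegrable f volume)
    (hκ : ContDiff ℝ ∞ κ) (hκc : HasCompactSupport κ) (β : ℕ × ℕ) :
    multiD β (fun x => ∫ w, f w * κ (x - w)) = fun x => ∫ w, f w * multiD β κ (x - w) := by
  induction β using multiIndex_induction with
  | h0 => rfl
  | h1 b ih =>
    rw [multiD_succ_snd, ih, multiD_succ_snd]
    exact partialD_convolution hf (contDiff_multiD hκ _) (hasCompactSupport_multiD hκc _) 1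
  | h2 a b ih =>
    rw [multiD_succ_fst, ih, multiD_succ_fst]
    exact partialD_convolution hf (contDiff_multiD hκ _) (hasCompactSupport_multiD hκc _) 0

/-- The kernel `ε⁻² ρ(-z/ε)`. -/
noncomputable def kern (ρ : Plane → ℝ) (ε : ℝ) (z : Plane) : ℝ :=
  (ε ^ 2)⁻¹ * ρ ((-ε⁻¹) • z)

/-- The smoothing operator `S_ε g (x) = ∫ g((1 - ε) x + ε z) ρ(z) dz`, written with the variable
`w = (1 - ε) x + ε z ∈ U`. For `x` in the convex set `U` and `ρ` supported in `U`, only values of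
`g` in `U` enter. -/
noncomputable def smoothing (U : Set Plane) (ρ : Plane → ℝ) (ε : ℝ) (g : Plane → ℝ) (x : Plane) : ℝ :=
  ∫ w, U.indicator g w * kern ρ ε ((1 - ε) • x - w)

section Smoothing

variable {U : Set Plane} {ρ : Plane → ℝ} {ε : ℝ}

lemma contDiff_kern (hρ : ContDiff ℝ ∞ ρ) : ContDiff ℝ ∞ (kern ρ ε) := by
  unfold kern
  exact contDiff_const.mul (hρ.comp (by fun_prop))

lemma hasCompactSupport_kern (hρc : HasCompactSupport ρ) (hε : 0 < ε) :
    HasCompactSupport (kern ρ ε) := by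
  have h1 : HasCompactSupport fun z : Plane => ρ ((-ε⁻¹) • z) :=
    hρc.comp_homeomorph (Homeomorph.smulOfNeZero (-ε⁻¹) (by simp [hε.ne']))
  exact h1.mul_left

lemma contDiff_smoothing (hρ : ContDiff ℝ ∞ ρ) (hρc : HasCompactSupport ρ) (hε : 0 < ε)
    {g : Plane → ℝ} (hg : LocallyIntegrable (U.indicator g) volume) :
    ContDiff ℝ ∞ (smoothing U ρ ε g) := by
  have h1 := (hasCompactSupport_kern hρc hε).contDiff_convolution_right
    (ContinuousLinearMap.mul ℝ ℝ) hg (contDiff_kern (ε := ε) hρ)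
  exact h1.comp (f := fun x : Plane => (1 - ε) • x) (by fun_prop)

/-- The kernel, as a function of the integration variable, is supported in `U`. -/
lemma tsupport_kern_subset (hU : Convex ℝ U) (hρU : tsupport ρ ⊆ U)
    (hε : 0 < ε) (hε1 : ε < 1) {x : Plane} (hx : x ∈ U) :
    tsupport (fun w => kern ρ ε ((1 - ε) • x - w)) ⊆ U := by
  have hcl : IsClosed {w : Plane | ε⁻¹ • (w - (1 - ε) • x) ∈ tsupport ρ} :=
    (isClosed_tsupport ρ).preimage (by fun_prop)
  have h1 : tsupport (fun w => kern ρ ε ((1 - ε) • x - w))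
      ⊆ {w : Plane | ε⁻¹ • (w - (1 - ε) • x) ∈ tsupport ρ} := by
    refine closure_minimal (fun w hw => ?_) hcl
    refine subset_tsupport _ ?_
    rw [Function.mem_support] at hw ⊢
    intro h0
    refine hw ?_
    rw [kern, neg_smul, ← smul_neg, neg_sub, h0, mul_zero]
  refine h1.trans fun w hw => ?_
  have h2 := hU hx (hρU hw) (by linarith : 0 ≤ 1 - ε) hε.le (by ring)
  convert h2 using 1
  rw [smul_smul, mul_inv_cancel₀ hε.ne', one_smul]
  abel

lemma integral_kern (hε : 0 < ε) (hρ1 : ∫ z, ρ z = 1) (y : Plane) :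
    ∫ w, kern ρ ε (y - w) = 1 := by
  rw [integral_sub_left_eq_self (fun z => kern ρ ε z) volume y]
  unfold kern
  rw [integral_const_mul, Measure.integral_comp_smul]
  simp only [finrank_euclideanSpace, Fintype.card_fin, hρ1, smul_eq_mul, mul_one]
  rw [neg_sq, inv_pow, inv_inv, abs_of_pos (by positivity), inv_mul_cancel₀ (by positivity)]

/-- Smoothing commutes with weak derivatives up to a factor. -/
lemma multiD_smoothing (hU : Convex ℝ U) (hUm : MeasurableSet U)
    (hρ : ContDiff ℝ ∞ ρ) (hρc : HasCompactSupport ρ) (hρU : tsupport ρ ⊆ U) (hε : 0 < ε)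
    (hε1 : ε < 1) {g g' : Plane → ℝ} {β : ℕ × ℕ} (hg : LocallyIntegrable (U.indicator g) volume)
    (hD : IsWeakDeriv U β g g') {x : Plane} (hx : x ∈ U) :
    multiD β (smoothing U ρ ε g) x = (1 - ε) ^ (β.1 + β.2) * smoothing U ρ ε g' x := by
  have hk := contDiff_kern (ε := ε) hρ
  have hkc := hasCompactSupport_kern (ρ := ρ) hρc hε
  have hconv : ContDiff ℝ ∞ (fun y => ∫ w, U.indicator g w * kern ρ ε (y - w)) :=
    hkc.contDiff_convolution_right (ContinuousLinearMap.mul ℝ ℝ) hg hk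
  have h1 : multiD β (smoothing U ρ ε g) x
      = (1 - ε) ^ (β.1 + β.2) * ∫ w, U.indicator g w * multiD β (kern ρ ε) ((1 - ε) • x - w) := by
    have := multiD_comp_affine hconv β (1 - ε) 0
    simp only [add_zero] at this
    have h2 := congrFun this x
    rw [multiD_convolution hg hk hkc] at h2
    exact h2
  rw [h1]
  congr 1
  set y := (1 - ε) • x with hy
  have h3 := hD (fun w => kern ρ ε (y - w)) (hk.comp (by fun_prop))
    (hkc.comp_homeomorph (Homeomorph.subLeft y)) (tsupport_kern_subset hU hρU hε hε1 hx)
  have h4 := multiD_comp_affine hk β (-1) y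
  have h5 : (fun w => kern ρ ε (y - w)) = fun w => kern ρ ε ((-1 : ℝ) • w + y) := by
    ext w; congr 1; module
  rw [h5, h4] at h3
  have h6 : ∀ w : Plane, (-1 : ℝ) • w + y = y - w := fun w => by module
  simp only [h6] at h3
  have h7 (f κ : Plane → ℝ) : ∫ w, U.indicator f w * κ (y - w) = ∫ w in U, f w * κ (y - w) := by
    rw [← integral_indicator hUm]
    congr 1
    ext w
    exact (Set.indicator_mul_left U f (fun w => κ (y - w))).symm
  have h8 : smoothing U ρ ε g' x = ∫ w in U, g' w * kern ρ ε (y - w) := h7 _ _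
  rw [h7, h8]
  have h9 : ((-1 : ℝ) ^ (β.1 + β.2)) * ((-1 : ℝ) ^ (β.1 + β.2)) = 1 := by
    rw [← mul_pow]; norm_num
  have h10 : ∫ w in U, g w * ((-1 : ℝ) ^ (β.1 + β.2) * multiD β (kern ρ ε) (y - w))
      = (-1 : ℝ) ^ (β.1 + β.2) * ∫ w in U, g w * multiD β (kern ρ ε) (y - w) := by
    rw [← integral_const_mul]
    congr 1
    ext w
    ring
  rw [h10] at h3
  calc ∫ w in U, g w * multiD β (kern ρ ε) (y - w)
      = ((-1 : ℝ) ^ (β.1 + β.2)) * ((-1 : ℝ) ^ (β.1 + β.2)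
          * ∫ w in U, g w * multiD β (kern ρ ε) (y - w)) := by rw [← mul_assoc, h9, one_mul]
    _ = _ := by rw [h3, ← mul_assoc, h9, one_mul]

end Smoothing

lemma eLpNorm_two_sq {X E : Type*} [MeasurableSpace X] [NormedAddCommGroup E] (μ : Measure X)
    (f : X → E) : eLpNorm f 2 μ ^ 2 = ∫⁻ x, ‖f x‖ₑ ^ 2 ∂μ := by
  have := eLpNorm_nnreal_pow_eq_lintegral (μ := μ) (f := f) (p := 2) (by norm_num)
  simpa using this

section SmoothingL2

variable {U : Set Plane} {ρ : Plane → ℝ} {ε : ℝ}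

lemma lintegral_kern (hρ : ContDiff ℝ ∞ ρ) (hρc : HasCompactSupport ρ) (hρ0 : ∀ z, 0 ≤ ρ z)
    (hρ1 : ∫ z, ρ z = 1) (hε : 0 < ε) (y : Plane) :
    ∫⁻ w, ENNReal.ofReal (kern ρ ε (y - w)) = 1 := by
  rw [← ofReal_integral_eq_lintegral_ofReal, integral_kern hε hρ1, ENNReal.ofReal_one]
  · exact (((contDiff_kern hρ).continuous.integrable_of_hasCompactSupport
      (hasCompactSupport_kern hρc hε)).comp_sub_left y)
  · exact ae_of_all _ fun w => mul_nonneg (by positivity) (hρ0 _)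

lemma lintegral_kern_left (hρ : ContDiff ℝ ∞ ρ) (hρc : HasCompactSupport ρ)
    (hρ0 : ∀ z, 0 ≤ ρ z) (hρ1 : ∫ z, ρ z = 1) (hε : 0 < ε) (hε1 : ε < 1) (w : Plane) :
    ∫⁻ x, ENNReal.ofReal (kern ρ ε ((1 - ε) • x - w)) = ENNReal.ofReal (((1 - ε) ^ 2)⁻¹) := by
  have hs : 0 < 1 - ε := by linarith
  have hint : Integrable (kern ρ ε) := (contDiff_kern hρ).continuous.integrable_of_hasCompactSupport
      (hasCompactSupport_kern hρc hε)
  have h2 : Integrable (fun x => kern ρ ε (x - w)) := hint.comp_sub_right w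
  rw [← ofReal_integral_eq_lintegral_ofReal]
  · congr 1
    rw [Measure.integral_comp_smul volume (fun x => kern ρ ε (x - w)), integral_sub_right_eq_self]
    have := integral_kern (ρ := ρ) hε hρ1 0
    rw [integral_sub_left_eq_self (fun z => kern ρ ε z) volume 0] at this
    rw [this]
    simp [abs_of_pos hs]
  · exact h2.comp_smul hs.ne'
  · exact ae_of_all _ fun w => mul_nonneg (by positivity) (hρ0 _)

/-- Smoothing is bounded on `L²(U)`. -/
lemma eLpNorm_smoothing_le (hUm : MeasurableSet U) (hρ : ContDiff ℝ ∞ ρ)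
    (hρc : HasCompactSupport ρ)
    (hρ0 : ∀ z, 0 ≤ ρ z) (hρ1 : ∫ z, ρ z = 1) (hε : 0 < ε) (hε1 : ε < 1) {g : Plane → ℝ}
    (hg : AEStronglyMeasurable g (volume.restrict U)) :
    eLpNorm (smoothing U ρ ε g) 2 (volume.restrict U)
      ≤ ENNReal.ofReal ((1 - ε)⁻¹) * eLpNorm g 2 (volume.restrict U) := by
  have hs : 0 < 1 - ε := by linarith
  set G : Plane → ℝ := U.indicator g with hG
  have hGm : AEStronglyMeasurable G volume := (aestronglyMeasurable_indicator_iff hUm).2 hg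
  have hkc : Continuous (kern ρ ε) := (contDiff_kern hρ).continuous
  have hk0 : ∀ z, 0 ≤ kern ρ ε z := fun z => mul_nonneg (by positivity) (hρ0 _)
  have pt : ∀ x, ‖smoothing U ρ ε g x‖ₑ ^ 2
      ≤ ∫⁻ w, ‖G w‖ₑ ^ 2 * ENNReal.ofReal (kern ρ ε ((1 - ε) • x - w)) := by
    intro x
    set κ : Plane → ENNReal := fun w => ENNReal.ofReal (kern ρ ε ((1 - ε) • x - w)) with hκ
    have hκm : Measurable κ := by
      have : Continuous fun w => kern ρ ε ((1 - ε) • x - w) := hkc.comp (by fun_prop)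
      exact this.measurable.ennreal_ofReal
    set ν : Measure Plane := volume.withDensity κ with hν
    have hν1 : ν Set.univ = 1 := by
      rw [hν, withDensity_apply _ MeasurableSet.univ, Measure.restrict_univ]
      exact lintegral_kern hρ hρc hρ0 hρ1 hε _
    have hGν : AEMeasurable (fun w => ‖G w‖ₑ) ν :=
      hGm.enorm.mono_ac (withDensity_absolutelyContinuous _ _)
    have h1 : ‖smoothing U ρ ε g x‖ₑ ≤ ∫⁻ w, ‖G w‖ₑ ∂ν := by
      refine (enorm_integral_le_lintegral_enorm _).trans (le_of_eq ?_)
      rw [hν, lintegral_withDensity_eq_lintegral_mul₀ hκm.aemeasurable hGm.enorm]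
      refine lintegral_congr fun w => ?_
      rw [enorm_mul, Pi.mul_apply, mul_comm, Real.enorm_of_nonneg (hk0 _)]
    have h2 : ∫⁻ w, ‖G w‖ₑ ∂ν ≤ (∫⁻ w, ‖G w‖ₑ ^ 2 ∂ν) ^ (1 / 2 : ℝ) := by
      have := ENNReal.lintegral_mul_le_Lp_mul_Lq ν Real.HolderConjugate.two_two hGν
        (aemeasurable_const (b := (1 : ENNReal)))
      simpa [hν1] using this
    have h3 : ∫⁻ w, ‖G w‖ₑ ^ 2 ∂ν = ∫⁻ w, ‖G w‖ₑ ^ 2 * κ w := by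
      rw [hν, lintegral_withDensity_eq_lintegral_mul₀ hκm.aemeasurable (hGm.enorm.pow_const 2)]
      refine lintegral_congr fun w => ?_
      rw [Pi.mul_apply, mul_comm]
    calc ‖smoothing U ρ ε g x‖ₑ ^ 2 ≤ ((∫⁻ w, ‖G w‖ₑ ^ 2 ∂ν) ^ (1 / 2 : ℝ)) ^ 2 :=
          pow_le_pow_left' (h1.trans h2) 2
      _ = ∫⁻ w, ‖G w‖ₑ ^ 2 * κ w := by
          rw [← ENNReal.rpow_natCast, ← ENNReal.rpow_mul, h3]
          norm_num
  have hprod : AEMeasurable (Function.uncurry fun x w : Plane =>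
      ‖G w‖ₑ ^ 2 * ENNReal.ofReal (kern ρ ε ((1 - ε) • x - w)))
      ((volume : Measure Plane).prod volume) := by
    have h1 : AEMeasurable (fun z : Plane × Plane => ‖G z.2‖ₑ ^ 2)
        ((volume : Measure Plane).prod volume) := (hGm.enorm.pow_const 2).comp_snd
    have h2 : Continuous fun z : Plane × Plane => kern ρ ε ((1 - ε) • z.1 - z.2) :=
      hkc.comp (by fun_prop)
    exact h1.mul h2.measurable.ennreal_ofReal.aemeasurable
  have hsq : eLpNorm (smoothing U ρ ε g) 2 (volume.restrict U) ^ 2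
      ≤ (ENNReal.ofReal ((1 - ε)⁻¹) * eLpNorm g 2 (volume.restrict U)) ^ 2 := by
    rw [mul_pow, eLpNorm_two_sq, eLpNorm_two_sq]
    calc ∫⁻ x in U, ‖smoothing U ρ ε g x‖ₑ ^ 2
        ≤ ∫⁻ x, ∫⁻ w, ‖G w‖ₑ ^ 2 * ENNReal.ofReal (kern ρ ε ((1 - ε) • x - w)) :=
          (setLIntegral_le_lintegral _ _).trans (lintegral_mono pt)
      _ = ∫⁻ w, ∫⁻ x, ‖G w‖ₑ ^ 2 * ENNReal.ofReal (kern ρ ε ((1 - ε) • x - w)) :=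
          lintegral_lintegral_swap hprod
      _ = ∫⁻ w, ‖G w‖ₑ ^ 2 * ENNReal.ofReal (((1 - ε) ^ 2)⁻¹) := by
          refine lintegral_congr fun w => ?_
          rw [lintegral_const_mul' _ _ (by simp), lintegral_kern_left hρ hρc hρ0 hρ1 hε hε1]
      _ = ENNReal.ofReal (((1 - ε) ^ 2)⁻¹) * ∫⁻ w in U, ‖g w‖ₑ ^ 2 := by
          rw [lintegral_mul_const' _ _ (by simp), mul_comm, ← lintegral_indicator hUm]
          congr 1
          refine lintegral_congr fun w => ?_
          by_cases hw : w ∈ U <;> simp [hG, hw]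
      _ = _ := by
          rw [← inv_pow, ENNReal.ofReal_pow (by positivity)]
  exact (ENNReal.pow_right_strictMono two_ne_zero).le_iff_le.1 hsq

/-- Smoothing converges on `L²(U)`. -/
lemma tendsto_smoothing (hUo : IsOpen U) (hU : Convex ℝ U) (hUb : Bornology.IsBounded U)
    (hρ : ContDiff ℝ ∞ ρ) (hρc : HasCompactSupport ρ) (hρU : tsupport ρ ⊆ U)
    (hρ0 : ∀ z, 0 ≤ ρ z) (hρ1 : ∫ z, ρ z = 1) {g : Plane → ℝ}
    (hg : MemLp g 2 (volume.restrict U)) :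
    Tendsto (fun n : ℕ => eLpNorm (fun x => smoothing U ρ (1 / (n + 2)) g x - g x) 2
      (volume.restrict U)) atTop (𝓝 0) := by
  have hUm := hUo.measurableSet
  have hUf : volume U ≠ ⊤ := hUb.measure_lt_top.ne
  have : IsFiniteMeasure (volume.restrict U) := ⟨by simpa using hUf.lt_top⟩
  rw [ENNReal.tendsto_atTop_zero]
  intro δ hδ
  obtain ⟨δ', hδ'0, hδ'⟩ : ∃ δ' : ENNReal, δ' ≠ 0 ∧ 4 * δ' ≤ δ :=
    ⟨δ / 4, by simp [hδ.ne'], by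
      rw [mul_comm]; exact (ENNReal.div_mul_cancel (by norm_num) (by norm_num)).le⟩
  obtain ⟨f, hfc, hfg, hf, hfL⟩ := hg.exists_hasCompactSupport_eLpNorm_sub_le (by simp) hδ'0
  -- a modulus of continuity of `f` that is small in `L²(U)`
  obtain ⟨η, hη0, hη⟩ : ∃ η : ℝ, 0 < η ∧
      ENNReal.ofReal η * (volume U) ^ (1 / 2 : ℝ) ≤ δ' := by
    have h1 : Tendsto (fun η : ℝ => ENNReal.ofReal η * (volume U) ^ (1 / 2 : ℝ)) (𝓝[>] 0)
        (𝓝 (ENNReal.ofReal 0 * (volume U) ^ (1 / 2 : ℝ))) :=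
      ENNReal.Tendsto.mul_const
        ((ENNReal.continuous_ofReal.tendsto 0).mono_left nhdsWithin_le_nhds)
        (Or.inr (ENNReal.rpow_ne_top_of_nonneg (by norm_num) hUf))
    rw [ENNReal.ofReal_zero, zero_mul] at h1
    have h2 := (h1.eventually (ge_mem_nhds (pos_iff_ne_zero.2 hδ'0))).and self_mem_nhdsWithin
    obtain ⟨η, h3, h4⟩ := h2.exists
    exact ⟨η, h4, h3⟩
  obtain ⟨τ, hτ0, hτ⟩ := Metric.uniformContinuous_iff.1
    (hfc.uniformContinuous_of_continuous hf) η hη0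
  obtain ⟨D, hD⟩ := Metric.isBounded_iff.1 hUb
  obtain ⟨N, hN⟩ := exists_nat_gt (max D 0 / τ)
  refine ⟨N, fun n hn => ?_⟩
  set ε : ℝ := 1 / (n + 2) with hε
  have hε0 : 0 < ε := by positivity
  have hε2 : ε ≤ 1 / 2 := by
    rw [hε]
    exact one_div_le_one_div_of_le (by norm_num) (by linarith [(Nat.cast_nonneg n : (0 : ℝ) ≤ n)])
  have hε1 : ε < 1 := by linarith
  have hεD : ε * max D 0 < τ := by
    have h1 : max D 0 < τ * N := by rwa [div_lt_iff₀ hτ0, mul_comm] at hN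
    have h2 : (N : ℝ) ≤ n := by exact_mod_cast hn
    rw [hε, one_div_mul_eq_div, div_lt_iff₀ (by positivity)]
    nlinarith
  have hkc : Continuous (kern ρ ε) := (contDiff_kern hρ).continuous
  have hkcc := hasCompactSupport_kern (ρ := ρ) hρc hε0
  have hk0 : ∀ z, 0 ≤ kern ρ ε z := fun z => mul_nonneg (by positivity) (hρ0 _)
  have hInt {u : Plane → ℝ} (hu : MemLp u 2 (volume.restrict U)) (y : Plane) :
      Integrable (fun w => U.indicator u w * kern ρ ε (y - w)) := by
    have h1 : Integrable (U.indicator u) :=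
      (integrable_indicator_iff hUm).2 (hu.integrable (by norm_num))
    obtain ⟨M, hM⟩ := hkcc.exists_bound_of_continuous hkc
    refine h1.mul_bdd (c := M) ?_ (ae_of_all _ fun w => hM _)
    exact (hkc.comp (by fun_prop)).aestronglyMeasurable
  have hsm {u : Plane → ℝ} (hu : MemLp u 2 (volume.restrict U)) :
      AEStronglyMeasurable (smoothing U ρ ε u) (volume.restrict U) :=
    (contDiff_smoothing hρ hρc hε0 ((integrable_indicator_iff hUm).2
      (hu.integrable (by norm_num))).locallyIntegrable).continuous.aestronglyMeasurable
  have e1 : eLpNorm (smoothing U ρ ε (fun x => g x - f x)) 2 (volume.restrict U) ≤ 2 * δ' := by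
    refine (eLpNorm_smoothing_le hUm hρ hρc hρ0 hρ1 hε0 hε1 (hg.1.sub hfL.1)).trans ?_
    refine mul_le_mul' ?_ hfg
    rw [ENNReal.ofReal_le_iff_le_toReal (by simp)]
    rw [ENNReal.toReal_ofNat]
    rw [inv_le_comm₀ (by linarith) (by norm_num)]
    linarith
  have e2 : eLpNorm (fun x => smoothing U ρ ε f x - f x) 2 (volume.restrict U) ≤ δ' := by
    have hb : ∀ᵐ x ∂volume.restrict U, ‖smoothing U ρ ε f x - f x‖ ≤ η := by
      refine (ae_restrict_mem hUm).mono fun x hx => ?_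
      set y := (1 - ε) • x with hy
      have h1 : f x = ∫ w, f x * kern ρ ε (y - w) := by
        rw [integral_const_mul, integral_kern hε0 hρ1, mul_one]
      have h2 : Integrable fun w => kern ρ ε (y - w) :=
        (hkc.integrable_of_hasCompactSupport hkcc).comp_sub_left y
      have h3 : smoothing U ρ ε f x - f x
          = ∫ w, (U.indicator f w - f x) * kern ρ ε (y - w) := by
        conv_lhs => rw [h1]
        unfold smoothing
        rw [← integral_sub (hInt hfL y) (h2.const_mul _)]
        congr 1
        ext w
        ring
      rw [h3]
      have h4 : ∀ w, ‖(U.indicator f w - f x) * kern ρ ε (y - w)‖ ≤ η * kern ρ ε (y - w) := by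
        intro w
        rw [norm_mul, Real.norm_of_nonneg (hk0 _)]
        by_cases hw : kern ρ ε (y - w) = 0
        · simp [hw]
        refine mul_le_mul_of_nonneg_right ?_ (hk0 _)
        have hwU : w ∈ U := tsupport_kern_subset hU hρU hε0 hε1 hx
          (subset_tsupport _ (by simpa using hw))
        rw [Set.indicator_of_mem hwU]
        -- `w = (1 - ε) x + ε z` with `z ∈ U`, so that `|w - x| = ε |z - x|`
        have hz : ε⁻¹ • (w - y) ∈ U := by
          refine hρU (subset_tsupport _ fun h0 => hw ?_)
          rw [kern, neg_smul, ← smul_neg, neg_sub, h0, mul_zero]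
        have hwz : w - x = ε • (ε⁻¹ • (w - y) - x) := by
          rw [smul_sub, smul_smul, mul_inv_cancel₀ hε0.ne', one_smul, hy]
          module
        have hd : dist w x < τ := by
          rw [dist_eq_norm, hwz, norm_smul, Real.norm_of_nonneg hε0.le, ← dist_eq_norm]
          refine lt_of_le_of_lt ?_ hεD
          exact mul_le_mul_of_nonneg_left ((hD hz hx).trans (le_max_left _ _)) hε0.le
        have := hτ hd
        rw [Real.dist_eq] at this
        exact this.le
      refine (norm_integral_le_of_norm_le (h2.const_mul η) (ae_of_all _ h4)).trans (le_of_eq ?_)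
      rw [integral_const_mul, integral_kern hε0 hρ1, mul_one]
    refine (eLpNorm_le_of_ae_bound hb).trans ?_
    simp only [Measure.restrict_apply_univ, ENNReal.toReal_ofNat]
    rw [mul_comm, ← one_div]
    exact hη
  have e3 : (fun x => smoothing U ρ ε g x - g x)
      = (smoothing U ρ ε (fun x => g x - f x) + fun x => smoothing U ρ ε f x - f x)
        - fun x => g x - f x := by
    ext x
    have h1 : smoothing U ρ ε (fun x => g x - f x) x
        = smoothing U ρ ε g x - smoothing U ρ ε f x := by
      unfold smoothing
      rw [← integral_sub (hInt hg _) (hInt hfL _)]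
      congr 1
      ext w
      by_cases hw : w ∈ U <;> simp [hw, sub_mul]
    simp only [Pi.sub_apply, Pi.add_apply, h1]
    ring
  have hgf : MemLp (fun x => g x - f x) 2 (volume.restrict U) := hg.sub hfL
  rw [e3]
  calc _ ≤ eLpNorm (smoothing U ρ ε (fun x => g x - f x) + fun x => smoothing U ρ ε f x - f x) 2
            (volume.restrict U) + eLpNorm (fun x => g x - f x) 2 (volume.restrict U) :=
        eLpNorm_sub_le ((hsm hgf).add ((hsm hfL).sub hfL.1)) hgf.1 (by norm_num)
    _ ≤ (2 * δ' + δ') + δ' := by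
        refine add_le_add ((eLpNorm_add_le (hsm hgf) ((hsm hfL).sub hfL.1) (by norm_num)).trans
          (add_le_add e1 e2)) hfg
    _ = 4 * δ' := by ring
    _ ≤ δ := hδ'

end SmoothingL2

/-- Functions on a bounded convex open set are approximated by functions that are smooth on the
whole plane, in `L²` together with all their square-integrable weak derivatives. -/
theorem exists_smooth_approx {U : Set Plane} (hUo : IsOpen U) (hU : Convex ℝ U)
    (hUb : Bornology.IsBounded U) (hUn : U.Nonempty) {g : Plane → ℝ}
    (hg : MemLp g 2 (volume.restrict U)) :
    ∃ φ : ℕ → Plane → ℝ, (∀ n, ContDiff ℝ ∞ (φ n)) ∧ ∀ (β : ℕ × ℕ) (g' : Plane → ℝ),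
      MemLp g' 2 (volume.restrict U) → IsWeakDeriv U β g g' →
      Tendsto (fun n => eLpNorm (fun x => multiD β (φ n) x - g' x) 2 (volume.restrict U))
        atTop (𝓝 0) := by
  obtain ⟨c, hc⟩ := hUn
  obtain ⟨r, hr, hrU⟩ := Metric.isOpen_iff.1 hUo c hc
  let f : ContDiffBump c := ⟨r / 4, r / 2, by positivity, by linarith⟩
  set ρ : Plane → ℝ := f.normed volume with hρdef
  have hρ : ContDiff ℝ ∞ ρ := f.contDiff_normed
  have hρc : HasCompactSupport ρ := f.hasCompactSupport_normed
  have hρ0 : ∀ z, 0 ≤ ρ z := f.nonneg_normed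
  have hρ1 : ∫ z, ρ z = 1 := f.integral_normed
  have hρU : tsupport ρ ⊆ U := by
    rw [hρdef, f.tsupport_normed_eq]
    exact (Metric.closedBall_subset_ball (by change r / 2 < r; linarith)).trans hrU
  have hUm := hUo.measurableSet
  have : IsFiniteMeasure (volume.restrict U) := ⟨by simpa using hUb.measure_lt_top⟩
  have hloc : LocallyIntegrable (U.indicator g) volume :=
    ((integrable_indicator_iff hUm).2 (hg.integrable (by norm_num))).locallyIntegrable
  refine ⟨fun n => smoothing U ρ (1 / (n + 2)) g, fun n =>
    contDiff_smoothing hρ hρc (by positivity) hloc, fun β g' hg' hD => ?_⟩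
  set m := β.1 + β.2
  have hloc' : LocallyIntegrable (U.indicator g') volume :=
    ((integrable_indicator_iff hUm).2 (hg'.integrable (by norm_num))).locallyIntegrable
  have h1 := tendsto_smoothing hUo hU hUb hρ hρc hρU hρ0 hρ1 hg'
  set a : ℕ → ℝ := fun n => (1 - 1 / ((n : ℝ) + 2)) ^ m with ha
  have ha1 : Tendsto a atTop (𝓝 1) := by
    have h2 : Tendsto (fun n : ℕ => 1 / ((n : ℝ) + 2)) atTop (𝓝 0) := by
      refine Tendsto.div_atTop tendsto_const_nhds ?_
      exact tendsto_atTop_add_const_right _ _ tendsto_natCast_atTop_atTop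
    have h3 : Tendsto a atTop (𝓝 ((1 - 0) ^ m)) := (tendsto_const_nhds.sub h2).pow m
    simpa using h3
  have hbound : ∀ n : ℕ, eLpNorm (fun x => multiD β (smoothing U ρ (1 / (n + 2)) g) x - g' x) 2
      (volume.restrict U) ≤ ‖a n‖ₑ * eLpNorm (fun x => smoothing U ρ (1 / (n + 2)) g' x - g' x) 2
        (volume.restrict U) + ‖a n - 1‖ₑ * eLpNorm g' 2 (volume.restrict U) := by
    intro n
    have hε1 : (1 : ℝ) / (n + 2) < 1 := by
      rw [div_lt_one (by positivity)]
      linarith [(Nat.cast_nonneg n : (0 : ℝ) ≤ n)]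
    have h4 : (fun x => multiD β (smoothing U ρ (1 / (n + 2)) g) x - g' x)
        =ᵐ[volume.restrict U] (a n • fun x => smoothing U ρ (1 / (n + 2)) g' x - g' x)
          + (a n - 1) • g' := by
      refine (ae_restrict_mem hUm).mono fun x hx => ?_
      simp only
      rw [multiD_smoothing hU hUm hρ hρc hρU (by positivity) hε1 hloc hD hx]
      simp only [ha, Pi.add_apply, Pi.smul_apply, smul_eq_mul]
      ring
    have h5 : AEStronglyMeasurable (fun x => smoothing U ρ (1 / (n + 2)) g' x - g' x)
        (volume.restrict U) :=
      (contDiff_smoothing hρ hρc (by positivity) hloc').continuous.aestronglyMeasurable.sub hg'.1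
    rw [eLpNorm_congr_ae h4, ← eLpNorm_const_smul, ← eLpNorm_const_smul]
    exact eLpNorm_add_le (h5.const_smul _) (hg'.1.const_smul _) (by norm_num)
  refine tendsto_of_tendsto_of_tendsto_of_le_of_le tendsto_const_nhds ?_ (fun _ => bot_le) hbound
  have h6 : Tendsto (fun n => ‖a n‖ₑ) atTop (𝓝 ‖(1 : ℝ)‖ₑ) :=
    (continuous_enorm.tendsto _).comp ha1
  have h7 : Tendsto (fun n => ‖a n - 1‖ₑ) atTop (𝓝 ‖(1 : ℝ) - 1‖ₑ) :=
    (continuous_enorm.tendsto _).comp (ha1.sub_const 1)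
  have h8 := (ENNReal.Tendsto.mul h6 (Or.inr (by simp)) h1 (Or.inr (by simp))).add
    (ENNReal.Tendsto.mul_const h7 (Or.inr hg'.eLpNorm_ne_top))
  simpa using h8

/-! ### Traces on the edges of a triangle -/

lemma eq_sum_single (v : Plane) :
    v = v 0 • EuclideanSpace.single (0 : Fin 2) (1 : ℝ)
      + v 1 • EuclideanSpace.single (1 : Fin 2) (1 : ℝ) := by
  ext j; fin_cases j <;> simp

lemma fderiv_eq_partialD (φ : Plane → ℝ) (x v : Plane) :
    fderiv ℝ φ x v = v 0 * partialD 0 φ x + v 1 * partialD 1 φ x := by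
  conv_lhs => rw [eq_sum_single v, map_add, map_smul, map_smul]
  rfl

lemma inner_single_right (n : Plane) (i : Fin 2) :
    ⟪n, EuclideanSpace.single i (1 : ℝ)⟫ = n i := by
  simp [EuclideanSpace.inner_single_right]

instance isFiniteMeasure_hull (t : Finset Plane) :
    IsFiniteMeasure ((volume : Measure Plane).restrict (hull t)) :=
  ⟨by simpa using (isCompact_hull t).measure_lt_top⟩

lemma memLp_hull {E : Type*} [NormedAddCommGroup E] [SecondCountableTopology E] {f : Plane → E}
    (hf : Continuous f) (t : Finset Plane) : MemLp f 2 (volume.restrict (hull t)) :=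
  memLp_of_continuous hf (isCompact_hull t) (ae_restrict_mem (measurableSet_hull t))

/-- `c` is the centre of a disc of radius `r` in the triangle `t`, whose diameter is at
most `D`. -/
structure HasDisc (t : Finset Plane) (c : Plane) (r D : ℝ) : Prop where
  pos : 0 < r
  ball : Metric.closedBall c r ⊆ hull t
  diam : Metric.diam (hull t) ≤ D

lemma HasDisc.center_mem {t : Finset Plane} {c : Plane} {r D : ℝ} (hd : HasDisc t c r D) :
    c ∈ hull t := hd.ball (Metric.mem_closedBall_self hd.pos.le)

lemma HasDisc.dist_le {t : Finset Plane} {c : Plane} {r D : ℝ} (hd : HasDisc t c r D)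
    {x y : Plane} (hx : x ∈ hull t) (hy : y ∈ hull t) : ‖x - y‖ ≤ D := by
  rw [← dist_eq_norm]
  exact (Metric.dist_le_diam_of_mem (isCompact_hull t).isBounded hx hy).trans hd.diam

lemma HasDisc.D_nonneg {t : Finset Plane} {c : Plane} {r D : ℝ} (hd : HasDisc t c r D) : 0 ≤ D :=
  (norm_nonneg _).trans (hd.dist_le hd.center_mem hd.center_mem)

namespace IsTri

variable {t : Finset Plane} (h : IsTri t)
include h

lemma le_height_mul_bary {c : Plane} {r D s : ℝ} (hd : HasDisc t c r D) (i : t) {x : Plane}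
    (hs : 0 ≤ s) (hx : ‖x - c‖ + s ≤ r) : s ≤ h.height i * h.bary i x := by
  set n := outwardNormal {t} (t.erase (i : Plane)) with hn
  have hn1 : ‖n‖ = 1 := h.norm_normal i
  have h1 : x + s • n ∈ hull t := by
    refine hd.ball ?_
    rw [mem_closedBall_iff_norm]
    calc ‖x + s • n - c‖ = ‖(x - c) + s • n‖ := by congr 1; abel
      _ ≤ ‖x - c‖ + ‖s • n‖ := norm_add_le _ _
      _ = ‖x - c‖ + s := by rw [norm_smul, hn1, mul_one, Real.norm_of_nonneg hs]
      _ ≤ r := hx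
  have h2 := h.mem_hull_iff.1 h1 i
  have h3 := h.inner_normal_sub i (x + s • n) x
  rw [add_sub_cancel_left, inner_smul_right, ← hn, real_inner_self_eq_norm_sq, hn1] at h3
  nlinarith [h.height_pos i]

lemma inner_normal_edge {i : t} {x : Plane} (hx : x ∈ hull (t.erase (i : Plane))) (c : Plane) :
    ⟪outwardNormal {t} (t.erase (i : Plane)), x - c⟫ = h.height i * h.bary i c := by
  rw [h.inner_normal_sub, (h.mem_edge_iff.1 hx).2, sub_zero]

/-- Green's formula for a coordinate direction. -/
lemma green_partialD {φ : Plane → ℝ} (hφ : ContDiff ℝ 1 φ) (j : Fin 2) :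
    ∫ x in hull t, partialD j φ x = ∑ i : t,
      outwardNormal {t} (t.erase (i : Plane)) j * ∫ x, φ x ∂edgeMeasure (t.erase (i : Plane)) := by
  have := h.green hφ (EuclideanSpace.single j 1)
  simp only [inner_single_right] at this
  exact this

/-- The multiplicative trace inequality for smooth functions, by the divergence theorem for the
field `φ² (x - c)`. -/
lemma trace_sq_le {c : Plane} {r D : ℝ} (hd : HasDisc t c r D) {φ : Plane → ℝ}
    (hφ : ContDiff ℝ 1 φ) (i : t) :
    r * ∫ x, φ x ^ 2 ∂edgeMeasure (t.erase (i : Plane)) ≤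
      3 * (∫ x in hull t, φ x ^ 2) + D ^ 2 * ((∫ x in hull t, partialD 0 φ x ^ 2)
        + ∫ x in hull t, partialD 1 φ x ^ 2) := by
  have hcd (j : Fin 2) : ContDiff ℝ 1 (fun x : Plane => φ x ^ 2 * (x j - c j)) :=
    (hφ.pow 2).mul ((EuclideanSpace.proj j : Plane →L[ℝ] ℝ).contDiff.sub contDiff_const)
  have hφd (x : Plane) : DifferentiableAt ℝ φ x := hφ.differentiable (by simp) x
  have hpc (j : Fin 2) : Continuous (partialD j φ) :=
    (hφ.continuous_fderiv (by simp)).clm_apply continuous_const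
  have hφc := hφ.continuous
  have hder (j : Fin 2) (x : Plane) : partialD j (fun x : Plane => φ x ^ 2 * (x j - c j)) x
      = φ x ^ 2 + 2 * φ x * partialD j φ x * (x j - c j) := by
    have h1 : DifferentiableAt ℝ (fun x : Plane => x j - c j) x :=
      ((EuclideanSpace.proj j : Plane →L[ℝ] ℝ).differentiableAt).sub_const _
    rw [partialD_mul ((hφd x).fun_pow 2) h1]
    have h2 : partialD j (fun x : Plane => x j - c j) x = 1 := by
      have := partialD_coord j j x
      simp only [partialD, if_true] at this ⊢
      rw [fderiv_sub_const]
      exact this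
    have h3 : partialD j (fun x => φ x ^ 2) x = 2 * φ x * partialD j φ x := by
      simp only [sq]
      rw [partialD_mul (hφd x) (hφd x)]
      ring
    rw [h2, h3]
    ring
  have hI {f : Plane → ℝ} (hf : Continuous f) : Integrable f (volume.restrict (hull t)) :=
    hf.continuousOn.integrableOn_compact (isCompact_hull t)
  have hIe (k : t) {f : Plane → ℝ} (hf : Continuous f) :
      Integrable f (edgeMeasure (t.erase (k : Plane))) := by
    have := isFiniteMeasure_edge (h.card_edge k)
    exact (memLp_edge (h.card_edge k) hf).integrable (by norm_num)
  have hg0 := h.green_partialD (hcd 0) 0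
  have hg1 := h.green_partialD (hcd 1) 1
  have hbd : ∀ k : t, r * ∫ x, φ x ^ 2 ∂edgeMeasure (t.erase (k : Plane)) ≤
      (outwardNormal {t} (t.erase (k : Plane)) 0
        * ∫ x, φ x ^ 2 * (x 0 - c 0) ∂edgeMeasure (t.erase (k : Plane)))
      + outwardNormal {t} (t.erase (k : Plane)) 1
        * ∫ x, φ x ^ 2 * (x 1 - c 1) ∂edgeMeasure (t.erase (k : Plane)) := by
    intro k
    rw [← integral_const_mul, ← integral_const_mul, ← integral_const_mul, ← integral_add]
    · refine integral_mono_ae (hIe k (by fun_prop)) (hIe k (by fun_prop)) ?_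
      filter_upwards [ae_edgeMeasure_mem (t.erase (k : Plane))] with x hx
      have h1 := h.inner_normal_edge hx c
      rw [inner_plane] at h1
      have h2 := h.le_height_mul_bary hd k (x := c) hd.pos.le (by simp)
      rw [← h1] at h2
      simp only [PiLp.sub_apply] at h2
      have := mul_le_mul_of_nonneg_left h2 (sq_nonneg (φ x))
      linarith
    · exact hIe k (by fun_prop)
    · exact hIe k (by fun_prop)
  have hpos : ∀ k : t, 0 ≤ r * ∫ x, φ x ^ 2 ∂edgeMeasure (t.erase (k : Plane)) := fun k =>
    mul_nonneg hd.pos.le (integral_nonneg fun x => sq_nonneg _)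
  calc r * ∫ x, φ x ^ 2 ∂edgeMeasure (t.erase (i : Plane))
      ≤ ∑ k : t, r * ∫ x, φ x ^ 2 ∂edgeMeasure (t.erase (k : Plane)) :=
        Finset.single_le_sum (f := fun k : t => r * ∫ x, φ x ^ 2 ∂edgeMeasure (t.erase (k : Plane)))
          (fun k _ => hpos k) (Finset.mem_univ i)
    _ ≤ (∫ x in hull t, partialD 0 (fun x : Plane => φ x ^ 2 * (x 0 - c 0)) x)
          + ∫ x in hull t, partialD 1 (fun x : Plane => φ x ^ 2 * (x 1 - c 1)) x := by
        rw [hg0, hg1, ← Finset.sum_add_distrib]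
        exact Finset.sum_le_sum fun k _ => hbd k
    _ ≤ ∫ x in hull t, (3 * φ x ^ 2 + D ^ 2 * (partialD 0 φ x ^ 2 + partialD 1 φ x ^ 2)) := by
        simp only [hder]
        have h0 := hpc 0
        have h1 := hpc 1
        rw [← integral_add (hI (by fun_prop)) (hI (by fun_prop))]
        refine integral_mono_ae (hI (by fun_prop)) (hI (by fun_prop)) ?_
        filter_upwards [ae_restrict_mem (measurableSet_hull t)] with x hx
        have h2 := hd.dist_le hx hd.center_mem
        have h3 : (x 0 - c 0) ^ 2 + (x 1 - c 1) ^ 2 ≤ D ^ 2 := by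
          have := normSq_plane (x - c)
          simp only [PiLp.sub_apply] at this
          rw [← this]
          exact pow_le_pow_left₀ (norm_nonneg _) h2 2
        have h4 : (partialD 0 φ x * (x 0 - c 0) + partialD 1 φ x * (x 1 - c 1)) ^ 2
            ≤ (partialD 0 φ x ^ 2 + partialD 1 φ x ^ 2) * D ^ 2 := by
          refine le_trans ?_ (mul_le_mul_of_nonneg_left h3 (by positivity))
          nlinarith [sq_nonneg (partialD 0 φ x * (x 1 - c 1) - partialD 1 φ x * (x 0 - c 0))]
        nlinarith [sq_nonneg (φ x - (partialD 0 φ x * (x 0 - c 0)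
          + partialD 1 φ x * (x 1 - c 1)))]
    _ = _ := by
        have h0 := hpc 0
        have h1 := hpc 1
        rw [integral_add (hI (by fun_prop)) (hI (by fun_prop)), integral_const_mul,
          integral_const_mul, integral_add (hI (by fun_prop)) (hI (by fun_prop))]

end IsTri

/-! ### Weak derivatives -/

/-- Weak derivatives are unique. -/
lemma IsWeakDeriv.ae_eq {U : Set Plane} (hU : IsOpen U) (hUb : volume U ≠ ⊤) {β : ℕ × ℕ}
    {g g₁ g₂ : Plane → ℝ} (h₁ : MemLp g₁ 2 (volume.restrict U)) (h₂ : MemLp g₂ 2 (volume.restrict U))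
    (hd₁ : IsWeakDeriv U β g g₁) (hd₂ : IsWeakDeriv U β g g₂) :
    g₁ =ᵐ[volume.restrict U] g₂ := by
  have : IsFiniteMeasure (volume.restrict U) := ⟨by simpa using hUb.lt_top⟩
  have hint : Integrable (fun x => g₁ x - g₂ x) (volume.restrict U) :=
    (h₁.sub h₂).integrable (by norm_num)
  have h0 := hU.ae_eq_zero_of_integral_contDiff_smul_eq_zero (μ := volume.restrict U)
    (f := fun x => g₁ x - g₂ x) (hint.locallyIntegrable.locallyIntegrableOn U)
    (fun φ hφ hφc hφU => by
      have e1 := hd₁ φ hφ hφc hφU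
      have e2 := hd₂ φ hφ hφc hφU
      rw [e1] at e2
      have e3 : ∫ x in U, g₁ x * φ x = ∫ x in U, g₂ x * φ x := by
        have : ((-1 : ℝ)) ^ (β.1 + β.2) ≠ 0 := by positivity
        exact mul_left_cancel₀ this e2
      have hb : ∃ M, ∀ x, ‖φ x‖ ≤ M := hφc.exists_bound_of_continuous hφ.continuous
      obtain ⟨M, hM⟩ := hb
      have i1 : Integrable (fun x => g₁ x * φ x) (volume.restrict U) :=
        (h₁.integrable (by norm_num)).mul_bdd (c := M) hφ.continuous.aestronglyMeasurable
          (ae_of_all _ hM)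
      have i2 : Integrable (fun x => g₂ x * φ x) (volume.restrict U) :=
        (h₂.integrable (by norm_num)).mul_bdd (c := M) hφ.continuous.aestronglyMeasurable
          (ae_of_all _ hM)
      rw [← sub_eq_zero, ← integral_sub i1 i2] at e3
      rw [← e3]
      congr 1
      ext x
      simp only [smul_eq_mul]
      ring)
  filter_upwards [h0, ae_restrict_mem hU.measurableSet] with x hx hxU
  exact sub_eq_zero.1 (hx hxU)

lemma weakD_spec {U : Set Plane} {β : ℕ × ℕ} {g : Plane → ℝ}
    (h : ∃ g', MemLp g' 2 (volume.restrict U) ∧ IsWeakDeriv U β g g') :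
    MemLp (weakD U β g) 2 (volume.restrict U) ∧ IsWeakDeriv U β g (weakD U β g) :=
  Classical.epsilon_spec h

lemma setIntegral_mul_eq_of_tsupport {U V : Set Plane}
    (hU : MeasurableSet U) (hVU : V ⊆ U)
    {φ : Plane → ℝ} (hφ : tsupport φ ⊆ V) (g : Plane → ℝ) :
    ∫ x in U, g x * φ x = ∫ x in V, g x * φ x := by
  refine (setIntegral_eq_of_subset_of_forall_sdiff_eq_zero hU hVU fun x hx => ?_)
  rw [image_eq_zero_of_notMem_tsupport fun h => hx.2 (hφ h), mul_zero]

lemma IsWeakDeriv.mono {U V : Set Plane} (hU : MeasurableSet U)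
    (hVU : V ⊆ U) {β : ℕ × ℕ} {g g' : Plane → ℝ} (h : IsWeakDeriv U β g g') :
    IsWeakDeriv V β g g' := by
  intro φ hφ hφc hφV
  have := h φ hφ hφc (hφV.trans hVU)
  rwa [setIntegral_mul_eq_of_tsupport hU hVU ((tsupport_multiD_subset β φ).trans hφV),
    setIntegral_mul_eq_of_tsupport hU hVU hφV] at this

lemma isWeakDeriv_zero (U : Set Plane) (g : Plane → ℝ) : IsWeakDeriv U (0, 0) g g := by
  intro φ _ _ _
  simp [multiD_zero]

/-- The multi-index of the partial derivative in direction `i`. -/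
def dirIndex (i : Fin 2) : ℕ × ℕ := if i = 0 then (1, 0) else (0, 1)

lemma multiD_dirIndex (i : Fin 2) (φ : Plane → ℝ) : multiD (dirIndex i) φ = partialD i φ := by
  fin_cases i <;> rfl

/-! ### Boundary values of Sobolev functions on a triangle -/

/-- `g` is a function on the triangle `t` with gradient `(G 0, G 1)` and boundary values `τ e` on
the edges `e`: all of these are limits in `L²` of one sequence of smooth functions. -/
structure H1Trace (t : Finset Plane) (g : Plane → ℝ) (G : Fin 2 → Plane → ℝ)
    (τ : Finset Plane → Plane → ℝ) : Prop where
  memLp : MemLp g 2 (volume.restrict (hull t))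
  memLp_grad : ∀ i, MemLp (G i) 2 (volume.restrict (hull t))
  memLp_trace : ∀ e ∈ triEdges t, MemLp (τ e) 2 (edgeMeasure e)
  approx : ∃ φ : ℕ → Plane → ℝ, (∀ n, ContDiff ℝ ∞ (φ n)) ∧
    Tendsto (fun n => eLpNorm (fun x => φ n x - g x) 2 (volume.restrict (hull t))) atTop (𝓝 0) ∧
    (∀ i, Tendsto (fun n => eLpNorm (fun x => partialD i (φ n) x - G i x) 2
      (volume.restrict (hull t))) atTop (𝓝 0)) ∧
    ∀ e ∈ triEdges t, Tendsto (fun n => eLpNorm (fun x => φ n x - τ e x) 2 (edgeMeasure e))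
      atTop (𝓝 0)

section Limits

variable {X : Type*} [MeasurableSpace X] {μ : Measure X}

lemma integrable_mul_of_memLp {f g : X → ℝ} (hf : MemLp f 2 μ) (hg : MemLp g 2 μ) :
    Integrable (fun x => f x * g x) μ := hf.integrable_mul hg

lemma ae_eq_of_nrm_sub_eq_zero {f g : X → ℝ} (hf : MemLp f 2 μ) (hg : MemLp g 2 μ)
    (h : nrm μ (fun x => f x - g x) = 0) : f =ᵐ[μ] g := by
  have h1 : eLpNorm (fun x => f x - g x) 2 μ = 0 :=
    ((ENNReal.toReal_eq_zero_iff _).1 h).resolve_right (hf.sub hg).eLpNorm_ne_top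
  have h2 := (eLpNorm_eq_zero_iff (hf.sub hg).1 (by norm_num)).1 h1
  filter_upwards [h2] with x hx
  exact sub_eq_zero.1 hx

lemma tendsto_nrm_sub {f : ℕ → X → ℝ} {g : X → ℝ}
    (h : Tendsto (fun n => eLpNorm (fun x => f n x - g x) 2 μ) atTop (𝓝 0)) :
    Tendsto (fun n => nrm μ (fun x => f n x - g x)) atTop (𝓝 0) := by
  exact (ENNReal.tendsto_toReal ENNReal.zero_ne_top).comp h

lemma tendsto_integral_mul {f : ℕ → X → ℝ} {g z : X → ℝ} (hf : ∀ n, MemLp (f n) 2 μ)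
    (hg : MemLp g 2 μ) (hz : MemLp z 2 μ)
    (h : Tendsto (fun n => eLpNorm (fun x => f n x - g x) 2 μ) atTop (𝓝 0)) :
    Tendsto (fun n => ∫ x, f n x * z x ∂μ) atTop (𝓝 (∫ x, g x * z x ∂μ)) := by
  rw [tendsto_iff_norm_sub_tendsto_zero]
  have h1 := (tendsto_nrm_sub h).mul_const (nrm μ z)
  rw [zero_mul] at h1
  refine squeeze_zero (fun _ => norm_nonneg _) (fun n => ?_) h1
  rw [← integral_sub (integrable_mul_of_memLp (hf n) hz) (integrable_mul_of_memLp hg hz), Real.norm_eq_abs]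
  refine le_trans (le_of_eq ?_) (abs_integral_mul_le ((hf n).sub hg) hz)
  congr 2
  ext x
  simp [sub_mul]

lemma tendsto_nrm {f : ℕ → X → ℝ} {g : X → ℝ} (hf : ∀ n, MemLp (f n) 2 μ) (hg : MemLp g 2 μ)
    (h : Tendsto (fun n => eLpNorm (fun x => f n x - g x) 2 μ) atTop (𝓝 0)) :
    Tendsto (fun n => nrm μ (f n)) atTop (𝓝 (nrm μ g)) := by
  rw [tendsto_iff_norm_sub_tendsto_zero]
  refine squeeze_zero (fun _ => norm_nonneg _) (fun n => ?_) (tendsto_nrm_sub h)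
  rw [Real.norm_eq_abs, abs_le]
  have h1 := nrm_add_le ((hf n).sub hg) hg
  have h2 := nrm_sub_le (hf n) ((hf n).sub hg)
  simp only [Pi.sub_apply, sub_add_cancel, sub_sub_cancel] at h1 h2
  have e1 : nrm μ (f n) ≤ nrm μ (fun x => f n x - g x) + nrm μ g := h1
  have e2 : nrm μ g ≤ nrm μ (f n) + nrm μ (fun x => f n x - g x) := h2
  constructor <;> linarith

end Limits

lemma nrm_sq_real {X : Type*} [MeasurableSpace X] {μ : Measure X} {f : X → ℝ} (hf : MemLp f 2 μ) :
    nrm μ f ^ 2 = ∫ x, f x ^ 2 ∂μ := by simpa using nrm_sq hf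

namespace IsTri

variable {t : Finset Plane} (h : IsTri t)
include h

lemma mem_triEdges (i : t) : t.erase (i : Plane) ∈ triEdges t := by
  rw [h.triEdges_eq]
  exact Finset.mem_image_of_mem _ (Finset.mem_univ i)

lemma exists_of_mem_triEdges {e : Finset Plane} (he : e ∈ triEdges t) :
    ∃ i : t, e = t.erase (i : Plane) := by
  rw [h.triEdges_eq] at he
  obtain ⟨i, -, rfl⟩ := Finset.mem_image.1 he
  exact ⟨i, rfl⟩

lemma trace_nrm_sq_le {c : Plane} {r D : ℝ} (hd : HasDisc t c r D) {φ : Plane → ℝ}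
    (hφ : ContDiff ℝ 1 φ) {e : Finset Plane} (he : e ∈ triEdges t) :
    r * nrm (edgeMeasure e) φ ^ 2 ≤ 3 * nrm (volume.restrict (hull t)) φ ^ 2
      + D ^ 2 * (nrm (volume.restrict (hull t)) (partialD 0 φ) ^ 2
        + nrm (volume.restrict (hull t)) (partialD 1 φ) ^ 2) := by
  obtain ⟨i, rfl⟩ := h.exists_of_mem_triEdges he
  have hpc (j : Fin 2) : Continuous (partialD j φ) :=
    (hφ.continuous_fderiv (by simp)).clm_apply continuous_const
  rw [nrm_sq_real (memLp_edge (h.card_edge i) hφ.continuous), nrm_sq_real (memLp_hull hφ.continuous t),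
    nrm_sq_real (memLp_hull (hpc 0) t), nrm_sq_real (memLp_hull (hpc 1) t)]
  exact h.trace_sq_le hd hφ i

/-- The trace inequality for Sobolev functions. -/
lemma H1Trace.nrm_sq_le {c : Plane} {r D : ℝ} (hd : HasDisc t c r D) {g : Plane → ℝ}
    {G : Fin 2 → Plane → ℝ} {τ : Finset Plane → Plane → ℝ} (hg : H1Trace t g G τ)
    {e : Finset Plane} (he : e ∈ triEdges t) :
    r * nrm (edgeMeasure e) (τ e) ^ 2 ≤ 3 * nrm (volume.restrict (hull t)) g ^ 2
      + D ^ 2 * (nrm (volume.restrict (hull t)) (G 0) ^ 2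
        + nrm (volume.restrict (hull t)) (G 1) ^ 2) := by
  obtain ⟨φ, hφ, h0, h1, h2⟩ := hg.approx
  obtain ⟨i, rfl⟩ := h.exists_of_mem_triEdges he
  have m0 (n : ℕ) := memLp_hull (hφ n).continuous t
  have m1 (n : ℕ) (j : Fin 2) := memLp_hull (contDiff_partialD (hφ n) j).continuous t
  have m2 (n : ℕ) := memLp_edge (h.card_edge i) (hφ n).continuous
  have l0 := tendsto_nrm m0 hg.memLp h0
  have l1 (j : Fin 2) := tendsto_nrm (fun n => m1 n j) (hg.memLp_grad j) (h1 j)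
  have l2 := tendsto_nrm m2 (hg.memLp_trace _ he) (h2 _ he)
  refine le_of_tendsto_of_tendsto' ((l2.pow 2).const_mul r)
    (((l0.pow 2).const_mul 3).add ((((l1 0).pow 2).add ((l1 1).pow 2)).const_mul (D ^ 2)))
    fun n => ?_
  exact h.trace_nrm_sq_le hd ((hφ n).of_le (by simp)) he

/-- Green's formula for a Sobolev function and a smooth function. -/
lemma H1Trace.green {g : Plane → ℝ} {G : Fin 2 → Plane → ℝ} {τ : Finset Plane → Plane → ℝ}
    (hg : H1Trace t g G τ) {ζ : Plane → ℝ} (hζ : ContDiff ℝ ∞ ζ) (j : Fin 2) :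
    (∫ x in hull t, G j x * ζ x) + ∫ x in hull t, g x * partialD j ζ x
      = ∑ i : t, outwardNormal {t} (t.erase (i : Plane)) j *
        ∫ x, τ (t.erase (i : Plane)) x * ζ x ∂edgeMeasure (t.erase (i : Plane)) := by
  obtain ⟨φ, hφ, h0, h1, h2⟩ := hg.approx
  have m0 (n : ℕ) := memLp_hull (hφ n).continuous t
  have m1 (n : ℕ) := memLp_hull (contDiff_partialD (hφ n) j).continuous t
  have l0 := tendsto_integral_mul m0 hg.memLp
    (memLp_hull (contDiff_partialD hζ j).continuous t) h0
  have l1 := tendsto_integral_mul m1 (hg.memLp_grad j) (memLp_hull hζ.continuous t) (h1 j)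
  have l2 := tendsto_finsetSum (Finset.univ : Finset t) fun i _ =>
    (tendsto_integral_mul (fun n => memLp_edge (h.card_edge i) (hφ n).continuous)
      (hg.memLp_trace _ (h.mem_triEdges i)) (memLp_edge (h.card_edge i) hζ.continuous)
      (h2 _ (h.mem_triEdges i))).const_mul (outwardNormal {t} (t.erase (i : Plane)) j)
  refine tendsto_nhds_unique (l1.add l0) (l2.congr fun n => ?_)
  rw [← h.green_partialD ((((hφ n).mul hζ).of_le (by simp) : ContDiff ℝ 1 fun x => φ n x * ζ x)) j,
    ← integral_add (integrable_mul_of_memLp (m1 n) (memLp_hull hζ.continuous t))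
      (integrable_mul_of_memLp (m0 n) (memLp_hull (contDiff_partialD hζ j).continuous t))]
  refine integral_congr_ae (ae_of_all _ fun x => ?_)
  exact partialD_mul ((hφ n).differentiable (by simp) x) (hζ.differentiable (by simp) x)

/-- Subtracting a smooth function. -/
lemma H1Trace.sub_smooth {g : Plane → ℝ} {G : Fin 2 → Plane → ℝ} {τ : Finset Plane → Plane → ℝ}
    (hg : H1Trace t g G τ) {p : Plane → ℝ} (hp : ContDiff ℝ ∞ p) :
    H1Trace t (fun x => g x - p x) (fun i x => G i x - partialD i p x) (fun e x => τ e x - p x) := by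
  obtain ⟨φ, hφ, h0, h1, h2⟩ := hg.approx
  refine ⟨hg.memLp.sub (memLp_hull hp.continuous t), fun i => (hg.memLp_grad i).sub
    (memLp_hull (contDiff_partialD hp i).continuous t), fun e he => ?_,
    fun n x => φ n x - p x, fun n => (hφ n).sub hp, ?_, fun i => ?_, fun e he => ?_⟩
  · obtain ⟨i, rfl⟩ := h.exists_of_mem_triEdges he
    exact (hg.memLp_trace _ he).sub (memLp_edge (h.card_edge i) hp.continuous)
  · simpa using h0
  · refine (h1 i).congr fun n => ?_
    congr 1
    ext x
    have : partialD i (fun x => φ n x - p x) x = partialD i (φ n) x - partialD i p x := by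
      simp only [partialD]
      rw [fderiv_fun_sub ((hφ n).differentiable (by simp) x) (hp.differentiable (by simp) x)]
      rfl
    rw [this]
    ring
  · simpa using h2 e he

/-- A function with square-integrable weak gradient has boundary values. -/
theorem exists_H1Trace {c : Plane} {r D : ℝ} (hd : HasDisc t c r D) {g : Plane → ℝ}
    {G : Fin 2 → Plane → ℝ} (hg : MemLp g 2 (volume.restrict (hull t)))
    (hG : ∀ i, MemLp (G i) 2 (volume.restrict (hull t)))
    (hw : ∀ i, IsWeakDeriv (openTri t) (dirIndex i) g (G i)) :
    ∃ τ, H1Trace t g G τ := by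
  rw [← restrict_openTri] at hg hG
  obtain ⟨φ, hφ, hlim⟩ := exists_smooth_approx isOpen_openTri convex_openTri
    ((isCompact_hull t).isBounded.subset openTri_subset) h.openTri_nonempty hg
  have h0 := hlim (0, 0) g hg (isWeakDeriv_zero _ g)
  have h1 (i : Fin 2) := hlim (dirIndex i) (G i) (hG i) (hw i)
  simp only [multiD_zero, multiD_dirIndex, restrict_openTri] at h0 h1
  rw [restrict_openTri] at hg hG
  set μ := (volume : Measure Plane).restrict (hull t) with hμ
  have m0 (n : ℕ) := memLp_hull (hφ n).continuous t
  have m1 (n : ℕ) (j : Fin 2) := memLp_hull (contDiff_partialD (hφ n) j).continuous t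
  set a : ℕ → ℝ := fun n => nrm μ (fun x => φ n x - g x)
    + (nrm μ (fun x => partialD 0 (φ n) x - G 0 x) + nrm μ (fun x => partialD 1 (φ n) x - G 1 x))
  have ha : Tendsto a atTop (𝓝 0) := by
    simpa using (tendsto_nrm_sub h0).add ((tendsto_nrm_sub (h1 0)).add (tendsto_nrm_sub (h1 1)))
  have htri {f₁ f₂ f : Plane → ℝ} (e₁ : MemLp f₁ 2 μ) (e₂ : MemLp f₂ 2 μ) (e : MemLp f 2 μ) :
      nrm μ (fun x => f₁ x - f₂ x) ≤ nrm μ (fun x => f₁ x - f x) + nrm μ (fun x => f₂ x - f x) := by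
    have := nrm_sub_le (e₁.sub e) (e₂.sub e)
    refine le_trans (le_of_eq ?_) this
    congr 1
    ext x
    simp
  have key : ∀ e ∈ triEdges t, ∃ τe : Plane → ℝ, MemLp τe 2 (edgeMeasure e) ∧
      Tendsto (fun n => eLpNorm (fun x => φ n x - τe x) 2 (edgeMeasure e)) atTop (𝓝 0) := by
    intro e he
    obtain ⟨i, rfl⟩ := h.exists_of_mem_triEdges he
    have m2 (n : ℕ) := memLp_edge (h.card_edge i) (hφ n).continuous
    set e := t.erase (i : Plane)
    let F : ℕ → Lp ℝ 2 (edgeMeasure e) := fun n => (m2 n).toLp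
    set M : ℝ := (3 + D ^ 2) / r with hM
    have hM0 : 0 < M := div_pos (by positivity) hd.pos
    have hb : ∀ n m, dist (F n) (F m) ^ 2 ≤ M * (a n + a m) ^ 2 := by
      intro n m
      have e1 : dist (F n) (F m) = nrm (edgeMeasure e) (fun x => φ n x - φ m x) := by
        rw [dist_eq_norm, ← MemLp.toLp_sub, Lp.norm_toLp]; rfl
      have e2 := h.trace_nrm_sq_le hd (((hφ n).sub (hφ m)).of_le (by simp) :
        ContDiff ℝ 1 fun x => φ n x - φ m x) he
      have e3 (j : Fin 2) : partialD j (fun x => φ n x - φ m x)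
          = fun x => partialD j (φ n) x - partialD j (φ m) x := by
        ext x
        simp only [partialD]
        rw [fderiv_fun_sub ((hφ n).differentiable (by simp) x) ((hφ m).differentiable (by simp) x)]
        rfl
      rw [e3, e3] at e2
      have i0 := htri (m0 n) (m0 m) hg
      have i1 := htri (m1 n 0) (m1 m 0) (hG 0)
      have i2 := htri (m1 n 1) (m1 m 1) (hG 1)
      have hmu : volume.restrict (hull t) = μ := rfl
      rw [hmu] at e2
      rw [e1, hM, div_mul_eq_mul_div, le_div_iff₀ hd.pos]
      have n0 := nrm_nonneg (μ := μ) (fun x => φ n x - φ m x)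
      have n1 := nrm_nonneg (μ := μ) (fun x => partialD 0 (φ n) x - partialD 0 (φ m) x)
      have n2 := nrm_nonneg (μ := μ) (fun x => partialD 1 (φ n) x - partialD 1 (φ m) x)
      have hsum : nrm μ (fun x => φ n x - φ m x)
          + (nrm μ (fun x => partialD 0 (φ n) x - partialD 0 (φ m) x)
          + nrm μ (fun x => partialD 1 (φ n) x - partialD 1 (φ m) x)) ≤ a n + a m := by
        simp only [a]
        linarith
      set A := nrm μ (fun x => φ n x - φ m x)
      set B₀ := nrm μ (fun x => partialD 0 (φ n) x - partialD 0 (φ m) x)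
      set B₁ := nrm μ (fun x => partialD 1 (φ n) x - partialD 1 (φ m) x)
      have q1 : A ^ 2 ≤ (a n + a m) ^ 2 := pow_le_pow_left₀ n0 (by linarith) 2
      have q2 : B₀ ^ 2 + B₁ ^ 2 ≤ (a n + a m) ^ 2 :=
        le_trans (by nlinarith) (pow_le_pow_left₀ (by linarith) (by linarith : B₀ + B₁ ≤ a n + a m) 2)
      calc nrm (edgeMeasure e) (fun x => φ n x - φ m x) ^ 2 * r
          = r * nrm (edgeMeasure e) (fun x => φ n x - φ m x) ^ 2 := mul_comm _ _
        _ ≤ 3 * A ^ 2 + D ^ 2 * (B₀ ^ 2 + B₁ ^ 2) := e2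
        _ ≤ 3 * (a n + a m) ^ 2 + D ^ 2 * (a n + a m) ^ 2 := by gcongr
        _ = _ := by ring
    have hcau : CauchySeq F := by
      have h3 : Tendsto (fun p : ℕ × ℕ => M * (a p.1 + a p.2) ^ 2) atTop (𝓝 0) := by
        have l1 : Tendsto (fun p : ℕ × ℕ => a p.1) atTop (𝓝 0) :=
          ha.comp (tendsto_fst.mono_left prod_atTop_atTop_eq.ge)
        have l2 : Tendsto (fun p : ℕ × ℕ => a p.2) atTop (𝓝 0) :=
          ha.comp (tendsto_snd.mono_left prod_atTop_atTop_eq.ge)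
        simpa using ((l1.add l2).pow 2).const_mul M
      have h4 : Tendsto (fun p : ℕ × ℕ => dist (F p.1) (F p.2) ^ 2) atTop (𝓝 0) :=
        squeeze_zero (fun _ => sq_nonneg _) (fun p => hb p.1 p.2) h3
      rw [cauchySeq_iff_tendsto_dist_atTop_0]
      have h5 := (Real.continuous_sqrt.tendsto 0).comp h4
      rw [Real.sqrt_zero] at h5
      refine h5.congr fun p => ?_
      simp [Real.sqrt_sq dist_nonneg]
    obtain ⟨T, hT⟩ := cauchySeq_tendsto_of_complete hcau
    refine ⟨T, Lp.memLp T, ?_⟩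
    have h6 := (Lp.tendsto_Lp_iff_tendsto_eLpNorm' F T).1 hT
    refine h6.congr fun n => eLpNorm_congr_ae ?_
    filter_upwards [(m2 n).coeFn_toLp] with x hx
    simp only [Pi.sub_apply, F]
    rw [hx]
  choose! τ hτ using key
  exact ⟨τ, hg, hG, fun e he => (hτ e he).1, φ, hφ, h0, h1, fun e he => (hτ e he).2⟩

/-- Boundary values in the sense of `IsTraceFrom` are those of `H1Trace`. -/
lemma H1Trace.isTraceFrom_iff {c : Plane} {r D : ℝ} (hd : HasDisc t c r D) {g : Plane → ℝ}
    {G : Fin 2 → Plane → ℝ} {τ : Finset Plane → Plane → ℝ} (hg : H1Trace t g G τ)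
    (hw : ∀ i, IsWeakDeriv (openTri t) (dirIndex i) g (G i))
    {e : Finset Plane} (he : e ∈ triEdges t) {τ' : Plane → ℝ} (hτ' : MemLp τ' 2 (edgeMeasure e)) :
    IsTraceFrom t e g τ' ↔ τ' =ᵐ[edgeMeasure e] τ e := by
  have hGw (i : Fin 2) : weakD (openTri t) (dirIndex i) g =ᵐ[volume.restrict (hull t)] G i := by
    have hGi := hg.memLp_grad i
    rw [← restrict_openTri] at hGi ⊢
    have hs := weakD_spec ⟨G i, hGi, hw i⟩
    exact hs.2.ae_eq isOpen_openTri
      ((isCompact_hull t).isBounded.subset openTri_subset).measure_lt_top.ne hs.1 hGi (hw i)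
  have hG0 : weakD (openTri t) (1, 0) g =ᵐ[volume.restrict (hull t)] G 0 := hGw 0
  have hG1 : weakD (openTri t) (0, 1) g =ᵐ[volume.restrict (hull t)] G 1 := hGw 1
  have hcongr {f f₁ f₂ : Plane → ℝ} (hf : f₁ =ᵐ[volume.restrict (hull t)] f₂) :
      eLpNorm (fun x => f x - f₁ x) 2 (volume.restrict (hull t))
        = eLpNorm (fun x => f x - f₂ x) 2 (volume.restrict (hull t)) :=
    eLpNorm_congr_ae (hf.mono fun x hx => by simp only; rw [hx])
  unfold IsTraceFrom
  rw [restrict_openTri]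
  simp only [hcongr hG0, hcongr hG1]
  obtain ⟨i, rfl⟩ := h.exists_of_mem_triEdges he
  constructor
  · rintro ⟨ψ, hψ, k0, k1, k2, k3⟩
    obtain ⟨φ, hφ, h0, h1, h2⟩ := hg.approx
    have m2 (n : ℕ) := memLp_edge (h.card_edge i) (hφ n).continuous
    have m2' (n : ℕ) := memLp_edge (h.card_edge i) (hψ n).continuous
    have hτ := hg.memLp_trace _ he
    have m0 (n : ℕ) := memLp_hull (hφ n).continuous t
    have m1 (n : ℕ) (j : Fin 2) := memLp_hull (contDiff_partialD (hφ n) j).continuous t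
    have m0' (n : ℕ) := memLp_hull (hψ n).continuous t
    have m1' (n : ℕ) (j : Fin 2) := memLp_hull (contDiff_partialD (hψ n) j).continuous t
    -- the difference of the two approximating sequences tends to `0` in the triangle
    have hdiff {X : Type} [MeasurableSpace X] {μ : Measure X} {f f' : ℕ → X → ℝ} {z z' : X → ℝ}
        (q1 : ∀ n, MemLp (f n) 2 μ) (q2 : ∀ n, MemLp (f' n) 2 μ) (q3 : MemLp z 2 μ)
        (q3' : MemLp z' 2 μ)
        (q4 : Tendsto (fun n => eLpNorm (fun x => f n x - z x) 2 μ) atTop (𝓝 0))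
        (q5 : Tendsto (fun n => eLpNorm (fun x => f' n x - z' x) 2 μ) atTop (𝓝 0)) :
        Tendsto (fun n => eLpNorm (fun x => (f n x - f' n x) - (z x - z' x)) 2 μ) atTop (𝓝 0) := by
      have q6 := q4.add q5
      rw [add_zero] at q6
      refine tendsto_of_tendsto_of_tendsto_of_le_of_le tendsto_const_nhds q6 (fun _ => bot_le)
        fun n => ?_
      have := eLpNorm_sub_le ((q1 n).sub q3).1 ((q2 n).sub q3').1 (p := 2) (by norm_num)
      refine le_trans (le_of_eq ?_) this
      congr 1
      ext x
      simp only [Pi.sub_apply]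
      ring
    have d0 := hdiff m0 m0' hg.memLp hg.memLp h0 k0
    have d1 := hdiff (fun n => m1 n 0) (fun n => m1' n 0) (hg.memLp_grad 0) (hg.memLp_grad 0)
      (h1 0) k1
    have d2 := hdiff (fun n => m1 n 1) (fun n => m1' n 1) (hg.memLp_grad 1) (hg.memLp_grad 1)
      (h1 1) k2
    have d3 := hdiff m2 m2' hτ hτ' (h2 _ he) k3
    simp only [sub_self] at d0 d1 d2
    have hm (n : ℕ) : ContDiff ℝ ∞ fun x => φ n x - ψ n x := (hφ n).sub (hψ n)
    have e3 (n : ℕ) (j : Fin 2) : (fun x => partialD j (φ n) x - partialD j (ψ n) x)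
        = partialD j (fun x => φ n x - ψ n x) := by
      ext x
      simp only [partialD]
      rw [fderiv_fun_sub ((hφ n).differentiable (by simp) x) ((hψ n).differentiable (by simp) x)]
      rfl
    have l0 := tendsto_nrm (fun n => (m0 n).sub (m0' n)) (MemLp.zero' (ε := ℝ)) d0
    have l1 := tendsto_nrm (fun n => (m1 n 0).sub (m1' n 0)) (MemLp.zero' (ε := ℝ)) d1
    have l2 := tendsto_nrm (fun n => (m1 n 1).sub (m1' n 1)) (MemLp.zero' (ε := ℝ)) d2
    have l3 := tendsto_nrm (fun n => (m2 n).sub (m2' n)) (hτ.sub hτ') d3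
    have hlim := le_of_tendsto_of_tendsto' ((l3.pow 2).const_mul r)
      (((l0.pow 2).const_mul 3).add (((l1.pow 2).add (l2.pow 2)).const_mul (D ^ 2)))
      fun n => by
        have := h.trace_nrm_sq_le hd ((hm n).of_le (by simp)) he
        rw [← e3, ← e3] at this
        exact this
    have z0 : nrm (volume.restrict (hull t)) (fun _ : Plane => (0 : ℝ)) = 0 := by simp [nrm]
    rw [z0] at hlim
    have hr := hd.pos
    have h9 : nrm (edgeMeasure (t.erase (i : Plane))) (τ (t.erase (i : Plane)) - τ') = 0 := by
      have h10 : r * nrm (edgeMeasure (t.erase (i : Plane))) (τ (t.erase (i : Plane)) - τ') ^ 2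
          ≤ 0 := by simpa using hlim
      have h11 : nrm (edgeMeasure (t.erase (i : Plane))) (τ (t.erase (i : Plane)) - τ') ^ 2 ≤ 0 := by
        nlinarith [sq_nonneg (nrm (edgeMeasure (t.erase (i : Plane))) (τ (t.erase (i : Plane)) - τ'))]
      exact pow_eq_zero_iff (two_ne_zero) |>.1 (le_antisymm h11 (sq_nonneg _))
    exact (ae_eq_of_nrm_sub_eq_zero hτ hτ' h9).symm
  · intro hτe
    obtain ⟨φ, hφ, h0, h1, h2⟩ := hg.approx
    refine ⟨φ, hφ, h0, h1 0, h1 1, (h2 _ he).congr fun n => eLpNorm_congr_ae ?_⟩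
    filter_upwards [hτe] with x hx
    rw [hx]

end IsTri

/-! ### Iterated weak derivatives and products with smooth coefficients -/

lemma partialD_comm {φ : Plane → ℝ} (hφ : ContDiff ℝ ∞ φ) (i j : Fin 2) :
    partialD i (partialD j φ) = partialD j (partialD i φ) := by
  have key (v w x : Plane) :
      fderiv ℝ (fun y => fderiv ℝ φ y v) x w = fderiv ℝ (fderiv ℝ φ) x w v := by
    have h1 : DifferentiableAt ℝ (fderiv ℝ φ) x :=
      (hφ.fderiv_right (m := ∞) (by simp)).differentiable (by simp) x
    rw [fderiv_clm_apply h1 (differentiableAt_const v)]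
    simp
  ext x
  have hs : IsSymmSndFDerivAt ℝ φ x :=
    hφ.contDiffAt.isSymmSndFDerivAt (by
      rw [minSmoothness_of_isRCLikeNormedField]
      exact WithTop.coe_le_coe.2 (le_top : (2 : ℕ∞) ≤ ⊤))
  change fderiv ℝ (fun y => fderiv ℝ φ y _) x _ = fderiv ℝ (fun y => fderiv ℝ φ y _) x _
  rw [key, key]
  exact hs _ _

lemma partialD_multiD {φ : Plane → ℝ} (hφ : ContDiff ℝ ∞ φ) (i : Fin 2) (β : ℕ × ℕ) :
    partialD i (multiD β φ) = multiD (β + dirIndex i) φ := by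
  obtain ⟨a, b⟩ := β
  fin_cases i
  · exact (multiD_succ_fst a b φ).symm
  · change partialD 1 (multiD (a, b) φ) = multiD (a, b + 1) φ
    induction a with
    | zero => exact (multiD_succ_snd b φ).symm
    | succ a ih =>
      rw [multiD_succ_fst, partialD_comm (contDiff_multiD hφ _), ih, multiD_succ_fst]

lemma multiD_partialD {φ : Plane → ℝ} (hφ : ContDiff ℝ ∞ φ) (i : Fin 2) (β : ℕ × ℕ) :
    multiD β (partialD i φ) = multiD (β + dirIndex i) φ := by
  induction β using multiIndex_induction with
  | h0 => rw [multiD_zero, ← Prod.zero_eq_mk, zero_add, multiD_dirIndex]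
  | h1 b ih =>
    rw [multiD_succ_snd, ih, partialD_multiD hφ]
    congr 1
    simp only [Prod.ext_iff, Prod.fst_add, Prod.snd_add, dirIndex]
    fin_cases i <;> simp
  | h2 a b ih =>
    rw [multiD_succ_fst, ih, partialD_multiD hφ]
    congr 1
    simp only [Prod.ext_iff, Prod.fst_add, Prod.snd_add, dirIndex]
    fin_cases i <;> simp

lemma dirIndex_order (i : Fin 2) : (dirIndex i).1 + (dirIndex i).2 = 1 := by
  fin_cases i <;> rfl

lemma IsWeakDeriv.comp {U : Set Plane} {i : Fin 2} {β : ℕ × ℕ} {g g₁ g₂ : Plane → ℝ}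
    (h₁ : IsWeakDeriv U (dirIndex i) g g₁) (h₂ : IsWeakDeriv U β g₁ g₂) :
    IsWeakDeriv U (β + dirIndex i) g g₂ := by
  intro φ hφ hφc hφU
  have e1 := h₁ (multiD β φ) (contDiff_multiD hφ β) (hasCompactSupport_multiD hφc β)
    ((tsupport_multiD_subset β φ).trans hφU)
  rw [multiD_dirIndex, partialD_multiD hφ, h₂ φ hφ hφc hφU, dirIndex_order] at e1
  rw [e1, Prod.fst_add, Prod.snd_add, show β.1 + (dirIndex i).1 + (β.2 + (dirIndex i).2)
    = β.1 + β.2 + 1 by have := dirIndex_order i; omega]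
  ring

lemma IsWeakDeriv.of_add {U : Set Plane} {i : Fin 2} {β : ℕ × ℕ} {g g₁ g₂ : Plane → ℝ}
    (h₁ : IsWeakDeriv U β g g₁) (h₂ : IsWeakDeriv U (β + dirIndex i) g g₂) :
    IsWeakDeriv U (dirIndex i) g₁ g₂ := by
  intro φ hφ hφc hφU
  have e1 := h₁ (partialD i φ) (contDiff_partialD hφ i)
    (by rw [← multiD_dirIndex]; exact hasCompactSupport_multiD hφc _)
    ((tsupport_partialD_subset i φ).trans hφU)
  rw [multiD_partialD hφ, h₂ φ hφ hφc hφU, Prod.fst_add, Prod.snd_add,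
    show β.1 + (dirIndex i).1 + (β.2 + (dirIndex i).2)
    = β.1 + β.2 + 1 by have := dirIndex_order i; omega, pow_succ, mul_assoc] at e1
  have := mul_left_cancel₀ (by positivity) e1
  rw [multiD_dirIndex, dirIndex_order, ← this, pow_one]

lemma IsWeakDeriv.add {U : Set Plane} (hUb : Bornology.IsBounded U) {β : ℕ × ℕ}
    {f f' g g' : Plane → ℝ} (hf : MemLp f 2 (volume.restrict U))
    (hf' : MemLp f' 2 (volume.restrict U)) (hg : MemLp g 2 (volume.restrict U))
    (hg' : MemLp g' 2 (volume.restrict U)) (h₁ : IsWeakDeriv U β f f')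
    (h₂ : IsWeakDeriv U β g g') :
    IsWeakDeriv U β (fun x => f x + g x) (fun x => f' x + g' x) := by
  intro φ hφ hφc hφU
  have : IsFiniteMeasure (volume.restrict U) := ⟨by simpa using hUb.measure_lt_top⟩
  have m1 : MemLp φ 2 (volume.restrict U) :=
    (hφ.continuous.memLp_of_hasCompactSupport hφc).restrict U
  have m2 : MemLp (multiD β φ) 2 (volume.restrict U) :=
    ((contDiff_multiD hφ β).continuous.memLp_of_hasCompactSupport
      (hasCompactSupport_multiD hφc β)).restrict U
  simp only [add_mul]
  rw [integral_add (integrable_mul_of_memLp hf m2) (integrable_mul_of_memLp hg m2),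
    integral_add (integrable_mul_of_memLp hf' m1) (integrable_mul_of_memLp hg' m1),
    h₁ φ hφ hφc hφU, h₂ φ hφ hφc hφU]
  ring

/-- The product rule for a weakly differentiable function and a `C¹` coefficient that is bounded
together with its derivatives. -/
lemma IsWeakDeriv.mul_coeff {U : Set Plane} (hUo : IsOpen U) (hU : Convex ℝ U)
    (hUb : Bornology.IsBounded U) {i : Fin 2} {a a' g g' : Plane → ℝ} {B : ℝ}
    (ha : ContDiffOn ℝ 1 a U) (haB : ∀ x ∈ U, |a x| ≤ B)
    (ha' : ∀ x ∈ U, a' x = partialD i a x) (ha'B : ∀ x ∈ U, |a' x| ≤ B)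
    (hg : MemLp g 2 (volume.restrict U)) (hg' : MemLp g' 2 (volume.restrict U))
    (hd : IsWeakDeriv U (dirIndex i) g g') :
    IsWeakDeriv U (dirIndex i) (fun x => a x * g x) (fun x => a' x * g x + a x * g' x) := by
  intro ζ hζ hζc hζU
  rcases U.eq_empty_or_nonempty with rfl | hUn
  · simp
  have : IsFiniteMeasure (volume.restrict U) := ⟨by simpa using hUb.measure_lt_top⟩
  obtain ⟨φ, hφ, hlim⟩ := exists_smooth_approx hUo hU hUb hUn hg
  have h0 := hlim (0, 0) g hg (isWeakDeriv_zero _ g)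
  have h1 := hlim (dirIndex i) g' hg' hd
  simp only [multiD_zero, multiD_dirIndex] at h0 h1
  have hmem (f : Plane → ℝ) (hf : Continuous f) : MemLp f 2 (volume.restrict U) :=
    memLp_of_continuous hf hUb.isCompact_closure
      (by filter_upwards [ae_restrict_mem hUo.measurableSet] with x hx using subset_closure hx)
  -- the product of the coefficient and the test function is a compactly supported `C¹` function
  have hts : tsupport (fun x => a x * ζ x) ⊆ tsupport ζ := tsupport_mul_subset_right
  have hη : ContDiff ℝ 1 (fun x => a x * ζ x) := by
    refine contDiff_iff_contDiffAt.2 fun x => ?_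
    by_cases hx : x ∈ tsupport fun x => a x * ζ x
    swap
    · exact (contDiffAt_const (c := (0 : ℝ))).congr_of_eventuallyEq
        (notMem_tsupport_iff_eventuallyEq.1 hx)
    have hxU := hζU (hts hx)
    exact (ha.contDiffAt (hUo.mem_nhds hxU)).mul (hζ.of_le (by simp)).contDiffAt
  have hηc : HasCompactSupport (fun x => a x * ζ x) :=
    hζc.of_isClosed_subset (isClosed_tsupport _) hts
  have hη' : Continuous (partialD i fun x => a x * ζ x) :=
    (hη.continuous_fderiv (by simp)).clm_apply continuous_const
  have htsη : tsupport (partialD i fun x => a x * ζ x) ⊆ tsupport ζ :=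
    (tsupport_partialD_subset i _).trans hts
  have hη'c : HasCompactSupport (partialD i fun x => a x * ζ x) :=
    hζc.of_isClosed_subset (isClosed_tsupport _) htsη
  have ibp (n : ℕ) : ∫ x in U, φ n x * partialD i (fun x => a x * ζ x) x
      = -∫ x in U, partialD i (φ n) x * (a x * ζ x) := by
    have hc := (hφ n).continuous
    have hc' := (contDiff_partialD (hφ n) i).continuous
    have e := integral_mul_fderiv_eq_neg_fderiv_mul_of_integrable (μ := (volume : Measure Plane))
      (f := φ n) (g := fun x => a x * ζ x) (v := EuclideanSpace.single i 1)
      ((hc'.mul hη.continuous).integrable_of_hasCompactSupport hηc.mul_left)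
      ((hc.mul hη').integrable_of_hasCompactSupport hη'c.mul_left)
      ((hc.mul hη.continuous).integrable_of_hasCompactSupport hηc.mul_left)
      (fun x _ => (hφ n).differentiable (by simp) x) (fun x _ => hη.differentiable (by simp) x)
    have e1 := setIntegral_mul_eq_of_tsupport MeasurableSet.univ (Set.subset_univ U)
      (htsη.trans hζU) (φ n)
    have e2 := setIntegral_mul_eq_of_tsupport MeasurableSet.univ (Set.subset_univ U)
      (hts.trans hζU) (partialD i (φ n))
    rw [setIntegral_univ] at e1 e2
    rw [← e1, ← e2]
    exact e
  have l1 := tendsto_integral_mul (fun n => hmem _ (hφ n).continuous) hg (hmem _ hη') h0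
  have l2 := tendsto_integral_mul (fun n => hmem _ (contDiff_partialD (hφ n) i).continuous) hg'
    (hmem _ hη.continuous) h1
  have hlimit := tendsto_nhds_unique (l1.congr ibp) l2.neg
  have prod (x : Plane) (hx : x ∈ U) : partialD i (fun x => a x * ζ x) x
      = a x * partialD i ζ x + ζ x * a' x := by
    rw [partialD_mul ((ha.contDiffAt (hUo.mem_nhds hx)).differentiableAt (by simp))
      (hζ.differentiable (by simp) x), ha' x hx]
    ring
  have maem (f : Plane → ℝ) (hf : ContinuousOn f U) (hfB : ∀ x ∈ U, |f x| ≤ B) (k : Plane → ℝ)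
      (hk : MemLp k 2 (volume.restrict U)) : MemLp (fun x => f x * k x) 2 (volume.restrict U) :=
    MemLp.of_le_mul (c := B) hk ((hf.aestronglyMeasurable hUo.measurableSet).mul hk.1)
      (by
        filter_upwards [ae_restrict_mem hUo.measurableSet] with x hx
        rw [norm_mul]
        exact mul_le_mul_of_nonneg_right (hfB x hx) (norm_nonneg _))
  have hca' : ContinuousOn a' U := by
    have : ContinuousOn (partialD i a) U :=
      (ha.continuousOn_fderiv_of_isOpen hUo le_rfl).clm_apply continuousOn_const
    exact this.congr ha'
  have ma := maem a ha.continuousOn haB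
  have ma' := maem a' hca' ha'B
  have mζ := hmem _ hζ.continuous
  have mζ' := hmem _ (contDiff_partialD hζ i).continuous
  rw [multiD_dirIndex, dirIndex_order]
  have s1 : ∫ x in U, g x * partialD i (fun x => a x * ζ x) x
      = (∫ x in U, a x * g x * partialD i ζ x) + ∫ x in U, a' x * g x * ζ x := by
    rw [← integral_add (integrable_mul_of_memLp (ma g hg) mζ')
      (integrable_mul_of_memLp (ma' g hg) mζ)]
    refine setIntegral_congr_fun hUo.measurableSet fun x hx => ?_
    simp only [prod x hx]
    ring
  have s2 : ∫ x in U, (a' x * g x + a x * g' x) * ζ x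
      = (∫ x in U, a' x * g x * ζ x) + ∫ x in U, g' x * (a x * ζ x) := by
    simp only [add_mul]
    rw [integral_add (integrable_mul_of_memLp (ma' g hg) mζ) (integrable_mul_of_memLp (ma g' hg') mζ)]
    congr 2
    ext x
    ring
  rw [s2]
  rw [s1] at hlimit
  linarith

/-- `g` belongs to `H^m(U)`, with all iterated weak derivatives of order at most `m` of `L²` norm
at most `N`. -/
def SobolevBound (U : Set Plane) : ℕ → (Plane → ℝ) → ℝ → Prop
  | 0, g, N => MemLp g 2 (volume.restrict U) ∧ nrm (volume.restrict U) g ≤ N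
  | m + 1, g, N => (MemLp g 2 (volume.restrict U) ∧ nrm (volume.restrict U) g ≤ N) ∧
      ∀ i, ∃ g', IsWeakDeriv U (dirIndex i) g g' ∧ SobolevBound U m g' N

/-- `a` is of class `C^m` on `U`, with all iterated derivatives of order at most `m` bounded
by `B`. -/
def CoeffBound (U : Set Plane) : ℕ → (Plane → ℝ) → ℝ → Prop
  | 0, a, B => ContinuousOn a U ∧ ∀ x ∈ U, |a x| ≤ B
  | m + 1, a, B => (ContDiffOn ℝ 1 a U ∧ ∀ x ∈ U, |a x| ≤ B) ∧
      ∀ i, ∃ a', (∀ x ∈ U, a' x = partialD i a x) ∧ CoeffBound U m a' B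

namespace SobolevBound

variable {U : Set Plane}

lemma memLp {m : ℕ} {g : Plane → ℝ} {N : ℝ} (h : SobolevBound U m g N) :
    MemLp g 2 (volume.restrict U) := by
  cases m with
  | zero => exact h.1
  | succ m => exact h.1.1

lemma nrm_le {m : ℕ} {g : Plane → ℝ} {N : ℝ} (h : SobolevBound U m g N) :
    nrm (volume.restrict U) g ≤ N := by
  cases m with
  | zero => exact h.2
  | succ m => exact h.1.2

lemma of_succ {m : ℕ} {g : Plane → ℝ} {N : ℝ} (h : SobolevBound U (m + 1) g N) :
    SobolevBound U m g N := by
  induction m generalizing g with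
  | zero => exact h.1
  | succ m ih =>
    refine ⟨h.1, fun i => ?_⟩
    obtain ⟨g', h1, h2⟩ := h.2 i
    exact ⟨g', h1, ih h2⟩

lemma mono {m : ℕ} {g : Plane → ℝ} {N N' : ℝ} (h : SobolevBound U m g N) (hN : N ≤ N') :
    SobolevBound U m g N' := by
  induction m generalizing g with
  | zero => exact ⟨h.1, h.2.trans hN⟩
  | succ m ih =>
    refine ⟨⟨h.1.1, h.1.2.trans hN⟩, fun i => ?_⟩
    obtain ⟨g', h1, h2⟩ := h.2 i
    exact ⟨g', h1, ih h2⟩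

lemma add (hUb : Bornology.IsBounded U) {m : ℕ} {f g : Plane → ℝ} {M N : ℝ}
    (hf : SobolevBound U m f M) (hg : SobolevBound U m g N) :
    SobolevBound U m (fun x => f x + g x) (M + N) := by
  induction m generalizing f g with
  | zero => exact ⟨hf.1.add hg.1, (nrm_add_le hf.1 hg.1).trans (add_le_add hf.2 hg.2)⟩
  | succ m ih =>
    refine ⟨⟨hf.1.1.add hg.1.1, (nrm_add_le hf.1.1 hg.1.1).trans (add_le_add hf.1.2 hg.1.2)⟩,
      fun i => ?_⟩
    obtain ⟨f', h1, h2⟩ := hf.2 i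
    obtain ⟨g', h3, h4⟩ := hg.2 i
    exact ⟨_, h1.add hUb hf.1.1 h2.memLp hg.1.1 h4.memLp h3, ih h2 h4⟩

lemma exists_weakDeriv {m : ℕ} {g : Plane → ℝ} {N : ℝ} (h : SobolevBound U m g N) (β : ℕ × ℕ)
    (hβ : β.1 + β.2 ≤ m) : ∃ g', MemLp g' 2 (volume.restrict U) ∧
      nrm (volume.restrict U) g' ≤ N ∧ IsWeakDeriv U β g g' := by
  induction m generalizing g β with
  | zero =>
    obtain ⟨a, b⟩ := β
    obtain ⟨rfl, rfl⟩ : a = 0 ∧ b = 0 := by simp only at hβ; omega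
    exact ⟨g, h.1, h.2, isWeakDeriv_zero U g⟩
  | succ m ih =>
    obtain ⟨a, b⟩ := β
    simp only at hβ
    have step (i : Fin 2) (γ : ℕ × ℕ) (hγ : γ.1 + γ.2 ≤ m) (e : γ + dirIndex i = (a, b)) :
        ∃ g', MemLp g' 2 (volume.restrict U) ∧
          nrm (volume.restrict U) g' ≤ N ∧ IsWeakDeriv U (a, b) g g' := by
      obtain ⟨g₁, h1, h2⟩ := h.2 i
      obtain ⟨g', h3, h4, h5⟩ := ih h2 γ hγ
      exact ⟨g', h3, h4, e ▸ h1.comp h5⟩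
    rcases a with _ | a
    · rcases b with _ | b
      · exact ⟨g, h.1.1, h.1.2, isWeakDeriv_zero U g⟩
      · exact step 1 (0, b) (by simp only; omega) (by simp [dirIndex])
    · exact step 0 (a, b) (by simp only; omega) (by simp [dirIndex])

end SobolevBound

namespace CoeffBound

variable {U : Set Plane}

lemma continuousOn {m : ℕ} {a : Plane → ℝ} {B : ℝ} (h : CoeffBound U m a B) :
    ContinuousOn a U := by
  cases m with
  | zero => exact h.1
  | succ m => exact h.1.1.continuousOn

lemma abs_le {m : ℕ} {a : Plane → ℝ} {B : ℝ} (h : CoeffBound U m a B) :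
    ∀ x ∈ U, |a x| ≤ B := by
  cases m with
  | zero => exact h.2
  | succ m => exact h.1.2

lemma of_succ {m : ℕ} {a : Plane → ℝ} {B : ℝ} (h : CoeffBound U (m + 1) a B) :
    CoeffBound U m a B := by
  induction m generalizing a with
  | zero => exact ⟨h.1.1.continuousOn, h.1.2⟩
  | succ m ih =>
    refine ⟨h.1, fun i => ?_⟩
    obtain ⟨a', h1, h2⟩ := h.2 i
    exact ⟨a', h1, ih h2⟩

lemma mul (hUo : IsOpen U) (hU : Convex ℝ U) (hUb : Bornology.IsBounded U) {m : ℕ}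
    {a g : Plane → ℝ} {B N : ℝ} (hB : 0 ≤ B) (hN : 0 ≤ N) (ha : CoeffBound U m a B)
    (hg : SobolevBound U m g N) :
    SobolevBound U m (fun x => a x * g x) (2 ^ m * (B * N)) := by
  have hle (m : ℕ) : B * N ≤ 2 ^ m * (B * N) :=
    le_mul_of_one_le_left (by positivity) (one_le_pow₀ (by norm_num))
  have base {m : ℕ} {a g : Plane → ℝ} (ha : CoeffBound U m a B) (hg : SobolevBound U m g N) :
      MemLp (fun x => a x * g x) 2 (volume.restrict U) ∧
        nrm (volume.restrict U) (fun x => a x * g x) ≤ 2 ^ m * (B * N) := by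
    have hae : ∀ᵐ x ∂(volume.restrict U), ‖a x * g x‖ ≤ B * ‖g x‖ := by
      filter_upwards [ae_restrict_mem hUo.measurableSet] with x hx
      rw [norm_mul]
      exact mul_le_mul_of_nonneg_right (ha.abs_le x hx) (norm_nonneg _)
    refine ⟨MemLp.of_le_mul hg.memLp
      ((ha.continuousOn.aestronglyMeasurable hUo.measurableSet).mul hg.memLp.1) hae, ?_⟩
    exact (nrm_mono hg.memLp hB hae).trans
      ((mul_le_mul_of_nonneg_left hg.nrm_le hB).trans (hle m))
  induction m generalizing a g with
  | zero => exact base ha hg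
  | succ m ih =>
    refine ⟨base ha hg, fun i => ?_⟩
    obtain ⟨a', h1, h2⟩ := ha.2 i
    obtain ⟨g', h3, h4⟩ := hg.2 i
    refine ⟨_, h3.mul_coeff hUo hU hUb ha.1.1 ha.1.2 h1 h2.abs_le hg.memLp h4.memLp, ?_⟩
    have := (ih h2 hg.of_succ).add hUb (ih ha.of_succ h4)
    exact this.mono (by rw [pow_succ]; linarith)

/-- The entries of a smooth field of operators. -/
lemma of_iteratedFDeriv (hUo : IsOpen U) {m : ℕ} {E : Type} [NormedAddCommGroup E]
    [NormedSpace ℝ E] {F : Plane → E} {B : ℝ} (hF : ContDiffOn ℝ m F U)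
    (hB : ∀ j ≤ m, ∀ x ∈ U, ‖iteratedFDeriv ℝ j F x‖ ≤ B) (ℓ : E →L[ℝ] ℝ) (hℓ : ‖ℓ‖ ≤ 1) :
    CoeffBound U m (fun x => ℓ (F x)) B := by
  have hle {E : Type} [NormedAddCommGroup E] [NormedSpace ℝ E] (ℓ : E →L[ℝ] ℝ) (hℓ : ‖ℓ‖ ≤ 1)
      (v : E) (hv : ‖v‖ ≤ B) : |ℓ v| ≤ B :=
    (ℓ.le_of_opNorm_le hℓ v).trans (by rwa [one_mul])
  induction m generalizing E with
  | zero =>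
    refine ⟨ℓ.continuous.comp_continuousOn hF.continuousOn, fun x hx => hle ℓ hℓ _ ?_⟩
    simpa using hB 0 le_rfl x hx
  | succ m ih =>
    refine ⟨⟨ℓ.contDiff.comp_contDiffOn (hF.of_le (by simp)), fun x hx => hle ℓ hℓ _ ?_⟩,
      fun i => ?_⟩
    · simpa using hB 0 (Nat.zero_le _) x hx
    refine ⟨fun x => (ℓ.comp (ContinuousLinearMap.apply ℝ E (EuclideanSpace.single i 1)))
      (fderiv ℝ F x), fun x hx => ?_, ?_⟩
    · have hd : DifferentiableAt ℝ F x :=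
        (hF.contDiffAt (hUo.mem_nhds hx)).differentiableAt (by simp)
      change _ = fderiv ℝ (ℓ ∘ F) x _
      rw [fderiv_comp x ℓ.differentiableAt hd, ℓ.fderiv]
      rfl
    · refine ih (hF.fderiv_of_isOpen hUo (by simp)) (fun j hj x hx => ?_) _ ?_
      · rw [norm_iteratedFDeriv_fderiv]
        exact hB (j + 1) (by omega) x hx
      · refine ContinuousLinearMap.opNorm_le_bound _ zero_le_one fun L => ?_
        have h1 := ℓ.le_of_opNorm_le hℓ (L (EuclideanSpace.single i 1))
        have h2 := L.le_opNorm (EuclideanSpace.single i (1 : ℝ))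
        simp only [PiLp.norm_single, norm_one, mul_one] at h2
        simp only [ContinuousLinearMap.comp_apply, ContinuousLinearMap.apply_apply]
        linarith

end CoeffBound

/-! ### Taylor polynomials -/

lemma multiD_add {f g : Plane → ℝ} (hf : ContDiff ℝ ∞ f) (hg : ContDiff ℝ ∞ g) (β : ℕ × ℕ) :
    multiD β (fun x => f x + g x) = fun x => multiD β f x + multiD β g x := by
  have step (i : Fin 2) (γ : ℕ × ℕ) : partialD i (fun x => multiD γ f x + multiD γ g x)
      = fun x => partialD i (multiD γ f) x + partialD i (multiD γ g) x := by
    ext x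
    exact partialD_add ((contDiff_multiD hf γ).differentiable (by simp) x)
      ((contDiff_multiD hg γ).differentiable (by simp) x)
  induction β using multiIndex_induction with
  | h0 => rfl
  | h1 b ih => rw [multiD_succ_snd, ih, step, multiD_succ_snd, multiD_succ_snd]
  | h2 a b ih => rw [multiD_succ_fst, ih, step, multiD_succ_fst, multiD_succ_fst]

lemma multiD_const_mul {f : Plane → ℝ} (hf : ContDiff ℝ ∞ f) (c : ℝ) (β : ℕ × ℕ) :
    multiD β (fun x => c * f x) = fun x => c * multiD β f x := by
  induction β using multiIndex_induction with
  | h0 => rfl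
  | h1 b ih => rw [multiD_succ_snd, ih, partialD_const_mul (contDiff_multiD hf _), multiD_succ_snd]
  | h2 a b ih => rw [multiD_succ_fst, ih, partialD_const_mul (contDiff_multiD hf _), multiD_succ_fst]

lemma multiD_sub {f g : Plane → ℝ} (hf : ContDiff ℝ ∞ f) (hg : ContDiff ℝ ∞ g) (β : ℕ × ℕ) :
    multiD β (fun x => f x - g x) = fun x => multiD β f x - multiD β g x := by
  have h1 := multiD_add hf ((contDiff_const (c := (-1 : ℝ))).mul hg) β
  rw [multiD_const_mul hg] at h1
  simpa only [neg_one_mul, ← sub_eq_add_neg] using h1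

/-- The polynomial `(x₀ - y₀)ᵃ / a! · (x₁ - y₁)ᵇ / b!`. -/
noncomputable def taylorMon (y : Plane) (a b : ℕ) (x : Plane) : ℝ :=
  ((x 0 - y 0) ^ a / a.factorial) * ((x 1 - y 1) ^ b / b.factorial)

lemma taylorMon_mem (y : Plane) (a b : ℕ) : taylorMon y a b ∈ polyFun (a + b) := by
  have hl (i : Fin 2) : (fun x : Plane => x i - y i) ∈ polyFun 1 :=
    (polyFun 1).sub_mem (polyFun_coord i) (polyFun_const 1 (y i))
  have h1 (i : Fin 2) (n : ℕ) : (fun x : Plane => (x i - y i) ^ n / n.factorial) ∈ polyFun n := by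
    have := (polyFun n).smul_mem ((n.factorial : ℝ)⁻¹) (polyFun_pow (hl i) n)
    convert this using 1
    ext x
    simp [div_eq_inv_mul]
  exact polyFun_mul (h1 0 a) (h1 1 b)

lemma hasDerivAt_pow_div_factorial (n : ℕ) (t : ℝ) :
    HasDerivAt (fun s : ℝ => s ^ (n + 1) / (n + 1).factorial) (t ^ n / n.factorial) t := by
  have h1 := (hasDerivAt_pow (n + 1) t).div_const ((n + 1).factorial : ℝ)
  have e : ((n + 1 : ℕ) : ℝ) * t ^ (n + 1 - 1) / (n + 1).factorial = t ^ n / n.factorial := by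
    rw [Nat.factorial_succ]
    have : (n.factorial : ℝ) ≠ 0 := by positivity
    push_cast
    field_simp
  rwa [e] at h1

lemma hasDerivAt_pow_div_factorial' (n : ℕ) (t : ℝ) :
    HasDerivAt (fun s : ℝ => s ^ n / n.factorial)
      (if n = 0 then 0 else t ^ (n - 1) / (n - 1).factorial) t := by
  rcases n with _ | n
  · simpa using hasDerivAt_const t (1 : ℝ)
  · simpa using hasDerivAt_pow_div_factorial n t

lemma partialD_taylorMon (y : Plane) (a b : ℕ) :
    partialD 0 (taylorMon y a b) = (if a = 0 then 0 else taylorMon y (a - 1) b) ∧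
      partialD 1 (taylorMon y a b) = (if b = 0 then 0 else taylorMon y a (b - 1)) := by
  have hc (i : Fin 2) (x : Plane) := (hasFDerivAt_coord i x).sub_const (y i)
  have key (x : Plane) := ((hasDerivAt_pow_div_factorial' a (x 0 - y 0)).comp_hasFDerivAt x
    (hc 0 x)).mul ((hasDerivAt_pow_div_factorial' b (x 1 - y 1)).comp_hasFDerivAt x (hc 1 x))
  constructor
  · ext x
    have e := congrArg (fun L => L (EuclideanSpace.single 0 1)) (key x).fderiv
    change partialD 0 (taylorMon y a b) x = _ at e
    rw [e]
    split_ifs with h <;> simp [taylorMon, mul_comm]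
  · ext x
    have e := congrArg (fun L => L (EuclideanSpace.single 1 1)) (key x).fderiv
    change partialD 1 (taylorMon y a b) x = _ at e
    rw [e]
    split_ifs with h <;> simp [taylorMon, mul_comm]

lemma multiD_taylorMon (y : Plane) (a b : ℕ) (β : ℕ × ℕ) :
    multiD β (taylorMon y a b)
      = if β.1 ≤ a ∧ β.2 ≤ b then taylorMon y (a - β.1) (b - β.2) else 0 := by
  induction β using multiIndex_induction with
  | h0 => simp [multiD_zero]
  | h1 j ih =>
    rw [multiD_succ_snd, ih]
    by_cases hj : j ≤ b
    · rw [if_pos ⟨Nat.zero_le _, hj⟩, (partialD_taylorMon y _ _).2]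
      by_cases hj' : j + 1 ≤ b
      · rw [if_neg (by simp only; omega), if_pos ⟨Nat.zero_le _, hj'⟩, Nat.sub_sub]
      · rw [if_pos (by simp only; omega), if_neg (by simp only; omega)]
    · rw [if_neg (by simp only; omega), if_neg (by simp only; omega), partialD_zero_fun]
  | h2 i j ih =>
    rw [multiD_succ_fst, ih]
    by_cases hj : i ≤ a ∧ j ≤ b
    · rw [if_pos hj, (partialD_taylorMon y _ _).1]
      by_cases hj' : i + 1 ≤ a
      · rw [if_neg (by simp only; omega), if_pos ⟨hj', hj.2⟩, Nat.sub_sub]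
      · rw [if_pos (by simp only; omega), if_neg (by simp only; omega)]
    · rw [if_neg hj, if_neg (by simp only; omega), partialD_zero_fun]

lemma taylorMon_self (y : Plane) (a b : ℕ) :
    taylorMon y a b y = if a = 0 ∧ b = 0 then 1 else 0 := by
  unfold taylorMon
  rcases a with _ | a <;> rcases b with _ | b <;> simp

/-- There is a polynomial of degree `k` with prescribed derivatives of order at most `k` at a
given point. -/
lemma exists_polyFun_jet (k : ℕ) (y : Plane) (c : ℕ × ℕ → ℝ) :
    ∃ P ∈ polyFun k, (∀ β : ℕ × ℕ, β.1 + β.2 ≤ k → multiD β P y = c β) ∧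
      ∀ β : ℕ × ℕ, β.1 + β.2 = k + 1 → multiD β P = 0 := by
  have key (s : Finset (ℕ × ℕ)) (hs : ∀ β ∈ s, β.1 + β.2 ≤ k) :
      ∃ P ∈ polyFun k, (∀ β, multiD β P y = if β ∈ s then c β else 0) ∧
        ∀ β : ℕ × ℕ, β.1 + β.2 = k + 1 → multiD β P = 0 := by
    induction s using Finset.induction_on with
    | empty =>
      have h0 (β : ℕ × ℕ) : multiD β (0 : Plane → ℝ) = 0 := by
        have := multiD_const_mul (f := 0) contDiff_const 0 β
        simpa [← Pi.zero_def] using this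
      exact ⟨0, (polyFun k).zero_mem, fun β => by simp [h0], fun β _ => h0 β⟩
    | insert γ s hγ ih =>
      obtain ⟨P, hP, h1, h2⟩ := ih fun β hβ => hs β (Finset.mem_insert_of_mem hβ)
      have hm : taylorMon y γ.1 γ.2 ∈ polyFun k :=
        polyFun_mono (hs γ (Finset.mem_insert_self _ _)) (taylorMon_mem y _ _)
      have hms : ContDiff ℝ ∞ (taylorMon y γ.1 γ.2) := polyFun_contDiff hm
      have hsum (β : ℕ × ℕ) : multiD β (fun x => P x + c γ * taylorMon y γ.1 γ.2 x)
          = fun x => multiD β P x + c γ * multiD β (taylorMon y γ.1 γ.2) x := by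
        rw [multiD_add (polyFun_contDiff hP) (contDiff_const.mul hms), multiD_const_mul hms]
      refine ⟨fun x => P x + c γ * taylorMon y γ.1 γ.2 x,
        (polyFun k).add_mem hP ((polyFun k).smul_mem (c γ) hm), fun β => ?_, fun β hβ => ?_⟩
      · simp only [hsum, h1, multiD_taylorMon]
        by_cases hβγ : β = γ
        · subst hβγ
          simp [hγ, taylorMon_self]
        · have hne : ¬(β.1 = γ.1 ∧ β.2 = γ.2) := fun h => hβγ (Prod.ext h.1 h.2)
          have : (if β.1 ≤ γ.1 ∧ β.2 ≤ γ.2 then taylorMon y (γ.1 - β.1) (γ.2 - β.2)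
              else 0) y = 0 := by
            split_ifs with h
            · rw [taylorMon_self, if_neg (by omega)]
            · rfl
          rw [this]
          simp [hβγ]
      · have := hs γ (Finset.mem_insert_self _ _)
        rw [hsum, h2 β hβ, multiD_taylorMon, if_neg (by omega)]
        simp [Pi.zero_def]
  let s := ((Finset.range (k + 1)) ×ˢ (Finset.range (k + 1))).filter fun p => p.1 + p.2 ≤ k
  obtain ⟨P, hP, h1, h2⟩ := key s fun β hβ => (Finset.mem_filter.1 hβ).2
  refine ⟨P, hP, fun β hβ => ?_, h2⟩
  rw [h1, if_pos]
  simp only [s, Finset.mem_filter, Finset.mem_product, Finset.mem_range]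
  omega

/-! ### Polynomial approximation in Sobolev norms -/

/-- The sum of the absolute values of the derivatives of order `m`. -/
noncomputable def derivSum (m : ℕ) (g : Plane → ℝ) (x : Plane) : ℝ :=
  ∑ β ∈ Finset.HasAntidiagonal.antidiagonal m, |multiD β g x|

lemma derivSum_nonneg (m : ℕ) (g : Plane → ℝ) (x : Plane) : 0 ≤ derivSum m g x :=
  Finset.sum_nonneg fun _ _ => abs_nonneg _

lemma continuous_derivSum (m : ℕ) {g : Plane → ℝ} (hg : ContDiff ℝ ∞ g) :
    Continuous (derivSum m g) := by
  unfold derivSum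
  have (β : ℕ × ℕ) := (contDiff_multiD hg β).continuous
  fun_prop

/-- The mean value inequality along a segment that starts at a zero of the function. -/
lemma abs_le_integral_segment {F : Plane → ℝ} (hF : ContDiff ℝ ∞ F) {x y : Plane} (hy : F y = 0)
    {D : ℝ} (hD : ‖x - y‖ ≤ D) {s : ℝ} (hs : s ∈ Set.Icc (0 : ℝ) 1) :
    |F (y + s • (x - y))| ≤ D * ∫ σ in (0 : ℝ)..1,
      (|partialD 0 F (y + σ • (x - y))| + |partialD 1 F (y + σ • (x - y))|) := by
  have hD0 : 0 ≤ D := (norm_nonneg _).trans hD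
  have hc (i : Fin 2) := (contDiff_partialD hF i).continuous
  have hline (σ : ℝ) : HasDerivAt (fun σ : ℝ => y + σ • (x - y)) (x - y) σ := by
    simpa using ((hasDerivAt_id σ).smul_const (x - y)).const_add y
  have hder (σ : ℝ) : HasDerivAt (fun σ : ℝ => F (y + σ • (x - y)))
      ((x - y) 0 * partialD 0 F (y + σ • (x - y)) + (x - y) 1 * partialD 1 F (y + σ • (x - y)))
      σ := by
    have := ((hF.differentiable (by simp) (y + σ • (x - y))).hasFDerivAt).comp_hasDerivAt σ
      (hline σ)
    rwa [fderiv_eq_partialD] at this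
  have hcont : Continuous fun σ : ℝ => (x - y) 0 * partialD 0 F (y + σ • (x - y))
      + (x - y) 1 * partialD 1 F (y + σ • (x - y)) := by fun_prop
  have hftc := intervalIntegral.integral_eq_sub_of_hasDerivAt (fun σ _ => hder σ)
    (hcont.intervalIntegrable 0 s)
  simp only [zero_smul, add_zero, hy, sub_zero] at hftc
  rw [← hftc]
  have hcoord (i : Fin 2) : |(x - y) i| ≤ D := (PiLp.norm_apply_le (x - y) i).trans hD
  have hc2 : Continuous fun σ : ℝ => D * (|partialD 0 F (y + σ • (x - y))|
      + |partialD 1 F (y + σ • (x - y))|) := by fun_prop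
  calc |∫ σ in (0 : ℝ)..s, _|
      ≤ ∫ σ in (0 : ℝ)..s, |(x - y) 0 * partialD 0 F (y + σ • (x - y))
        + (x - y) 1 * partialD 1 F (y + σ • (x - y))| :=
        intervalIntegral.abs_integral_le_integral_abs hs.1
    _ ≤ ∫ σ in (0 : ℝ)..s, D * (|partialD 0 F (y + σ • (x - y))|
        + |partialD 1 F (y + σ • (x - y))|) := by
        refine intervalIntegral.integral_mono hs.1 (hcont.abs.intervalIntegrable _ _)
          (hc2.intervalIntegrable _ _) fun σ => ?_
        refine (abs_add_le _ _).trans ?_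
        rw [abs_mul, abs_mul, mul_add]
        exact add_le_add (mul_le_mul_of_nonneg_right (hcoord 0) (abs_nonneg _))
          (mul_le_mul_of_nonneg_right (hcoord 1) (abs_nonneg _))
    _ ≤ ∫ σ in (0 : ℝ)..1, D * (|partialD 0 F (y + σ • (x - y))|
        + |partialD 1 F (y + σ • (x - y))|) :=
        intervalIntegral.integral_mono_interval le_rfl hs.1 hs.2
          (ae_of_all _ fun σ => by positivity) (hc2.intervalIntegrable _ _)
    _ = _ := by rw [intervalIntegral.integral_const_mul]

/-- If all derivatives of order at most `k` of `g` vanish at `y`, then `g` and its derivatives are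
controlled along segments from `y` by the derivatives of order `k + 1`. -/
lemma abs_multiD_le_integral_segment {g : Plane → ℝ} (hg : ContDiff ℝ ∞ g) {k : ℕ} {x y : Plane}
    (hy : ∀ β : ℕ × ℕ, β.1 + β.2 ≤ k → multiD β g y = 0) {D : ℝ} (hD : ‖x - y‖ ≤ D) (j : ℕ)
    {β : ℕ × ℕ} (hβ : β.1 + β.2 + j = k) {s : ℝ} (hs : s ∈ Set.Icc (0 : ℝ) 1) :
    |multiD β g (y + s • (x - y))| ≤ (2 * D) ^ (j + 1) * ∫ σ in (0 : ℝ)..1,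
      derivSum (k + 1) g (y + σ • (x - y)) := by
  have hD0 : 0 ≤ D := (norm_nonneg _).trans hD
  have hc (γ : ℕ × ℕ) := (contDiff_multiD hg γ).continuous
  have hline : Continuous fun σ : ℝ => y + σ • (x - y) := by fun_prop
  have hS := continuous_derivSum (k + 1) hg
  have hS0 : 0 ≤ ∫ σ in (0 : ℝ)..1, derivSum (k + 1) g (y + σ • (x - y)) :=
    intervalIntegral.integral_nonneg zero_le_one fun σ _ => derivSum_nonneg _ _ _
  induction j generalizing β s with
  | zero =>
    have h1 := abs_le_integral_segment (contDiff_multiD hg β) (hy β (by omega)) hD hs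
    rw [partialD_multiD hg, partialD_multiD hg] at h1
    refine h1.trans ?_
    have h2 : ∫ σ in (0 : ℝ)..1, (|multiD (β + dirIndex 0) g (y + σ • (x - y))|
        + |multiD (β + dirIndex 1) g (y + σ • (x - y))|)
        ≤ ∫ σ in (0 : ℝ)..1, derivSum (k + 1) g (y + σ • (x - y)) := by
      refine intervalIntegral.integral_mono zero_le_one
        (Continuous.intervalIntegrable (by fun_prop) _ _)
        ((hS.comp hline).intervalIntegrable _ _) fun σ => ?_
      have hne : β + dirIndex 0 ≠ β + dirIndex 1 := by
        simp [dirIndex]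
      refine (Finset.sum_pair (f := fun γ => |multiD γ g (y + σ • (x - y))|) hne).symm.le.trans ?_
      refine Finset.sum_le_sum_of_subset_of_nonneg ?_ fun _ _ _ => abs_nonneg _
      intro γ hγ
      simp only [Finset.mem_insert, Finset.mem_singleton] at hγ
      rw [Finset.HasAntidiagonal.mem_antidiagonal]
      rcases hγ with rfl | rfl <;> simp [dirIndex] <;> omega
    have h3 := mul_le_mul_of_nonneg_left h2 hD0
    refine h3.trans ?_
    rw [zero_add, pow_one]
    nlinarith
  | succ j ih =>
    have h1 := abs_le_integral_segment (contDiff_multiD hg β) (hy β (by omega)) hD hs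
    rw [partialD_multiD hg, partialD_multiD hg] at h1
    refine h1.trans ?_
    set I := ∫ σ in (0 : ℝ)..1, derivSum (k + 1) g (y + σ • (x - y)) with hI
    have h2 : ∫ σ in (0 : ℝ)..1, (|multiD (β + dirIndex 0) g (y + σ • (x - y))|
        + |multiD (β + dirIndex 1) g (y + σ • (x - y))|)
        ≤ ∫ σ in (0 : ℝ)..1, 2 * ((2 * D) ^ (j + 1) * I) := by
      refine intervalIntegral.integral_mono_on zero_le_one
        (Continuous.intervalIntegrable (by fun_prop) _ _)
        (by simp) fun σ hσ => ?_
      have e0 := ih (β := β + dirIndex 0) (by simp [dirIndex]; omega) hσ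
      have e1 := ih (β := β + dirIndex 1) (by simp [dirIndex]; omega) hσ
      linarith
    rw [intervalIntegral.integral_const, sub_zero, one_smul] at h2
    refine (mul_le_mul_of_nonneg_left h2 hD0).trans (le_of_eq ?_)
    rw [pow_succ _ (j + 1)]
    ring

lemma lintegral_comp_add_smul (f : Plane → ENNReal) (b : Plane) {s : ℝ} (hs : s ≠ 0) :
    ∫⁻ x, f (b + s • x) = ENNReal.ofReal ((s ^ 2)⁻¹) * ∫⁻ x, f x := by
  have e : MeasurableEmbedding fun x : Plane => b + s • x :=
    ((Homeomorph.smulOfNeZero s hs).trans (Homeomorph.addLeft b)).measurableEmbedding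
  have hmap : Measure.map (fun x : Plane => b + s • x) volume
      = ENNReal.ofReal ((s ^ 2)⁻¹) • (volume : Measure Plane) := by
    have h1 := Measure.map_addHaar_smul (volume : Measure Plane) hs
    rw [show (fun x : Plane => b + s • x) = (fun x => b + x) ∘ (fun x => s • x) from rfl,
      ← Measure.map_map (measurable_const_add b) (measurable_const_smul s), h1,
      Measure.map_smul, map_add_left_eq_self]
    simp
  rw [← e.lintegral_map, hmap, lintegral_smul_measure, smul_eq_mul]

/-- Some point of a convex set is a good centre: the mean of a function over the segments from it
to the points of the set is controlled by the integral of the function. -/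
lemma exists_center_lintegral_segment_le {U : Set Plane} (hUo : IsOpen U) (hU : Convex ℝ U)
    (hUb : Bornology.IsBounded U) (hUn : U.Nonempty) {f : Plane → ENNReal} (hf : Measurable f) :
    ∃ y ∈ U, ∫⁻ x in U, ∫⁻ s in Set.Icc (0 : ℝ) 1, f (y + s • (x - y))
      ≤ 4 * ∫⁻ x in U, f x := by
  have hUm := hUo.measurableSet
  have hv0 : volume U ≠ 0 := (hUo.measure_pos volume hUn).ne'
  have hvt : volume U ≠ ⊤ := hUb.measure_lt_top.ne
  have hmeas3 : Measurable fun p : (Plane × Plane) × ℝ => f (p.1.1 + p.2 • (p.1.2 - p.1.1)) :=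
    hf.comp (by fun_prop)
  have hmeas2 : Measurable fun p : Plane × Plane =>
      ∫⁻ s in Set.Icc (0 : ℝ) 1, f (p.1 + s • (p.2 - p.1)) := hmeas3.lintegral_prod_right'
  have hmeas1 : Measurable fun y : Plane =>
      ∫⁻ x in U, ∫⁻ s in Set.Icc (0 : ℝ) 1, f (y + s • (x - y)) := hmeas2.lintegral_prod_right'
  obtain ⟨y, hy, hle⟩ := exists_le_setLAverage hv0 hvt hmeas1.aemeasurable
  refine ⟨y, hy, hle.trans ?_⟩
  rw [setLAverage_eq, ENNReal.div_le_iff hv0 hvt]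
  -- for `s ≥ 1/2` (`s ≤ 1/2`) the map `x ↦ y + s (x - y)` (`y ↦ y + s (x - y)`) shrinks areas by
  -- a factor of at most four
  have inner (z : Plane) (hz : z ∈ U) {s : ℝ} (hs1 : 1 / 2 ≤ s) (hs2 : s ≤ 1) :
      ∫⁻ x in U, f ((1 - s) • z + s • x) ≤ 4 * ∫⁻ x in U, f x := by
    calc ∫⁻ x in U, f ((1 - s) • z + s • x)
        = ∫⁻ x in U, U.indicator f ((1 - s) • z + s • x) := by
          refine setLIntegral_congr_fun hUm fun x hx => ?_
          have : (1 - s) • z + s • x ∈ U := hU hz hx (by linarith) (by linarith) (by ring)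
          simp only [Set.indicator_of_mem this]
      _ ≤ ∫⁻ x, U.indicator f ((1 - s) • z + s • x) := setLIntegral_le_lintegral _ _
      _ = ENNReal.ofReal ((s ^ 2)⁻¹) * ∫⁻ x in U, f x := by
          rw [lintegral_comp_add_smul _ _ (by linarith), lintegral_indicator hUm]
      _ ≤ 4 * ∫⁻ x in U, f x := by
          gcongr
          rw [show (4 : ENNReal) = ENNReal.ofReal 4 by simp]
          refine ENNReal.ofReal_le_ofReal ?_
          rw [inv_le_comm₀ (by positivity) (by norm_num)]
          nlinarith
  have hswap1 (y : Plane) : ∫⁻ x in U, ∫⁻ s in Set.Icc (0 : ℝ) 1, f (y + s • (x - y))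
      = ∫⁻ s in Set.Icc (0 : ℝ) 1, ∫⁻ x in U, f (y + s • (x - y)) := by
    refine lintegral_lintegral_swap (Measurable.aemeasurable ?_)
    exact hf.comp (by fun_prop)
  simp only [hswap1]
  rw [lintegral_lintegral_swap]
  swap
  · refine (Measurable.lintegral_prod_right' (f := fun p : (Plane × ℝ) × Plane =>
      f (p.1.1 + p.1.2 • (p.2 - p.1.1))) (hf.comp (by fun_prop))).aemeasurable
  have hs (s : ℝ) (hs : s ∈ Set.Icc (0 : ℝ) 1) :
      ∫⁻ y in U, ∫⁻ x in U, f (y + s • (x - y)) ≤ 4 * (∫⁻ x in U, f x) * volume U := by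
    have e (x y : Plane) : y + s • (x - y) = (1 - s) • y + s • x := by module
    have e' (x y : Plane) : y + s • (x - y) = (1 - (1 - s)) • x + (1 - s) • y := by module
    rcases le_total (1 / 2) s with h | h
    · simp only [e]
      refine (setLIntegral_mono' hUm fun y hy => inner y hy h hs.2).trans ?_
      rw [setLIntegral_const]
    · rw [lintegral_lintegral_swap]
      swap
      · exact (hf.comp (by fun_prop)).aemeasurable
      simp only [e']
      refine (setLIntegral_mono' hUm fun y hy => inner y hy (by linarith) (by linarith [hs.1])).trans
        ?_
      rw [setLIntegral_const]
  refine (setLIntegral_mono' measurableSet_Icc hs).trans ?_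
  rw [setLIntegral_const]
  simp

/-- Approximation of a smooth function by Taylor polynomials at a good centre. -/
lemma exists_polyFun_approx_smooth {U : Set Plane} (hUo : IsOpen U) (hU : Convex ℝ U)
    (hUb : Bornology.IsBounded U) (hUn : U.Nonempty) {D : ℝ}
    (hD : ∀ x ∈ U, ∀ y ∈ U, ‖x - y‖ ≤ D) (k : ℕ) {q : Plane → ℝ} (hq : ContDiff ℝ ∞ q) :
    ∃ P ∈ polyFun k, ∀ β : ℕ × ℕ, β.1 + β.2 ≤ k + 1 →
      nrm (volume.restrict U) (fun x => multiD β q x - multiD β P x)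
        ≤ 2 * (2 * D) ^ (k + 1 - (β.1 + β.2)) * nrm (volume.restrict U) (derivSum (k + 1) q) := by
  have : IsFiniteMeasure (volume.restrict U) := ⟨by simpa using hUb.measure_lt_top⟩
  have hD0 : 0 ≤ D := by
    obtain ⟨x, hx⟩ := hUn
    exact (norm_nonneg _).trans (hD x hx x hx)
  have hmem (f : Plane → ℝ) (hf : Continuous f) : MemLp f 2 (volume.restrict U) :=
    memLp_of_continuous hf hUb.isCompact_closure
      (by filter_upwards [ae_restrict_mem hUo.measurableSet] with x hx using subset_closure hx)
  have hS := continuous_derivSum (k + 1) hq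
  obtain ⟨y, hy, hle⟩ := exists_center_lintegral_segment_le hUo hU hUb hUn
    (f := fun x => ENNReal.ofReal (derivSum (k + 1) q x ^ 2)) (by fun_prop)
  obtain ⟨P, hP, hjet, hvan⟩ := exists_polyFun_jet k y fun β => multiD β q y
  have hPs : ContDiff ℝ ∞ P := polyFun_contDiff hP
  refine ⟨P, hP, fun β hβ => ?_⟩
  have hgs : ContDiff ℝ ∞ fun x => q x - P x := hq.sub hPs
  have hsub := multiD_sub hq hPs
  have hsum : derivSum (k + 1) (fun x => q x - P x) = derivSum (k + 1) q := by
    ext x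
    refine Finset.sum_congr rfl fun γ hγ => ?_
    rw [hsub, hvan γ (Finset.HasAntidiagonal.mem_antidiagonal.1 hγ)]
    simp
  have hn0 := nrm_nonneg (μ := volume.restrict U) (derivSum (k + 1) q)
  rcases hβ.lt_or_eq with hβ | hβ
  swap
  · have h1 : nrm (volume.restrict U) (fun x => multiD β q x - multiD β P x)
        ≤ 1 * nrm (volume.restrict U) (derivSum (k + 1) q) := by
      refine nrm_mono (hmem _ hS) zero_le_one (ae_of_all _ fun x => ?_)
      rw [hvan β hβ, one_mul, Real.norm_of_nonneg (derivSum_nonneg _ _ _)]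
      simp only [Pi.zero_apply, sub_zero, Real.norm_eq_abs]
      exact Finset.single_le_sum (f := fun γ => |multiD γ q x|) (fun _ _ => abs_nonneg _)
        (Finset.HasAntidiagonal.mem_antidiagonal.2 hβ)
    rw [hβ, Nat.sub_self, pow_zero]
    linarith
  -- for the lower orders, Taylor's formula along the segments from the centre `y`
  set I : Plane → ℝ := fun x => ∫ σ in (0 : ℝ)..1, derivSum (k + 1) q (y + σ • (x - y)) with hI
  have hIc : Continuous I :=
    intervalIntegral.continuous_parametric_intervalIntegral_of_continuous'
      (f := fun x σ => derivSum (k + 1) q (y + σ • (x - y))) (by fun_prop) 0 1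
  have hI0 (x : Plane) : 0 ≤ I x :=
    intervalIntegral.integral_nonneg zero_le_one fun _ _ => derivSum_nonneg _ _ _
  have hpt (x : Plane) (hx : x ∈ U) :
      |multiD β q x - multiD β P x| ≤ (2 * D) ^ (k + 1 - (β.1 + β.2)) * I x := by
    have h1 := abs_multiD_le_integral_segment hgs (k := k) (x := x) (y := y)
      (fun γ hγ => by rw [hsub]; simp [hjet γ hγ]) (hD x hx y hy) (k - (β.1 + β.2)) (β := β)
      (by omega) (s := 1) (by simp)
    rw [hsub, hsum, show k - (β.1 + β.2) + 1 = k + 1 - (β.1 + β.2) by omega] at h1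
    simpa using h1
  -- Cauchy–Schwarz on each segment, then the choice of the centre
  have hIsq (x : Plane) : I x ^ 2 ≤ ∫ σ in Set.Icc (0 : ℝ) 1,
      derivSum (k + 1) q (y + σ • (x - y)) ^ 2 := by
    have hc : Continuous fun σ : ℝ => derivSum (k + 1) q (y + σ • (x - y)) := by fun_prop
    have hm : MemLp (fun σ : ℝ => derivSum (k + 1) q (y + σ • (x - y))) 2
        (volume.restrict (Set.Icc (0 : ℝ) 1)) :=
      memLp_of_continuous hc isCompact_Icc (ae_restrict_mem measurableSet_Icc)
    have h1 := abs_integral_mul_le hm (memLp_const (1 : ℝ))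
    have h2 : nrm (volume.restrict (Set.Icc (0 : ℝ) 1)) (fun _ => (1 : ℝ)) = 1 := by
      rw [nrm_eq_sqrt (memLp_const (1 : ℝ))]
      simp
    rw [h2, mul_one] at h1
    have h3 : I x = ∫ σ in Set.Icc (0 : ℝ) 1, derivSum (k + 1) q (y + σ • (x - y)) := by
      rw [integral_Icc_eq_integral_Ioc, ← intervalIntegral.integral_of_le zero_le_one]
    simp only [mul_one] at h1
    rw [← nrm_sq_real hm, ← h3] at *
    exact pow_le_pow_left₀ (hI0 x) ((le_abs_self _).trans h1) 2
  have hIn : nrm (volume.restrict U) I ≤ 2 * nrm (volume.restrict U) (derivSum (k + 1) q) := by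
    refine le_of_sq_le_sq ?_ (by positivity)
    rw [nrm_sq_real (hmem _ hIc), mul_pow, nrm_sq_real (hmem _ hS)]
    have hb : 0 ≤ (2 : ℝ) ^ 2 * ∫ x in U, derivSum (k + 1) q x ^ 2 :=
      mul_nonneg (by norm_num) (integral_nonneg fun x => sq_nonneg _)
    rw [← ENNReal.ofReal_le_ofReal_iff hb,
      ofReal_integral_eq_lintegral_ofReal (hmem _ hIc).integrable_sq (ae_of_all _ fun x => sq_nonneg _),
      ENNReal.ofReal_mul (by norm_num),
      ofReal_integral_eq_lintegral_ofReal (hmem _ hS).integrable_sq (ae_of_all _ fun x => sq_nonneg _),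
      show ENNReal.ofReal (2 ^ 2) = 4 by norm_num]
    refine (lintegral_mono fun x => ?_).trans hle
    refine (ENNReal.ofReal_le_ofReal (hIsq x)).trans (le_of_eq ?_)
    refine ofReal_integral_eq_lintegral_ofReal ?_ (ae_of_all _ fun x => sq_nonneg _)
    exact Continuous.integrableOn_Icc (by fun_prop)
  calc nrm (volume.restrict U) (fun x => multiD β q x - multiD β P x)
      ≤ (2 * D) ^ (k + 1 - (β.1 + β.2)) * nrm (volume.restrict U) I := by
        refine nrm_mono (hmem _ hIc) (by positivity) ?_
        filter_upwards [ae_restrict_mem hUo.measurableSet] with x hx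
        rw [Real.norm_of_nonneg (hI0 x)]
        exact hpt x hx
    _ ≤ _ := by
        have := mul_le_mul_of_nonneg_left hIn
          (show (0 : ℝ) ≤ (2 * D) ^ (k + 1 - (β.1 + β.2)) by positivity)
        linarith

/-- The Bramble–Hilbert estimate on a convex set for a function of class `H^{k+1}` and its
gradient. -/
theorem SobolevBound.exists_polyFun_approx (k : ℕ) : ∃ C : ℝ, 0 < C ∧ ∀ {U : Set Plane},
    IsOpen U → Convex ℝ U → U.Nonempty → ∀ {D : ℝ}, 0 < D →
    (∀ x ∈ U, ∀ y ∈ U, ‖x - y‖ ≤ D) → ∀ {q : Plane → ℝ} {N : ℝ}, 0 < N →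
    SobolevBound U (k + 1) q N → ∀ {G : Fin 2 → Plane → ℝ},
    (∀ i, MemLp (G i) 2 (volume.restrict U)) → (∀ i, IsWeakDeriv U (dirIndex i) q (G i)) →
    ∃ P ∈ polyFun k, nrm (volume.restrict U) (fun x => q x - P x) ≤ C * D ^ (k + 1) * N ∧
      ∀ i, nrm (volume.restrict U) (fun x => G i x - partialD i P x) ≤ C * D ^ k * N := by
  refine ⟨1 + 2 * 2 ^ (k + 1) * ((k + 2) * 2), by positivity, ?_⟩
  intro U hUo hU hUn D hD0 hD q N hN hq G hG hGd
  have hUb : Bornology.IsBounded U :=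
    Metric.isBounded_iff.2 ⟨D, fun x hx y hy => by rw [dist_eq_norm]; exact hD x hx y hy⟩
  have : IsFiniteMeasure (volume.restrict U) := ⟨by simpa using hUb.measure_lt_top⟩
  have hmem (f : Plane → ℝ) (hf : Continuous f) : MemLp f 2 (volume.restrict U) :=
    memLp_of_continuous hf hUb.isCompact_closure
      (by filter_upwards [ae_restrict_mem hUo.measurableSet] with x hx using subset_closure hx)
  obtain ⟨φ, hφ, hlim⟩ := exists_smooth_approx hUo hU hUb hUn hq.memLp
  have hm (β : ℕ × ℕ) (n : ℕ) := hmem _ (contDiff_multiD (hφ n) β).continuous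
  -- one smooth approximation `φ n` whose errors are of the size of the bounds to be proved; its
  -- Taylor polynomial then approximates `q` as well
  have e1 : ∀ᶠ n in atTop, ∀ β ∈ Finset.HasAntidiagonal.antidiagonal (k + 1),
      nrm (volume.restrict U) (multiD β (φ n)) < 2 * N := by
    rw [Finset.eventually_all]
    intro β hβ
    obtain ⟨g', h1, h2, h3⟩ := hq.exists_weakDeriv β
      (Finset.HasAntidiagonal.mem_antidiagonal.1 hβ).le
    exact (tendsto_nrm (hm β) h1 (hlim β g' h1 h3)).eventually_lt_const (by linarith)
  have e2 : ∀ᶠ n in atTop, nrm (volume.restrict U) (fun x => φ n x - q x) < D ^ (k + 1) * N :=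
    (tendsto_nrm_sub (hlim (0, 0) q hq.memLp (isWeakDeriv_zero U q))).eventually_lt_const
      (by positivity)
  have e3 : ∀ᶠ n in atTop, ∀ i : Fin 2,
      nrm (volume.restrict U) (fun x => multiD (dirIndex i) (φ n) x - G i x) < D ^ k * N := by
    rw [Filter.eventually_all]
    intro i
    exact (tendsto_nrm_sub (hlim _ _ (hG i) (hGd i))).eventually_lt_const (by positivity)
  obtain ⟨n, h1, h2, h3⟩ := (e1.and (e2.and e3)).exists
  obtain ⟨P, hP, happ⟩ := exists_polyFun_approx_smooth hUo hU hUb hUn hD k (hφ n)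
  have hPs : ContDiff ℝ ∞ P := polyFun_contDiff hP
  have hS : nrm (volume.restrict U) (derivSum (k + 1) (φ n)) ≤ (k + 2) * (2 * N) := by
    have : ∀ s : Finset (ℕ × ℕ), s ⊆ Finset.HasAntidiagonal.antidiagonal (k + 1) →
        nrm (volume.restrict U) (fun x => ∑ β ∈ s, |multiD β (φ n) x|) ≤ s.card * (2 * N) := by
      intro s
      induction s using Finset.induction_on with
      | empty => simp [nrm]
      | insert γ s hγ ih =>
        intro hs
        simp only [Finset.sum_insert hγ, Finset.card_insert_of_notMem hγ]
        refine (nrm_add_le (hm γ n).abs (memLp_finsetSum _ fun β _ => (hm β n).abs)).trans ?_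
        have a1 := ih ((Finset.subset_insert _ _).trans hs)
        have a2 := h1 γ (hs (Finset.mem_insert_self _ _))
        have a3 : nrm (volume.restrict U) (fun x => |multiD γ (φ n) x|)
            = nrm (volume.restrict U) (multiD γ (φ n)) := by
          unfold nrm
          rw [← eLpNorm_norm (multiD γ (φ n))]
          rfl
        change nrm _ (fun x => |multiD γ (φ n) x|) + nrm _ (fun x => ∑ β ∈ s, |multiD β (φ n) x|) ≤ _
        rw [a3]
        push_cast
        linarith
    have h := this _ subset_rfl
    rw [Finset.Nat.card_antidiagonal] at h
    push_cast at h
    refine h.trans (le_of_eq ?_)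
    ring
  have step (β : ℕ × ℕ) (m : ℕ) (hβ : β.1 + β.2 + m = k + 1) (g : Plane → ℝ)
      (hg : MemLp g 2 (volume.restrict U))
      (hgn : nrm (volume.restrict U) (fun x => multiD β (φ n) x - g x) < D ^ m * N) :
      nrm (volume.restrict U) (fun x => g x - multiD β P x)
        ≤ (1 + 2 * 2 ^ (k + 1) * ((k + 2) * 2)) * D ^ m * N := by
    have b1 := happ β (by omega)
    rw [show k + 1 - (β.1 + β.2) = m by omega] at b1
    have b2 := nrm_sub_le ((hm β n).sub (hmem _ (contDiff_multiD hPs β).continuous))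
      ((hm β n).sub hg)
    simp only [Pi.sub_apply, sub_sub_sub_cancel_left] at b2
    have b3 : 2 * (2 * D) ^ m * nrm (volume.restrict U) (derivSum (k + 1) (φ n))
        ≤ 2 * (2 ^ (k + 1) * D ^ m) * ((k + 2) * (2 * N)) := by
      rw [mul_pow]
      have : (2 : ℝ) ^ m ≤ 2 ^ (k + 1) := pow_le_pow_right₀ (by norm_num) (by omega)
      have h0 := nrm_nonneg (μ := volume.restrict U) (derivSum (k + 1) (φ n))
      gcongr
    refine b2.trans ?_
    have b4 : nrm (volume.restrict U) (multiD β (φ n) - multiD β P)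
      = nrm (volume.restrict U) (fun x => multiD β (φ n) x - multiD β P x) := rfl
    have b5 : nrm (volume.restrict U) (multiD β (φ n) - g)
      = nrm (volume.restrict U) (fun x => multiD β (φ n) x - g x) := rfl
    rw [b4, b5]
    linarith
  refine ⟨P, hP, step (0, 0) (k + 1) (by simp) q hq.memLp h2, fun i => ?_⟩
  have := step (dirIndex i) k (by rw [dirIndex_order]; ring) (G i) (hG i) (h3 i)
  rwa [multiD_dirIndex] at this

/-! ### The discrete gradient -/

/-- The gradient of a differentiable function. -/
noncomputable def grad (p : Plane → ℝ) (x : Plane) : Plane := !₂[partialD 0 p x, partialD 1 p x]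

lemma inner_grad (p : Plane → ℝ) (x v : Plane) :
    ⟪grad p x, v⟫ = partialD 0 p x * v 0 + partialD 1 p x * v 1 := by
  rw [inner_plane]
  rfl

lemma norm_grad_sq (p : Plane → ℝ) (x : Plane) :
    ‖grad p x‖ ^ 2 = partialD 0 p x ^ 2 + partialD 1 p x ^ 2 := normSq_plane _

lemma grad_mem_RT {k : ℕ} {p : Plane → ℝ} (hp : p ∈ polyFun k) : grad p ∈ RT k :=
  RT_of_polyFun (polyFun_partialD hp 0) (polyFun_partialD hp 1)

lemma RT_eq_zero_of_ae {k : ℕ} {q : Plane → Plane} (hq : q ∈ RT k) {U : Set Plane}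
    (hU : IsOpen U) (hUn : U.Nonempty) (h0 : q =ᵐ[volume.restrict U] 0) : q = 0 := by
  have hz : ∀ x ∈ U, q x = 0 := by
    have h1 := Measure.eqOn_of_ae_eq (X := Plane) (Y := Plane) h0
      (RT_continuous hq).continuousOn continuousOn_const
      (by rw [hU.interior_eq]; exact subset_closure)
    exact fun x hx => h1 hx
  obtain ⟨z, hzU⟩ := hUn
  ext x i
  have := polyFun_eq_zero_of_open (RT_comp hq i) hU hzU (fun x hx => by
    simp [hz x hx])
  exact congrFun this x

lemma RT_sub {k : ℕ} {q q' : Plane → Plane} (hq : q ∈ RT k) (hq' : q' ∈ RT k) :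
    (fun x => q x - q' x) ∈ RT k :=
  mem_rtSub.1 ((rtSub k).sub_mem (mem_rtSub.2 hq) (mem_rtSub.2 hq'))

namespace IsTri

variable {t : Finset Plane} (h : IsTri t)
include h

/-- Green's formula for a polynomial and a Raviart–Thomas field. -/
lemma green_RT {k l : ℕ} {p : Plane → ℝ} (hp : p ∈ polyFun l) {q : Plane → Plane} (hq : q ∈ RT k) :
    (∫ x in hull t, ⟪grad p x, q x⟫) + ∫ x in hull t, p x * divergence q x
      = ∑ e ∈ triEdges t, ∫ x, p x * ⟪q x, outwardNormal {t} e⟫ ∂edgeMeasure e := by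
  have hqs (j : Fin 2) : ContDiff ℝ ∞ (fun x => q x j) := polyFun_contDiff (RT_comp hq j)
  have hps : ContDiff ℝ ∞ p := polyFun_contDiff hp
  have hc (j : Fin 2) := (hqs j).continuous
  have hpc := hps.continuous
  have hI {f : Plane → ℝ} (hf : Continuous f) : Integrable f (volume.restrict (hull t)) :=
    hf.continuousOn.integrableOn_compact (isCompact_hull t)
  have hIe (i : t) {f : Plane → ℝ} (hf : Continuous f) :
      Integrable f (edgeMeasure (t.erase (i : Plane))) := by
    have := isFiniteMeasure_edge (h.card_edge i)
    exact (memLp_edge (h.card_edge i) hf).integrable (by norm_num)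
  have hg (j : Fin 2) := h.green_partialD ((hps.mul (hqs j)).of_le (by simp)) j
  have hd (j : Fin 2) (x : Plane) : partialD j (fun x => p x * q x j) x
      = p x * partialD j (fun x => q x j) x + q x j * partialD j p x := by
    rw [partialD_mul (hps.differentiable (by simp) x) ((hqs j).differentiable (by simp) x)]
    ring
  have hcg := (RT_continuous (grad_mem_RT hp))
  have hcd := (polyFun_contDiff (RT_divergence hq) (n := 0)).continuous
  have hcq := RT_continuous hq
  have hcp (j : Fin 2) := (contDiff_partialD hps j).continuous
  have hcqp (j : Fin 2) := (contDiff_partialD (hqs j) j).continuous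
  rw [h.sum_triEdges, ← integral_add (hI (by fun_prop)) (hI (by fun_prop))]
  calc _ = ∫ x in hull t, partialD 0 (fun x => p x * q x 0) x
        + partialD 1 (fun x => p x * q x 1) x := by
        refine integral_congr_ae (ae_of_all _ fun x => ?_)
        simp only [hd, inner_grad, divergence, Fin.sum_univ_two]
        ring
    _ = (∫ x in hull t, partialD 0 (fun x => p x * q x 0) x)
        + ∫ x in hull t, partialD 1 (fun x => p x * q x 1) x := by
        simp only [hd]
        exact integral_add (hI (by fun_prop)) (hI (by fun_prop))
    _ = _ := by
        rw [hg 0, hg 1, ← Finset.sum_add_distrib]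
        refine Finset.sum_congr rfl fun i _ => ?_
        rw [← integral_const_mul, ← integral_const_mul, ← integral_add
          ((hIe i (by fun_prop)).const_mul _) ((hIe i (by fun_prop)).const_mul _)]
        refine integral_congr_ae (ae_of_all _ fun x => ?_)
        simp only [inner_plane]
        ring

/-- The discrete gradient exists: it satisfies its defining relation, here also in the form that
results from integration by parts. -/
lemma discGrad_spec {k : ℕ} {w : WeakFun} (hw0 : w.1 t ∈ polyFun k)
    (hwb : ∀ e ∈ triEdges t, w.2 e ∈ polyFun k) :
    discGrad k w t ∈ RT k ∧ (∀ q ∈ RT k,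
      ∫ x in hull t, ⟪discGrad k w t x, q x⟫ = -(∫ x in hull t, w.1 t x * divergence q x)
        + ∑ e ∈ triEdges t, ∫ x, w.2 e x * ⟪q x, outwardNormal {t} e⟫ ∂edgeMeasure e) ∧
      ∀ q ∈ RT k, ∫ x in hull t, ⟪discGrad k w t x, q x⟫
        = (∫ x in hull t, ⟪grad (w.1 t) x, q x⟫)
        + ∑ e ∈ triEdges t, ∫ x, (w.2 e x - w.1 t x) * ⟪q x, outwardNormal {t} e⟫
          ∂edgeMeasure e := by
  have hIe {e : Finset Plane} (he : e ∈ triEdges t) {f : Plane → ℝ} (hf : Continuous f) :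
      Integrable f (edgeMeasure e) := by
    have hc : e.card = 2 := (Finset.mem_powersetCard.1 he).2
    have := isFiniteMeasure_edge hc
    exact (memLp_edge hc hf).integrable (by norm_num)
  have hI {f : Plane → ℝ} (hf : Continuous f) : Integrable f (volume.restrict (hull t)) :=
    hf.continuousOn.integrableOn_compact (isCompact_hull t)
  have hc0 := (polyFun_contDiff hw0 (n := 0)).continuous
  have hcb (e : Finset Plane) (he : e ∈ triEdges t) :=
    (polyFun_contDiff (hwb e he) (n := 0)).continuous
  have hcg := RT_continuous (grad_mem_RT hw0)
  have hq {q : Plane → Plane} (hq : q ∈ RT k) := RT_continuous hq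
  have key (q : Plane → Plane) (hqR : q ∈ RT k) :
      -(∫ x in hull t, w.1 t x * divergence q x)
        + ∑ e ∈ triEdges t, ∫ x, w.2 e x * ⟪q x, outwardNormal {t} e⟫ ∂edgeMeasure e
      = (∫ x in hull t, ⟪grad (w.1 t) x, q x⟫)
        + ∑ e ∈ triEdges t, ∫ x, (w.2 e x - w.1 t x) * ⟪q x, outwardNormal {t} e⟫
          ∂edgeMeasure e := by
    have hqc := hq hqR
    have e1 : ∑ e ∈ triEdges t, ∫ x, (w.2 e x - w.1 t x) * ⟪q x, outwardNormal {t} e⟫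
          ∂edgeMeasure e
        = (∑ e ∈ triEdges t, ∫ x, w.2 e x * ⟪q x, outwardNormal {t} e⟫ ∂edgeMeasure e)
          - ∑ e ∈ triEdges t, ∫ x, w.1 t x * ⟪q x, outwardNormal {t} e⟫ ∂edgeMeasure e := by
      rw [← Finset.sum_sub_distrib]
      refine Finset.sum_congr rfl fun e he => ?_
      have := hcb e he
      rw [← integral_sub (hIe he (by fun_prop)) (hIe he (by fun_prop))]
      simp only [sub_mul]
    have e2 := h.green_RT hw0 hqR
    rw [e1]
    linarith
  have hex : ∃ G, G ∈ RT k ∧ ∀ q ∈ RT k,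
      ∫ x in hull t, ⟪G x, q x⟫ = -(∫ x in hull t, w.1 t x * divergence q x)
      + ∑ e ∈ triEdges t, ∫ x, w.2 e x * ⟪q x, outwardNormal {t} e⟫ ∂edgeMeasure e := by
    obtain ⟨G, hG, hs⟩ := exists_integral_inner_eq (μ := volume.restrict (hull t)) (rtSub k)
      (fun q hq' => memLp_hull (hq (mem_rtSub.1 hq')) t)
      { toFun := fun q => (∫ x in hull t, ⟪grad (w.1 t) x, (q : Plane → Plane) x⟫)
          + ∑ e ∈ triEdges t, ∫ x, (w.2 e x - w.1 t x)
            * ⟪(q : Plane → Plane) x, outwardNormal {t} e⟫ ∂edgeMeasure e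
        map_add' := fun q q' => by
          have c1 := hq (mem_rtSub.1 q.2)
          have c2 := hq (mem_rtSub.1 q'.2)
          simp only [Submodule.coe_add, Pi.add_apply, inner_add_right, inner_add_left, mul_add]
          rw [integral_add (hI (by fun_prop)) (hI (by fun_prop)), add_add_add_comm,
            ← Finset.sum_add_distrib]
          congr 1
          refine Finset.sum_congr rfl fun e he => ?_
          have := hcb e he
          exact integral_add (hIe he (by fun_prop)) (hIe he (by fun_prop))
        map_smul' := fun c q => by
          simp only [Submodule.coe_smul, Pi.smul_apply, inner_smul_right, inner_smul_left,
            RingHom.id_apply, smul_eq_mul, conj_trivial, mul_add, Finset.mul_sum]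
          rw [integral_const_mul]
          congr 1
          refine Finset.sum_congr rfl fun e he => ?_
          rw [← integral_const_mul]
          congr 1
          ext x
          ring }
      (fun q hq0 => by
        have : (q : Plane → Plane) = 0 :=
          RT_eq_zero_of_ae (mem_rtSub.1 q.2) isOpen_openTri h.openTri_nonempty
            (by rwa [restrict_openTri])
        simp [this])
    refine ⟨G, mem_rtSub.1 hG, fun q hqR => ?_⟩
    rw [key q hqR]
    exact hs q (mem_rtSub.2 hqR)
  obtain ⟨h1, h2⟩ := Classical.epsilon_spec hex
  exact ⟨h1, h2, fun q hqR => (h2 q hqR).trans (key q hqR)⟩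

/-- A Raviart–Thomas field is determined by its moments. -/
lemma RT_eq_of_integral_inner {k : ℕ} {G G' : Plane → Plane} (hG : G ∈ RT k) (hG' : G' ∈ RT k)
    (he : ∀ q ∈ RT k, ∫ x in hull t, ⟪G x, q x⟫ = ∫ x in hull t, ⟪G' x, q x⟫) : G = G' := by
  have hd := RT_sub hG hG'
  have m1 := memLp_hull (RT_continuous hG) t
  have m2 := memLp_hull (RT_continuous hG') t
  have md := memLp_hull (RT_continuous hd) t
  have h0 : ∫ x in hull t, ⟪G x - G' x, G x - G' x⟫ = 0 := by
    have e1 (x : Plane) : ⟪G x - G' x, G x - G' x⟫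
        = ⟪G x, G x - G' x⟫ - ⟪G' x, G x - G' x⟫ := inner_sub_left _ _ _
    simp only [e1]
    rw [integral_sub (integrable_inner_of_memLp m1 md) (integrable_inner_of_memLp m2 md), he _ hd,
      sub_self]
  have h1 := (integral_eq_zero_iff_of_nonneg (fun x => real_inner_self_nonneg)
    (integrable_inner_of_memLp md md)).1 h0
  have h2 := RT_eq_zero_of_ae hd isOpen_openTri h.openTri_nonempty (by
    rw [restrict_openTri]
    filter_upwards [h1] with x hx
    simpa using hx)
  ext1 x
  exact sub_eq_zero.1 (congrFun h2 x)

lemma discGrad_sub {k : ℕ} {w z : WeakFun} (hw0 : w.1 t ∈ polyFun k)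
    (hwb : ∀ e ∈ triEdges t, w.2 e ∈ polyFun k) (hz0 : z.1 t ∈ polyFun k)
    (hzb : ∀ e ∈ triEdges t, z.2 e ∈ polyFun k) :
    discGrad k (w - z) t = fun x => discGrad k w t x - discGrad k z t x := by
  obtain ⟨w1, w2, -⟩ := h.discGrad_spec hw0 hwb
  obtain ⟨z1, z2, -⟩ := h.discGrad_spec hz0 hzb
  obtain ⟨d1, d2, -⟩ := h.discGrad_spec (w := w - z) ((polyFun k).sub_mem hw0 hz0)
    (fun e he => (polyFun k).sub_mem (hwb e he) (hzb e he))
  refine h.RT_eq_of_integral_inner d1 (RT_sub w1 z1) fun q hq => ?_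
  have hqc := RT_continuous hq
  have mq := memLp_hull hqc t
  have hI {f : Plane → ℝ} (hf : Continuous f) : Integrable f (volume.restrict (hull t)) :=
    hf.continuousOn.integrableOn_compact (isCompact_hull t)
  have hIe {e : Finset Plane} (he : e ∈ triEdges t) {f : Plane → ℝ} (hf : Continuous f) :
      Integrable f (edgeMeasure e) := by
    have hc : e.card = 2 := (Finset.mem_powersetCard.1 he).2
    have := isFiniteMeasure_edge hc
    exact (memLp_edge hc hf).integrable (by norm_num)
  have hcd := (polyFun_contDiff (RT_divergence hq) (n := 0)).continuous
  have c1 := (polyFun_contDiff hw0 (n := 0)).continuous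
  have c2 := (polyFun_contDiff hz0 (n := 0)).continuous
  simp only [inner_sub_left]
  rw [integral_sub (integrable_inner_of_memLp (memLp_hull (RT_continuous w1) t) mq)
    (integrable_inner_of_memLp (memLp_hull (RT_continuous z1) t) mq), d2 q hq, w2 q hq, z2 q hq]
  simp only [Prod.fst_sub, Prod.snd_sub, Pi.sub_apply, sub_mul]
  rw [integral_sub (hI (by fun_prop)) (hI (by fun_prop))]
  have : ∑ e ∈ triEdges t, ∫ x, (w.2 e x * ⟪q x, outwardNormal {t} e⟫
        - z.2 e x * ⟪q x, outwardNormal {t} e⟫) ∂edgeMeasure e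
      = (∑ e ∈ triEdges t, ∫ x, w.2 e x * ⟪q x, outwardNormal {t} e⟫ ∂edgeMeasure e)
        - ∑ e ∈ triEdges t, ∫ x, z.2 e x * ⟪q x, outwardNormal {t} e⟫ ∂edgeMeasure e := by
    rw [← Finset.sum_sub_distrib]
    refine Finset.sum_congr rfl fun e he => ?_
    have c3 := (polyFun_contDiff (hwb e he) (n := 0)).continuous
    have c4 := (polyFun_contDiff (hzb e he) (n := 0)).continuous
    exact integral_sub (hIe he (by fun_prop)) (hIe he (by fun_prop))
  rw [this]
  ring

end IsTri

/-! ### Stability of the discrete gradient -/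

lemma le_of_sq_le_mul {x y : ℝ} (hx : 0 ≤ x) (hy : 0 ≤ y) (hxy : x ^ 2 ≤ y * x) : x ≤ y := by
  rcases hx.eq_or_lt with rfl | hx
  · exact hy
  · rw [sq] at hxy
    exact le_of_mul_le_mul_right hxy hx

namespace IsTri

variable {t : Finset Plane} (h : IsTri t)
include h

lemma height_le_norm {i j : t} (hij : i ≠ j) : h.height i ≤ ‖(j : Plane) - i‖ := by
  have h1 := h.inner_normal_sub i j i
  rw [h.bary_vertex, h.bary_vertex, if_pos rfl, if_neg hij, sub_zero, mul_one] at h1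
  rw [← h1]
  refine (real_inner_le_norm _ _).trans ?_
  rw [h.norm_normal, one_mul]

variable {c : Plane} {r D : ℝ} (hd : HasDisc t c r D)
include hd

lemma radius_le_height (i : t) : r ≤ h.height i := by
  have h1 := h.le_height_mul_bary hd i (x := c) hd.pos.le (by simp)
  have h2 : h.bary i c ≤ 1 := by
    rw [← h.sum_bary c]
    exact Finset.single_le_sum (fun j _ => h.mem_hull_iff.1 hd.center_mem j) (Finset.mem_univ i)
  nlinarith [h.height_pos i]

lemma height_le_diam (i : t) : h.height i ≤ D := by
  obtain ⟨j, hj⟩ := h.exists_ne_vertex i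
  exact (h.height_le_norm hj.symm).trans (hd.dist_le (subset_hull t j.2) (subset_hull t i.2))

lemma radius_le_diam : r ≤ D := by
  obtain ⟨i, hi⟩ := Finset.card_pos.1 (by rw [h.card]; norm_num : 0 < t.card)
  exact (h.radius_le_height hd ⟨i, hi⟩).trans (h.height_le_diam hd ⟨i, hi⟩)

lemma diam_pos : 0 < D := hd.pos.trans_le (h.radius_le_diam hd)

lemma radius_le_edge {i j : t} (hij : i ≠ j) : r ≤ ‖(j : Plane) - i‖ :=
  (h.radius_le_height hd i).trans (h.height_le_norm hij)

omit h in
lemma area_le : (volume (hull t)).toReal ≤ Real.pi * D ^ 2 := by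
  have hsub : hull t ⊆ Metric.closedBall c D := fun x hx => by
    rw [mem_closedBall_iff_norm]
    exact hd.dist_le hx hd.center_mem
  have h1 := measure_mono (μ := (volume : Measure Plane)) hsub
  rw [EuclideanSpace.volume_closedBall_fin_two] at h1
  have h2 := ENNReal.toReal_mono (by finiteness) h1
  rw [ENNReal.toReal_mul, ENNReal.toReal_pow, ENNReal.toReal_ofReal hd.D_nonneg,
    ENNReal.toReal_ofReal Real.pi_pos.le] at h2
  linarith

omit h in
/-- The integral over a triangle is at most the area times a bound. -/
lemma integral_hull_le {f : Plane → ℝ} {M : ℝ} (hM : 0 ≤ M) (hf : ∀ x ∈ hull t, f x ≤ M) :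
    ∫ x in hull t, f x ≤ Real.pi * D ^ 2 * M := by
  by_cases hi : Integrable f (volume.restrict (hull t))
  · calc ∫ x in hull t, f x ≤ ∫ _ in hull t, M :=
        integral_mono_ae hi (integrable_const _)
          (by filter_upwards [ae_restrict_mem (measurableSet_hull t)] with x hx using hf x hx)
      _ = (volume (hull t)).toReal * M := by simp [Measure.real]
      _ ≤ _ := mul_le_mul_of_nonneg_right (area_le hd) hM
  · rw [integral_undef hi]
    positivity

omit h in
/-- The inverse estimate from the inscribed disc to the triangle. -/
lemma sq_le_of_inverse_ball {σ : ℝ} (hσ : D ≤ σ * r) {C : ℝ} {k : ℕ}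
    (hC : ∀ (c : Plane) (r : ℝ), 0 < r → ∀ p ∈ polyFun k, ∀ x ∈ Metric.closedBall c (r * σ),
      p x ^ 2 ≤ C / r ^ 2 * ∫ y in Metric.ball c (r * (1 / 2)), p y ^ 2)
    {p : Plane → ℝ} (hp : p ∈ polyFun k) {x : Plane} (hx : x ∈ hull t) :
    p x ^ 2 ≤ C / r ^ 2 * ∫ y in Metric.ball c (r * (1 / 2)), p y ^ 2 := by
  refine hC c r hd.pos p hp x ?_
  rw [mem_closedBall_iff_norm]
  linarith [hd.dist_le hx hd.center_mem]

/-- On the inner disc the weighted squares of the components of a vector in the directions of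
the vertices control the vector. -/
lemma norm_sq_le_sum_bary {x : Plane} (hx : ‖x - c‖ ≤ r / 2) (g : Plane) :
    r ^ 3 / (8 * D) * ‖g‖ ^ 2 ≤ ∑ i : t, h.bary i x * ⟪x - (i : Plane), g⟫ ^ 2 := by
  have hD := h.diam_pos hd
  have hr := hd.pos
  have hb (i : t) : r / (2 * D) ≤ h.bary i x := by
    have h1 := h.le_height_mul_bary hd i (x := x) (s := r / 2) (by positivity) (by linarith)
    have h2 := h.height_le_diam hd i
    have h3 : 0 ≤ h.bary i x := by
      by_contra hneg
      push Not at hneg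
      nlinarith [h.height_pos i]
    rw [div_le_iff₀ (by positivity)]
    nlinarith
  have hsum : r ^ 2 / 4 * ‖g‖ ^ 2 ≤ ∑ i : t, ⟪x - (i : Plane), g⟫ ^ 2 := by
    rcases eq_or_ne g 0 with rfl | hg
    · simp
    have hgn : 0 < ‖g‖ := norm_pos_iff.2 hg
    -- the point at distance `r / 2` from `x` in direction `g` is a convex combination of vertices
    set y := x + (r / 2 / ‖g‖) • g with hy
    have hyt : y ∈ hull t := by
      refine hd.ball ?_
      rw [mem_closedBall_iff_norm]
      calc ‖y - c‖ = ‖(x - c) + (r / 2 / ‖g‖) • g‖ := by rw [hy]; congr 1; abel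
        _ ≤ ‖x - c‖ + ‖(r / 2 / ‖g‖) • g‖ := norm_add_le _ _
        _ = ‖x - c‖ + r / 2 := by
          rw [norm_smul, Real.norm_of_nonneg (by positivity)]
          field_simp
        _ ≤ r := by linarith
    have hμ := h.mem_hull_iff.1 hyt
    have h1 : ∑ i : t, h.bary i y * ⟪(i : Plane) - x, g⟫ = r / 2 * ‖g‖ := by
      have e1 : ∑ i : t, h.bary i y • ((i : Plane) - x) = y - x := by
        simp only [smul_sub, Finset.sum_sub_distrib, h.sum_bary_smul, ← Finset.sum_smul,
          h.sum_bary, one_smul]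
      have e2 := congrArg (fun z => ⟪z, g⟫) e1
      simp only [sum_inner, inner_smul_left, conj_trivial] at e2
      rw [e2, hy, add_sub_cancel_left, inner_smul_left, real_inner_self_eq_norm_sq]
      simp only [conj_trivial]
      field_simp
    have h2 := Finset.sum_sq_le_sum_mul_sum_of_sq_le_mul Finset.univ
      (r := fun i : t => h.bary i y * ⟪(i : Plane) - x, g⟫) (f := fun i => h.bary i y)
      (g := fun i => h.bary i y * ⟪(i : Plane) - x, g⟫ ^ 2) (fun i _ => hμ i)
      (fun i _ => mul_nonneg (hμ i) (sq_nonneg _)) (fun i _ => by rw [mul_pow, sq, mul_assoc])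
    rw [h1, h.sum_bary, one_mul] at h2
    calc r ^ 2 / 4 * ‖g‖ ^ 2 = (r / 2 * ‖g‖) ^ 2 := by ring
      _ ≤ _ := h2
      _ ≤ _ := by
        refine Finset.sum_le_sum fun i _ => ?_
        have h3 : h.bary i y ≤ 1 := by
          rw [← h.sum_bary y]
          exact Finset.single_le_sum (fun j _ => hμ j) (Finset.mem_univ i)
        have h4 : ⟪(i : Plane) - x, g⟫ ^ 2 = ⟪x - (i : Plane), g⟫ ^ 2 := by
          rw [← neg_sub x (i : Plane), inner_neg_left, neg_sq]
        rw [h4]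
        exact mul_le_of_le_one_left (sq_nonneg _) h3
  calc r ^ 3 / (8 * D) * ‖g‖ ^ 2 = r / (2 * D) * (r ^ 2 / 4 * ‖g‖ ^ 2) := by
        field_simp
        ring
    _ ≤ r / (2 * D) * ∑ i : t, ⟪x - (i : Plane), g⟫ ^ 2 :=
        mul_le_mul_of_nonneg_left hsum (by positivity)
    _ ≤ _ := by
        rw [Finset.mul_sum]
        exact Finset.sum_le_sum fun i _ => mul_le_mul_of_nonneg_right (hb i) (sq_nonneg _)

/-- The gradient of the interior component is controlled on the inner disc by the discrete
gradient. The discrete gradient is tested with the field `∑ λᵢ ((x - aᵢ) · ∇w₀) (x - aᵢ)`, which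
belongs to `RT_k` since `∑ λᵢ (x - aᵢ) = 0`, and whose normal trace vanishes. -/
lemma integral_ball_grad_sq_le {k : ℕ} {w : WeakFun} (hw0 : w.1 t ∈ polyFun k)
    (hwb : ∀ e ∈ triEdges t, w.2 e ∈ polyFun k) :
    r ^ 3 / (8 * D) * ∫ x in Metric.ball c (r * (1 / 2)), ‖grad (w.1 t) x‖ ^ 2
      ≤ D ^ 2 * nrm (volume.restrict (hull t)) (discGrad k w t) ^ 2 := by
  obtain ⟨hG, -, hs⟩ := h.discGrad_spec hw0 hwb
  have hD := h.diam_pos hd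
  set g := grad (w.1 t) with hg
  have hgc : Continuous g := RT_continuous (grad_mem_RT hw0)
  -- the coefficients `-λᵢ (aᵢ · ∇w₀)` are in `P_k`, while `λᵢ ((x - aᵢ) · ∇w₀)` has degree `k + 1`;
  -- the two sets of coefficients give the same field, see `hS'`
  let ρ : t → Plane → ℝ := fun i x => -((i : Plane) 0 * (h.bary i x * partialD 0 (w.1 t) x)
    + (i : Plane) 1 * (h.bary i x * partialD 1 (w.1 t) x))
  have hρ (i : t) : ρ i ∈ polyFun k :=
    (polyFun k).neg_mem ((polyFun k).add_mem
      ((polyFun k).smul_mem _ (polyFun_mul_partialD hw0 (h.bary_mem_polyFun i) 0))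
      ((polyFun k).smul_mem _ (polyFun_mul_partialD hw0 (h.bary_mem_polyFun i) 1)))
  have hρ' (i : t) (x : Plane) : ρ i x = -(h.bary i x * ⟪(i : Plane), g x⟫) := by
    rw [inner_plane, hg]
    simp only [ρ, grad, PiLp.toLp_apply, Matrix.cons_val_zero, Matrix.cons_val_one]
    ring
  let S : Plane → Plane := fun x => ∑ i : t, ρ i x • (x - (i : Plane))
  have hS : S ∈ RT k := by
    rw [← mem_rtSub]
    have := (rtSub k).sum_mem (t := Finset.univ) fun (i : t) _ =>
      mem_rtSub.2 (RT_smul_sub (hρ i) (i : Plane))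
    convert this using 1
    ext1 x
    simp [S]
  have hS' (x : Plane) : S x = ∑ i : t, (h.bary i x * ⟪x - (i : Plane), g x⟫) • (x - (i : Plane)) := by
    have h0 : ∑ i : t, h.bary i x • (x - (i : Plane)) = 0 := by
      simp only [smul_sub, Finset.sum_sub_distrib, h.sum_bary_smul, ← Finset.sum_smul,
        h.sum_bary, one_smul, sub_self]
    have h1 : ∑ i : t, (h.bary i x * ⟪x - (i : Plane), g x⟫) • (x - (i : Plane))
        = ⟪x, g x⟫ • (∑ i : t, h.bary i x • (x - (i : Plane))) + S x := by
      simp only [S]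
      rw [Finset.smul_sum, ← Finset.sum_add_distrib]
      refine Finset.sum_congr rfl fun i _ => ?_
      rw [hρ', inner_sub_left, smul_smul, ← add_smul]
      congr 1
      ring
    rw [h1, h0, smul_zero, zero_add]
  set J : Plane → ℝ := fun x => ∑ i : t, h.bary i x * ⟪x - (i : Plane), g x⟫ ^ 2 with hJ
  have hbc (i : t) : Continuous (h.bary i) :=
    (polyFun_contDiff (h.bary_mem_polyFun i) (n := 0)).continuous
  have hJc : Continuous J := by fun_prop
  have hJ0 (x : Plane) (hx : x ∈ hull t) : 0 ≤ J x :=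
    Finset.sum_nonneg fun i _ => mul_nonneg (h.mem_hull_iff.1 hx i) (sq_nonneg _)
  have hgS (x : Plane) : ⟪g x, S x⟫ = J x := by
    rw [hS', inner_sum]
    refine Finset.sum_congr rfl fun i _ => ?_
    rw [inner_smul_right, real_inner_comm]
    ring
  have hSJ (x : Plane) (hx : x ∈ hull t) : ‖S x‖ ^ 2 ≤ D ^ 2 * J x := by
    have hb := h.mem_hull_iff.1 hx
    have h1 : ‖S x‖ ≤ D * ∑ i : t, h.bary i x * |⟪x - (i : Plane), g x⟫| := by
      rw [hS', Finset.mul_sum]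
      refine (norm_sum_le _ _).trans (Finset.sum_le_sum fun i _ => ?_)
      rw [norm_smul, Real.norm_eq_abs, abs_mul, abs_of_nonneg (hb i), mul_comm D]
      exact mul_le_mul_of_nonneg_left (hd.dist_le hx (subset_hull t i.2))
        (mul_nonneg (hb i) (abs_nonneg _))
    have h2 := Finset.sum_sq_le_sum_mul_sum_of_sq_le_mul Finset.univ
      (r := fun i : t => h.bary i x * |⟪x - (i : Plane), g x⟫|) (f := fun i => h.bary i x)
      (g := fun i => h.bary i x * ⟪x - (i : Plane), g x⟫ ^ 2) (fun i _ => hb i)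
      (fun i _ => mul_nonneg (hb i) (sq_nonneg _)) (fun i _ => by rw [mul_pow, sq_abs, sq, mul_assoc])
    rw [h.sum_bary, one_mul] at h2
    calc ‖S x‖ ^ 2 ≤ (D * ∑ i : t, h.bary i x * |⟪x - (i : Plane), g x⟫|) ^ 2 :=
          pow_le_pow_left₀ (norm_nonneg _) h1 2
      _ ≤ _ := by
          rw [mul_pow]
          exact mul_le_mul_of_nonneg_left h2 (sq_nonneg D)
  -- on the edge opposite to `aⱼ`, the field `x - aᵢ` is tangential for `i ≠ j`, and `λⱼ` vanishes
  have hbd : ∑ e ∈ triEdges t, ∫ x, (w.2 e x - w.1 t x) * ⟪S x, outwardNormal {t} e⟫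
      ∂edgeMeasure e = 0 := by
    rw [h.sum_triEdges]
    refine Finset.sum_eq_zero fun j _ => integral_eq_zero_of_ae ?_
    filter_upwards [ae_edgeMeasure_mem (t.erase (j : Plane))] with x hx
    have : ⟪S x, outwardNormal {t} (t.erase (j : Plane))⟫ = 0 := by
      rw [hS', sum_inner]
      refine Finset.sum_eq_zero fun i _ => ?_
      rw [inner_smul_left, real_inner_comm (outwardNormal {t} _) (x - (i : Plane)),
        h.inner_normal_edge hx, h.bary_vertex]
      by_cases hij : j = i
      · subst hij
        simp [(h.mem_edge_iff.1 hx).2]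
      · simp [hij]
    simp [this]
  have hmG := memLp_hull (RT_continuous hG) t
  have hmS := memLp_hull (RT_continuous hS) t
  have hIJ : ∫ x in hull t, J x = ∫ x in hull t, ⟪discGrad k w t x, S x⟫ := by
    rw [hs S hS, hbd, add_zero]
    simp only [hgS]
  have hIle : ∫ x in hull t, J x ≤ D ^ 2 * nrm (volume.restrict (hull t)) (discGrad k w t) ^ 2 := by
    have h1 := (le_abs_self _).trans (abs_integral_inner_le hmG hmS)
    rw [← hIJ] at h1
    have h2 : nrm (volume.restrict (hull t)) S ^ 2 ≤ D ^ 2 * ∫ x in hull t, J x := by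
      rw [nrm_sq hmS, ← integral_const_mul]
      refine setIntegral_mono_on ?_ ?_ (measurableSet_hull t) hSJ
      · exact hmS.norm.integrable_sq
      · exact (hJc.continuousOn.integrableOn_compact (isCompact_hull t)).const_mul _
    have hI0 : 0 ≤ ∫ x in hull t, J x := setIntegral_nonneg (measurableSet_hull t) hJ0
    have hG0 := nrm_nonneg (μ := volume.restrict (hull t)) (discGrad k w t)
    refine le_of_sq_le_mul hI0 (by positivity) ?_
    calc (∫ x in hull t, J x) ^ 2
        ≤ (nrm (volume.restrict (hull t)) (discGrad k w t) * nrm (volume.restrict (hull t)) S) ^ 2 :=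
          pow_le_pow_left₀ hI0 h1 2
      _ = nrm (volume.restrict (hull t)) (discGrad k w t) ^ 2
          * nrm (volume.restrict (hull t)) S ^ 2 := mul_pow _ _ _
      _ ≤ nrm (volume.restrict (hull t)) (discGrad k w t) ^ 2
          * (D ^ 2 * ∫ x in hull t, J x) := mul_le_mul_of_nonneg_left h2 (sq_nonneg _)
      _ = _ := by ring
  refine le_trans ?_ hIle
  have hball : Metric.ball c (r * (1 / 2)) ⊆ hull t := fun x hx => hd.ball (by
    rw [mem_ball_iff_norm] at hx
    rw [mem_closedBall_iff_norm]
    linarith [hd.pos])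
  have hJi := hJc.continuousOn.integrableOn_compact (isCompact_hull t) (μ := volume)
  calc r ^ 3 / (8 * D) * ∫ x in Metric.ball c (r * (1 / 2)), ‖g x‖ ^ 2
      = ∫ x in Metric.ball c (r * (1 / 2)), r ^ 3 / (8 * D) * ‖g x‖ ^ 2 :=
        (integral_const_mul _ _).symm
    _ ≤ ∫ x in Metric.ball c (r * (1 / 2)), J x := by
        refine setIntegral_mono_on ?_ (hJi.mono_set hball) measurableSet_ball fun x hx => ?_
        · exact ((memLp_hull hgc t).norm.integrable_sq.const_mul _).mono_measure
            (Measure.restrict_mono hball le_rfl)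
        · refine h.norm_sq_le_sum_bary hd ?_ _
          rw [mem_ball_iff_norm] at hx
          linarith
    _ ≤ ∫ x in hull t, J x := by
        refine setIntegral_mono_set hJi ?_ hball.eventuallyLE
        filter_upwards [ae_restrict_mem (measurableSet_hull t)] with x hx using hJ0 x hx

end IsTri

/-- The discrete gradient controls the gradient of the interior component. -/
theorem exists_grad_stability (k : ℕ) (σ : ℝ) : ∃ C : ℝ, 0 < C ∧ ∀ {t : Finset Plane} (_ : IsTri t)
    {c : Plane} {r D : ℝ}, HasDisc t c r D → D ≤ σ * r → ∀ {w : WeakFun}, w.1 t ∈ polyFun k →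
    (∀ e ∈ triEdges t, w.2 e ∈ polyFun k) →
    nrm (volume.restrict (hull t)) (grad (w.1 t)) ^ 2
      ≤ C * nrm (volume.restrict (hull t)) (discGrad k w t) ^ 2 := by
  obtain ⟨C, hC, hinv⟩ := polyFun_inverse_ball k σ
  refine ⟨8 * Real.pi * C * |σ| ^ 5 + 1, by positivity, ?_⟩
  intro t h c r D hd hσ w hw0 hwb
  have hr := hd.pos
  have hD := h.diam_pos hd
  have hσ0 : 0 < σ := by
    by_contra hneg
    push Not at hneg
    nlinarith
  rw [abs_of_pos hσ0]
  have hb := h.integral_ball_grad_sq_le hd hw0 hwb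
  set I := ∫ x in Metric.ball c (r * (1 / 2)), ‖grad (w.1 t) x‖ ^ 2 with hI
  set n := nrm (volume.restrict (hull t)) (discGrad k w t) with hn
  have hI0 : 0 ≤ I := integral_nonneg fun x => sq_nonneg _
  have hgc : Continuous (grad (w.1 t)) := RT_continuous (grad_mem_RT hw0)
  have hpt (x : Plane) (hx : x ∈ hull t) : ‖grad (w.1 t) x‖ ^ 2 ≤ C / r ^ 2 * I := by
    have e (i : Fin 2) := IsTri.sq_le_of_inverse_ball hd hσ hinv (polyFun_partialD hw0 i) hx
    have hc (i : Fin 2) : IntegrableOn (fun x => partialD i (w.1 t) x ^ 2)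
        (Metric.ball c (r * (1 / 2))) := by
      refine (((polyFun_contDiff (polyFun_partialD hw0 i) (n := 0)).continuous.pow 2).continuousOn.integrableOn_compact
        (isCompact_closedBall c (r * (1 / 2)))).mono_set Metric.ball_subset_closedBall
    have : I = (∫ y in Metric.ball c (r * (1 / 2)), partialD 0 (w.1 t) y ^ 2)
        + ∫ y in Metric.ball c (r * (1 / 2)), partialD 1 (w.1 t) y ^ 2 := by
      rw [hI, ← integral_add (hc 0) (hc 1)]
      simp only [norm_grad_sq]
    rw [norm_grad_sq, this, mul_add]
    exact add_le_add (e 0) (e 1)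
  rw [nrm_sq (memLp_hull hgc t)]
  have h1 := IsTri.integral_hull_le hd (by positivity) hpt
  have h2 : I ≤ 8 * σ ^ 3 * n ^ 2 := by
    rw [div_mul_eq_mul_div, div_le_iff₀ (by positivity)] at hb
    have h3 : D ^ 3 ≤ (σ * r) ^ 3 := pow_le_pow_left₀ hD.le hσ 3
    have h4 : r ^ 3 * I ≤ r ^ 3 * (8 * σ ^ 3 * n ^ 2) := by
      calc r ^ 3 * I ≤ D ^ 2 * n ^ 2 * (8 * D) := hb
        _ = D ^ 3 * (8 * n ^ 2) := by ring
        _ ≤ (σ * r) ^ 3 * (8 * n ^ 2) := mul_le_mul_of_nonneg_right h3 (by positivity)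
        _ = _ := by ring
    exact le_of_mul_le_mul_left h4 (by positivity)
  have h5 : D ^ 2 ≤ (σ * r) ^ 2 := pow_le_pow_left₀ hD.le hσ 2
  calc _ ≤ Real.pi * D ^ 2 * (C / r ^ 2 * I) := h1
    _ ≤ Real.pi * (σ * r) ^ 2 * (C / r ^ 2 * (8 * σ ^ 3 * n ^ 2)) := by gcongr
    _ = 8 * Real.pi * C * σ ^ 5 * n ^ 2 := by field_simp
    _ ≤ _ := by nlinarith [sq_nonneg n]

lemma edgeMeasure_univ_le {a b : Plane} (hab : a ≠ b) :
    (edgeMeasure {a, b} Set.univ).toReal = ‖b - a‖ := by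
  have h1 := integral_edge hab fun _ => (1 : ℝ)
  simpa [Measure.real] using h1

/-- The mismatch of the two components on an edge is controlled by the discrete gradient. The
test field is `ρ (x - a)` for the vertex `a` opposite to the edge, where `ρ` extends the mismatch
from the edge, constant in the direction of another edge. -/
theorem exists_jump_stability (k : ℕ) (σ : ℝ) : ∃ C : ℝ, 0 < C ∧ ∀ {t : Finset Plane} (_ : IsTri t)
    {c : Plane} {r D : ℝ}, HasDisc t c r D → D ≤ σ * r → ∀ {w : WeakFun}, w.1 t ∈ polyFun k →
    (∀ e ∈ triEdges t, w.2 e ∈ polyFun k) → ∀ e ∈ triEdges t,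
    nrm (edgeMeasure e) (fun x => w.2 e x - w.1 t x) ^ 2
      ≤ C * D * nrm (volume.restrict (hull t)) (discGrad k w t) ^ 2 := by
  obtain ⟨C₁, hC₁, hgrad⟩ := exists_grad_stability k σ
  obtain ⟨C₂, hC₂, hseg⟩ := polyFun_inverse_segment k
  refine ⟨2 * (1 + C₁) * Real.pi * C₂ * |σ| ^ 3 + 1, by positivity, ?_⟩
  intro t h c r D hd hσ w hw0 hwb e he
  have hr := hd.pos
  have hD := h.diam_pos hd
  have hσ0 : 0 < σ := by
    by_contra hneg
    push Not at hneg
    nlinarith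
  rw [abs_of_pos hσ0]
  have hg := hgrad h hd hσ hw0 hwb
  obtain ⟨hG, -, hs⟩ := h.discGrad_spec hw0 hwb
  obtain ⟨i, rfl⟩ := h.exists_of_mem_triEdges he
  obtain ⟨a, b, hab, hai, hbi, hedge, -, -⟩ := h.exists_vertices i
  have hab' : (a : Plane) ≠ b := fun hh => hab (Subtype.ext hh)
  set E := t.erase (i : Plane) with hE
  set p : Plane → ℝ := fun x => w.2 E x - w.1 t x with hp
  have hpP : p ∈ polyFun k := (polyFun k).sub_mem (hwb E he) hw0
  have hpc : Continuous p := (polyFun_contDiff hpP (n := 0)).continuous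
  -- the projection to the edge in the direction of the edge from `i` to `a`
  set π : Plane → Plane := fun x => (a : Plane) + h.bary b x • ((b : Plane) - a) with hπ
  have hcoord (j : Fin 2) : (fun x => π x j) ∈ polyFun 1 := by
    have := (polyFun 1).add_mem (polyFun_const 1 ((a : Plane) j))
      ((polyFun 1).smul_mem (((b : Plane) - a) j) (h.bary_mem_polyFun b))
    convert this using 1
    ext x
    simp [hπ, mul_comm]
  set ρ : Plane → ℝ := fun x => p (π x) with hρ
  have hρP : ρ ∈ polyFun k := by
    have := polyFun_comp hpP (hcoord 0) (hcoord 1)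
    convert this using 1
    ext x
    refine congrArg p ?_
    ext j
    fin_cases j <;> rfl
  have hρc : Continuous ρ := (polyFun_contDiff hρP (n := 0)).continuous
  have hq := RT_smul_sub hρP (i : Plane)
  set q : Plane → Plane := fun x => ρ x • (x - (i : Plane)) with hqdef
  have hπe (x : Plane) (hx : x ∈ hull E) : π x = x := by
    rw [hedge, hull_pair, mem_segment_iff_param] at hx
    obtain ⟨s, -, rfl⟩ := hx
    have h1 := h.inner_gradBary b ((a : Plane) + s • ((b : Plane) - a)) a
    rw [add_sub_cancel_left, inner_smul_right, h.inner_gradBary, h.bary_vertex, h.bary_vertex,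
      if_pos rfl, if_neg hab.symm] at h1
    simp only [hπ]
    rw [show h.bary b ((a : Plane) + s • ((b : Plane) - a)) = s by linarith]
  have hbd : ∑ e ∈ triEdges t, ∫ x, (w.2 e x - w.1 t x) * ⟪q x, outwardNormal {t} e⟫
      ∂edgeMeasure e = h.height i * nrm (edgeMeasure E) p ^ 2 := by
    rw [h.sum_triEdges, Finset.sum_eq_single i, nrm_sq_real (memLp_edge (h.card_edge i) hpc),
      ← integral_const_mul]
    · refine integral_congr_ae ?_
      filter_upwards [ae_edgeMeasure_mem E] with x hx
      simp only [hqdef]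
      rw [inner_smul_left, real_inner_comm (outwardNormal {t} _) (x - (i : Plane)),
        h.inner_normal_edge hx, h.bary_vertex, if_pos rfl, hρ]
      simp only [hπe x hx, conj_trivial]
      ring
    · intro j _ hji
      refine integral_eq_zero_of_ae ?_
      filter_upwards [ae_edgeMeasure_mem (t.erase (j : Plane))] with x hx
      simp only [hqdef]
      rw [inner_smul_left, real_inner_comm (outwardNormal {t} _) (x - (i : Plane)),
        h.inner_normal_edge hx, h.bary_vertex, if_neg hji]
      simp
    · simp
  have hmG := memLp_hull (RT_continuous hG) t
  have hmq := memLp_hull (RT_continuous hq) t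
  have hmg : MemLp (grad (w.1 t)) 2 (volume.restrict (hull t)) :=
    memLp_hull (RT_continuous (grad_mem_RT hw0)) t
  set n := nrm (volume.restrict (hull t)) (discGrad k w t) with hn
  set m := nrm (edgeMeasure E) p with hm
  set L := ‖(b : Plane) - a‖ with hL
  have hLr : r ≤ L := h.radius_le_edge hd hab
  have hL0 : 0 < L := hr.trans_le hLr
  -- the bound of the test field
  have hqn : nrm (volume.restrict (hull t)) q ^ 2 ≤ Real.pi * D ^ 2 * (D ^ 2 * (C₂ / L * m ^ 2)) := by
    rw [nrm_sq hmq]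
    refine IsTri.integral_hull_le hd (by positivity) fun x hx => ?_
    have hbx := h.mem_hull_iff.1 hx
    have hb1 : h.bary b x ≤ 1 := by
      rw [← h.sum_bary x]
      exact Finset.single_le_sum (fun j _ => hbx j) (Finset.mem_univ b)
    have h1 := hseg a b p hpP (h.bary b x) ⟨hbx b, hb1⟩
    have h2 : m ^ 2 = L * ∫ s in Set.Icc (0 : ℝ) 1, p ((a : Plane) + s • ((b : Plane) - a)) ^ 2 := by
      rw [hm, nrm_sq_real (memLp_edge (h.card_edge i) hpc), ← hE, hedge, integral_edge hab']
    have h3 : ρ x ^ 2 ≤ C₂ / L * m ^ 2 := by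
      rw [h2]
      calc ρ x ^ 2 ≤ _ := h1
        _ = _ := by field_simp
    rw [hqdef, norm_smul, mul_pow, Real.norm_eq_abs, sq_abs, mul_comm]
    exact mul_le_mul (pow_le_pow_left₀ (norm_nonneg _) (hd.dist_le hx (subset_hull t i.2)) 2) h3
      (sq_nonneg _) (sq_nonneg _)
  have hmain : h.height i * m ^ 2 = (∫ x in hull t, ⟪discGrad k w t x, q x⟫)
      - ∫ x in hull t, ⟪grad (w.1 t) x, q x⟫ := by
    rw [hs q hq, hbd]
    ring
  have hle : r * m ^ 2 ≤ (n + nrm (volume.restrict (hull t)) (grad (w.1 t)))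
      * nrm (volume.restrict (hull t)) q := by
    have e1 := abs_integral_inner_le hmG hmq
    have e2 := abs_integral_inner_le hmg hmq
    have e3 : r * m ^ 2 ≤ h.height i * m ^ 2 :=
      mul_le_mul_of_nonneg_right (h.radius_le_height hd i) (sq_nonneg _)
    rw [abs_le] at e1 e2
    rw [add_mul]
    linarith [e1.2, e2.1]
  have hsq : (n + nrm (volume.restrict (hull t)) (grad (w.1 t))) ^ 2 ≤ 2 * (1 + C₁) * n ^ 2 := by
    nlinarith [sq_nonneg (n - nrm (volume.restrict (hull t)) (grad (w.1 t)))]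
  have hm0 : 0 ≤ m := nrm_nonneg _
  have hq4 : (r * m ^ 2) ^ 2 ≤ 2 * (1 + C₁) * n ^ 2 * (Real.pi * D ^ 2 * (D ^ 2 * (C₂ / r * m ^ 2))) := by
    calc (r * m ^ 2) ^ 2 ≤ ((n + nrm (volume.restrict (hull t)) (grad (w.1 t)))
          * nrm (volume.restrict (hull t)) q) ^ 2 := pow_le_pow_left₀ (by positivity) hle 2
      _ = (n + nrm (volume.restrict (hull t)) (grad (w.1 t))) ^ 2
          * nrm (volume.restrict (hull t)) q ^ 2 := mul_pow _ _ _
      _ ≤ 2 * (1 + C₁) * n ^ 2 * (Real.pi * D ^ 2 * (D ^ 2 * (C₂ / L * m ^ 2))) :=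
          mul_le_mul hsq hqn (sq_nonneg _) (by positivity)
      _ ≤ _ := by gcongr
  have h5 : D ^ 3 ≤ (σ * r) ^ 3 := pow_le_pow_left₀ hD.le hσ 3
  have hfin : m ^ 2 ≤ 2 * (1 + C₁) * Real.pi * C₂ * σ ^ 3 * D * n ^ 2 := by
    refine le_of_sq_le_mul (sq_nonneg m) (by positivity) ?_
    have h6 : r ^ 3 * (m ^ 2) ^ 2
        ≤ r ^ 3 * (2 * (1 + C₁) * Real.pi * C₂ * σ ^ 3 * D * n ^ 2 * m ^ 2) := by
      calc r ^ 3 * (m ^ 2) ^ 2 = r * (r * m ^ 2) ^ 2 := by ring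
        _ ≤ r * (2 * (1 + C₁) * n ^ 2 * (Real.pi * D ^ 2 * (D ^ 2 * (C₂ / r * m ^ 2)))) :=
            mul_le_mul_of_nonneg_left hq4 hr.le
        _ = D ^ 3 * (2 * (1 + C₁) * n ^ 2 * (Real.pi * D * (C₂ * m ^ 2))) := by field_simp
        _ ≤ (σ * r) ^ 3 * (2 * (1 + C₁) * n ^ 2 * (Real.pi * D * (C₂ * m ^ 2))) :=
            mul_le_mul_of_nonneg_right h5 (by positivity)
        _ = _ := by ring
    exact le_of_mul_le_mul_left h6 (by positivity)
  have hDn : 0 ≤ D * n ^ 2 := by positivity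
  nlinarith

lemma sq_le_card_mul_sum {ι : Type*} {s : Finset ι} {a b : ι → ℝ} {n K : ℝ} (hK : 0 ≤ K)
    (h1 : n ^ 2 ≤ ∑ i ∈ s, a i * b i) (h2 : ∀ i ∈ s, b i ^ 2 ≤ K * n ^ 2) :
    n ^ 2 ≤ s.card * K * ∑ i ∈ s, a i ^ 2 := by
  have hS : 0 ≤ ∑ i ∈ s, a i ^ 2 := Finset.sum_nonneg fun _ _ => sq_nonneg _
  refine le_of_sq_le_mul (sq_nonneg n) (by positivity) ?_
  calc (n ^ 2) ^ 2 ≤ (∑ i ∈ s, a i * b i) ^ 2 := pow_le_pow_left₀ (sq_nonneg n) h1 2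
    _ ≤ (∑ i ∈ s, a i ^ 2) * ∑ i ∈ s, b i ^ 2 := Finset.sum_mul_sq_le_sq_mul_sq _ _ _
    _ ≤ (∑ i ∈ s, a i ^ 2) * ∑ _i ∈ s, K * n ^ 2 :=
        mul_le_mul_of_nonneg_left (Finset.sum_le_sum h2) hS
    _ = _ := by
        rw [Finset.sum_const, nsmul_eq_mul]
        ring

/-- The discrete gradient of a function with vanishing interior component is controlled by the
edge components. -/
theorem exists_lifting_bound (k : ℕ) (σ : ℝ) : ∃ C : ℝ, 0 < C ∧ ∀ {t : Finset Plane} (_ : IsTri t)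
    {c : Plane} {r D : ℝ}, HasDisc t c r D → D ≤ σ * r → ∀ {w : WeakFun}, w.1 t = 0 →
    (∀ e ∈ triEdges t, w.2 e ∈ polyFun k) →
    D * nrm (volume.restrict (hull t)) (discGrad k w t) ^ 2
      ≤ C * ∑ e ∈ triEdges t, nrm (edgeMeasure e) (w.2 e) ^ 2 := by
  obtain ⟨C, hC, hinv⟩ := polyFun_inverse_ball (k + 1) σ
  refine ⟨3 * C * |σ| ^ 2 + 1, by positivity, ?_⟩
  intro t h c r D hd hσ w hw0 hwb
  have hr := hd.pos
  have hD := h.diam_pos hd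
  obtain ⟨hG, hs, -⟩ := h.discGrad_spec (w := w) (by rw [hw0]; exact (polyFun k).zero_mem) hwb
  set G := discGrad k w t with hGdef
  have hGc : Continuous G := RT_continuous hG
  have hmG := memLp_hull hGc t
  set n := nrm (volume.restrict (hull t)) G with hn
  have hball : Metric.ball c (r * (1 / 2)) ⊆ hull t := fun x hx => hd.ball (by
    rw [mem_ball_iff_norm] at hx
    rw [mem_closedBall_iff_norm]
    linarith)
  have hpt (x : Plane) (hx : x ∈ hull t) : ‖G x‖ ^ 2 ≤ C / r ^ 2 * n ^ 2 := by
    have e (i : Fin 2) := IsTri.sq_le_of_inverse_ball hd hσ hinv (RT_comp hG i) hx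
    have hc (i : Fin 2) : IntegrableOn (fun x => G x i ^ 2) (Metric.ball c (r * (1 / 2))) :=
      (((polyFun_contDiff (RT_comp hG i) (n := 0)).continuous.pow 2).continuousOn.integrableOn_compact
        (isCompact_hull t)).mono_set hball
    have h1 : (∫ y in Metric.ball c (r * (1 / 2)), G y 0 ^ 2)
        + ∫ y in Metric.ball c (r * (1 / 2)), G y 1 ^ 2 ≤ n ^ 2 := by
      rw [hn, nrm_sq hmG, ← integral_add (hc 0) (hc 1)]
      simp only [← normSq_plane]
      refine setIntegral_mono_set hmG.norm.integrable_sq (ae_of_all _ fun x => sq_nonneg _)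
        hball.eventuallyLE
    rw [normSq_plane]
    calc _ ≤ _ := add_le_add (e 0) (e 1)
      _ = C / r ^ 2 * ((∫ y in Metric.ball c (r * (1 / 2)), G y 0 ^ 2)
        + ∫ y in Metric.ball c (r * (1 / 2)), G y 1 ^ 2) := by ring
      _ ≤ _ := mul_le_mul_of_nonneg_left h1 (by positivity)
  have hedge (e : Finset Plane) (he : e ∈ triEdges t) :
      nrm (edgeMeasure e) (fun x => ⟪G x, outwardNormal {t} e⟫) ^ 2 ≤ C * D / r ^ 2 * n ^ 2 := by
    obtain ⟨i, rfl⟩ := h.exists_of_mem_triEdges he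
    obtain ⟨a, b, hab, -, -, hedge, -, -⟩ := h.exists_vertices i
    have hab' : (a : Plane) ≠ b := fun hh => hab (Subtype.ext hh)
    have := isFiniteMeasure_edge (h.card_edge i)
    have hm := memLp_edge (h.card_edge i)
      (show Continuous fun x => ⟪G x, outwardNormal {t} (t.erase (i : Plane))⟫ by fun_prop)
    rw [nrm_sq_real hm]
    have hL : (edgeMeasure (t.erase (i : Plane)) Set.univ).toReal ≤ D := by
      rw [hedge, edgeMeasure_univ_le hab']
      exact hd.dist_le (subset_hull t b.2) (subset_hull t a.2)
    calc _ ≤ ∫ _, C / r ^ 2 * n ^ 2 ∂edgeMeasure (t.erase (i : Plane)) := by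
          refine integral_mono_ae hm.integrable_sq (integrable_const _) ?_
          filter_upwards [ae_edgeMeasure_mem (t.erase (i : Plane))] with x hx
          refine le_trans ?_ (hpt x (hull_mono (Finset.erase_subset _ _) hx))
          rw [← sq_abs]
          refine pow_le_pow_left₀ (abs_nonneg _) ((abs_real_inner_le_norm _ _).trans ?_) 2
          rw [h.norm_normal, mul_one]
      _ = (edgeMeasure (t.erase (i : Plane)) Set.univ).toReal * (C / r ^ 2 * n ^ 2) := by
          simp [Measure.real]
      _ ≤ D * (C / r ^ 2 * n ^ 2) := mul_le_mul_of_nonneg_right hL (by positivity)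
      _ = _ := by ring
  have hmain : n ^ 2 ≤ ∑ e ∈ triEdges t, nrm (edgeMeasure e) (w.2 e)
      * nrm (edgeMeasure e) (fun x => ⟪G x, outwardNormal {t} e⟫) := by
    have e1 := hs G hG
    simp only [real_inner_self_eq_norm_sq, hw0, Pi.zero_apply, zero_mul, integral_zero, neg_zero,
      zero_add] at e1
    rw [hn, nrm_sq hmG, e1]
    refine Finset.sum_le_sum fun e he => (le_abs_self _).trans ?_
    have hc : e.card = 2 := (Finset.mem_powersetCard.1 he).2
    have hcb := (polyFun_contDiff (hwb e he) (n := 0)).continuous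
    exact abs_integral_mul_le (memLp_edge hc hcb) (memLp_edge hc (by fun_prop))
  have hcard : (triEdges t).card = 3 := by
    rw [triEdges, Finset.card_powersetCard, h.card]
    rfl
  have hfin := sq_le_card_mul_sum (by positivity) hmain hedge
  rw [hcard] at hfin
  have hS0 : 0 ≤ ∑ e ∈ triEdges t, nrm (edgeMeasure e) (w.2 e) ^ 2 :=
    Finset.sum_nonneg fun _ _ => sq_nonneg _
  generalize ∑ e ∈ triEdges t, nrm (edgeMeasure e) (w.2 e) ^ 2 = S at hfin hS0 ⊢
  have h4 : D ≤ |σ| * r := hσ.trans (mul_le_mul_of_nonneg_right (le_abs_self σ) hr.le)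
  have h5 : D ^ 2 ≤ |σ| ^ 2 * r ^ 2 := (pow_le_pow_left₀ hD.le h4 2).trans_eq (mul_pow _ _ _)
  calc D * n ^ 2 ≤ D * ((3 : ℕ) * (C * D / r ^ 2) * S) := mul_le_mul_of_nonneg_left hfin hD.le
    _ = D ^ 2 * (3 * C / r ^ 2 * S) := by push_cast; ring
    _ ≤ |σ| ^ 2 * r ^ 2 * (3 * C / r ^ 2 * S) := mul_le_mul_of_nonneg_right h5 (by positivity)
    _ = 3 * C * |σ| ^ 2 * S := by field_simp
    _ ≤ _ := by linarith

/-! ### Local consistency -/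

lemma nrm_le_add_comp {μ : Measure Plane} {F : Plane → Plane} (hF : MemLp F 2 μ) :
    nrm μ F ≤ nrm μ (fun x => F x 0) + nrm μ (fun x => F x 1) := by
  have hm (i : Fin 2) : MemLp (fun x => F x i) 2 μ :=
    (EuclideanSpace.proj i : Plane →L[ℝ] ℝ).comp_memLp' hF
  have h0 := nrm_nonneg (μ := μ) (fun x => F x 0)
  have h1 := nrm_nonneg (μ := μ) (fun x => F x 1)
  refine le_of_sq_le_sq ?_ (by positivity)
  have e : nrm μ F ^ 2 = nrm μ (fun x => F x 0) ^ 2 + nrm μ (fun x => F x 1) ^ 2 := by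
    rw [nrm_sq hF, nrm_sq_real (hm 0), nrm_sq_real (hm 1),
      ← integral_add (hm 0).integrable_sq (hm 1).integrable_sq]
    simp only [normSq_plane]
  rw [e]
  nlinarith

lemma memLp_vec {μ : Measure Plane} {G : Fin 2 → Plane → ℝ} (hG : ∀ i, MemLp (G i) 2 μ) :
    MemLp (fun x => (!₂[G 0 x, G 1 x] : Plane)) 2 μ := by
  have h1 : (fun x => (!₂[G 0 x, G 1 x] : Plane))
      = fun x => G 0 x • EuclideanSpace.single (0 : Fin 2) (1 : ℝ)
        + G 1 x • EuclideanSpace.single (1 : Fin 2) (1 : ℝ) := by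
    ext x i
    fin_cases i <;> simp
  rw [h1]
  have h2 (i : Fin 2) (v : Plane) : MemLp (fun x => G i x • v) 2 μ :=
    (ContinuousLinearMap.toSpanSingleton ℝ v).comp_memLp' (hG i)
  exact (h2 0 _).add (h2 1 _)

namespace IsTri

variable {t : Finset Plane} (h : IsTri t)
include h

/-- The commuting property: the discrete gradient of the projection of `u` is the projection of
the gradient of `u` to the Raviart–Thomas fields. -/
lemma integral_inner_discGrad_of_proj {k : ℕ} {u : Plane → ℝ} {G : Fin 2 → Plane → ℝ}
    {τ : Finset Plane → Plane → ℝ} (hu : H1Trace t u G τ) {z : WeakFun} (hz0 : z.1 t ∈ polyFun k)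
    (hzb : ∀ e ∈ triEdges t, z.2 e ∈ polyFun k)
    (hzu : ∀ q ∈ polyFun k, ∫ x in hull t, z.1 t x * q x = ∫ x in hull t, u x * q x)
    (hzτ : ∀ e ∈ triEdges t, ∀ q ∈ polyFun k,
      ∫ x, z.2 e x * q x ∂edgeMeasure e = ∫ x, τ e x * q x ∂edgeMeasure e)
    {q : Plane → Plane} (hq : q ∈ RT k) :
    ∫ x in hull t, ⟪discGrad k z t x, q x⟫ = ∫ x in hull t, ⟪!₂[G 0 x, G 1 x], q x⟫ := by
  have hqs (j : Fin 2) : ContDiff ℝ ∞ (fun x => q x j) := polyFun_contDiff (RT_comp hq j)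
  have hm (j : Fin 2) := memLp_hull (hqs j).continuous t
  have hm' (j : Fin 2) := memLp_hull (contDiff_partialD (hqs j) j).continuous t
  rw [(h.discGrad_spec hz0 hzb).2.1 q hq, hzu _ (RT_divergence hq)]
  have e1 : ∑ e ∈ triEdges t, ∫ x, z.2 e x * ⟪q x, outwardNormal {t} e⟫ ∂edgeMeasure e
      = ∑ e ∈ triEdges t, ∫ x, τ e x * ⟪q x, outwardNormal {t} e⟫ ∂edgeMeasure e := by
    rw [h.sum_triEdges, h.sum_triEdges]
    refine Finset.sum_congr rfl fun i _ => ?_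
    set n := outwardNormal {t} (t.erase (i : Plane)) with hn
    obtain ⟨p, hp, hpn⟩ := RT_normal hq n (h.height i * h.bary i 0)
    have hae : ∀ᵐ x ∂edgeMeasure (t.erase (i : Plane)), ⟪q x, n⟫ = p x := by
      filter_upwards [ae_edgeMeasure_mem (t.erase (i : Plane))] with x hx
      refine hpn x ?_
      have := h.inner_normal_edge hx 0
      rwa [sub_zero, real_inner_comm] at this
    have c (g : Plane → ℝ) : ∫ x, g x * ⟪q x, n⟫ ∂edgeMeasure (t.erase (i : Plane))
        = ∫ x, g x * p x ∂edgeMeasure (t.erase (i : Plane)) :=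
      integral_congr_ae (by filter_upwards [hae] with x hx; rw [hx])
    rw [c, c, hzτ _ (h.mem_triEdges i) p hp]
  have e2 : ∫ x in hull t, u x * divergence q x
      = (∫ x in hull t, u x * partialD 0 (fun y => q y 0) x)
        + ∫ x in hull t, u x * partialD 1 (fun y => q y 1) x := by
    rw [← integral_add (integrable_mul_of_memLp hu.memLp (hm' 0))
      (integrable_mul_of_memLp hu.memLp (hm' 1))]
    simp only [divergence, Fin.sum_univ_two, mul_add]
  have e3 : ∫ x in hull t, ⟪!₂[G 0 x, G 1 x], q x⟫
      = (∫ x in hull t, G 0 x * q x 0) + ∫ x in hull t, G 1 x * q x 1 := by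
    rw [← integral_add (integrable_mul_of_memLp (hu.memLp_grad 0) (hm 0))
      (integrable_mul_of_memLp (hu.memLp_grad 1) (hm 1))]
    simp [inner_plane]
  have e4 : ∑ e ∈ triEdges t, ∫ x, τ e x * ⟪q x, outwardNormal {t} e⟫ ∂edgeMeasure e
      = (∑ i : t, outwardNormal {t} (t.erase (i : Plane)) 0 *
        ∫ x, τ (t.erase (i : Plane)) x * q x 0 ∂edgeMeasure (t.erase (i : Plane)))
        + ∑ i : t, outwardNormal {t} (t.erase (i : Plane)) 1 *
        ∫ x, τ (t.erase (i : Plane)) x * q x 1 ∂edgeMeasure (t.erase (i : Plane)) := by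
    rw [h.sum_triEdges, ← Finset.sum_add_distrib]
    refine Finset.sum_congr rfl fun i _ => ?_
    have hI (j : Fin 2) := integrable_mul_of_memLp (hu.memLp_trace _ (h.mem_triEdges i))
      (memLp_edge (h.card_edge i) (hqs j).continuous)
    rw [← integral_const_mul, ← integral_const_mul, ← integral_add ((hI 0).const_mul _)
      ((hI 1).const_mul _)]
    refine integral_congr_ae (ae_of_all _ fun x => ?_)
    simp only [inner_plane]
    ring
  have g0 := H1Trace.green h hu (hqs 0) 0
  have g1 := H1Trace.green h hu (hqs 1) 1
  rw [e1, e2, e3, e4, ← g0, ← g1]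
  ring

/-- The discrete gradient of the projection of `u` is the best approximation of the gradient. -/
lemma nrm_sub_discGrad_le {k : ℕ} {u : Plane → ℝ} {G : Fin 2 → Plane → ℝ}
    {τ : Finset Plane → Plane → ℝ} (hu : H1Trace t u G τ) {z : WeakFun} (hz0 : z.1 t ∈ polyFun k)
    (hzb : ∀ e ∈ triEdges t, z.2 e ∈ polyFun k)
    (hzu : ∀ q ∈ polyFun k, ∫ x in hull t, z.1 t x * q x = ∫ x in hull t, u x * q x)
    (hzτ : ∀ e ∈ triEdges t, ∀ q ∈ polyFun k,
      ∫ x, z.2 e x * q x ∂edgeMeasure e = ∫ x, τ e x * q x ∂edgeMeasure e)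
    {Q : Fin 2 → Plane → ℝ} (hQ : ∀ i, Q i ∈ polyFun k) {K : ℝ}
    (hK : ∀ i, nrm (volume.restrict (hull t)) (fun x => G i x - Q i x) ≤ K) :
    nrm (volume.restrict (hull t)) (fun x => !₂[G 0 x, G 1 x] - discGrad k z t x) ≤ 2 * K := by
  set μ := (volume : Measure Plane).restrict (hull t) with hμ
  have hz := (h.discGrad_spec hz0 hzb).1
  have hcomm := fun q hq => h.integral_inner_discGrad_of_proj hu hz0 hzb hzu hzτ (q := q) hq
  set Z := discGrad k z t with hZ
  have hQR : (fun x => !₂[Q 0 x, Q 1 x]) ∈ RT k := RT_of_polyFun (hQ 0) (hQ 1)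
  have mG : MemLp (fun x => (!₂[G 0 x, G 1 x] : Plane)) 2 μ := memLp_vec hu.memLp_grad
  have mZ : MemLp Z 2 μ := memLp_hull (RT_continuous hz) t
  have mQ : MemLp (fun x => (!₂[Q 0 x, Q 1 x] : Plane)) 2 μ := memLp_hull (RT_continuous hQR) t
  have mGZ : MemLp (fun x => !₂[G 0 x, G 1 x] - Z x) 2 μ := mG.sub mZ
  have mGQ : MemLp (fun x => !₂[G 0 x, G 1 x] - !₂[Q 0 x, Q 1 x]) 2 μ := mG.sub mQ
  have hQZ := RT_sub hQR hz
  have mQZ : MemLp (fun x => !₂[Q 0 x, Q 1 x] - Z x) 2 μ := mQ.sub mZ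
  have horth : ∫ x, ⟪!₂[G 0 x, G 1 x] - Z x, !₂[Q 0 x, Q 1 x] - Z x⟫ ∂μ = 0 := by
    simp only [inner_sub_left (𝕜 := ℝ) (_ : Plane) _ (_ - _)]
    rw [integral_sub (integrable_inner_of_memLp mG mQZ) (integrable_inner_of_memLp mZ mQZ),
      hcomm _ hQZ, sub_self]
  have hle : nrm μ (fun x => !₂[G 0 x, G 1 x] - Z x)
      ≤ nrm μ (fun x => !₂[G 0 x, G 1 x] - !₂[Q 0 x, Q 1 x]) := by
    refine le_of_sq_le_mul (nrm_nonneg _) (nrm_nonneg _) ?_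
    have e1 : nrm μ (fun x => !₂[G 0 x, G 1 x] - Z x) ^ 2
        = ∫ x, ⟪!₂[G 0 x, G 1 x] - Z x, !₂[G 0 x, G 1 x] - !₂[Q 0 x, Q 1 x]⟫ ∂μ := by
      rw [nrm_sq mGZ, ← add_zero (∫ x, ⟪_, _⟫ ∂μ), ← horth,
        ← integral_add (integrable_inner_of_memLp mGZ mGQ) (integrable_inner_of_memLp mGZ mQZ)]
      refine integral_congr_ae (ae_of_all _ fun x => ?_)
      simp only
      rw [← inner_add_right, sub_add_sub_cancel, real_inner_self_eq_norm_sq]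
    rw [e1, mul_comm]
    exact (le_abs_self _).trans (abs_integral_inner_le mGZ mGQ)
  refine hle.trans ((nrm_le_add_comp mGQ).trans ?_)
  have h0 := hK 0
  have h1 := hK 1
  simp only [PiLp.sub_apply]
  simp only [Matrix.cons_val_zero, Matrix.cons_val_one]
  linarith

/-- The consistency functional, written in terms of approximation errors. -/
lemma consistency_identity {k : ℕ} {F : Fin 2 → Plane → ℝ} {DF : Fin 2 → Fin 2 → Plane → ℝ}
    {τF : Fin 2 → Finset Plane → Plane → ℝ} (hF : ∀ i, H1Trace t (F i) (DF i) (τF i))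
    {f : Plane → ℝ} (hf : ∀ᵐ x ∂volume.restrict (hull t), f x = -(DF 0 0 x + DF 1 1 x))
    {w : WeakFun} (hw0 : w.1 t ∈ polyFun k) (hwb : ∀ e ∈ triEdges t, w.2 e ∈ polyFun k)
    {P : Fin 2 → Plane → ℝ} (hP : ∀ i, P i ∈ polyFun k) :
    (∫ x in hull t, f x * w.1 t x)
      + ∑ e ∈ triEdges t, ∫ x, (∑ j, outwardNormal {t} e j * τF j e x) * w.2 e x ∂edgeMeasure e
    = (∫ x in hull t, ⟪!₂[F 0 x, F 1 x] - !₂[P 0 x, P 1 x], grad (w.1 t) x⟫)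
      + (∑ e ∈ triEdges t, ∫ x, (∑ j, outwardNormal {t} e j * (τF j e x - P j x))
          * (w.2 e x - w.1 t x) ∂edgeMeasure e)
      + ∫ x in hull t, ⟪!₂[P 0 x, P 1 x], discGrad k w t x⟫ := by
  have hws : ContDiff ℝ ∞ (w.1 t) := polyFun_contDiff hw0
  have hwc := hws.continuous
  have hPc (i : Fin 2) : Continuous (P i) := (polyFun_contDiff (hP i) (n := 0)).continuous
  have mw := memLp_hull hwc t
  have mgw (j : Fin 2) := memLp_hull (contDiff_partialD hws j).continuous t
  have hPR : (fun x => !₂[P 0 x, P 1 x]) ∈ RT k := RT_of_polyFun (hP 0) (hP 1)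
  have mP := memLp_hull (RT_continuous hPR) t
  have mF : MemLp (fun x => (!₂[F 0 x, F 1 x] : Plane)) 2 (volume.restrict (hull t)) :=
    memLp_vec fun i => (hF i).memLp
  have mg : MemLp (grad (w.1 t)) 2 (volume.restrict (hull t)) :=
    memLp_hull (RT_continuous (grad_mem_RT hw0)) t
  have e1 : ∫ x in hull t, f x * w.1 t x
      = -((∫ x in hull t, DF 0 0 x * w.1 t x) + ∫ x in hull t, DF 1 1 x * w.1 t x) := by
    rw [← integral_add (integrable_mul_of_memLp ((hF 0).memLp_grad 0) mw)
      (integrable_mul_of_memLp ((hF 1).memLp_grad 1) mw), ← integral_neg]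
    refine integral_congr_ae ?_
    filter_upwards [hf] with x hx
    rw [hx]
    ring
  have g0 := H1Trace.green h (hF 0) hws 0
  have g1 := H1Trace.green h (hF 1) hws 1
  have e2 : ∫ x in hull t, ⟪!₂[F 0 x, F 1 x], grad (w.1 t) x⟫
      = (∫ x in hull t, F 0 x * partialD 0 (w.1 t) x)
        + ∫ x in hull t, F 1 x * partialD 1 (w.1 t) x := by
    rw [← integral_add (integrable_mul_of_memLp (hF 0).memLp (mgw 0))
      (integrable_mul_of_memLp (hF 1).memLp (mgw 1))]
    simp [inner_plane, grad]
  have e3 : ∫ x in hull t, ⟪!₂[F 0 x, F 1 x] - !₂[P 0 x, P 1 x], grad (w.1 t) x⟫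
      = (∫ x in hull t, ⟪!₂[F 0 x, F 1 x], grad (w.1 t) x⟫)
        - ∫ x in hull t, ⟪!₂[P 0 x, P 1 x], grad (w.1 t) x⟫ := by
    simp only [inner_sub_left]
    exact integral_sub (integrable_inner_of_memLp mF mg) (integrable_inner_of_memLp mP mg)
  have e4 : ∫ x in hull t, ⟪!₂[P 0 x, P 1 x], discGrad k w t x⟫
      = (∫ x in hull t, ⟪!₂[P 0 x, P 1 x], grad (w.1 t) x⟫)
        + ∑ e ∈ triEdges t, ∫ x, (w.2 e x - w.1 t x) * ⟪!₂[P 0 x, P 1 x], outwardNormal {t} e⟫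
          ∂edgeMeasure e := by
    have := (h.discGrad_spec hw0 hwb).2.2 _ hPR
    simp only [real_inner_comm (!₂[P 0 _, P 1 _] : Plane)] at this ⊢
    simp only [real_inner_comm (outwardNormal {t} _), real_inner_comm (grad (w.1 t) _)] at this ⊢
    exact this
  have e5 : ∑ e ∈ triEdges t, ∫ x, (∑ j, outwardNormal {t} e j * τF j e x) * w.2 e x ∂edgeMeasure e
      = (∑ e ∈ triEdges t, ∫ x, (∑ j, outwardNormal {t} e j * (τF j e x - P j x))
          * (w.2 e x - w.1 t x) ∂edgeMeasure e)
        + (∑ e ∈ triEdges t, ∫ x, (w.2 e x - w.1 t x) * ⟪!₂[P 0 x, P 1 x], outwardNormal {t} e⟫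
          ∂edgeMeasure e)
        + ((∑ i : t, outwardNormal {t} (t.erase (i : Plane)) 0 *
        ∫ x, τF 0 (t.erase (i : Plane)) x * w.1 t x ∂edgeMeasure (t.erase (i : Plane)))
        + ∑ i : t, outwardNormal {t} (t.erase (i : Plane)) 1 *
        ∫ x, τF 1 (t.erase (i : Plane)) x * w.1 t x ∂edgeMeasure (t.erase (i : Plane))) := by
    rw [h.sum_triEdges, h.sum_triEdges, h.sum_triEdges, ← Finset.sum_add_distrib,
      ← Finset.sum_add_distrib, ← Finset.sum_add_distrib]
    refine Finset.sum_congr rfl fun i _ => ?_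
    have mτ (j : Fin 2) := (hF j).memLp_trace _ (h.mem_triEdges i)
    have mwe := memLp_edge (h.card_edge i) hwc
    have hwbc := (polyFun_contDiff (hwb _ (h.mem_triEdges i)) (n := 0)).continuous
    have md := memLp_edge (h.card_edge i) (f := fun x => w.2 (t.erase (i : Plane)) x - w.1 t x)
      (hwbc.sub hwc)
    have mPe (j : Fin 2) := memLp_edge (h.card_edge i) (hPc j)
    have mn : MemLp (fun x => ∑ j, outwardNormal {t} (t.erase (i : Plane)) j
        * (τF j (t.erase (i : Plane)) x - P j x)) 2 (edgeMeasure (t.erase (i : Plane))) :=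
      memLp_finsetSum _ fun j _ => ((mτ j).sub (mPe j)).const_mul _
    have mPn := memLp_edge (h.card_edge i) (f := fun x =>
      ⟪!₂[P 0 x, P 1 x], outwardNormal {t} (t.erase (i : Plane))⟫)
      ((RT_continuous hPR).inner continuous_const)
    have i1 := integrable_mul_of_memLp mn md
    have i2 := integrable_mul_of_memLp md mPn
    have i3 (j : Fin 2) := (integrable_mul_of_memLp (mτ j) mwe).const_mul
      (outwardNormal {t} (t.erase (i : Plane)) j)
    rw [← integral_const_mul, ← integral_const_mul, ← integral_add (i3 0) (i3 1),
      ← integral_add i1 i2]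
    refine Eq.trans ?_ (integral_add (i1.add i2) ((i3 0).add (i3 1)))
    refine integral_congr_ae (ae_of_all _ fun x => ?_)
    simp only [Fin.sum_univ_two, inner_plane,
      Matrix.cons_val_zero, Matrix.cons_val_one]
    ring
  rw [e1, e3, e4, e5, e2, ← g0, ← g1]
  ring

end IsTri

/-- The product of the errors on an edge: the powers of the mesh size balance. -/
lemma mul_le_of_sq_le {x y a b K L r D σ : ℝ} (hr : 0 < r) (hσ : D ≤ σ * r) (hb : 0 ≤ b)
    (hL : 0 ≤ L) (hK : 0 ≤ K) (ha : 0 ≤ a)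
    (hx : r * x ^ 2 ≤ K * a ^ 2) (hy : y ^ 2 ≤ L * D * b ^ 2) :
    x * y ≤ (K * L * |σ| + 1) * (a * b) := by
  have hKL : 0 ≤ K * L * |σ| := by positivity
  have h1 : (x * y) ^ 2 ≤ ((K * L * |σ| + 1) * (a * b)) ^ 2 := by
    have h2 : r * (x * y) ^ 2 ≤ r * (K * L * |σ| * (a * b) ^ 2) := by
      calc r * (x * y) ^ 2 = (r * x ^ 2) * y ^ 2 := by ring
        _ ≤ (K * a ^ 2) * (L * D * b ^ 2) := mul_le_mul hx hy (sq_nonneg _) (by positivity)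
        _ = D * (K * a ^ 2 * (L * b ^ 2)) := by ring
        _ ≤ (|σ| * r) * (K * a ^ 2 * (L * b ^ 2)) := by
            refine mul_le_mul_of_nonneg_right (hσ.trans ?_) (by positivity)
            exact mul_le_mul_of_nonneg_right (le_abs_self σ) hr.le
        _ = _ := by ring
    have h3 := le_of_mul_le_mul_left h2 hr
    have h4 : K * L * |σ| ≤ (K * L * |σ| + 1) ^ 2 := by nlinarith
    calc (x * y) ^ 2 ≤ _ := h3
      _ ≤ (K * L * |σ| + 1) ^ 2 * (a * b) ^ 2 := mul_le_mul_of_nonneg_right h4 (sq_nonneg _)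
      _ = _ := by ring
  exact le_of_sq_le_sq h1 (by positivity)

/-- The boundary values of a function that is approximated by a smooth function. -/
lemma IsTri.H1Trace.mul_nrm_sub_sq_le {t : Finset Plane} (h : IsTri t) {c : Plane} {r D : ℝ}
    (hd : HasDisc t c r D) {g : Plane → ℝ} {G : Fin 2 → Plane → ℝ}
    {τ : Finset Plane → Plane → ℝ} (hg : H1Trace t g G τ) {p : Plane → ℝ} (hp : ContDiff ℝ ∞ p)
    {k : ℕ} {K : ℝ}
    (hK : nrm (volume.restrict (hull t)) (fun x => g x - p x) ≤ K * D ^ (k + 1))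
    (hK' : ∀ i, nrm (volume.restrict (hull t)) (fun x => G i x - partialD i p x) ≤ K * D ^ k)
    {e : Finset Plane} (he : e ∈ triEdges t) :
    r * nrm (edgeMeasure e) (fun x => τ e x - p x) ^ 2 ≤ 5 * (K * D ^ (k + 1)) ^ 2 := by
  have h1 := IsTri.H1Trace.nrm_sq_le h hd (IsTri.H1Trace.sub_smooth h hg hp) he
  have h2 := pow_le_pow_left₀ (nrm_nonneg _) hK 2
  have h3 := mul_le_mul_of_nonneg_left (add_le_add (pow_le_pow_left₀ (nrm_nonneg _) (hK' 0) 2)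
    (pow_le_pow_left₀ (nrm_nonneg _) (hK' 1) 2)) (sq_nonneg D)
  have h4 : D ^ 2 * ((K * D ^ k) ^ 2 + (K * D ^ k) ^ 2) = 2 * (K * D ^ (k + 1)) ^ 2 := by ring
  rw [h4] at h3
  linarith

/-- The consistency error on a triangle is of order `k + 1`. Here `z` is the projection of `u`,
`F` is the flux, and `P`, `Q` are polynomial approximations of the flux and of the gradient. -/
theorem exists_local_consistency (k : ℕ) (σ B : ℝ) : ∃ C : ℝ, 0 < C ∧
    ∀ {t : Finset Plane} (_ : IsTri t) {c : Plane} {r D : ℝ}, HasDisc t c r D → D ≤ σ * r →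
    ∀ {A : Plane → Plane →L[ℝ] Plane}, ContinuousOn A (openTri t) → (∀ x ∈ openTri t, ‖A x‖ ≤ B) →
    ∀ {u : Plane → ℝ} {G : Fin 2 → Plane → ℝ} {τ : Finset Plane → Plane → ℝ}, H1Trace t u G τ →
    ∀ {F : Fin 2 → Plane → ℝ} {DF : Fin 2 → Fin 2 → Plane → ℝ}
      {τF : Fin 2 → Finset Plane → Plane → ℝ}, (∀ i, H1Trace t (F i) (DF i) (τF i)) →
    (∀ᵐ x ∂volume.restrict (hull t), A x !₂[G 0 x, G 1 x] = !₂[F 0 x, F 1 x]) →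
    ∀ {f : Plane → ℝ}, (∀ᵐ x ∂volume.restrict (hull t), f x = -(DF 0 0 x + DF 1 1 x)) →
    ∀ {z : WeakFun}, z.1 t ∈ polyFun k → (∀ e ∈ triEdges t, z.2 e ∈ polyFun k) →
    (∀ q ∈ polyFun k, ∫ x in hull t, z.1 t x * q x = ∫ x in hull t, u x * q x) →
    (∀ e ∈ triEdges t, ∀ q ∈ polyFun k,
      ∫ x, z.2 e x * q x ∂edgeMeasure e = ∫ x, τ e x * q x ∂edgeMeasure e) →
    ∀ {K : ℝ}, 0 ≤ K → ∀ {P Q : Fin 2 → Plane → ℝ},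
    (∀ i, P i ∈ polyFun k) → (∀ i, Q i ∈ polyFun k) →
    (∀ i, nrm (volume.restrict (hull t)) (fun x => F i x - P i x) ≤ K * D ^ (k + 1)) →
    (∀ i j, nrm (volume.restrict (hull t)) (fun x => DF i j x - partialD j (P i) x) ≤ K * D ^ k) →
    (∀ i, nrm (volume.restrict (hull t)) (fun x => G i x - Q i x) ≤ K * D ^ (k + 1)) →
    ∀ {w : WeakFun}, w.1 t ∈ polyFun k → (∀ e ∈ triEdges t, w.2 e ∈ polyFun k) →
    |(∫ x in hull t, f x * w.1 t x)
      + (∑ e ∈ triEdges t, ∫ x, (∑ j, outwardNormal {t} e j * τF j e x) * w.2 e x ∂edgeMeasure e)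
      - ∫ x in hull t, ⟪A x (discGrad k z t x), discGrad k w t x⟫|
      ≤ C * (K * D ^ (k + 1)) * nrm (volume.restrict (hull t)) (discGrad k w t) := by
  obtain ⟨C₁, hC₁, hgrad⟩ := exists_grad_stability k σ
  obtain ⟨C₂, hC₂, hjump⟩ := exists_jump_stability k σ
  refine ⟨2 * (C₁ + 1) + 6 * (5 * C₂ * |σ| + 1) + 2 * (|B| + 1), by positivity, ?_⟩
  intro t h c r D hd hσ A hAc hAB u G τ hu F DF τF hF hAF f hf z hz0 hzb hzu hzτ K hK P Q hP hQ
    hFP hDFP hGQ w hw0 hwb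
  have hr := hd.pos
  have hD := h.diam_pos hd
  set μ := (volume : Measure Plane).restrict (hull t) with hμ
  have hPR : (fun x => !₂[P 0 x, P 1 x]) ∈ RT k := RT_of_polyFun (hP 0) (hP 1)
  have mP : MemLp (fun x => (!₂[P 0 x, P 1 x] : Plane)) 2 μ := memLp_hull (RT_continuous hPR) t
  have mF : MemLp (fun x => (!₂[F 0 x, F 1 x] : Plane)) 2 μ := memLp_vec fun i => (hF i).memLp
  have mFP : MemLp (fun x => (!₂[F 0 x, F 1 x] : Plane) - !₂[P 0 x, P 1 x]) 2 μ := mF.sub mP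
  have mG : MemLp (fun x => (!₂[G 0 x, G 1 x] : Plane)) 2 μ := memLp_vec hu.memLp_grad
  have hg := hgrad h hd hσ hw0 hwb
  have hj := hjump h hd hσ hw0 hwb
  have hWR := (h.discGrad_spec hw0 hwb).1
  have hZR := (h.discGrad_spec hz0 hzb).1
  have hGZ := h.nrm_sub_discGrad_le hu hz0 hzb hzu hzτ hQ hGQ
  rw [h.consistency_identity hF hf hw0 hwb hP]
  set W := discGrad k w t with hW
  set Z := discGrad k z t with hZ
  have mW : MemLp W 2 μ := memLp_hull (RT_continuous hWR) t
  have mZ : MemLp Z 2 μ := memLp_hull (RT_continuous hZR) t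
  have mGZ : MemLp (fun x => !₂[G 0 x, G 1 x] - Z x) 2 μ := mG.sub mZ
  set n := nrm μ W with hn
  have hn0 : 0 ≤ n := nrm_nonneg _
  set a := K * D ^ (k + 1) with ha
  have ha0 : 0 ≤ a := by positivity
  have hFPn : nrm μ (fun x => (!₂[F 0 x, F 1 x] : Plane) - !₂[P 0 x, P 1 x]) ≤ 2 * a := by
    refine (nrm_le_add_comp mFP).trans ?_
    have h0 := hFP 0
    have h1 := hFP 1
    simp only [PiLp.sub_apply, Matrix.cons_val_zero, Matrix.cons_val_one]
    linarith
  -- the coefficient applied to the error of the gradient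
  have hae : ∀ᵐ x ∂μ, x ∈ openTri t := by
    rw [hμ, ← IsTri.restrict_openTri]
    exact ae_restrict_mem IsTri.isOpen_openTri.measurableSet
  have mA {H : Plane → Plane} (hH : MemLp H 2 μ) : MemLp (fun x => A x (H x)) 2 μ := by
    have hAm : AEStronglyMeasurable A μ := by
      rw [hμ, ← IsTri.restrict_openTri]
      exact hAc.aestronglyMeasurable IsTri.isOpen_openTri.measurableSet
    refine hH.of_le_mul (c := B) ?_ ?_
    · exact (ContinuousLinearMap.id ℝ (Plane →L[ℝ] Plane)).aestronglyMeasurable_comp₂ hAm hH.1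
    · filter_upwards [hae] with x hx
      exact (A x).le_of_opNorm_le (hAB x hx) _
  have mAGZ := mA mGZ
  have hAn : nrm μ (fun x => A x (!₂[G 0 x, G 1 x] - Z x)) ≤ |B| * (2 * a) := by
    refine (nrm_mono mGZ (abs_nonneg B) ?_).trans (mul_le_mul_of_nonneg_left hGZ (abs_nonneg B))
    filter_upwards [hae] with x hx
    exact (A x).le_of_opNorm_le ((hAB x hx).trans (le_abs_self B)) _
  have e1 : |∫ x, ⟪(!₂[F 0 x, F 1 x] : Plane) - !₂[P 0 x, P 1 x], grad (w.1 t) x⟫ ∂μ|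
      ≤ 2 * (C₁ + 1) * a * n := by
    have mg : MemLp (grad (w.1 t)) 2 μ := memLp_hull (RT_continuous (grad_mem_RT hw0)) t
    refine (abs_integral_inner_le mFP mg).trans ?_
    have h1 : nrm μ (grad (w.1 t)) ≤ (C₁ + 1) * n := by
      refine le_of_sq_le_sq (hg.trans ?_) (by positivity)
      rw [mul_pow]
      exact mul_le_mul_of_nonneg_right (by nlinarith) (sq_nonneg n)
    calc _ ≤ 2 * a * ((C₁ + 1) * n) := mul_le_mul hFPn h1 (nrm_nonneg _) (by positivity)
      _ = _ := by ring
  have e2 : |∑ e ∈ triEdges t, ∫ x, (∑ j, outwardNormal {t} e j * (τF j e x - P j x))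
      * (w.2 e x - w.1 t x) ∂edgeMeasure e| ≤ 6 * (5 * C₂ * |σ| + 1) * a * n := by
    have hcard : (triEdges t).card = 3 := by
      rw [triEdges, Finset.card_powersetCard, h.card]
      rfl
    have hedge (e : Finset Plane) (he : e ∈ triEdges t) :
        |∫ x, (∑ j, outwardNormal {t} e j * (τF j e x - P j x)) * (w.2 e x - w.1 t x)
          ∂edgeMeasure e| ≤ 2 * ((5 * C₂ * |σ| + 1) * (a * n)) := by
      have hc : e.card = 2 := (Finset.mem_powersetCard.1 he).2
      have md : MemLp (fun x => w.2 e x - w.1 t x) 2 (edgeMeasure e) :=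
        memLp_edge hc ((polyFun_contDiff (hwb e he) (n := 0)).continuous.sub
          (polyFun_contDiff hw0 (n := 0)).continuous)
      have mj (j : Fin 2) : MemLp (fun x => τF j e x - P j x) 2 (edgeMeasure e) :=
        ((hF j).memLp_trace e he).sub (memLp_edge hc (polyFun_contDiff (hP j) (n := 0)).continuous)
      have hI (j : Fin 2) := integrable_mul_of_memLp (mj j) md
      have hnj (j : Fin 2) : |outwardNormal {t} e j| ≤ 1 := by
        obtain ⟨i, rfl⟩ := h.exists_of_mem_triEdges he
        have h1 := PiLp.norm_apply_le (outwardNormal {t} (t.erase (i : Plane))) j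
        rwa [h.norm_normal i, Real.norm_eq_abs] at h1
      have hsplit : ∫ x, (∑ j, outwardNormal {t} e j * (τF j e x - P j x)) * (w.2 e x - w.1 t x)
          ∂edgeMeasure e = ∑ j, outwardNormal {t} e j
            * ∫ x, (τF j e x - P j x) * (w.2 e x - w.1 t x) ∂edgeMeasure e := by
        simp only [← integral_const_mul]
        rw [← integral_finsetSum _ fun j _ => (hI j).const_mul _]
        refine integral_congr_ae (ae_of_all _ fun x => ?_)
        simp only [Finset.sum_mul, mul_assoc]
      have hone (j : Fin 2) : |∫ x, (τF j e x - P j x) * (w.2 e x - w.1 t x) ∂edgeMeasure e|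
          ≤ (5 * C₂ * |σ| + 1) * (a * n) :=
        (abs_integral_mul_le (mj j) md).trans (mul_le_of_sq_le hr hσ hn0 hC₂.le (by norm_num)
          ha0 (IsTri.H1Trace.mul_nrm_sub_sq_le h hd (hF j) (polyFun_contDiff (hP j)) (hFP j)
            (hDFP j) he) (hj e he))
      rw [hsplit, Fin.sum_univ_two]
      have h2 (j : Fin 2) : |outwardNormal {t} e j
          * ∫ x, (τF j e x - P j x) * (w.2 e x - w.1 t x) ∂edgeMeasure e|
          ≤ (5 * C₂ * |σ| + 1) * (a * n) := by
        rw [abs_mul]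
        exact (mul_le_of_le_one_left (abs_nonneg _) (hnj j)).trans (hone j)
      refine (abs_add_le _ _).trans ?_
      linarith [h2 0, h2 1]
    refine (Finset.abs_sum_le_sum_abs _ _).trans ((Finset.sum_le_sum hedge).trans (le_of_eq ?_))
    rw [Finset.sum_const, hcard, nsmul_eq_mul]
    push_cast
    ring
  have e3 : |(∫ x, ⟪(!₂[P 0 x, P 1 x] : Plane), W x⟫ ∂μ) - ∫ x, ⟪A x (Z x), W x⟫ ∂μ|
      ≤ 2 * (|B| + 1) * a * n := by
    have h1 : (∫ x, ⟪(!₂[P 0 x, P 1 x] : Plane), W x⟫ ∂μ) - ∫ x, ⟪A x (Z x), W x⟫ ∂μ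
        = (∫ x, ⟪A x (!₂[G 0 x, G 1 x] - Z x), W x⟫ ∂μ)
          - ∫ x, ⟪(!₂[F 0 x, F 1 x] : Plane) - !₂[P 0 x, P 1 x], W x⟫ ∂μ := by
      rw [← integral_sub (integrable_inner_of_memLp mP mW) (integrable_inner_of_memLp (mA mZ) mW),
        ← integral_sub (integrable_inner_of_memLp mAGZ mW) (integrable_inner_of_memLp mFP mW)]
      refine integral_congr_ae ?_
      filter_upwards [hAF] with x hx
      rw [map_sub, hx, ← inner_sub_left, ← inner_sub_left]
      congr 1
      abel
    rw [h1]
    refine (abs_sub _ _).trans ?_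
    have h2 := abs_integral_inner_le mAGZ mW
    have h3 := abs_integral_inner_le mFP mW
    have h4 := mul_le_mul_of_nonneg_right hAn hn0
    have h5 := mul_le_mul_of_nonneg_right hFPn hn0
    linarith
  rw [abs_le] at *
  constructor <;> linarith [e1.1, e1.2, e2.1, e2.2, e3.1, e3.2]

/-! ### Solutions on a triangle -/

/-- The part of the norm of `H^m(U)` that comes from the open triangle `t`. -/
noncomputable def localNorm (U : Set Plane) (m : ℕ) (g : Plane → ℝ) (t : Finset Plane) : ℝ :=
  Real.sqrt (∑ j ∈ Finset.range (m + 1), ∑ α ∈ Finset.HasAntidiagonal.antidiagonal j,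
    ∫ x in openTri t, (weakD U α g x) ^ 2)

lemma localNorm_nonneg (U : Set Plane) (m : ℕ) (g : Plane → ℝ) (t : Finset Plane) :
    0 ≤ localNorm U m g t := Real.sqrt_nonneg _

lemma localNorm_sq (U : Set Plane) (m : ℕ) (g : Plane → ℝ) (t : Finset Plane) :
    localNorm U m g t ^ 2 = ∑ j ∈ Finset.range (m + 1),
      ∑ α ∈ Finset.HasAntidiagonal.antidiagonal j, ∫ x in openTri t, (weakD U α g x) ^ 2 :=
  Real.sq_sqrt (Finset.sum_nonneg fun _ _ => Finset.sum_nonneg fun _ _ =>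
    integral_nonneg fun _ => sq_nonneg _)

namespace MemSobolev

variable {U : Set Plane} {m : ℕ} {g : Plane → ℝ}

lemma memLp_weakD (hg : MemSobolev U m g) {α : ℕ × ℕ} (hα : α.1 + α.2 ≤ m) {V : Set Plane}
    (hVU : V ⊆ U) : MemLp (weakD U α g) 2 (volume.restrict V) :=
  (weakD_spec (hg.2 α hα)).1.mono_measure (Measure.restrict_mono_set _ hVU)

lemma nrm_weakD_le (hg : MemSobolev U m g) {α : ℕ × ℕ} (hα : α.1 + α.2 ≤ m) {t : Finset Plane}
    (ht : openTri t ⊆ U) : nrm (volume.restrict (openTri t)) (weakD U α g) ≤ localNorm U m g t := by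
  refine le_of_sq_le_sq ?_ (localNorm_nonneg _ _ _ _)
  rw [localNorm_sq, nrm_sq (hg.memLp_weakD hα ht)]
  simp only [Real.norm_eq_abs, sq_abs]
  have h1 : ∫ x in openTri t, (weakD U α g x) ^ 2 ≤ ∑ β ∈ Finset.HasAntidiagonal.antidiagonal
      (α.1 + α.2), ∫ x in openTri t, (weakD U β g x) ^ 2 :=
    Finset.single_le_sum (f := fun β => ∫ x in openTri t, (weakD U β g x) ^ 2)
      (fun _ _ => integral_nonneg fun _ => sq_nonneg _)
      (Finset.HasAntidiagonal.mem_antidiagonal.2 rfl)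
  exact h1.trans (Finset.single_le_sum
    (f := fun j => ∑ β ∈ Finset.HasAntidiagonal.antidiagonal j,
      ∫ x in openTri t, (weakD U β g x) ^ 2)
    (fun _ _ => Finset.sum_nonneg fun _ _ => integral_nonneg fun _ => sq_nonneg _)
    (Finset.mem_range.2 (by omega)))

/-- The weak derivatives chosen by `weakD` are weak derivatives of each other. -/
lemma sobolevBound_weakD (hg : MemSobolev U m g) (hU : IsOpen U) {t : Finset Plane}
    (ht : openTri t ⊆ U) {l : ℕ} {α : ℕ × ℕ} (hα : α.1 + α.2 + l ≤ m) :
    SobolevBound (openTri t) l (weakD U α g) (localNorm U m g t) := by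
  induction l generalizing α with
  | zero => exact ⟨hg.memLp_weakD (by omega) ht, hg.nrm_weakD_le (by omega) ht⟩
  | succ l ih =>
    refine ⟨⟨hg.memLp_weakD (by omega) ht, hg.nrm_weakD_le (by omega) ht⟩, fun i => ?_⟩
    have ho : (α + dirIndex i).1 + (α + dirIndex i).2 = α.1 + α.2 + 1 := by
      have := dirIndex_order i
      simp only [Prod.fst_add, Prod.snd_add]
      omega
    refine ⟨weakD U (α + dirIndex i) g, ?_, ih (by omega)⟩
    exact ((weakD_spec (hg.2 α (by omega))).2.of_add
      (weakD_spec (hg.2 _ (by omega))).2).mono hU.measurableSet ht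

lemma isWeakDeriv_weakD (hg : MemSobolev U m g) (hU : IsOpen U) {V : Set Plane} (hVU : V ⊆ U)
    {α : ℕ × ℕ} (hα : α.1 + α.2 ≤ m) : IsWeakDeriv V α g (weakD U α g) :=
  (weakD_spec (hg.2 α hα)).2.mono hU.measurableSet hVU

end MemSobolev

lemma SobolevBound.exists_grad {U : Set Plane} {m : ℕ} {g : Plane → ℝ} {N : ℝ}
    (h : SobolevBound U (m + 1) g N) : ∃ G : Fin 2 → Plane → ℝ,
      (∀ i, MemLp (G i) 2 (volume.restrict U)) ∧ ∀ i, IsWeakDeriv U (dirIndex i) g (G i) := by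
  choose G h1 h2 using h.2
  exact ⟨G, fun i => (h2 i).memLp, h1⟩

/-- The components of the flux inherit the Sobolev regularity of the gradient. -/
lemma sobolevBound_flux {k : ℕ} {α B : ℝ} {T : Finset (Finset Plane)}
    {A : Plane → Plane →L[ℝ] Plane} (hA : Admissible T k α B A) {t : Finset Plane} (htT : t ∈ T)
    (h : IsTri t) {U : Set Plane} (hU : IsOpen U) (ht : openTri t ⊆ U) {u : Plane → ℝ}
    (hu : MemSobolev U (k + 2) u) (i : Fin 2) :
    SobolevBound (openTri t) (k + 1) (fun x => flux U A u x i)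
      (2 ^ (k + 2) * |B| * localNorm U (k + 2) u t) := by
  obtain ⟨hAc, hAb⟩ := hA t htT
  obtain ⟨x₀, hx₀⟩ := h.openTri_nonempty
  have hB : 0 ≤ B := (norm_nonneg _).trans ((hAb x₀ hx₀).2 0 (by omega))
  have hbd : Bornology.IsBounded (openTri t) := (isCompact_hull t).isBounded.subset IsTri.openTri_subset
  have key (j : Fin 2) : SobolevBound (openTri t) (k + 1)
      (fun x => A x (EuclideanSpace.single j 1) i * weakD U (dirIndex j) u x)
      (2 ^ (k + 1) * (B * localNorm U (k + 2) u t)) := by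
    have hN := hu.sobolevBound_weakD hU ht (l := k + 1) (α := dirIndex j)
      (by have := dirIndex_order j; omega)
    let ℓ : (Plane →L[ℝ] Plane) →L[ℝ] ℝ := (EuclideanSpace.proj i).comp
      (ContinuousLinearMap.apply ℝ Plane (EuclideanSpace.single j (1 : ℝ)))
    have hℓ : ‖ℓ‖ ≤ 1 := by
      refine ContinuousLinearMap.opNorm_le_bound _ zero_le_one fun M => ?_
      rw [one_mul]
      have h1 : ‖M (EuclideanSpace.single j 1)‖ ≤ ‖M‖ := by
        simpa using M.le_opNorm (EuclideanSpace.single j 1)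
      exact (PiLp.norm_apply_le (M (EuclideanSpace.single j 1)) i).trans h1
    have hc : CoeffBound (openTri t) (k + 1) (fun x => ℓ (A x)) B :=
      CoeffBound.of_iteratedFDeriv IsTri.isOpen_openTri hAc
        (fun l hl x hx => (hAb x hx).2 l hl) ℓ hℓ
    exact hc.mul IsTri.isOpen_openTri IsTri.convex_openTri hbd hB (localNorm_nonneg _ _ _ _) hN
  have hsum := (key 0).add hbd (key 1)
  have hfun : (fun x => flux U A u x i) = fun x => A x (EuclideanSpace.single 0 1) i
      * weakD U (dirIndex 0) u x + A x (EuclideanSpace.single 1 1) i * weakD U (dirIndex 1) u x := by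
    ext x
    have hx : weakGrad U u x = weakD U (dirIndex 0) u x • EuclideanSpace.single 0 1
        + weakD U (dirIndex 1) u x • EuclideanSpace.single 1 1 := by
      ext l
      fin_cases l <;> simp [weakGrad, dirIndex]
    rw [flux, hx, map_add, map_smul, map_smul]
    simp only [PiLp.add_apply, PiLp.smul_apply, smul_eq_mul]
    ring
  rw [hfun]
  refine hsum.mono (le_of_eq ?_)
  rw [abs_of_nonneg hB]
  ring

/-- The distributional equation holds almost everywhere in a triangle on which the flux is weakly
differentiable. -/
lemma SolvesPDE.ae_eq_neg_div {U : Set Plane} {A : Plane → Plane →L[ℝ] Plane} {f u : Plane → ℝ}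
    (hpde : SolvesPDE U A f u) (hU : IsOpen U) {V : Set Plane} (hV : IsOpen V)
    (hVb : Bornology.IsBounded V) (hVU : V ⊆ U)
    (hf : MemLp f 2 (volume.restrict V)) (hF : ∀ i, MemLp (fun x => flux U A u x i) 2 (volume.restrict V))
    {DF : Fin 2 → Fin 2 → Plane → ℝ} (hDF : ∀ i j, MemLp (DF i j) 2 (volume.restrict V))
    (hw : ∀ i j, IsWeakDeriv V (dirIndex j) (fun x => flux U A u x i) (DF i j)) :
    ∀ᵐ x ∂volume.restrict V, f x = -(DF 0 0 x + DF 1 1 x) := by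
  have hfin : IsFiniteMeasure (volume.restrict V) := ⟨by simpa using hVb.measure_lt_top⟩
  have hm : MemLp (fun x => -(DF 0 0 x + DF 1 1 x)) 2 (volume.restrict V) :=
    ((hDF 0 0).add (hDF 1 1)).neg
  refine (isWeakDeriv_zero V f).ae_eq hV hVb.measure_lt_top.ne hf hm ?_
  intro η hη hηc hηV
  have mη : MemLp η 2 (volume.restrict V) :=
    (hη.continuous.memLp_of_hasCompactSupport hηc).restrict V
  have md (i : Fin 2) : MemLp (partialD i η) 2 (volume.restrict V) := by
    rw [← multiD_dirIndex]
    exact ((contDiff_multiD hη _).continuous.memLp_of_hasCompactSupport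
      (hasCompactSupport_multiD hηc _)).restrict V
  have h1 := hpde η hη hηc (hηV.trans hVU)
  rw [setIntegral_mul_eq_of_tsupport hU.measurableSet hVU hηV,
    setIntegral_eq_of_subset_of_forall_sdiff_eq_zero hU.measurableSet hVU] at h1
  · have h2 : ∫ x in V, ⟪A x (weakGrad U u x), !₂[partialD 0 η x, partialD 1 η x]⟫
        = (∫ x in V, flux U A u x 0 * partialD 0 η x) + ∫ x in V, flux U A u x 1 * partialD 1 η x := by
      rw [← integral_add (integrable_mul_of_memLp (hF 0) (md 0))
        (integrable_mul_of_memLp (hF 1) (md 1))]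
      refine integral_congr_ae (ae_of_all _ fun x => ?_)
      simp only
      rw [inner_plane]
      simp [flux]
    have h3 (i : Fin 2) : ∫ x in V, flux U A u x i * partialD i η x = -∫ x in V, DF i i x * η x := by
      have := hw i i η hη hηc hηV
      rw [multiD_dirIndex, dirIndex_order] at this
      simpa using this
    rw [multiD_zero, zero_add, pow_zero, one_mul, ← h1, h2, h3, h3, ← neg_add,
      ← integral_add (integrable_mul_of_memLp (hDF 0 0) mη)
        (integrable_mul_of_memLp (hDF 1 1) mη), ← integral_neg]
    refine integral_congr_ae (ae_of_all _ fun x => ?_)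
    simp only
    ring
  · intro x hx
    have h0 (i : Fin 2) : partialD i η x = 0 :=
      image_eq_zero_of_notMem_tsupport fun hx' => hx.2 (hηV (tsupport_partialD_subset i η hx'))
    rw [inner_plane]
    simp [h0]

/-- The traces of a regular solution and of its flux on a triangle: `τ e` are the boundary values of
`u`, `τF i e` those of the component `i` of the flux, and `DF i j` is the derivative of that component
in direction `j`. -/
structure SolutionTraces (t : Finset Plane) (U : Set Plane) (A : Plane → Plane →L[ℝ] Plane)
    (f u : Plane → ℝ) (τ : Finset Plane → Plane → ℝ) (DF : Fin 2 → Fin 2 → Plane → ℝ)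
    (τF : Fin 2 → Finset Plane → Plane → ℝ) : Prop where
  trace_u : H1Trace t u (fun i => weakD U (dirIndex i) u) τ
  weak_u : ∀ i, IsWeakDeriv (openTri t) (dirIndex i) u (weakD U (dirIndex i) u)
  trace_flux : ∀ i, H1Trace t (fun x => flux U A u x i) (DF i) (τF i)
  weak_flux : ∀ i j, IsWeakDeriv (openTri t) (dirIndex j) (fun x => flux U A u x i) (DF i j)
  ae_eq : ∀ᵐ x ∂volume.restrict (hull t), f x = -(DF 0 0 x + DF 1 1 x)

lemma exists_solutionTraces {k : ℕ} {α B : ℝ} {T : Finset (Finset Plane)}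
    {A : Plane → Plane →L[ℝ] Plane} (hA : Admissible T k α B A) {t : Finset Plane} (htT : t ∈ T)
    (h : IsTri t) {c : Plane} {r D : ℝ} (hd : HasDisc t c r D)
    {U : Set Plane} (hU : IsOpen U) (ht : openTri t ⊆ U) {f u : Plane → ℝ}
    (hf : MemLp f 2 (volume.restrict U)) (hu : MemSobolev U (k + 2) u) (hpde : SolvesPDE U A f u) :
    ∃ τ DF τF, SolutionTraces t U A f u τ DF τF := by
  have hbd : Bornology.IsBounded (openTri t) := (isCompact_hull t).isBounded.subset IsTri.openTri_subset
  have hw (i : Fin 2) := hu.isWeakDeriv_weakD hU ht (α := dirIndex i)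
    (by have := dirIndex_order i; omega)
  have mG (i : Fin 2) : MemLp (weakD U (dirIndex i) u) 2 (volume.restrict (openTri t)) :=
    hu.memLp_weakD (by have := dirIndex_order i; omega) ht
  have mu : MemLp u 2 (volume.restrict (openTri t)) :=
    hu.1.mono_measure (Measure.restrict_mono_set _ ht)
  have hS (i : Fin 2) := sobolevBound_flux hA htT h hU ht hu i
  choose DF mDF wDF using fun i => (hS i).exists_grad
  have hae := hpde.ae_eq_neg_div hU IsTri.isOpen_openTri hbd ht
    (hf.mono_measure (Measure.restrict_mono_set _ ht)) (fun i => (hS i).memLp) mDF wDF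
  have mF (i : Fin 2) := (hS i).memLp
  rw [IsTri.restrict_openTri] at mu hae
  simp only [IsTri.restrict_openTri] at mG mDF mF
  obtain ⟨τ, hτ⟩ := h.exists_H1Trace hd mu mG hw
  choose τF hτF using fun i => h.exists_H1Trace hd (mF i) (mDF i) (wDF i)
  exact ⟨τ, DF, τF, hτ, hw, hτF, wDF, hae⟩

/-- A projection is the best approximation: it suffices that the error is orthogonal to the
difference of the two candidates. -/
lemma nrm_sub_le_of_proj {μ : Measure Plane} {θ p q : Plane → ℝ} (hθ : MemLp θ 2 μ)
    (hp : MemLp p 2 μ) (hq : MemLp q 2 μ)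
    (h : ∫ x, p x * (q x - p x) ∂μ = ∫ x, θ x * (q x - p x) ∂μ) :
    nrm μ (fun x => θ x - p x) ≤ nrm μ (fun x => θ x - q x) := by
  have m1 : MemLp (fun x => θ x - p x) 2 μ := hθ.sub hp
  have m2 : MemLp (fun x => θ x - q x) 2 μ := hθ.sub hq
  have m3 : MemLp (fun x => q x - p x) 2 μ := hq.sub hp
  refine le_of_sq_le_mul (nrm_nonneg _) (nrm_nonneg _) ?_
  have h0 : ∫ x, (θ x - p x) * (q x - p x) ∂μ = 0 := by
    rw [← sub_eq_zero.2 h.symm, ← integral_sub (integrable_mul_of_memLp hθ m3)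
      (integrable_mul_of_memLp hp m3)]
    exact integral_congr_ae (ae_of_all _ fun x => sub_mul _ _ _)
  have h1 : nrm μ (fun x => θ x - p x) ^ 2 = ∫ x, (θ x - q x) * (θ x - p x) ∂μ := by
    rw [nrm_sq_real m1, ← add_zero (∫ x, (θ x - q x) * (θ x - p x) ∂μ), ← h0,
      ← integral_add (integrable_mul_of_memLp m2 m1) (integrable_mul_of_memLp m1 m3)]
    refine integral_congr_ae (ae_of_all _ fun x => ?_)
    simp only
    ring
  rw [h1]
  exact (le_abs_self _).trans (abs_integral_mul_le m2 m1)

/-- The error of consistency on a triangle, and the distance of the normal flux from the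
polynomials on its edges, in terms of the local Sobolev norm. The coefficient and the solution are
smooth enough for the flux to be of class `H^{k+1}`. -/
theorem exists_solution_consistency (k : ℕ) (σ α B : ℝ) : ∃ C : ℝ, 0 < C ∧
    ∀ {T : Finset (Finset Plane)} {A : Plane → Plane →L[ℝ] Plane}, Admissible T k α B A →
    ∀ {t : Finset Plane}, t ∈ T → IsTri t → ∀ {c : Plane} {r D : ℝ}, HasDisc t c r D → D ≤ σ * r →
    ∀ {U : Set Plane}, IsOpen U → openTri t ⊆ U → ∀ {f u : Plane → ℝ}, MemSobolev U (k + 2) u →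
    ∀ {τ DF τF}, SolutionTraces t U A f u τ DF τF →
    (∀ {z : WeakFun}, z.1 t ∈ polyFun k → (∀ e ∈ triEdges t, z.2 e ∈ polyFun k) →
    (∀ q ∈ polyFun k, ∫ x in hull t, z.1 t x * q x = ∫ x in hull t, u x * q x) →
    (∀ e ∈ triEdges t, ∀ q ∈ polyFun k,
      ∫ x, z.2 e x * q x ∂edgeMeasure e = ∫ x, τ e x * q x ∂edgeMeasure e) →
    ∀ {w : WeakFun}, w.1 t ∈ polyFun k → (∀ e ∈ triEdges t, w.2 e ∈ polyFun k) →
    |(∫ x in hull t, f x * w.1 t x)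
      + (∑ e ∈ triEdges t, ∫ x, (∑ j, outwardNormal {t} e j * τF j e x) * w.2 e x ∂edgeMeasure e)
      - ∫ x in hull t, ⟪A x (discGrad k z t x), discGrad k w t x⟫|
      ≤ C * (localNorm U (k + 2) u t * D ^ (k + 1))
        * nrm (volume.restrict (hull t)) (discGrad k w t)) ∧
    ∀ e ∈ triEdges t, ∀ {p : Plane → ℝ}, p ∈ polyFun k →
      (∀ q ∈ polyFun k, ∫ x, p x * q x ∂edgeMeasure e
        = ∫ x, (∑ j, outwardNormal {t} e j * τF j e x) * q x ∂edgeMeasure e) →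
      r * nrm (edgeMeasure e) (fun x => (∑ j, outwardNormal {t} e j * τF j e x) - p x) ^ 2
        ≤ C * (localNorm U (k + 2) u t * D ^ (k + 1)) ^ 2 := by
  obtain ⟨C₁, hC₁, happ⟩ := SobolevBound.exists_polyFun_approx k
  obtain ⟨C₂, hC₂, hcons⟩ := exists_local_consistency k σ B
  set b : ℝ := 2 ^ (k + 2) * |B| + 1 with hb
  have hb1 : 1 ≤ b := le_add_of_nonneg_left (by positivity)
  refine ⟨C₂ * C₁ * b + 20 * (C₁ * b) ^ 2, by positivity, ?_⟩
  intro T A hA t htT h c r D hd hσ U hU ht f u hu τ DF τF hs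
  have hD : 0 < D := h.diam_pos hd
  obtain ⟨hAc, hAb⟩ := hA t htT
  set N := localNorm U (k + 2) u t with hN
  have hN0 : 0 ≤ N := localNorm_nonneg _ _ _ _
  have hdist : ∀ x ∈ openTri t, ∀ y ∈ openTri t, ‖x - y‖ ≤ D := fun x hx y hy => by
    rw [← dist_eq_norm]
    exact (Metric.dist_le_diam_of_mem (isCompact_hull t).isBounded (IsTri.openTri_subset hx)
      (IsTri.openTri_subset hy)).trans hd.diam
  -- the approximation estimate asks for a positive bound of the Sobolev norm: `N + ε` is used, and
  -- `ε` tends to zero at the end (`hlim`)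
  have hPQ (ε : ℝ) (hε : 0 < ε) : ∃ P Q : Fin 2 → Plane → ℝ, (∀ i, P i ∈ polyFun k) ∧
      (∀ i, Q i ∈ polyFun k) ∧
      (∀ i, nrm (volume.restrict (hull t)) (fun x => flux U A u x i - P i x)
        ≤ C₁ * b * (N + ε) * D ^ (k + 1)) ∧
      (∀ i j, nrm (volume.restrict (hull t)) (fun x => DF i j x - partialD j (P i) x)
        ≤ C₁ * b * (N + ε) * D ^ k) ∧
      ∀ i, nrm (volume.restrict (hull t)) (fun x => weakD U (dirIndex i) u x - Q i x)
        ≤ C₁ * b * (N + ε) * D ^ (k + 1) := by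
    have hbN : 0 < b * (N + ε) := by positivity
    have hF (i : Fin 2) := happ (q := fun x => flux U A u x i) (N := b * (N + ε))
      IsTri.isOpen_openTri IsTri.convex_openTri h.openTri_nonempty hD hdist hbN
      ((sobolevBound_flux hA htT h hU ht hu i).mono (by
        have := mul_nonneg (abs_nonneg B) hε.le
        have h2 : 0 ≤ (2 : ℝ) ^ (k + 2) := by positivity
        rw [hb, ← hN]
        nlinarith [mul_nonneg h2 this])) (G := DF i) (fun j => by
          rw [IsTri.restrict_openTri]; exact (hs.trace_flux i).memLp_grad j) (hs.weak_flux i)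
    have hG (i : Fin 2) : ∃ Q ∈ polyFun k,
        nrm (volume.restrict (openTri t)) (fun x => weakD U (dirIndex i) u x - Q x)
          ≤ C₁ * D ^ (k + 1) * (b * (N + ε)) := by
      have hSB := (hu.sobolevBound_weakD hU ht (l := k + 1) (α := dirIndex i)
        (by have := dirIndex_order i; omega)).mono (N' := b * (N + ε))
        (by nlinarith [mul_nonneg (sub_nonneg.2 hb1) (add_pos_of_nonneg_of_pos hN0 hε).le])
      obtain ⟨G', hG', hG''⟩ := hSB.exists_grad
      obtain ⟨Q, hQ, hQ1, _⟩ := happ IsTri.isOpen_openTri IsTri.convex_openTri h.openTri_nonempty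
        hD hdist hbN hSB hG' hG''
      exact ⟨Q, hQ, hQ1⟩
    choose P hP hP1 hP2 using hF
    choose Q hQ hQ1 using hG
    simp only [IsTri.restrict_openTri] at hP1 hP2 hQ1
    refine ⟨P, Q, hP, hQ, fun i => (hP1 i).trans (le_of_eq (by ring)),
      fun i j => (hP2 i j).trans (le_of_eq (by ring)), fun i => (hQ1 i).trans (le_of_eq (by ring))⟩
  have hlim {a b' X : ℝ} (hX : ∀ ε > 0, a ≤ X * (N + ε) ^ 2 + b' * (N + ε)) :
      a ≤ X * N ^ 2 + b' * N := by
    have hc : Tendsto (fun ε : ℝ => X * (N + ε) ^ 2 + b' * (N + ε)) (𝓝[>] 0)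
        (𝓝 (X * (N + 0) ^ 2 + b' * (N + 0))) :=
      (Continuous.tendsto (by fun_prop) 0).mono_left nhdsWithin_le_nhds
    rw [add_zero] at hc
    exact ge_of_tendsto hc (eventually_mem_nhdsWithin.mono hX)
  constructor
  · intro z hz0 hzb hzu hzτ w hw0 hwb
    set n := nrm (volume.restrict (hull t)) (discGrad k w t) with hn
    have hn0 : 0 ≤ n := nrm_nonneg _
    have h1 := hlim (a := |(∫ x in hull t, f x * w.1 t x)
      + (∑ e ∈ triEdges t, ∫ x, (∑ j, outwardNormal {t} e j * τF j e x) * w.2 e x ∂edgeMeasure e)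
      - ∫ x in hull t, ⟪A x (discGrad k z t x), discGrad k w t x⟫|)
      (b' := C₂ * C₁ * b * D ^ (k + 1) * n) (X := 0) (fun ε hε => by
        obtain ⟨P, Q, hP, hQ, e1, e2, e3⟩ := hPQ ε hε
        refine (hcons h hd hσ hAc.continuousOn (fun x hx => ?_) hs.trace_u hs.trace_flux ?_ hs.ae_eq hz0
          hzb hzu hzτ (K := C₁ * b * (N + ε)) (by positivity) hP hQ e1 e2 e3 hw0 hwb).trans
            (le_of_eq ?_)
        · have := (hAb x hx).2 0 (by omega)
          rwa [norm_iteratedFDeriv_zero] at this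
        · refine ae_of_all _ fun x => ?_
          have : (!₂[weakD U (dirIndex 0) u x, weakD U (dirIndex 1) u x] : Plane)
              = weakGrad U u x := rfl
          rw [this]
          ext l
          fin_cases l <;> rfl
        · ring)
    refine h1.trans ?_
    have h2 : 0 ≤ 20 * (C₁ * b) ^ 2 * (N * D ^ (k + 1)) * n := by positivity
    nlinarith
  · intro e he p hp hproj
    set θ : Plane → ℝ := fun x => ∑ j, outwardNormal {t} e j * τF j e x with hθ
    have hc : e.card = 2 := (Finset.mem_powersetCard.1 he).2
    have hnj (j : Fin 2) : |outwardNormal {t} e j| ≤ 1 := by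
      obtain ⟨i, rfl⟩ := h.exists_of_mem_triEdges he
      have h1 := PiLp.norm_apply_le (outwardNormal {t} (t.erase (i : Plane))) j
      rwa [h.norm_normal i, Real.norm_eq_abs] at h1
    have mτ (j : Fin 2) := (hs.trace_flux j).memLp_trace e he
    have mθ : MemLp θ 2 (edgeMeasure e) := memLp_finsetSum _ fun j _ => (mτ j).const_mul _
    have mpoly {q : Plane → ℝ} (hq : q ∈ polyFun k) : MemLp q 2 (edgeMeasure e) :=
      memLp_edge hc (polyFun_contDiff hq (n := 0)).continuous
    have h1 := hlim (a := r * nrm (edgeMeasure e) (fun x => θ x - p x) ^ 2)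
      (b' := 0) (X := 20 * (C₁ * b) ^ 2 * (D ^ (k + 1)) ^ 2) (fun ε hε => by
        obtain ⟨P, Q, hP, hQ, e1, e2, e3⟩ := hPQ ε hε
        set a := C₁ * b * (N + ε) * D ^ (k + 1) with ha
        set q : Plane → ℝ := fun x => ∑ j, outwardNormal {t} e j * P j x with hq
        have hqP : q ∈ polyFun k := by
          have : q = ∑ j, outwardNormal {t} e j • P j := by
            ext x
            simp [hq]
          rw [this]
          exact Submodule.sum_mem _ fun j _ => Submodule.smul_mem _ _ (hP j)
        have hj (j : Fin 2) := IsTri.H1Trace.mul_nrm_sub_sq_le h hd (hs.trace_flux j)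
          (polyFun_contDiff (hP j)) (e1 j) (e2 j) he
        have mj (j : Fin 2) : MemLp (fun x => τF j e x - P j x) 2 (edgeMeasure e) :=
          (mτ j).sub (mpoly (hP j))
        have hle : nrm (edgeMeasure e) (fun x => θ x - q x)
            ≤ nrm (edgeMeasure e) (fun x => τF 0 e x - P 0 x)
              + nrm (edgeMeasure e) (fun x => τF 1 e x - P 1 x) := by
          have hfun : (fun x => θ x - q x) = fun x => outwardNormal {t} e 0 * (τF 0 e x - P 0 x)
              + outwardNormal {t} e 1 * (τF 1 e x - P 1 x) := by
            ext x
            simp only [hθ, hq, Fin.sum_univ_two]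
            ring
          rw [hfun]
          refine (nrm_add_le ((mj 0).const_mul _) ((mj 1).const_mul _)).trans ?_
          have hone (j : Fin 2) : nrm (edgeMeasure e)
              (fun x => outwardNormal {t} e j * (τF j e x - P j x))
              ≤ nrm (edgeMeasure e) (fun x => τF j e x - P j x) := by
            refine (nrm_mono (mj j) zero_le_one (ae_of_all _ fun x => ?_)).trans_eq (one_mul _)
            rw [norm_mul]
            exact mul_le_mul_of_nonneg_right (hnj j) (norm_nonneg _)
          exact add_le_add (hone 0) (hone 1)
        -- the projection is the best approximation in the polynomials
        have hbest := nrm_sub_le_of_proj mθ (mpoly hp) (mpoly hqP)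
          (hproj (q - p) (Submodule.sub_mem _ hqP hp))
        have h7 := pow_le_pow_left₀ (nrm_nonneg _) (hbest.trans hle) 2
        have h8 := mul_le_mul_of_nonneg_left (h7.trans (add_sq_le)) hd.pos.le
        refine h8.trans (le_trans ?_ (le_of_eq (a := 20 * a ^ 2) (by rw [ha]; ring)))
        linarith [hj 0, hj 1])
    refine h1.trans ?_
    have h2 : 0 ≤ C₂ * C₁ * b * (N * D ^ (k + 1)) ^ 2 := by positivity
    nlinarith

/-! ### Conforming meshes -/

/-- A conforming set of triangles: two of them meet in the convex hull of their common vertices. -/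
structure IsMesh (T : Finset (Finset Plane)) : Prop where
  isTri : ∀ t ∈ T, IsTri t
  conforming : ∀ s ∈ T, ∀ t ∈ T, hull s ∩ hull t ⊆ hull (s ∩ t)

lemma eq_or_eq_neg_of_orthogonal {m n v : Plane} (hm : ‖m‖ = 1) (hn : ‖n‖ = 1) (hv : v ≠ 0)
    (hmv : ⟪m, v⟫ = 0) (hnv : ⟪n, v⟫ = 0) : m = n ∨ m = -n := by
  have hm2 : ‖m‖ ^ 2 = 1 := by rw [hm, one_pow]
  have hn2 : ‖n‖ ^ 2 = 1 := by rw [hn, one_pow]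
  have hv2 : 0 < ‖v‖ ^ 2 := by positivity
  rw [normSq_plane] at hm2 hn2 hv2
  rw [inner_plane] at hmv hnv
  have hdet : m 0 * n 1 - m 1 * n 0 = 0 := by
    have h : (m 0 * n 1 - m 1 * n 0) * (v 0 ^ 2 + v 1 ^ 2) = 0 := by
      linear_combination (n 1 * v 0 - n 0 * v 1) * hmv - (m 1 * v 0 - m 0 * v 1) * hnv
    exact (mul_eq_zero.1 h).resolve_right hv2.ne'
  have hsq : (m 0 * n 0 + m 1 * n 1 - 1) * (m 0 * n 0 + m 1 * n 1 + 1) = 0 := by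
    linear_combination hn2 * (m 0 ^ 2 + m 1 ^ 2) + hm2 - (m 0 * n 1 - m 1 * n 0) * hdet
  rcases mul_eq_zero.1 hsq with h | h
  · left
    rw [← sub_eq_zero, ← norm_eq_zero, ← sq_eq_zero_iff, normSq_plane]
    simp only [PiLp.sub_apply]
    linear_combination hm2 + hn2 - 2 * h
  · right
    rw [← sub_eq_zero, ← norm_eq_zero, ← sq_eq_zero_iff, normSq_plane]
    simp only [PiLp.sub_apply, PiLp.neg_apply]
    linear_combination hm2 + hn2 + 2 * h

namespace IsTri

variable {t : Finset Plane} (h : IsTri t)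
include h

lemma bary_lineMap (i : t) (x y : Plane) (s : ℝ) :
    h.bary i (x + s • (y - x)) = h.bary i x + s * (h.bary i y - h.bary i x) := by
  have h1 := h.inner_gradBary i (x + s • (y - x)) x
  have h2 := h.inner_gradBary i y x
  rw [add_sub_cancel_left, inner_smul_right, h2] at h1
  linarith

lemma bary_pos_of_mem_edge {c : t} {x : Plane} (hx : x ∈ hull (t.erase (c : Plane)))
    (hx' : x ∉ t.erase (c : Plane)) {i : t} (hi : i ≠ c) : 0 < h.bary i x := by
  obtain ⟨hxt, hc⟩ := h.mem_edge_iff.1 hx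
  have h0 := h.mem_hull_iff.1 hxt
  obtain ⟨a, b, hab, hac, hbc, he, -, hu⟩ := h.exists_vertices c
  have hsum := h.sum_bary x
  have hsm := h.sum_bary_smul x
  rw [hu, Finset.sum_insert (by simp [hab, hac]), Finset.sum_pair hbc, hc] at hsum hsm
  have key {i j : t} (hij : h.bary i x + h.bary j x = 1)
      (hij' : h.bary i x • (i : Plane) + h.bary j x • (j : Plane) = x)
      (hj : j ≠ c) : 0 < h.bary i x := by
    refine lt_of_le_of_ne (h0 i) fun h1 => hx' ?_
    rw [← h1, zero_add] at hij
    rw [← h1, hij, zero_smul, zero_add, one_smul] at hij'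
    rw [← hij']
    exact Finset.mem_erase.2 ⟨fun h2 => hj (Subtype.ext h2), j.2⟩
  rw [zero_smul, add_zero] at hsm
  rw [add_zero] at hsum
  have hi' : i ∈ ({a, b, c} : Finset t) := hu ▸ Finset.mem_univ i
  simp only [Finset.mem_insert, Finset.mem_singleton] at hi'
  rcases hi' with rfl | rfl | rfl
  · exact key hsum hsm hbc
  · exact key (by rw [add_comm]; exact hsum) (by rw [add_comm]; exact hsm) hac
  · exact absurd rfl hi

lemma continuous_bary (i : t) : Continuous (h.bary i) :=
  (polyFun_contDiff (h.bary_mem_polyFun i) (n := 0)).continuous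

end IsTri

namespace IsMesh

variable {T : Finset (Finset Plane)} (hT : IsMesh T)
include hT

lemma mono {S : Finset (Finset Plane)} (hS : S ⊆ T) : IsMesh S :=
  ⟨fun t ht => hT.isTri t (hS ht), fun s hs t ht => hT.conforming s (hS hs) t (hS ht)⟩

omit hT in
lemma subset_iff_mem_triEdges {t e : Finset Plane} (he : e.card = 2) : e ⊆ t ↔ e ∈ triEdges t := by
  rw [triEdges, Finset.mem_powersetCard, and_iff_left he]

lemma disjoint_openTri {s t : Finset Plane} (hs : s ∈ T) (ht : t ∈ T) (hst : s ≠ t) :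
    Disjoint (openTri s) (openTri t) := by
  rw [Set.disjoint_left]
  intro x hxs hxt
  have h := hT.isTri s hs
  have hns : ¬ s ⊆ t := fun h1 => hst (Finset.eq_of_subset_of_card_le h1
    (by rw [h.card, (hT.isTri t ht).card]))
  obtain ⟨c, hcs, hct⟩ := Finset.not_subset.1 hns
  have h1 := hT.conforming s hs t ht ⟨IsTri.openTri_subset hxs, IsTri.openTri_subset hxt⟩
  have h2 : s ∩ t ⊆ s.erase c := fun y hy => by
    rw [Finset.mem_inter] at hy
    exact Finset.mem_erase.2 ⟨fun h3 => hct (h3 ▸ hy.2), hy.1⟩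
  have h3 := ((h.mem_edge_iff (c := ⟨c, hcs⟩)).1 (hull_mono h2 h1)).2
  exact absurd h3 (h.mem_openTri_iff.1 hxs ⟨c, hcs⟩).ne'

lemma inter_eq_edge {s t e : Finset Plane} (hs : s ∈ T) (ht : t ∈ T) (hst : s ≠ t)
    (hes : e ∈ triEdges s) (het : e ∈ triEdges t) : s ∩ t = e := by
  rw [triEdges, Finset.mem_powersetCard] at hes het
  symm
  refine Finset.eq_of_subset_of_card_le (Finset.subset_inter hes.1 het.1) ?_
  rw [hes.2]
  by_contra hlt
  have hsc := (hT.isTri s hs).card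
  have h1 : s ∩ t = s := Finset.eq_of_subset_of_card_le Finset.inter_subset_left (by omega)
  exact hst (Finset.eq_of_subset_of_card_le (Finset.inter_eq_left.1 h1)
    (by rw [hsc, (hT.isTri t ht).card]))

/-- Two triangles with a common edge lie on opposite sides of it. -/
lemma bary_neg {s t : Finset Plane} (hs : s ∈ T) (ht : t ∈ T) (hst : s ≠ t) {c : t} {d : s}
    (hcd : t.erase (c : Plane) = s.erase (d : Plane)) : (hT.isTri t ht).bary c d < 0 := by
  have h := hT.isTri t ht
  have h' := hT.isTri s hs
  by_contra! hneg
  obtain ⟨a, b, hab, hac, hbc, he, -, hu⟩ := h.exists_vertices c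
  set m : Plane := a + (1 / 2 : ℝ) • ((b : Plane) - a) with hm
  have hme : m ∈ hull (t.erase (c : Plane)) := by
    rw [he, hull_pair, mem_segment_iff_param]
    exact ⟨1 / 2, by norm_num, rfl⟩
  have hmc : h.bary c m = 0 := (h.mem_edge_iff.1 hme).2
  have hmd : h'.bary d m = 0 := (h'.mem_edge_iff.1 (hcd ▸ hme)).2
  have hmi (i : t) (hi : i ≠ c) : 0 < h.bary i m := by
    rw [hm, h.bary_lineMap, h.bary_vertex, h.bary_vertex]
    have hi' : i ∈ ({a, b, c} : Finset t) := hu ▸ Finset.mem_univ i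
    simp only [Finset.mem_insert, Finset.mem_singleton] at hi'
    rcases hi' with rfl | rfl | rfl
    · rw [if_pos rfl, if_neg hab]; norm_num
    · rw [if_pos rfl, if_neg hab.symm]; norm_num
    · exact absurd rfl hi
  -- the points of `s` near the midpoint of the edge belong to both triangles
  have hev : ∀ᶠ ε : ℝ in 𝓝[>] 0, ∀ i : t, i ≠ c → 0 < h.bary i (m + ε • ((d : Plane) - m)) := by
    refine eventually_all.2 fun i => ?_
    by_cases hi : i = c
    · exact Eventually.of_forall fun ε h1 => absurd hi h1
    · have hc : Continuous fun ε : ℝ => h.bary i (m + ε • ((d : Plane) - m)) :=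
        (h.continuous_bary i).comp (by fun_prop)
      have h1 := hc.tendsto 0
      simp only [zero_smul, add_zero] at h1
      exact ((h1.eventually_const_lt (hmi i hi)).filter_mono nhdsWithin_le_nhds).mono
        fun ε h2 _ => h2
  have hev' : ∀ᶠ ε : ℝ in 𝓝[>] 0, ε ≤ 1 := nhdsWithin_le_nhds (eventually_le_nhds one_pos)
  obtain ⟨ε, ⟨hε, hε1⟩, hε0⟩ := ((hev.and hev').and eventually_mem_nhdsWithin).exists
  have hε0' : (0 : ℝ) < ε := hε0
  have hxs : m + ε • ((d : Plane) - m) ∈ hull s :=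
    (convex_hull s).add_smul_sub_mem (hull_mono (Finset.erase_subset _ _) (hcd ▸ hme))
      (subset_hull s d.2) ⟨hε0'.le, hε1⟩
  have hxt : m + ε • ((d : Plane) - m) ∈ hull t := by
    refine h.mem_hull_iff.2 fun i => ?_
    by_cases hi : i = c
    · rw [hi, h.bary_lineMap, hmc]
      simpa using mul_nonneg hε0'.le hneg
    · exact (hε i hi).le
  have h1 := hT.conforming s hs t ht ⟨hxs, hxt⟩
  rw [hT.inter_eq_edge hs ht hst (e := s.erase (d : Plane)) (h'.mem_triEdges d)
    (hcd ▸ h.mem_triEdges c)] at h1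
  have h2 := (h'.mem_edge_iff.1 h1).2
  rw [h'.bary_lineMap, hmd, h'.bary_vertex, if_pos rfl] at h2
  simp only [sub_zero, mul_one, zero_add] at h2
  exact hε0'.ne' h2

/-- Both normals are orthogonal to the edge, and the triangles lie on opposite sides of it. -/
lemma outwardNormal_eq_neg {s t e : Finset Plane} (hs : s ∈ T) (ht : t ∈ T) (hst : s ≠ t)
    (hes : e ∈ triEdges s) (het : e ∈ triEdges t) :
    outwardNormal {s} e = -outwardNormal {t} e := by
  have h := hT.isTri t ht
  have h' := hT.isTri s hs
  obtain ⟨c, hc⟩ := h.exists_of_mem_triEdges het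
  obtain ⟨d, hd⟩ := h'.exists_of_mem_triEdges hes
  have hcd : t.erase (c : Plane) = s.erase (d : Plane) := by rw [← hc, ← hd]
  obtain ⟨a, b, hab, he⟩ := exists_pair_of_card (Finset.mem_powersetCard.1 het).2
  have ha : a ∈ hull e := subset_hull e (by simp [he])
  have hb : b ∈ hull e := subset_hull e (by simp [he])
  have za := (h.mem_edge_iff.1 (hc ▸ ha)).2
  have zb := (h.mem_edge_iff.1 (hc ▸ hb)).2
  have za' := (h'.mem_edge_iff.1 (hd ▸ ha)).2
  have zb' := (h'.mem_edge_iff.1 (hd ▸ hb)).2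
  have n1 := h.norm_normal c
  have n2 := h'.norm_normal d
  have e1 := h.inner_normal_sub c b a
  have e2 := h'.inner_normal_sub d b a
  have e3 := h.inner_normal_sub c d a
  have e4 := h'.inner_normal_sub d d a
  rw [← hc] at n1 e1 e3
  rw [← hd] at n2 e2 e4
  rw [za, zb, sub_self, mul_zero] at e1
  rw [za', zb', sub_self, mul_zero] at e2
  rw [za] at e3
  rw [za', h'.bary_vertex, if_pos rfl] at e4
  rcases eq_or_eq_neg_of_orthogonal n2 n1 (sub_ne_zero.2 (Ne.symm hab)) e2 e1 with h1 | h1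
  · exfalso
    rw [h1, e3] at e4
    have h2 := mul_pos_of_neg_of_neg (hT.bary_neg hs ht hst hcd) (neg_lt_zero.2 (h.height_pos c))
    have h3 := h'.height_pos d
    linarith
  · exact h1

/-- An edge belongs to at most two triangles: of three outward normals, each would be the negative of
the other two. -/
lemma card_filter_le_two {e : Finset Plane} (he : e.card = 2) :
    (T.filter (e ⊆ ·)).card ≤ 2 := by
  by_contra! hlt
  obtain ⟨a, b, c, ha, hb, hc, hab, hac, hbc⟩ := Finset.two_lt_card_iff.1 hlt
  simp only [Finset.mem_filter, subset_iff_mem_triEdges he] at ha hb hc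
  have h1 := hT.outwardNormal_eq_neg ha.1 hb.1 hab ha.2 hb.2
  have h2 := hT.outwardNormal_eq_neg ha.1 hc.1 hac ha.2 hc.2
  have h3 := hT.outwardNormal_eq_neg hb.1 hc.1 hbc hb.2 hc.2
  rw [h2, h3, neg_neg] at h1
  obtain ⟨i, hi⟩ := (hT.isTri c hc.1).exists_of_mem_triEdges hc.2
  have h4 := (hT.isTri c hc.1).norm_normal i
  rw [← hi] at h4
  have h5 : outwardNormal {c} e = 0 := by
    have h6 : (2 : ℝ) • outwardNormal {c} e = 0 := by
      rw [two_smul]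
      nth_rewrite 1 [← h1]
      exact neg_add_cancel _
    exact (smul_eq_zero.1 h6).resolve_left two_ne_zero
  rw [h5, norm_zero] at h4
  exact zero_ne_one h4

/-- Two triangles with a common edge contain a neighbourhood of its relative interior. -/
lemma exists_patch {s t e : Finset Plane} (hs : s ∈ T) (ht : t ∈ T) (hst : s ≠ t)
    (hes : e ∈ triEdges s) (het : e ∈ triEdges t) :
    ∃ V : Set Plane, IsOpen V ∧ V ⊆ hull t ∪ hull s ∧ (∀ᵐ x ∂edgeMeasure e, x ∈ V) ∧
      (∀ e' ∈ triEdges t, e' ≠ e → Disjoint (hull e') V) ∧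
      ∀ e' ∈ triEdges s, e' ≠ e → Disjoint (hull e') V := by
  have h := hT.isTri t ht
  have h' := hT.isTri s hs
  have hnn := hT.outwardNormal_eq_neg hs ht hst hes het
  have hec : e.card = 2 := (Finset.mem_powersetCard.1 het).2
  obtain ⟨c, rfl⟩ := h.exists_of_mem_triEdges het
  obtain ⟨d, hd⟩ := h'.exists_of_mem_triEdges hes
  have hopen {t : Finset Plane} (h : IsTri t) (c : t) :
      IsOpen {x | ∀ i : t, i ≠ c → 0 < h.bary i x} := by
    simp only [Set.ofPred_forall]
    exact isOpen_iInter_of_finite fun i => isOpen_iInter_of_finite fun _ =>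
      isOpen_lt continuous_const (h.continuous_bary i)
  have hdisj {t : Finset Plane} (h : IsTri t) (c : t) {V : Set Plane}
      (hV : V ⊆ {x | ∀ i : t, i ≠ c → 0 < h.bary i x}) :
      ∀ e' ∈ triEdges t, e' ≠ t.erase (c : Plane) → Disjoint (hull e') V := by
    intro e' he' hne
    obtain ⟨i, rfl⟩ := h.exists_of_mem_triEdges he'
    refine Set.disjoint_left.2 fun x hx hxV => ?_
    have hic : i ≠ c := fun h1 => hne (by rw [h1])
    exact (hV hxV i hic).ne' (h.mem_edge_iff.1 hx).2
  refine ⟨{x | ∀ i : t, i ≠ c → 0 < h.bary i x} ∩ {x | ∀ i : s, i ≠ d → 0 < h'.bary i x},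
    (hopen h c).inter (hopen h' d), ?_, ?_, hdisj h c Set.inter_subset_left,
    hd ▸ hdisj h' d Set.inter_subset_right⟩
  · rintro x ⟨hx, hx'⟩
    by_cases hxc : 0 ≤ h.bary c x
    · refine Or.inl (h.mem_hull_iff.2 fun i => ?_)
      by_cases hi : i = c
      · rwa [hi]
      · exact (hx i hi).le
    · refine Or.inr (h'.mem_hull_iff.2 fun i => ?_)
      by_cases hi : i = d
      · obtain ⟨a, b, hab, he⟩ := exists_pair_of_card hec
        have ha : a ∈ hull (t.erase (c : Plane)) := subset_hull _ (by simp [he])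
        have e1 := h.inner_normal_sub c x a
        have e2 := h'.inner_normal_sub d x a
        rw [(h.mem_edge_iff.1 ha).2] at e1
        rw [(h'.mem_edge_iff.1 (hd ▸ ha)).2, ← hd, hnn, inner_neg_left, e1] at e2
        rw [hi]
        have h1 := mul_pos_of_neg_of_neg (not_le.1 hxc) (neg_lt_zero.2 (h.height_pos c))
        by_contra! hneg
        have h2 := mul_nonneg (h'.height_pos d).le (neg_nonneg.2 hneg.le)
        linarith
      · exact (hx' i hi).le
  · -- the endpoints of an edge are negligible
    have hnull : edgeMeasure (t.erase (c : Plane)) (t.erase (c : Plane) : Finset Plane) = 0 := by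
      rw [← Set.biUnion_of_singleton ((t.erase (c : Plane) : Finset Plane) : Set Plane)]
      exact (measure_biUnion_null_iff (Finset.countable_toSet _)).2 fun x _ =>
        edgeMeasure_singleton _ x
    filter_upwards [ae_edgeMeasure_mem (t.erase (c : Plane)),
      compl_mem_ae_iff.2 hnull] with x hx hx'
    exact ⟨fun i hi => h.bary_pos_of_mem_edge hx hx' hi,
      fun i hi => h'.bary_pos_of_mem_edge (hd ▸ hx) (hd ▸ hx') hi⟩

end IsMesh

/-! ### Traces and fluxes across an edge -/

/-- A function that is orthogonal to all smooth functions supported in an open set of full measure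
vanishes almost everywhere. -/
lemma ae_eq_zero_of_integral_mul {μ : Measure Plane} [IsFiniteMeasure μ] {V : Set Plane}
    (hV : IsOpen V) (hae : ∀ᵐ x ∂μ, x ∈ V) {θ : Plane → ℝ} (hθ : MemLp θ 2 μ)
    (h : ∀ ζ : Plane → ℝ, ContDiff ℝ ∞ ζ → HasCompactSupport ζ → tsupport ζ ⊆ V →
      ∫ x, θ x * ζ x ∂μ = 0) : ∀ᵐ x ∂μ, θ x = 0 := by
  have hint : Integrable θ μ := hθ.integrable (by norm_num)
  have h0 := hV.ae_eq_zero_of_integral_contDiff_smul_eq_zero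
    (hint.locallyIntegrable.locallyIntegrableOn V) (fun ζ h1 h2 h3 => by
      rw [← h ζ h1 h2 h3]
      exact integral_congr_ae (ae_of_all _ fun x => mul_comm _ _))
  filter_upwards [h0, hae] with x hx hxV using hx hxV

/-- Green's formula for a function supported near one edge. -/
lemma IsTri.H1Trace.green_edge {t : Finset Plane} (h : IsTri t) {g : Plane → ℝ}
    {G : Fin 2 → Plane → ℝ} {τ : Finset Plane → Plane → ℝ} (hg : H1Trace t g G τ)
    {V : Set Plane} {e : Finset Plane} (he : e ∈ triEdges t)
    (hV : ∀ e' ∈ triEdges t, e' ≠ e → Disjoint (hull e') V) {ζ : Plane → ℝ}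
    (hζ : ContDiff ℝ ∞ ζ) (hζV : tsupport ζ ⊆ V) (j : Fin 2) :
    (∫ x in hull t, G j x * ζ x) + ∫ x in hull t, g x * partialD j ζ x
      = outwardNormal {t} e j * ∫ x, τ e x * ζ x ∂edgeMeasure e := by
  rw [IsTri.H1Trace.green h hg hζ j,
    ← h.sum_triEdges fun e' => outwardNormal {t} e' j * ∫ x, τ e' x * ζ x ∂edgeMeasure e',
    Finset.sum_eq_single_of_mem e he]
  intro e' he' hne
  rw [integral_eq_zero_of_ae, mul_zero]
  filter_upwards [ae_edgeMeasure_mem e'] with x hx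
  rw [image_eq_zero_of_notMem_tsupport fun h1 => Set.disjoint_left.1 (hV e' he' hne) hx (hζV h1)]
  exact mul_zero _

/-- A function that vanishes outside two disjoint triangles. -/
lemma setIntegral_eq_add_of_eq_zero {U : Set Plane} (hU : MeasurableSet U) {s t : Finset Plane}
    (hs : openTri s ⊆ U) (ht : openTri t ⊆ U) (hst : Disjoint (openTri s) (openTri t))
    {F : Plane → ℝ} (h0 : ∀ x, x ∉ hull t ∪ hull s → F x = 0) (hFs : IntegrableOn F (hull s))
    (hFt : IntegrableOn F (hull t)) :
    ∫ x in U, F x = (∫ x in hull t, F x) + ∫ x in hull s, F x := by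
  have hfr (t : Finset Plane) : ∀ᵐ x, x ∈ hull t → x ∈ openTri t := by
    have h1 : (volume : Measure Plane) (frontier (hull t)) = 0 := (convex_hull t).addHaar_frontier _
    filter_upwards [compl_mem_ae_iff.2 h1] with x hx hxt
    by_contra hx'
    exact hx ⟨subset_closure hxt, hx'⟩
  have h1 : ∫ x in openTri t ∪ openTri s, F x = ∫ x in U, F x := by
    refine (setIntegral_eq_of_subset_of_ae_sdiff_eq_zero hU.nullMeasurableSet
      (Set.union_subset ht hs) ?_).symm
    filter_upwards [hfr t, hfr s] with x hxt hxs hx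
    refine h0 x fun h2 => hx.2 ?_
    exact h2.imp hxt hxs
  rw [← h1, setIntegral_union hst.symm IsTri.isOpen_openTri.measurableSet
    (hFt.mono_set IsTri.openTri_subset) (hFs.mono_set IsTri.openTri_subset),
    IsTri.restrict_openTri, IsTri.restrict_openTri]

namespace IsMesh

variable {T : Finset (Finset Plane)} (hT : IsMesh T)
include hT

/-- The traces of a weakly differentiable function from both sides of an edge agree: Green's formula
on the two triangles is compared with the definition of the weak derivative on their union. -/
lemma trace_ae_eq {s t e : Finset Plane} (hs : s ∈ T) (ht : t ∈ T) (hst : s ≠ t)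
    (hes : e ∈ triEdges s) (het : e ∈ triEdges t) {U : Set Plane}
    (hU : U = interior (⋃ t ∈ T, hull t)) (hsU : openTri s ⊆ U) (htU : openTri t ⊆ U)
    {g : Plane → ℝ} {G : Fin 2 → Plane → ℝ} (hw : ∀ i, IsWeakDeriv U (dirIndex i) g (G i))
    {τ τ' : Finset Plane → Plane → ℝ} (hg : H1Trace t g G τ) (hg' : H1Trace s g G τ') :
    τ e =ᵐ[edgeMeasure e] τ' e := by
  have h := hT.isTri t ht
  have h' := hT.isTri s hs
  have hUo : IsOpen U := hU ▸ isOpen_interior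
  obtain ⟨V, hVo, hVst, hVe, hVt, hVs⟩ := hT.exists_patch hs ht hst hes het
  have hVU : V ⊆ U := hU ▸ interior_maximal (hVst.trans (Set.union_subset
    (Set.subset_biUnion_of_mem (u := hull) ht) (Set.subset_biUnion_of_mem (u := hull) hs))) hVo
  have := isFiniteMeasure_edge (Finset.mem_powersetCard.1 het).2
  have m1 := hg.memLp_trace e het
  have m2 := hg'.memLp_trace e hes
  obtain ⟨j, hj⟩ : ∃ j, outwardNormal {t} e j ≠ 0 := by
    by_contra! h0
    obtain ⟨i, rfl⟩ := h.exists_of_mem_triEdges het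
    have h1 := h.norm_normal i
    rw [show outwardNormal {t} (t.erase (i : Plane)) = 0 from PiLp.ext h0, norm_zero] at h1
    exact zero_ne_one h1
  have hz := ae_eq_zero_of_integral_mul hVo hVe (θ := fun x => τ e x - τ' e x) (m1.sub m2)
    (fun ζ hζ hζc hζV => by
      have mζ := memLp_edge (Finset.mem_powersetCard.1 het).2 hζ.continuous
      have h1 := hw j ζ hζ hζc (hζV.trans hVU)
      have hz (x : Plane) (hx : x ∉ hull t ∪ hull s) : ζ x = 0 :=
        image_eq_zero_of_notMem_tsupport fun h2 => hx (hVst (hζV h2))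
      have hz' (x : Plane) (hx : x ∉ hull t ∪ hull s) : partialD j ζ x = 0 :=
        image_eq_zero_of_notMem_tsupport fun h2 =>
          hx (hVst (hζV (tsupport_partialD_subset j ζ h2)))
      have hd (t : Finset Plane) := memLp_hull hζ.continuous t
      have hd' (t : Finset Plane) := memLp_hull (contDiff_partialD hζ j).continuous t
      rw [multiD_dirIndex, dirIndex_order, pow_one,
        setIntegral_eq_add_of_eq_zero hUo.measurableSet hsU htU (hT.disjoint_openTri hs ht hst)
          (fun x hx => by rw [hz' x hx, mul_zero]) (integrable_mul_of_memLp hg'.memLp (hd' s))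
          (integrable_mul_of_memLp hg.memLp (hd' t)),
        setIntegral_eq_add_of_eq_zero hUo.measurableSet hsU htU (hT.disjoint_openTri hs ht hst)
          (fun x hx => by rw [hz x hx, mul_zero])
          (integrable_mul_of_memLp (hg'.memLp_grad j) (hd s))
          (integrable_mul_of_memLp (hg.memLp_grad j) (hd t))] at h1
      have e1 := IsTri.H1Trace.green_edge h hg het hVt hζ hζV j
      have e2 := IsTri.H1Trace.green_edge h' hg' hes hVs hζ hζV j
      rw [hT.outwardNormal_eq_neg hs ht hst hes het, PiLp.neg_apply] at e2
      simp only [sub_mul]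
      rw [integral_sub (integrable_mul_of_memLp m1 mζ) (integrable_mul_of_memLp m2 mζ)]
      refine (mul_eq_zero.1 (?_ : outwardNormal {t} e j * _ = 0)).resolve_left hj
      linarith)
  filter_upwards [hz] with x hx using sub_eq_zero.1 hx

/-- The normal components of the flux from both sides of an edge cancel: only the divergence of the
flux is a function on the union of the two triangles, not its full gradient. -/
lemma flux_ae_eq {s t e : Finset Plane} (hs : s ∈ T) (ht : t ∈ T) (hst : s ≠ t)
    (hes : e ∈ triEdges s) (het : e ∈ triEdges t) {U : Set Plane}
    (hU : U = interior (⋃ t ∈ T, hull t)) (hsU : openTri s ⊆ U) (htU : openTri t ⊆ U)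
    {A : Plane → Plane →L[ℝ] Plane} {f u : Plane → ℝ} (hpde : SolvesPDE U A f u)
    {τ τ' DF DF' τF τF'} (hg : SolutionTraces t U A f u τ DF τF)
    (hg' : SolutionTraces s U A f u τ' DF' τF') :
    ∀ᵐ x ∂edgeMeasure e, (∑ j, outwardNormal {t} e j * τF j e x)
      + ∑ j, outwardNormal {s} e j * τF' j e x = 0 := by
  have h := hT.isTri t ht
  have h' := hT.isTri s hs
  have hUo : IsOpen U := hU ▸ isOpen_interior
  obtain ⟨V, hVo, hVst, hVe, hVt, hVs⟩ := hT.exists_patch hs ht hst hes het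
  have hVU : V ⊆ U := hU ▸ interior_maximal (hVst.trans (Set.union_subset
    (Set.subset_biUnion_of_mem (u := hull) ht) (Set.subset_biUnion_of_mem (u := hull) hs))) hVo
  have hec := (Finset.mem_powersetCard.1 het).2
  have := isFiniteMeasure_edge hec
  have m1 (j : Fin 2) := (hg.trace_flux j).memLp_trace e het
  have m2 (j : Fin 2) := (hg'.trace_flux j).memLp_trace e hes
  refine ae_eq_zero_of_integral_mul hVo hVe ((memLp_finsetSum _ fun j _ => (m1 j).const_mul _).add
    (memLp_finsetSum _ fun j _ => (m2 j).const_mul _)) fun ζ hζ hζc hζV => ?_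
  have mζ := memLp_edge hec hζ.continuous
  have h1 := hpde ζ hζ hζc (hζV.trans hVU)
  have hz (x : Plane) (hx : x ∉ hull t ∪ hull s) : ζ x = 0 :=
    image_eq_zero_of_notMem_tsupport fun h2 => hx (hVst (hζV h2))
  have hz' (j : Fin 2) (x : Plane) (hx : x ∉ hull t ∪ hull s) : partialD j ζ x = 0 :=
    image_eq_zero_of_notMem_tsupport fun h2 =>
      hx (hVst (hζV (tsupport_partialD_subset j ζ h2)))
  have hd (t : Finset Plane) := memLp_hull hζ.continuous t
  have hd' (j : Fin 2) (t : Finset Plane) := memLp_hull (contDiff_partialD hζ j).continuous t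
  have hflux (x : Plane) : ⟪A x (weakGrad U u x), !₂[partialD 0 ζ x, partialD 1 ζ x]⟫
      = flux U A u x 0 * partialD 0 ζ x + flux U A u x 1 * partialD 1 ζ x := by
    rw [inner_plane]
    simp [flux]
  have key {t : Finset Plane} {τ DF τF} (hg : SolutionTraces t U A f u τ DF τF) :
      IntegrableOn (fun x => flux U A u x 0 * partialD 0 ζ x + flux U A u x 1 * partialD 1 ζ x)
        (hull t) ∧ IntegrableOn (fun x => f x * ζ x) (hull t) ∧
      (∫ x in hull t, (flux U A u x 0 * partialD 0 ζ x + flux U A u x 1 * partialD 1 ζ x))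
        - ∫ x in hull t, f x * ζ x = ∑ j, ((∫ x in hull t, DF j j x * ζ x)
          + ∫ x in hull t, flux U A u x j * partialD j ζ x) := by
    have i1 (j : Fin 2) := integrable_mul_of_memLp (hg.trace_flux j).memLp (hd' j t)
    have i2 (j : Fin 2) := integrable_mul_of_memLp ((hg.trace_flux j).memLp_grad j) (hd t)
    have hf : (fun x => f x * ζ x) =ᵐ[volume.restrict (hull t)]
        fun x => -(DF 0 0 x * ζ x + DF 1 1 x * ζ x) := by
      filter_upwards [hg.ae_eq] with x hx
      rw [hx]
      ring
    have i3 : Integrable (fun x => -(DF 0 0 x * ζ x + DF 1 1 x * ζ x))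
        (volume.restrict (hull t)) := ((i2 0).add (i2 1)).neg
    refine ⟨(i1 0).add (i1 1), i3.congr hf.symm, ?_⟩
    rw [integral_congr_ae hf, integral_neg, integral_add (i1 0) (i1 1),
      integral_add (i2 0) (i2 1), Fin.sum_univ_two]
    ring
  obtain ⟨i1, i2, k1⟩ := key hg
  obtain ⟨i1', i2', k2⟩ := key hg'
  simp only [hflux] at h1
  rw [setIntegral_eq_add_of_eq_zero hUo.measurableSet hsU htU (hT.disjoint_openTri hs ht hst)
      (fun x hx => by rw [hz' 0 x hx, hz' 1 x hx, mul_zero, mul_zero, add_zero]) i1' i1,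
    setIntegral_eq_add_of_eq_zero hUo.measurableSet hsU htU (hT.disjoint_openTri hs ht hst)
      (fun x hx => by rw [hz x hx, mul_zero]) i2' i2] at h1
  have e1 (j : Fin 2) := IsTri.H1Trace.green_edge h (hg.trace_flux j) het hVt hζ hζV j
  have e2 (j : Fin 2) := IsTri.H1Trace.green_edge h' (hg'.trace_flux j) hes hVs hζ hζV j
  simp only [e1] at k1
  simp only [e2] at k2
  have e3 (ν : Plane) {σ : Fin 2 → Plane → ℝ} (hσ : ∀ j, MemLp (σ j) 2 (edgeMeasure e)) :
      Integrable (fun x => (∑ j, ν j * σ j x) * ζ x) (edgeMeasure e) ∧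
      ∫ x, (∑ j, ν j * σ j x) * ζ x ∂edgeMeasure e
        = ∑ j, ν j * ∫ x, σ j x * ζ x ∂edgeMeasure e := by
    have hi (j : Fin 2) := (integrable_mul_of_memLp (hσ j) mζ).const_mul (ν j)
    simp only [Finset.sum_mul, mul_assoc]
    refine ⟨integrable_finsetSum _ fun j _ => hi j, ?_⟩
    rw [integral_finsetSum _ fun j _ => hi j]
    simp only [integral_const_mul]
  have e4 := e3 (outwardNormal {t} e) m1
  have e5 := e3 (outwardNormal {s} e) m2
  simp only [add_mul]
  rw [integral_add e4.1 e5.1, e4.2, e5.2]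
  linarith

end IsMesh

/-! ### A subdomain with its mesh -/

lemma sum_localNorm_sq_le {T : Finset (Finset Plane)} (hT : IsMesh T) {U : Set Plane}
    (hsub : ∀ t ∈ T, openTri t ⊆ U) {m : ℕ} {g : Plane → ℝ} (hg : MemSobolev U m g) :
    ∑ t ∈ T, localNorm U m g t ^ 2 ≤ sobolevNorm U m g ^ 2 := by
  rw [sobolevNorm, Real.sq_sqrt (Finset.sum_nonneg fun _ _ => Finset.sum_nonneg fun _ _ =>
    integral_nonneg fun _ => sq_nonneg _)]
  simp only [localNorm_sq]
  rw [Finset.sum_comm]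
  refine Finset.sum_le_sum fun j hj => ?_
  rw [Finset.sum_comm]
  refine Finset.sum_le_sum fun α hα => ?_
  have hα' : α.1 + α.2 ≤ m := by
    rw [Finset.HasAntidiagonal.mem_antidiagonal] at hα
    have := Finset.mem_range.1 hj
    omega
  have hint : IntegrableOn (fun x => weakD U α g x ^ 2) U :=
    (hg.memLp_weakD hα' subset_rfl).integrable_sq
  have hsub' : ⋃ t ∈ T, openTri t ⊆ U := Set.iUnion₂_subset hsub
  rw [← integral_biUnion_finset T (fun t _ => IsTri.isOpen_openTri.measurableSet)
    (fun s hs t ht hst => hT.disjoint_openTri hs ht hst)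
    (fun t ht => hint.mono_set (hsub t ht))]
  exact setIntegral_mono_set hint (ae_of_all _ fun x => sq_nonneg _) hsub'.eventuallyLE

/-- The outward normal of a subdomain on a boundary edge is that of the adjacent triangle. -/
lemma outwardNormal_eq_singleton {T : Finset (Finset Plane)} {t e : Finset Plane}
    (he : T.filter (e ⊆ ·) = {t}) : outwardNormal T e = outwardNormal {t} e := by
  have h1 (s : Finset Plane) : s ∈ T ∧ e ⊆ s ↔ s = t := by
    rw [← Finset.mem_singleton, ← he, Finset.mem_filter]
  have h2 : e ⊆ t := ((h1 t).2 rfl).2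
  unfold outwardNormal
  congr 1
  ext n
  refine and_congr_right fun _ => and_congr_right fun _ => ⟨fun h3 s hs => ?_, fun h3 s hs hes => ?_⟩
  · rw [Finset.mem_singleton] at hs
    exact h3 s ((h1 s).2 hs).1
  · exact h3 s (Finset.mem_singleton.2 ((h1 s).1 ⟨hs, hes⟩)) hes

/-- The trace is determined by the traces from the single triangles. -/
lemma memLp_trace_and_ae_eq {T : Finset (Finset Plane)} (hT : ∀ t ∈ T, IsTri t)
    {e t₀ : Finset Plane} (hec : e.card = 2) (ht₀ : t₀ ∈ T) (het₀ : e ⊆ t₀) {g τ : Plane → ℝ}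
    (hτ : MemLp τ 2 (edgeMeasure e))
    (h : ∀ t ∈ T, e ⊆ t → ∃ c r D G τ', HasDisc t c r D ∧ H1Trace t g G τ' ∧
      (∀ i, IsWeakDeriv (openTri t) (dirIndex i) g (G i)) ∧ τ =ᵐ[edgeMeasure e] τ' e) :
    MemLp (trace T e g) 2 (edgeMeasure e) ∧ trace T e g =ᵐ[edgeMeasure e] τ := by
  have hspec : MemLp (trace T e g) 2 (edgeMeasure e) ∧
      ∀ t ∈ T, e ⊆ t → IsTraceFrom t e g (trace T e g) := by
    refine Classical.epsilon_spec (p := fun τ : Plane → ℝ => MemLp τ 2 (edgeMeasure e) ∧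
      ∀ t ∈ T, e ⊆ t → IsTraceFrom t e g τ) ⟨τ, hτ, fun t ht het => ?_⟩
    obtain ⟨c, r, D, G, τ', hd, hg, hw, hτ'⟩ := h t ht het
    exact (IsTri.H1Trace.isTraceFrom_iff (hT t ht) hd hg hw
      ((IsMesh.subset_iff_mem_triEdges hec).1 het) hτ).2 hτ'
  refine ⟨hspec.1, ?_⟩
  obtain ⟨c, r, D, G, τ', hd, hg, hw, hτ'⟩ := h t₀ ht₀ het₀
  exact ((IsTri.H1Trace.isTraceFrom_iff (hT t₀ ht₀) hd hg hw
    ((IsMesh.subset_iff_mem_triEdges hec).1 het₀) hspec.1).1 (hspec.2 t₀ ht₀ het₀)).trans hτ'.symm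

/-- The edges outside `Γ` that belong to just one triangle. For the two subdomains of an interface
mesh these are, by definition, `bdryEdges₁` and `bdryEdges₂`. -/
noncomputable def bdryEdges (T Γ : Finset (Finset Plane)) : Finset (Finset Plane) :=
  (meshEdges T).filter fun e => e ∉ Γ ∧ (T.filter (e ⊆ ·)).card = 1

/-- One of the two subdomains `U` with its mesh `T`, the interface edges `Γ`, and a regular
solution `u` of the equation. Here `σ` is the shape regularity parameter, `α` and `B` are the bounds
of the coefficient, and `h` is an upper bound of the diameters. -/
structure Side (k : ℕ) (σ α B h : ℝ) (T Γ : Finset (Finset Plane)) (U : Set Plane)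
    (A : Plane → Plane →L[ℝ] Plane) (f u : Plane → ℝ) : Prop where
  mesh : IsMesh T
  fits : U = interior (⋃ t ∈ T, hull t)
  disc : ∀ t ∈ T, ∃ c r, HasDisc t c r (Metric.diam (hull t)) ∧ Metric.diam (hull t) ≤ σ * r
  diam_le : ∀ t ∈ T, Metric.diam (hull t) ≤ h
  gamma_subset : Γ ⊆ meshEdges T
  card_gamma : ∀ e ∈ Γ, (T.filter (e ⊆ ·)).card = 1
  coeff : Admissible T k α B A
  memLp_f : MemLp f 2 (volume.restrict U)
  memSobolev : MemSobolev U (k + 2) u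
  pde : SolvesPDE U A f u

lemma card_of_mem_meshEdges {T : Finset (Finset Plane)} {e : Finset Plane}
    (he : e ∈ meshEdges T) : e.card = 2 := by
  obtain ⟨t, -, ht⟩ := Finset.mem_biUnion.1 he
  exact (Finset.mem_powersetCard.1 ht).2

/-- A sum over the triangles and their edges, rearranged by edges. -/
lemma sum_sum_triEdges (T : Finset (Finset Plane)) (F : Finset Plane → Finset Plane → ℝ) :
    ∑ t ∈ T, ∑ e ∈ triEdges t, F t e
      = ∑ e ∈ meshEdges T, ∑ t ∈ T.filter (e ⊆ ·), F t e := by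
  refine Finset.sum_comm' fun t e => ?_
  rw [Finset.mem_filter]
  constructor
  · rintro ⟨ht, he⟩
    exact ⟨⟨ht, (Finset.mem_powersetCard.1 he).1⟩, Finset.mem_biUnion.2 ⟨t, ht, he⟩⟩
  · rintro ⟨⟨ht, hes⟩, he⟩
    exact ⟨ht, (IsMesh.subset_iff_mem_triEdges (card_of_mem_meshEdges he)).1 hes⟩

namespace Side

variable {k : ℕ} {σ α B h : ℝ} {T Γ : Finset (Finset Plane)} {U : Set Plane}
  {A : Plane → Plane →L[ℝ] Plane} {f u : Plane → ℝ}
  {τ : Finset Plane → Finset Plane → Plane → ℝ} {DF : Finset Plane → Fin 2 → Fin 2 → Plane → ℝ}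
  {τF : Finset Plane → Fin 2 → Finset Plane → Plane → ℝ} (S : Side k σ α B h T Γ U A f u)
include S

lemma isOpen : IsOpen U := S.fits ▸ isOpen_interior

lemma openTri_subset {t : Finset Plane} (ht : t ∈ T) : openTri t ⊆ U := by
  rw [S.fits]
  exact interior_mono (Set.subset_biUnion_of_mem (u := hull) ht)

lemma exists_traces : ∃ (τ : Finset Plane → Finset Plane → Plane → ℝ)
    (DF : Finset Plane → Fin 2 → Fin 2 → Plane → ℝ)
    (τF : Finset Plane → Fin 2 → Finset Plane → Plane → ℝ),
    ∀ t ∈ T, SolutionTraces t U A f u (τ t) (DF t) (τF t) := by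
  have h1 : ∀ t ∈ T, ∃ τ DF τF, SolutionTraces t U A f u τ DF τF := fun t ht => by
    obtain ⟨c, r, hd, -⟩ := S.disc t ht
    exact exists_solutionTraces S.coeff ht (S.mesh.isTri t ht) hd S.isOpen (S.openTri_subset ht)
      S.memLp_f S.memSobolev S.pde
  choose! τ DF τF h2 using h1
  exact ⟨τ, DF, τF, h2⟩

lemma filter_gamma {e t : Finset Plane} (he : e ∈ Γ) (ht : t ∈ T) (het : e ∈ triEdges t) :
    T.filter (e ⊆ ·) = {t} := by
  obtain ⟨s, hs⟩ := Finset.card_eq_one.1 (S.card_gamma e he)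
  have h1 : t ∈ T.filter (e ⊆ ·) := Finset.mem_filter.2 ⟨ht, (Finset.mem_powersetCard.1 het).1⟩
  rw [hs, Finset.mem_singleton] at h1
  rw [hs, h1]

/-- The trace on an edge is well defined also where two triangles meet, and may be computed from
either of them. -/
lemma trace_spec (hS : ∀ t ∈ T, SolutionTraces t U A f u (τ t) (DF t) (τF t))
    {t e : Finset Plane} (ht : t ∈ T) (het : e ∈ triEdges t) :
    MemLp (trace T e u) 2 (edgeMeasure e) ∧ trace T e u =ᵐ[edgeMeasure e] τ t e := by
  have hec := (Finset.mem_powersetCard.1 het).2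
  have hw (i : Fin 2) := S.memSobolev.isWeakDeriv_weakD S.isOpen subset_rfl (α := dirIndex i)
    (by have := dirIndex_order i; omega)
  refine memLp_trace_and_ae_eq S.mesh.isTri hec ht (Finset.mem_powersetCard.1 het).1
    ((hS t ht).trace_u.memLp_trace e het) fun s hs hes => ?_
  obtain ⟨c, r, hd, -⟩ := S.disc s hs
  refine ⟨c, r, _, _, τ s, hd, (hS s hs).trace_u, (hS s hs).weak_u, ?_⟩
  by_cases hst : s = t
  · rw [hst]
  · exact S.mesh.trace_ae_eq hs ht hst ((IsMesh.subset_iff_mem_triEdges hec).1 hes) het S.fits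
      (S.openTri_subset hs) (S.openTri_subset ht) hw (hS t ht).trace_u (hS s hs).trace_u

lemma normalTrace_spec (hS : ∀ t ∈ T, SolutionTraces t U A f u (τ t) (DF t) (τF t))
    {t e : Finset Plane} (he : e ∈ Γ) (ht : t ∈ T) (het : e ∈ triEdges t) :
    MemLp (normalTrace T e (flux U A u)) 2 (edgeMeasure e) ∧
    normalTrace T e (flux U A u) =ᵐ[edgeMeasure e]
      fun x => ∑ j, outwardNormal {t} e j * τF t j e x := by
  have hec := (Finset.mem_powersetCard.1 het).2
  have hf := S.filter_gamma he ht het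
  have h1 (j : Fin 2) : MemLp (trace T e (fun y => flux U A u y j)) 2 (edgeMeasure e) ∧
      trace T e (fun y => flux U A u y j) =ᵐ[edgeMeasure e] τF t j e := by
    refine memLp_trace_and_ae_eq S.mesh.isTri hec ht (Finset.mem_powersetCard.1 het).1
      (((hS t ht).trace_flux j).memLp_trace e het) fun s hs hes => ?_
    have hst : s ∈ T.filter (e ⊆ ·) := Finset.mem_filter.2 ⟨hs, hes⟩
    rw [hf, Finset.mem_singleton] at hst
    obtain ⟨c, r, hd, -⟩ := S.disc s hs
    exact ⟨c, r, _, _, τF s j, hd, (hS s hs).trace_flux j, (hS s hs).weak_flux j, by rw [hst]⟩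
  refine ⟨memLp_finsetSum _ fun j _ => (h1 j).1.const_mul _, ?_⟩
  filter_upwards [(h1 0).2, (h1 1).2] with x hx0 hx1
  rw [normalTrace, outwardNormal_eq_singleton hf, Fin.sum_univ_two, Fin.sum_univ_two, hx0, hx1]

/-- The projections in `Qh` exist, so that `Qh k T u` is characterized by its moments. -/
lemma Qh_spec : Qh k T u ∈ WGSpace k T ∧
    (∀ t ∈ T, ∀ q ∈ polyFun k, ∫ x in hull t, (Qh k T u).1 t x * q x = ∫ x in hull t, u x * q x) ∧
    ∀ e ∈ meshEdges T, MemLp (trace T e u) 2 (edgeMeasure e) ∧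
      ∀ q ∈ polyFun k, ∫ x, (Qh k T u).2 e x * q x ∂edgeMeasure e
        = ∫ x, trace T e u x * q x ∂edgeMeasure e := by
  obtain ⟨τ, DF, τF, hS⟩ := S.exists_traces
  have h1 (t : Finset Plane) (ht : t ∈ T) := l2Proj_spec k (isCompact_hull t)
    (ae_restrict_mem (measurableSet_hull t)) (hS t ht).trace_u.memLp
  have h2 (e : Finset Plane) (he : e ∈ meshEdges T) : MemLp (trace T e u) 2 (edgeMeasure e) := by
    obtain ⟨t, ht, het⟩ := Finset.mem_biUnion.1 he
    exact (S.trace_spec hS ht het).1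
  have h3 (e : Finset Plane) (he : e ∈ meshEdges T) :=
    have := isFiniteMeasure_edge (card_of_mem_meshEdges he)
    l2Proj_spec k (isCompact_hull e) (ae_edgeMeasure_mem e) (h2 e he)
  exact ⟨⟨fun t ht => (h1 t ht).1, fun e he => (h3 e he).1⟩, fun t ht => (h1 t ht).2,
    fun e he => ⟨h2 e he, (h3 e he).2⟩⟩

/-- Only the interface contributes to the sum of the normal fluxes over the boundaries of the
triangles. -/
lemma sum_normal_flux (hS : ∀ t ∈ T, SolutionTraces t U A f u (τ t) (DF t) (τF t))
    {w : WeakFun} (hw : w ∈ WGTestSpace k T (bdryEdges T Γ)) :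
    ∑ t ∈ T, ∑ e ∈ triEdges t,
      ∫ x, (∑ j, outwardNormal {t} e j * τF t j e x) * w.2 e x ∂edgeMeasure e
      = edgePairing Γ (fun e => normalTrace T e (flux U A u)) w.2 := by
  rw [sum_sum_triEdges, edgePairing, ← Finset.sum_subset S.gamma_subset]
  · refine Finset.sum_congr rfl fun e he => ?_
    obtain ⟨t, ht, het⟩ := Finset.mem_biUnion.1 (S.gamma_subset he)
    rw [S.filter_gamma he ht het, Finset.sum_singleton]
    refine integral_congr_ae ?_
    filter_upwards [(S.normalTrace_spec hS he ht het).2] with x hx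
    rw [hx]
  · intro e he heΓ
    have hec := card_of_mem_meshEdges he
    obtain ⟨t, ht, het⟩ := Finset.mem_biUnion.1 he
    have htf : t ∈ T.filter (e ⊆ ·) := Finset.mem_filter.2 ⟨ht, (Finset.mem_powersetCard.1 het).1⟩
    have hpos := Finset.card_pos.2 ⟨t, htf⟩
    have hle := S.mesh.card_filter_le_two hec
    -- a boundary edge outside `Γ`, where the test function vanishes, or an interior edge
    rcases (show (T.filter (e ⊆ ·)).card = 1 ∨ (T.filter (e ⊆ ·)).card = 2 by omega) with h1 | h2
    · refine Finset.sum_eq_zero fun s _ => integral_eq_zero_of_ae ?_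
      filter_upwards [ae_edgeMeasure_mem e] with x hx
      rw [hw.2 e (Finset.mem_filter.2 ⟨he, heΓ, h1⟩) x hx]
      exact mul_zero _
    · obtain ⟨a, b, hab, hf⟩ := Finset.card_eq_two.1 h2
      have ha : a ∈ T.filter (e ⊆ ·) := by rw [hf]; simp
      have hb : b ∈ T.filter (e ⊆ ·) := by rw [hf]; simp
      simp only [Finset.mem_filter, IsMesh.subset_iff_mem_triEdges hec] at ha hb
      have hm {s : Finset Plane} (hs : s ∈ T) (hes : e ∈ triEdges s) :
          Integrable (fun x => (∑ j, outwardNormal {s} e j * τF s j e x) * w.2 e x)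
            (edgeMeasure e) :=
        integrable_mul_of_memLp (memLp_finsetSum _ fun j _ =>
          (((hS s hs).trace_flux j).memLp_trace e hes).const_mul _)
          (memLp_edge hec (polyFun_contDiff (hw.1.2 e he) (n := 0)).continuous)
      rw [hf, Finset.sum_pair hab, ← integral_add (hm ha.1 ha.2) (hm hb.1 hb.2)]
      refine integral_eq_zero_of_ae ?_
      filter_upwards [S.mesh.flux_ae_eq ha.1 hb.1 hab ha.2 hb.2 S.fits (S.openTri_subset ha.1)
        (S.openTri_subset hb.1) S.pde (hS b hb.1) (hS a ha.1)] with x hx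
      rw [← add_mul, add_comm, hx]
      exact zero_mul _

end Side

/-! ### Estimates on a subdomain -/

lemma memLp_discGrad {k : ℕ} {T : Finset (Finset Plane)} (hT : IsMesh T) {w : WeakFun}
    (hw : w ∈ WGSpace k T) {t : Finset Plane} (ht : t ∈ T) :
    MemLp (discGrad k w t) 2 (volume.restrict (hull t)) :=
  memLp_hull (RT_continuous ((hT.isTri t ht).discGrad_spec (hw.1 t ht)
    fun e he => hw.2 e (Finset.mem_biUnion.2 ⟨t, ht, he⟩)).1) t

lemma gradNorm_nonneg (k : ℕ) (T : Finset (Finset Plane)) (w : WeakFun) : 0 ≤ gradNorm k T w :=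
  Real.sqrt_nonneg _

lemma gradNorm_eq {k : ℕ} {T : Finset (Finset Plane)} (hT : IsMesh T) {w : WeakFun}
    (hw : w ∈ WGSpace k T) : gradNorm k T w
      = Real.sqrt (∑ t ∈ T, nrm (volume.restrict (hull t)) (discGrad k w t) ^ 2) := by
  rw [gradNorm]
  congr 1
  exact Finset.sum_congr rfl fun t ht => (nrm_sq (memLp_discGrad hT hw ht)).symm

lemma gradNorm_sq {k : ℕ} {T : Finset (Finset Plane)} (hT : IsMesh T) {w : WeakFun}
    (hw : w ∈ WGSpace k T) : gradNorm k T w ^ 2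
      = ∑ t ∈ T, nrm (volume.restrict (hull t)) (discGrad k w t) ^ 2 := by
  rw [gradNorm_eq hT hw, Real.sq_sqrt (Finset.sum_nonneg fun _ _ => sq_nonneg _)]

lemma WGSpace_sub {k : ℕ} {T : Finset (Finset Plane)} {w z : WeakFun} (hw : w ∈ WGSpace k T)
    (hz : z ∈ WGSpace k T) : w - z ∈ WGSpace k T :=
  ⟨fun t ht => (polyFun k).sub_mem (hw.1 t ht) (hz.1 t ht),
    fun e he => (polyFun k).sub_mem (hw.2 e he) (hz.2 e he)⟩

section Coefficient

variable {k : ℕ} {α B : ℝ} {T : Finset (Finset Plane)} {A : Plane → Plane →L[ℝ] Plane}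

lemma Admissible.opNorm_le (hA : Admissible T k α B A) {t : Finset Plane} (ht : t ∈ T)
    {x : Plane} (hx : x ∈ openTri t) : ‖A x‖ ≤ B := by
  have := ((hA t ht).2 x hx).2 0 (by omega)
  rwa [norm_iteratedFDeriv_zero] at this

lemma ae_mem_openTri (t : Finset Plane) : ∀ᵐ x ∂volume.restrict (hull t), x ∈ openTri t := by
  rw [← IsTri.restrict_openTri]
  exact ae_restrict_mem IsTri.isOpen_openTri.measurableSet

lemma Admissible.memLp (hA : Admissible T k α B A) {t : Finset Plane} (ht : t ∈ T)
    {H : Plane → Plane} (hH : MemLp H 2 (volume.restrict (hull t))) :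
    MemLp (fun x => A x (H x)) 2 (volume.restrict (hull t)) := by
  have hAm : AEStronglyMeasurable A (volume.restrict (hull t)) := by
    rw [← IsTri.restrict_openTri]
    exact (hA t ht).1.continuousOn.aestronglyMeasurable IsTri.isOpen_openTri.measurableSet
  refine hH.of_le_mul (c := B) ?_ ?_
  · exact (ContinuousLinearMap.id ℝ (Plane →L[ℝ] Plane)).aestronglyMeasurable_comp₂ hAm hH.1
  · filter_upwards [ae_mem_openTri t] with x hx
    exact (A x).le_of_opNorm_le (hA.opNorm_le ht hx) _

lemma gradForm_sub (hA : Admissible T k α B A) (hT : IsMesh T) {w z v : WeakFun}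
    (hw : w ∈ WGSpace k T) (hz : z ∈ WGSpace k T) (hv : v ∈ WGSpace k T) :
    gradForm k T A (w - z) v = gradForm k T A w v - gradForm k T A z v := by
  rw [gradForm, gradForm, gradForm, ← Finset.sum_sub_distrib]
  refine Finset.sum_congr rfl fun t ht => ?_
  have hsub {e : Finset Plane} (he : e ∈ triEdges t) := Finset.mem_biUnion.2 ⟨t, ht, he⟩
  have mv := memLp_discGrad hT hv ht
  rw [← integral_sub (integrable_inner_of_memLp (hA.memLp ht (memLp_discGrad hT hw ht)) mv)
    (integrable_inner_of_memLp (hA.memLp ht (memLp_discGrad hT hz ht)) mv),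
    (hT.isTri t ht).discGrad_sub (hw.1 t ht) (fun e he => hw.2 e (hsub he)) (hz.1 t ht)
      (fun e he => hz.2 e (hsub he))]
  refine integral_congr_ae (ae_of_all _ fun x => ?_)
  simp only
  rw [map_sub, inner_sub_left]

lemma gradForm_coercive (hA : Admissible T k α B A) (hT : IsMesh T) {w : WeakFun}
    (hw : w ∈ WGSpace k T) : α * gradNorm k T w ^ 2 ≤ gradForm k T A w w := by
  rw [gradNorm_sq hT hw, Finset.mul_sum]
  refine Finset.sum_le_sum fun t ht => ?_
  have mw := memLp_discGrad hT hw ht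
  rw [nrm_sq mw, ← integral_const_mul]
  refine integral_mono_ae ?_ (integrable_inner_of_memLp (hA.memLp ht mw) mw) ?_
  · exact mw.norm.integrable_sq.const_mul α
  · filter_upwards [ae_mem_openTri t] with x hx using ((hA t ht).2 x hx).1 _

lemma abs_gradForm_le (hA : Admissible T k α B A) (hT : IsMesh T) {z w : WeakFun}
    (hz : z ∈ WGSpace k T) (hw : w ∈ WGSpace k T) :
    |gradForm k T A z w| ≤ |B| * (gradNorm k T z * gradNorm k T w) := by
  rw [gradNorm_eq hT hz, gradNorm_eq hT hw]
  refine le_trans ?_ (mul_le_mul_of_nonneg_left (Real.sum_mul_le_sqrt_mul_sqrt T _ _)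
    (abs_nonneg B))
  rw [Finset.mul_sum]
  refine (Finset.abs_sum_le_sum_abs _ _).trans (Finset.sum_le_sum fun t ht => ?_)
  have mz := memLp_discGrad hT hz ht
  refine (abs_integral_inner_le (hA.memLp ht mz) (memLp_discGrad hT hw ht)).trans ?_
  rw [← mul_assoc]
  refine mul_le_mul_of_nonneg_right (nrm_mono mz (abs_nonneg B) ?_) (nrm_nonneg _)
  filter_upwards [ae_mem_openTri t] with x hx
  exact (A x).le_of_opNorm_le ((hA.opNorm_le ht hx).trans (le_abs_self B)) _

end Coefficient

/-- The consistency error on a subdomain, and the distance of the normal flux on the interface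
from the polynomials. -/
theorem exists_side_consistency (k : ℕ) (σ α B : ℝ) : ∃ C : ℝ, 0 < C ∧
    ∀ {h : ℝ} {T Γ : Finset (Finset Plane)} {U : Set Plane} {A : Plane → Plane →L[ℝ] Plane}
      {f u : Plane → ℝ}, 0 ≤ h → Side k σ α B h T Γ U A f u →
    (∀ w ∈ WGTestSpace k T (bdryEdges T Γ),
      |load T f w + edgePairing Γ (fun e => normalTrace T e (flux U A u)) w.2
        - gradForm k T A (Qh k T u) w|
        ≤ C * (h ^ (k + 1) * sobolevNorm U (k + 2) u) * gradNorm k T w) ∧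
    ((∀ t ∈ T, (∃ e ∈ triEdges t, e ∈ Γ) → h ≤ σ * Metric.diam (hull t)) →
      ∀ p : Finset Plane → Plane → ℝ, (∀ e ∈ Γ, p e ∈ polyFun k ∧ ∀ q ∈ polyFun k,
        ∫ x, p e x * q x ∂edgeMeasure e
          = ∫ x, normalTrace T e (flux U A u) x * q x ∂edgeMeasure e) →
      h * ∑ e ∈ Γ, nrm (edgeMeasure e) (fun x => normalTrace T e (flux U A u) x - p e x) ^ 2
        ≤ C * (h ^ (k + 1) * sobolevNorm U (k + 2) u) ^ 2) := by
  obtain ⟨C, hC, hcons⟩ := exists_solution_consistency k σ α B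
  refine ⟨C + 3 * (σ ^ 2 * C), by positivity, ?_⟩
  intro h T Γ U A f u hh S
  obtain ⟨τ, DF, τF, hS⟩ := S.exists_traces
  set N := localNorm U (k + 2) u with hN
  set M := sobolevNorm U (k + 2) u with hM
  have hM0 : 0 ≤ M := Real.sqrt_nonneg _
  have hNM : ∑ t ∈ T, N t ^ 2 ≤ M ^ 2 :=
    sum_localNorm_sq_le S.mesh (fun t ht => S.openTri_subset ht) S.memSobolev
  have hN0 (t : Finset Plane) : 0 ≤ N t := localNorm_nonneg _ _ _ _
  have hND (t : Finset Plane) (ht : t ∈ T) :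
      N t * Metric.diam (hull t) ^ (k + 1) ≤ h ^ (k + 1) * N t := by
    rw [mul_comm]
    exact mul_le_mul_of_nonneg_right (pow_le_pow_left₀ Metric.diam_nonneg (S.diam_le t ht) _) (hN0 t)
  have hsub {t e : Finset Plane} (ht : t ∈ T) (he : e ∈ triEdges t) : e ∈ meshEdges T :=
    Finset.mem_biUnion.2 ⟨t, ht, he⟩
  constructor
  · intro w hw
    obtain ⟨hQ, hQ0, hQb⟩ := S.Qh_spec
    rw [← S.sum_normal_flux hS hw, load, gradForm, ← Finset.sum_add_distrib,
      ← Finset.sum_sub_distrib]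
    have h1 (t : Finset Plane) (ht : t ∈ T) : |(∫ x in hull t, f x * w.1 t x)
        + (∑ e ∈ triEdges t,
          ∫ x, (∑ j, outwardNormal {t} e j * τF t j e x) * w.2 e x ∂edgeMeasure e)
        - ∫ x in hull t, ⟪A x (discGrad k (Qh k T u) t x), discGrad k w t x⟫|
        ≤ C * (h ^ (k + 1) * (N t * nrm (volume.restrict (hull t)) (discGrad k w t))) := by
      obtain ⟨c, r, hd, hr⟩ := S.disc t ht
      refine ((hcons S.coeff ht (S.mesh.isTri t ht) hd hr S.isOpen (S.openTri_subset ht)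
        S.memSobolev (hS t ht)).1 (hQ.1 t ht) (fun e he => hQ.2 e (hsub ht he)) (hQ0 t ht)
        (fun e he q hq => ?_) (hw.1.1 t ht) (fun e he => hw.1.2 e (hsub ht he))).trans ?_
      · rw [(hQb e (hsub ht he)).2 q hq]
        refine integral_congr_ae ?_
        filter_upwards [(S.trace_spec hS ht he).2] with x hx
        rw [hx]
      · rw [mul_assoc, ← mul_assoc (h ^ (k + 1))]
        exact mul_le_mul_of_nonneg_left
          (mul_le_mul_of_nonneg_right (hND t ht) (nrm_nonneg _)) hC.le
    refine (Finset.abs_sum_le_sum_abs _ _).trans ((Finset.sum_le_sum h1).trans ?_)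
    rw [← Finset.mul_sum, ← Finset.mul_sum]
    have h2 : ∑ t ∈ T, N t * nrm (volume.restrict (hull t)) (discGrad k w t)
        ≤ M * gradNorm k T w := by
      rw [gradNorm_eq S.mesh hw.1]
      refine (Real.sum_mul_le_sqrt_mul_sqrt T _ _).trans
        (mul_le_mul_of_nonneg_right ?_ (Real.sqrt_nonneg _))
      exact (Real.sqrt_le_left hM0).2 hNM
    have h3 := mul_le_mul_of_nonneg_left h2 (by positivity : 0 ≤ C * h ^ (k + 1))
    have h4 : 0 ≤ 3 * (σ ^ 2 * C) * (h ^ (k + 1) * M) * gradNorm k T w :=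
      mul_nonneg (by positivity) (gradNorm_nonneg _ _ _)
    linarith
  · intro hquasi p hp
    -- the factor `r` in the local estimate is comparable to `h` on the triangles at the interface
    set Y : Finset Plane → ℝ := fun t => σ ^ 2 * C * (h ^ (k + 1) * N t) ^ 2 with hY
    have hY0 (t : Finset Plane) : 0 ≤ Y t := by positivity
    have h1 (e : Finset Plane) (he : e ∈ Γ) :
        h * nrm (edgeMeasure e) (fun x => normalTrace T e (flux U A u) x - p e x) ^ 2
          ≤ ∑ t ∈ T.filter (e ⊆ ·), Y t := by
      obtain ⟨t, ht, het⟩ := Finset.mem_biUnion.1 (S.gamma_subset he)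
      obtain ⟨c, r, hd, hr⟩ := S.disc t ht
      have hD := (S.mesh.isTri t ht).diam_pos hd
      have hσ : 0 ≤ σ := nonneg_of_mul_nonneg_left (hD.le.trans hr) hd.pos
      obtain ⟨-, hθ⟩ := S.normalTrace_spec hS he ht het
      have h2 := (hcons S.coeff ht (S.mesh.isTri t ht) hd hr S.isOpen (S.openTri_subset ht)
        S.memSobolev (hS t ht)).2 e het (hp e he).1 (fun q hq => by
          rw [(hp e he).2 q hq]
          refine integral_congr_ae ?_
          filter_upwards [hθ] with x hx
          rw [hx])
      rw [nrm_congr (G := fun x => (∑ j, outwardNormal {t} e j * τF t j e x) - p e x)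
        (hθ.mono fun x hx => by simp only [hx])]
      rw [S.filter_gamma he ht het, Finset.sum_singleton]
      set n := nrm (edgeMeasure e) (fun x => (∑ j, outwardNormal {t} e j * τF t j e x) - p e x)
      have h3 : h ≤ σ ^ 2 * r := by
        refine (hquasi t ht ⟨e, het, he⟩).trans ?_
        rw [sq, mul_assoc]
        exact mul_le_mul_of_nonneg_left hr hσ
      calc h * n ^ 2 ≤ σ ^ 2 * r * n ^ 2 := mul_le_mul_of_nonneg_right h3 (sq_nonneg _)
        _ = σ ^ 2 * (r * n ^ 2) := by ring
        _ ≤ σ ^ 2 * (C * (h ^ (k + 1) * N t) ^ 2) := by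
            refine mul_le_mul_of_nonneg_left (h2.trans (mul_le_mul_of_nonneg_left ?_ hC.le))
              (sq_nonneg σ)
            exact pow_le_pow_left₀ (mul_nonneg (hN0 t) (pow_nonneg Metric.diam_nonneg _)) (hND t ht) 2
        _ = Y t := by rw [hY]; ring
    rw [Finset.mul_sum]
    refine (Finset.sum_le_sum h1).trans ((Finset.sum_le_sum_of_subset_of_nonneg S.gamma_subset
      fun e _ _ => Finset.sum_nonneg fun t _ => hY0 t).trans ?_)
    rw [← sum_sum_triEdges T fun t _ => Y t]
    have h4 (t : Finset Plane) (ht : t ∈ T) : ∑ _e ∈ triEdges t, Y t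
        = 3 * (σ ^ 2 * C) * h ^ (2 * (k + 1)) * N t ^ 2 := by
      rw [Finset.sum_const, triEdges, Finset.card_powersetCard, (S.mesh.isTri t ht).card,
        nsmul_eq_mul, hY, show Nat.choose 3 2 = 3 from rfl]
      push_cast
      ring
    rw [Finset.sum_congr rfl h4, ← Finset.mul_sum]
    have h5 := mul_le_mul_of_nonneg_left hNM
      (by positivity : 0 ≤ 3 * (σ ^ 2 * C) * h ^ (2 * (k + 1)))
    have h6 : 3 * (σ ^ 2 * C) * h ^ (2 * (k + 1)) * M ^ 2
        = 3 * (σ ^ 2 * C) * (h ^ (k + 1) * M) ^ 2 := by ring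
    have h7 : 0 ≤ C * (h ^ (k + 1) * M) ^ 2 := by positivity
    linarith

/-- The discrete gradient of a function that is supported on the interface. Only triangles at the
interface contribute, and their diameters are comparable to `h`. -/
theorem exists_side_lifting (k : ℕ) (σ : ℝ) : ∃ C : ℝ, 0 < C ∧
    ∀ {α B h : ℝ} {T Γ : Finset (Finset Plane)} {U : Set Plane} {A : Plane → Plane →L[ℝ] Plane}
      {f u : Plane → ℝ}, Side k σ α B h T Γ U A f u →
    (∀ t ∈ T, (∃ e ∈ triEdges t, e ∈ Γ) → h ≤ σ * Metric.diam (hull t)) →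
    ∀ w ∈ WGSpace k T, w.1 = 0 → (∀ e ∉ Γ, w.2 e = 0) →
    h * gradNorm k T w ^ 2 ≤ C * ∑ e ∈ Γ, nrm (edgeMeasure e) (w.2 e) ^ 2 := by
  obtain ⟨C, hC, hlift⟩ := exists_lifting_bound k σ
  refine ⟨|σ| * C + 1, by positivity, ?_⟩
  intro α B h T Γ U A f u S hquasi w hw hw0 hwΓ
  have hnull (e : Finset Plane) (he : e ∉ Γ) : nrm (edgeMeasure e) (w.2 e) ^ 2 = 0 := by
    rw [hwΓ e he]
    simp [nrm]
  have h1 (t : Finset Plane) (ht : t ∈ T) :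
      h * nrm (volume.restrict (hull t)) (discGrad k w t) ^ 2
        ≤ |σ| * C * ∑ e ∈ triEdges t, nrm (edgeMeasure e) (w.2 e) ^ 2 := by
    obtain ⟨c, r, hd, hr⟩ := S.disc t ht
    have h2 := hlift (S.mesh.isTri t ht) hd hr (w := w) (by rw [hw0]; rfl)
      fun e he => hw.2 e (Finset.mem_biUnion.2 ⟨t, ht, he⟩)
    have hD := (S.mesh.isTri t ht).diam_pos hd
    set n := nrm (volume.restrict (hull t)) (discGrad k w t)
    by_cases hΓ : ∃ e ∈ triEdges t, e ∈ Γ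
    · calc h * n ^ 2 ≤ |σ| * Metric.diam (hull t) * n ^ 2 := by
            refine mul_le_mul_of_nonneg_right ((hquasi t ht hΓ).trans ?_) (sq_nonneg _)
            exact mul_le_mul_of_nonneg_right (le_abs_self σ) hD.le
        _ = |σ| * (Metric.diam (hull t) * n ^ 2) := by ring
        _ ≤ _ := by
            rw [mul_assoc]
            exact mul_le_mul_of_nonneg_left h2 (abs_nonneg σ)
    · push Not at hΓ
      rw [Finset.sum_eq_zero fun e he => hnull e (hΓ e he), mul_zero] at h2 ⊢
      have h3 : n ^ 2 ≤ 0 := by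
        by_contra! hpos
        exact absurd h2 (not_le.2 (mul_pos hD hpos))
      rw [le_antisymm h3 (sq_nonneg _), mul_zero]
  rw [gradNorm_sq S.mesh hw, Finset.mul_sum]
  refine (Finset.sum_le_sum h1).trans ?_
  rw [← Finset.mul_sum, sum_sum_triEdges T fun _ e => nrm (edgeMeasure e) (w.2 e) ^ 2,
    ← Finset.sum_subset S.gamma_subset fun e _ he => by simp [hnull e he],
    Finset.sum_congr rfl fun e he => by
      rw [Finset.sum_const, S.card_gamma e he, one_smul]]
  have : 0 ≤ ∑ e ∈ Γ, nrm (edgeMeasure e) (w.2 e) ^ 2 :=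
    Finset.sum_nonneg fun _ _ => sq_nonneg _
  linarith

/-! ### The two subdomains and the error estimates -/

namespace InterfaceMesh

variable {Ω₁ Ω₂ : Set Plane} (𝒯 : InterfaceMesh Ω₁ Ω₂)

lemma isMesh : IsMesh (𝒯.T₁ ∪ 𝒯.T₂) :=
  ⟨fun t ht => ⟨𝒯.card_eq t ht, 𝒯.indep t ht⟩, 𝒯.conforming⟩

lemma size_nonneg : 0 ≤ 𝒯.size :=
  Real.sSup_nonneg (by rintro _ ⟨t, -, rfl⟩; exact Metric.diam_nonneg)

lemma diam_le_size {t : Finset Plane} (ht : t ∈ 𝒯.T₁ ∪ 𝒯.T₂) : Metric.diam (hull t) ≤ 𝒯.size :=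
  le_csSup ((Finset.finite_toSet _).image _).bddAbove ⟨t, Finset.mem_coe.2 ht, rfl⟩

/-- An interface edge belongs to one triangle of each subdomain, as it is shared by two in all. -/
lemma card_filter_gamma {e : Finset Plane} (he : e ∈ 𝒯.gammaEdges) :
    (𝒯.T₁.filter (e ⊆ ·)).card = 1 ∧ (𝒯.T₂.filter (e ⊆ ·)).card = 1 := by
  obtain ⟨h1, h2⟩ := Finset.mem_inter.1 he
  have hpos {T : Finset (Finset Plane)} (h : e ∈ meshEdges T) : 0 < (T.filter (e ⊆ ·)).card := by
    obtain ⟨t, ht, het⟩ := Finset.mem_biUnion.1 h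
    exact Finset.card_pos.2 ⟨t, Finset.mem_filter.2 ⟨ht, (Finset.mem_powersetCard.1 het).1⟩⟩
  have h3 := 𝒯.isMesh.card_filter_le_two (card_of_mem_meshEdges h1)
  rw [Finset.filter_union, Finset.card_union_of_disjoint
    (Finset.disjoint_filter_filter 𝒯.disj)] at h3
  have h4 := hpos h1
  have h5 := hpos h2
  omega

variable {𝒯} {k : ℕ} {σ α B : ℝ} {d : Data} {u v : Plane → ℝ}

lemma side₁ (hreg : 𝒯.ShapeRegular σ) (hA : Admissible 𝒯.T₁ k α B d.A₁)
    (hf : MemLp d.f₁ 2 (volume.restrict Ω₁)) (hu : MemSobolev Ω₁ (k + 2) u)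
    (hsol : SolvesInterfaceProblem 𝒯 d u v) :
    Side k σ α B 𝒯.size 𝒯.T₁ 𝒯.gammaEdges Ω₁ d.A₁ d.f₁ u where
  mesh := 𝒯.isMesh.mono Finset.subset_union_left
  fits := 𝒯.fits₁
  disc t ht := by
    obtain ⟨c, r, hr, hb, hd⟩ := hreg t (Finset.mem_union_left _ ht)
    exact ⟨c, r, ⟨hr, hb, le_rfl⟩, hd⟩
  diam_le t ht := 𝒯.diam_le_size (Finset.mem_union_left _ ht)
  gamma_subset := Finset.inter_subset_left
  card_gamma e he := (𝒯.card_filter_gamma he).1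
  coeff := hA
  memLp_f := hf
  memSobolev := hu
  pde := hsol.eq₁

lemma side₂ (hreg : 𝒯.ShapeRegular σ) (hA : Admissible 𝒯.T₂ k α B d.A₂)
    (hf : MemLp d.f₂ 2 (volume.restrict Ω₂)) (hv : MemSobolev Ω₂ (k + 2) v)
    (hsol : SolvesInterfaceProblem 𝒯 d u v) :
    Side k σ α B 𝒯.size 𝒯.T₂ 𝒯.gammaEdges Ω₂ d.A₂ d.f₂ v where
  mesh := 𝒯.isMesh.mono Finset.subset_union_right
  fits := 𝒯.fits₂
  disc t ht := by
    obtain ⟨c, r, hr, hb, hd⟩ := hreg t (Finset.mem_union_right _ ht)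
    exact ⟨c, r, ⟨hr, hb, le_rfl⟩, hd⟩
  diam_le t ht := 𝒯.diam_le_size (Finset.mem_union_right _ ht)
  gamma_subset := Finset.inter_subset_right
  card_gamma e he := (𝒯.card_filter_gamma he).2
  coeff := hA
  memLp_f := hf
  memSobolev := hv
  pde := hsol.eq₂

end InterfaceMesh

lemma l2Proj_congr {k : ℕ} {μ : Measure Plane} {f g : Plane → ℝ} (h : f =ᵐ[μ] g) :
    l2Proj k μ f = l2Proj k μ g := by
  have h1 (q : Plane → ℝ) : ∫ x, f x * q x ∂μ = ∫ x, g x * q x ∂μ :=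
    integral_congr_ae (h.mono fun x hx => by simp only [hx])
  simp only [l2Proj, h1]

lemma edgePairing_congr {S : Finset (Finset Plane)} {μ ν ν' : Finset Plane → Plane → ℝ}
    (h : ∀ e ∈ S, ν e =ᵐ[edgeMeasure e] ν' e) : edgePairing S μ ν = edgePairing S μ ν' :=
  Finset.sum_congr rfl fun e he =>
    integral_congr_ae ((h e he).mono fun x hx => by simp only [hx])

/-- A polynomial on an edge all of whose moments vanish. -/
lemma ae_eq_zero_of_moments {k : ℕ} {e : Finset Plane} (he : e.card = 2) {p : Plane → ℝ}
    (hp : p ∈ polyFun k) (h : ∫ x, p x * p x ∂edgeMeasure e = 0) :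
    ∀ᵐ x ∂edgeMeasure e, p x = 0 := by
  have mp := memLp_edge he (polyFun_contDiff hp (n := 0)).continuous
  have h1 := (integral_eq_zero_iff_of_nonneg (fun x => mul_self_nonneg (p x))
    (integrable_mul_of_memLp mp mp)).1 h
  filter_upwards [h1] with x hx using mul_self_eq_zero.1 hx

section Error

variable {Ω₁ Ω₂ : Set Plane} {𝒯 : InterfaceMesh Ω₁ Ω₂} {k : ℕ} {σ α B : ℝ} {d : Data}
  {u v : Plane → ℝ} {uh vh : WeakFun} {lam : Finset Plane → Plane → ℝ}

/-- The edge components of the two errors agree on the interface: they have the same moments. -/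
lemma error_ae_eq_on_gamma
    (S₁ : Side k σ α B 𝒯.size 𝒯.T₁ 𝒯.gammaEdges Ω₁ d.A₁ d.f₁ u)
    (S₂ : Side k σ α B 𝒯.size 𝒯.T₂ 𝒯.gammaEdges Ω₂ d.A₂ d.f₂ v)
    (hsol : SolvesInterfaceProblem 𝒯 d u v) (hwg : SolvesWG 𝒯 k d uh vh lam)
    {e : Finset Plane} (he : e ∈ 𝒯.gammaEdges) :
    (Qh k 𝒯.T₁ u - uh).2 e =ᵐ[edgeMeasure e] (Qh k 𝒯.T₂ v - vh).2 e := by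
  have he₁ := S₁.gamma_subset he
  have he₂ := S₂.gamma_subset he
  have hec := card_of_mem_meshEdges he₁
  obtain ⟨hQ₁, -, hQb₁⟩ := S₁.Qh_spec
  obtain ⟨hQ₂, -, hQb₂⟩ := S₂.Qh_spec
  set p₁ := (Qh k 𝒯.T₁ u - uh).2 e with hp₁
  set p₂ := (Qh k 𝒯.T₂ v - vh).2 e with hp₂
  have m₁ : p₁ ∈ polyFun k := (WGSpace_sub hQ₁ hwg.mem_U).2 e he₁
  have m₂ : p₂ ∈ polyFun k := (WGSpace_sub hQ₂ hwg.mem_V).2 e he₂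
  have hp : p₁ - p₂ ∈ polyFun k := (polyFun k).sub_mem m₁ m₂
  set q := p₁ - p₂ with hq
  have mpoly {q : Plane → ℝ} (hq : q ∈ polyFun k) : MemLp q 2 (edgeMeasure e) :=
    memLp_edge hec (polyFun_contDiff hq (n := 0)).continuous
  -- the constraint of the scheme, tested on the single edge `e`
  have hwg₃ : ∫ x, (uh.2 e x - vh.2 e x) * q x ∂edgeMeasure e = ∫ x, d.φ x * q x ∂edgeMeasure e := by
    have h1 := hwg.wg₃ (fun e' => if e' = e then q else 0) (fun e' _ => by
      split_ifs
      · exact hp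
      · exact (polyFun k).zero_mem)
    rw [edgePairing, edgePairing, Finset.sum_eq_single_of_mem e he, Finset.sum_eq_single_of_mem e he]
      at h1
    · simpa using h1
    · intro e' _ hne
      simp [hne]
    · intro e' _ hne
      simp [hne]
  have hjump : ∫ x, (trace 𝒯.T₁ e u x - trace 𝒯.T₂ e v x) * q x ∂edgeMeasure e
      = ∫ x, d.φ x * q x ∂edgeMeasure e :=
    integral_congr_ae ((hsol.jump e he).mono fun x hx => by simp only at hx ⊢; rw [hx])
  have hzero : ∫ x, q x * q x ∂edgeMeasure e = 0 := by
    have e₁ := (hQb₁ e he₁).2 q hp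
    have e₂ := (hQb₂ e he₂).2 q hp
    have mQ₁ := mpoly (hQ₁.2 e he₁)
    have mQ₂ := mpoly (hQ₂.2 e he₂)
    have mu := mpoly (hwg.mem_U.2 e he₁)
    have mv := mpoly (hwg.mem_V.2 e he₂)
    have mq := mpoly hp
    simp only [sub_mul] at hwg₃ hjump
    rw [integral_sub (integrable_mul_of_memLp mu mq) (integrable_mul_of_memLp mv mq)] at hwg₃
    rw [integral_sub (integrable_mul_of_memLp (hQb₁ e he₁).1 mq)
      (integrable_mul_of_memLp (hQb₂ e he₂).1 mq)] at hjump
    have hfun : (fun x => q x * q x) = fun x => ((Qh k 𝒯.T₁ u).2 e x * q x - uh.2 e x * q x)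
        - ((Qh k 𝒯.T₂ v).2 e x * q x - vh.2 e x * q x) := by
      ext x
      simp only [hq, hp₁, hp₂, Pi.sub_apply, Prod.snd_sub]
      ring
    have hsub {a b : Plane → ℝ} (ha : MemLp a 2 (edgeMeasure e)) (hb : MemLp b 2 (edgeMeasure e)) :
        Integrable (fun x => a x * q x - b x * q x) (edgeMeasure e) :=
      (integrable_mul_of_memLp ha mq).sub (integrable_mul_of_memLp hb mq)
    rw [hfun, integral_sub (hsub mQ₁ mu) (hsub mQ₂ mv),
      integral_sub (integrable_mul_of_memLp mQ₁ mq) (integrable_mul_of_memLp mu mq),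
      integral_sub (integrable_mul_of_memLp mQ₂ mq) (integrable_mul_of_memLp mv mq)]
    linarith
  filter_upwards [ae_eq_zero_of_moments hec hp hzero] with x hx
  exact sub_eq_zero.1 hx

/-- The boundary data of the scheme are the projections of the traces of the solution. -/
lemma error_mem_testSpace {T Γ : Finset (Finset Plane)} {h : ℝ} {U : Set Plane}
    {A : Plane → Plane →L[ℝ] Plane} {f g : Plane → ℝ} (S : Side k σ α B h T Γ U A f u)
    (huh : uh ∈ WGSpace k T)
    (hbc : ∀ e ∈ bdryEdges T Γ, trace T e u =ᵐ[edgeMeasure e] g)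
    (hbc' : ∀ e ∈ bdryEdges T Γ, ∀ x ∈ hull e, uh.2 e x = l2Proj k (edgeMeasure e) g x) :
    Qh k T u - uh ∈ WGTestSpace k T (bdryEdges T Γ) := by
  refine ⟨WGSpace_sub S.Qh_spec.1 huh, fun e he x hx => ?_⟩
  have h1 : (Qh k T u).2 e = l2Proj k (edgeMeasure e) g := l2Proj_congr (hbc e he)
  rw [Prod.snd_sub, Pi.sub_apply, Pi.sub_apply, h1, hbc' e he x hx, sub_self]

/-- The energy estimate: the multiplier drops out because the errors agree on the interface. -/
lemma gradNorm_error_le (hα : 0 < α) {C : ℝ} (hC : 0 ≤ C)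
    (S₁ : Side k σ α B 𝒯.size 𝒯.T₁ 𝒯.gammaEdges Ω₁ d.A₁ d.f₁ u)
    (S₂ : Side k σ α B 𝒯.size 𝒯.T₂ 𝒯.gammaEdges Ω₂ d.A₂ d.f₂ v)
    (hsol : SolvesInterfaceProblem 𝒯 d u v) (hwg : SolvesWG 𝒯 k d uh vh lam)
    (h₁ : ∀ w ∈ WGTestSpace k 𝒯.T₁ (bdryEdges 𝒯.T₁ 𝒯.gammaEdges),
      |load 𝒯.T₁ d.f₁ w
        + edgePairing 𝒯.gammaEdges (fun e => normalTrace 𝒯.T₁ e (flux Ω₁ d.A₁ u)) w.2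
        - gradForm k 𝒯.T₁ d.A₁ (Qh k 𝒯.T₁ u) w|
        ≤ C * (𝒯.size ^ (k + 1) * sobolevNorm Ω₁ (k + 2) u) * gradNorm k 𝒯.T₁ w)
    (h₂ : ∀ w ∈ WGTestSpace k 𝒯.T₂ (bdryEdges 𝒯.T₂ 𝒯.gammaEdges),
      |load 𝒯.T₂ d.f₂ w
        + edgePairing 𝒯.gammaEdges (fun e => normalTrace 𝒯.T₂ e (flux Ω₂ d.A₂ v)) w.2
        - gradForm k 𝒯.T₂ d.A₂ (Qh k 𝒯.T₂ v) w|
        ≤ C * (𝒯.size ^ (k + 1) * sobolevNorm Ω₂ (k + 2) v) * gradNorm k 𝒯.T₂ w) :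
    gradNorm k 𝒯.T₁ (Qh k 𝒯.T₁ u - uh) + gradNorm k 𝒯.T₂ (Qh k 𝒯.T₂ v - vh)
      ≤ 2 * C / α * (𝒯.size ^ (k + 1)
        * (sobolevNorm Ω₁ (k + 2) u + sobolevNorm Ω₂ (k + 2) v)) := by
  have hQ₁ := S₁.Qh_spec.1
  have hQ₂ := S₂.Qh_spec.1
  set θ₁ : Finset Plane → Plane → ℝ := fun e => normalTrace 𝒯.T₁ e (flux Ω₁ d.A₁ u) with hθ₁
  set θ₂ : Finset Plane → Plane → ℝ := fun e => normalTrace 𝒯.T₂ e (flux Ω₂ d.A₂ v) with hθ₂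
  set w₁ := Qh k 𝒯.T₁ u - uh with hw₁
  set w₂ := Qh k 𝒯.T₂ v - vh with hw₂
  have t₁ : w₁ ∈ WGTestSpace k 𝒯.T₁ (bdryEdges 𝒯.T₁ 𝒯.gammaEdges) :=
    error_mem_testSpace S₁ hwg.mem_U hsol.bc₁ hwg.bc₁
  have t₂ : w₂ ∈ WGTestSpace k 𝒯.T₂ (bdryEdges 𝒯.T₂ 𝒯.gammaEdges) :=
    error_mem_testSpace S₂ hwg.mem_V hsol.bc₂ hwg.bc₂
  have hae (e : Finset Plane) (he : e ∈ 𝒯.gammaEdges) : w₁.2 e =ᵐ[edgeMeasure e] w₂.2 e :=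
    error_ae_eq_on_gamma S₁ S₂ hsol hwg he
  have p1 : edgePairing 𝒯.gammaEdges θ₁ w₁.2 = edgePairing 𝒯.gammaEdges θ₁ w₂.2 :=
    edgePairing_congr hae
  have p2 : edgePairing 𝒯.gammaEdges lam w₁.2 = edgePairing 𝒯.gammaEdges lam w₂.2 :=
    edgePairing_congr hae
  -- the jump condition for the flux, tested with the common edge component
  have p3 : edgePairing 𝒯.gammaEdges θ₁ w₂.2 + edgePairing 𝒯.gammaEdges θ₂ w₂.2
      = edgePairing 𝒯.gammaEdges (fun _ => d.ψ) w₂.2 := by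
    obtain ⟨τ₁, DF₁, τF₁, hS₁⟩ := S₁.exists_traces
    obtain ⟨τ₂, DF₂, τF₂, hS₂⟩ := S₂.exists_traces
    rw [edgePairing, edgePairing, edgePairing, ← Finset.sum_add_distrib]
    refine Finset.sum_congr rfl fun e he => ?_
    obtain ⟨t, ht, het⟩ := Finset.mem_biUnion.1 (S₁.gamma_subset he)
    obtain ⟨s, hs, hes⟩ := Finset.mem_biUnion.1 (S₂.gamma_subset he)
    have mw := memLp_edge (card_of_mem_meshEdges (S₂.gamma_subset he))
      (polyFun_contDiff (t₂.1.2 e (S₂.gamma_subset he)) (n := 0)).continuous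
    rw [← integral_add (integrable_mul_of_memLp (S₁.normalTrace_spec hS₁ he ht het).1 mw)
      (integrable_mul_of_memLp (S₂.normalTrace_spec hS₂ he hs hes).1 mw)]
    refine integral_congr_ae ((hsol.fluxJump e he).mono fun x hx => ?_)
    simp only at hx ⊢
    rw [← add_mul, hx]
  have g₁ := gradForm_sub S₁.coeff S₁.mesh hQ₁ hwg.mem_U t₁.1
  have g₂ := gradForm_sub S₂.coeff S₂.mesh hQ₂ hwg.mem_V t₂.1
  have c₁ := gradForm_coercive S₁.coeff S₁.mesh t₁.1
  have c₂ := gradForm_coercive S₂.coeff S₂.mesh t₂.1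
  have s₁ := hwg.wg₁ w₁ t₁
  have s₂ := hwg.wg₂ w₂ t₂
  have b₁ := (abs_le.1 (h₁ w₁ t₁)).1
  have b₂ := (abs_le.1 (h₂ w₂ t₂)).1
  rw [← hw₁] at g₁
  rw [← hw₂] at g₂
  have x0 := gradNorm_nonneg k 𝒯.T₁ w₁
  have y0 := gradNorm_nonneg k 𝒯.T₂ w₂
  have a0 : 0 ≤ sobolevNorm Ω₁ (k + 2) u := Real.sqrt_nonneg _
  have b0 : 0 ≤ sobolevNorm Ω₂ (k + 2) v := Real.sqrt_nonneg _
  have H0 : 0 ≤ C * 𝒯.size ^ (k + 1) := mul_nonneg hC (pow_nonneg 𝒯.size_nonneg _)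
  set x := gradNorm k 𝒯.T₁ w₁
  set y := gradNorm k 𝒯.T₂ w₂
  set a := sobolevNorm Ω₁ (k + 2) u
  set b := sobolevNorm Ω₂ (k + 2) v
  have key : α * (x ^ 2 + y ^ 2) ≤ C * 𝒯.size ^ (k + 1) * (a * x + b * y) := by linarith
  have key2 : α * (x + y) ^ 2 ≤ 2 * (C * 𝒯.size ^ (k + 1)) * (a + b) * (x + y) := by
    have h3 : α * (x + y) ^ 2 ≤ 2 * (α * (x ^ 2 + y ^ 2)) := by
      nlinarith [mul_nonneg hα.le (sq_nonneg (x - y))]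
    have h4 : a * x + b * y ≤ (a + b) * (x + y) := by nlinarith [mul_nonneg a0 y0, mul_nonneg b0 x0]
    have h5 := mul_le_mul_of_nonneg_left h4 H0
    linarith
  refine le_of_sq_le_mul (add_nonneg x0 y0) ?_ ?_
  · exact mul_nonneg (div_nonneg (by positivity) hα.le)
      (mul_nonneg (pow_nonneg 𝒯.size_nonneg _) (add_nonneg a0 b0))
  · rw [← mul_le_mul_iff_right₀ hα]
    refine key2.trans (le_of_eq ?_)
    field_simp

/-- The multiplier is compared with the projection of the normal flux by testing with a function
that is supported on the interface. -/
lemma size_mul_edgeNorm_sq_le {C C' : ℝ} (hC' : 0 ≤ C')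
    (S₁ : Side k σ α B 𝒯.size 𝒯.T₁ 𝒯.gammaEdges Ω₁ d.A₁ d.f₁ u)
    (hwg : SolvesWG 𝒯 k d uh vh lam) {K E : ℝ}
    (h₁ : ∀ w ∈ WGTestSpace k 𝒯.T₁ (bdryEdges 𝒯.T₁ 𝒯.gammaEdges),
      |load 𝒯.T₁ d.f₁ w
        + edgePairing 𝒯.gammaEdges (fun e => normalTrace 𝒯.T₁ e (flux Ω₁ d.A₁ u)) w.2
        - gradForm k 𝒯.T₁ d.A₁ (Qh k 𝒯.T₁ u) w| ≤ C * E * gradNorm k 𝒯.T₁ w)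
    (hproj : ∀ p : Finset Plane → Plane → ℝ, (∀ e ∈ 𝒯.gammaEdges, p e ∈ polyFun k ∧
      ∀ q ∈ polyFun k, ∫ x, p e x * q x ∂edgeMeasure e
        = ∫ x, normalTrace 𝒯.T₁ e (flux Ω₁ d.A₁ u) x * q x ∂edgeMeasure e) →
      𝒯.size * ∑ e ∈ 𝒯.gammaEdges,
        nrm (edgeMeasure e) (fun x => normalTrace 𝒯.T₁ e (flux Ω₁ d.A₁ u) x - p e x) ^ 2
        ≤ C * E ^ 2)
    (hlift : ∀ w ∈ WGSpace k 𝒯.T₁, w.1 = 0 → (∀ e ∉ 𝒯.gammaEdges, w.2 e = 0) →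
      𝒯.size * gradNorm k 𝒯.T₁ w ^ 2
        ≤ C' * ∑ e ∈ 𝒯.gammaEdges, nrm (edgeMeasure e) (w.2 e) ^ 2)
    (hgrad : gradNorm k 𝒯.T₁ (Qh k 𝒯.T₁ u - uh) ≤ K * E) :
    𝒯.size * edgeNorm 𝒯.gammaEdges
        (fun e => normalTrace 𝒯.T₁ e (flux Ω₁ d.A₁ u) - lam e) ^ 2
      ≤ (2 * C + 2 * (C' * (|B| * K + C) ^ 2)) * E ^ 2 := by
  set Γ := 𝒯.gammaEdges with hΓ
  set θ : Finset Plane → Plane → ℝ := fun e => normalTrace 𝒯.T₁ e (flux Ω₁ d.A₁ u) with hθ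
  have hcard (e : Finset Plane) (he : e ∈ Γ) : e.card = 2 :=
    card_of_mem_meshEdges (S₁.gamma_subset he)
  have mθ (e : Finset Plane) (he : e ∈ Γ) : MemLp (θ e) 2 (edgeMeasure e) := by
    obtain ⟨τ, DF, τF, hS⟩ := S₁.exists_traces
    obtain ⟨t, ht, het⟩ := Finset.mem_biUnion.1 (S₁.gamma_subset he)
    exact (S₁.normalTrace_spec hS he ht het).1
  set p : Finset Plane → Plane → ℝ := fun e => l2Proj k (edgeMeasure e) (θ e) with hp
  have hps (e : Finset Plane) (he : e ∈ Γ) : p e ∈ polyFun k ∧ ∀ q ∈ polyFun k,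
      ∫ x, p e x * q x ∂edgeMeasure e = ∫ x, θ e x * q x ∂edgeMeasure e :=
    have := isFiniteMeasure_edge (hcard e he)
    l2Proj_spec k (isCompact_hull e) (ae_edgeMeasure_mem e) (mθ e he)
  -- the test function: `p - λ_h` on the interface, zero elsewhere
  set w : WeakFun := (0, fun e => if e ∈ Γ then p e - lam e else 0) with hw
  have hwΓ (e : Finset Plane) (he : e ∈ Γ) : w.2 e = p e - lam e := if_pos he
  have hwp (e : Finset Plane) : w.2 e ∈ polyFun k := by
    by_cases he : e ∈ Γ
    · rw [hwΓ e he]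
      exact (polyFun k).sub_mem (hps e he).1 (hwg.mem_Lambda e he)
    · rw [show w.2 e = 0 from if_neg he]
      exact (polyFun k).zero_mem
  have hwS : w ∈ WGSpace k 𝒯.T₁ := ⟨fun t _ => (polyFun k).zero_mem, fun e _ => hwp e⟩
  have hwT : w ∈ WGTestSpace k 𝒯.T₁ (bdryEdges 𝒯.T₁ Γ) := by
    refine ⟨hwS, fun e he x _ => ?_⟩
    rw [show w.2 e = 0 from if_neg (Finset.mem_filter.1 he).2.1]
    rfl
  have mpoly {e : Finset Plane} (he : e ∈ Γ) {q : Plane → ℝ} (hq : q ∈ polyFun k) :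
      MemLp q 2 (edgeMeasure e) := memLp_edge (hcard e he) (polyFun_contDiff hq (n := 0)).continuous
  set s := ∑ e ∈ Γ, nrm (edgeMeasure e) (w.2 e) ^ 2 with hs
  have hs0 : 0 ≤ s := Finset.sum_nonneg fun _ _ => sq_nonneg _
  have hpair : edgePairing Γ θ w.2 - edgePairing Γ lam w.2 = s := by
    rw [edgePairing, edgePairing, ← Finset.sum_sub_distrib]
    refine Finset.sum_congr rfl fun e he => ?_
    have m1 := mpoly he (hps e he).1
    have m2 := mpoly he (hwg.mem_Lambda e he)
    have m3 := mpoly he (hwp e)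
    rw [← (hps e he).2 _ (hwp e), ← integral_sub (integrable_mul_of_memLp m1 m3)
      (integrable_mul_of_memLp m2 m3), nrm_sq_real m3]
    refine integral_congr_ae (ae_of_all _ fun x => ?_)
    simp only [hwΓ e he, Pi.sub_apply]
    ring
  have hQ := S₁.Qh_spec.1
  have g := gradForm_sub S₁.coeff S₁.mesh hQ hwg.mem_U hwS
  have hbound := (le_abs_self _).trans (abs_gradForm_le S₁.coeff S₁.mesh
    (WGSpace_sub hQ hwg.mem_U) hwS)
  have hwg₁ := hwg.wg₁ w hwT
  have hcons := (le_abs_self _).trans (h₁ w hwT)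
  have hl := hlift w hwS rfl fun e he => if_neg he
  have hG0 := gradNorm_nonneg k 𝒯.T₁ w
  set G := gradNorm k 𝒯.T₁ w with hG
  have hsG : s ≤ (|B| * K + C) * E * G := by
    have h3 : |B| * (gradNorm k 𝒯.T₁ (Qh k 𝒯.T₁ u - uh) * G) ≤ |B| * (K * E * G) :=
      mul_le_mul_of_nonneg_left (mul_le_mul_of_nonneg_right hgrad hG0) (abs_nonneg B)
    rw [← hΓ] at hwg₁
    linarith
  have hss : 𝒯.size * s ≤ C' * (|B| * K + C) ^ 2 * E ^ 2 := by
    rcases hs0.eq_or_lt with h0 | h0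
    · rw [← h0, mul_zero]
      positivity
    · refine le_of_mul_le_mul_right ?_ h0
      have h4 := pow_le_pow_left₀ hs0 hsG 2
      calc 𝒯.size * s * s = 𝒯.size * s ^ 2 := by ring
        _ ≤ 𝒯.size * ((|B| * K + C) * E * G) ^ 2 := mul_le_mul_of_nonneg_left h4 𝒯.size_nonneg
        _ = ((|B| * K + C) * E) ^ 2 * (𝒯.size * G ^ 2) := by ring
        _ ≤ ((|B| * K + C) * E) ^ 2 * (C' * s) := mul_le_mul_of_nonneg_left hl (sq_nonneg _)
        _ = _ := by ring
  -- the triangle inequality for `θ - λ_h = (θ - p) + (p - λ_h)`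
  have hedge : edgeNorm Γ (fun e => θ e - lam e) ^ 2
      ≤ 2 * ∑ e ∈ Γ, nrm (edgeMeasure e) (fun x => θ e x - p e x) ^ 2 + 2 * s := by
    rw [edgeNorm, Real.sq_sqrt (Finset.sum_nonneg fun _ _ => integral_nonneg fun _ => sq_nonneg _),
      hs, Finset.mul_sum, Finset.mul_sum, ← Finset.sum_add_distrib]
    refine Finset.sum_le_sum fun e he => ?_
    have m1 : MemLp (fun x => θ e x - p e x) 2 (edgeMeasure e) :=
      (mθ e he).sub (mpoly he (hps e he).1)
    have m3 := mpoly he (hwp e)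
    have m4 : MemLp (θ e - lam e) 2 (edgeMeasure e) := (mθ e he).sub (mpoly he (hwg.mem_Lambda e he))
    rw [← nrm_sq_real m4]
    have h5 : nrm (edgeMeasure e) (θ e - lam e)
        ≤ nrm (edgeMeasure e) (fun x => θ e x - p e x) + nrm (edgeMeasure e) (w.2 e) := by
      refine le_trans (le_of_eq ?_) (nrm_add_le m1 m3)
      congr 1
      ext x
      simp only [hwΓ e he, Pi.sub_apply]
      ring
    have h6 := (pow_le_pow_left₀ (nrm_nonneg _) h5 2).trans add_sq_le
    linarith
  have h7 := mul_le_mul_of_nonneg_left hedge 𝒯.size_nonneg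
  have h8 := hproj p hps
  linarith

end Error

end WGInterface

open WGInterface in
theorem mainTheorem1 (k : ℕ) (σ α B : ℝ) (hα : 0 < α) :
    ∃ C : ℝ, 0 < C ∧ ∀ (Ω₁ Ω₂ : Set Plane) (𝒯 : InterfaceMesh Ω₁ Ω₂), 𝒯.ShapeRegular σ →
      ∀ d : Data, Admissible 𝒯.T₁ k α B d.A₁ → Admissible 𝒯.T₂ k α B d.A₂ →
      MemLp d.f₁ 2 (volume.restrict Ω₁) → MemLp d.f₂ 2 (volume.restrict Ω₂) →
      ∀ u v : Plane → ℝ, MemSobolev Ω₁ (k + 2) u → MemSobolev Ω₂ (k + 2) v →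
      SolvesInterfaceProblem 𝒯 d u v →
      ∀ (uh vh : WeakFun) (lam : Finset Plane → Plane → ℝ), SolvesWG 𝒯 k d uh vh lam →
        gradNorm k 𝒯.T₁ (Qh k 𝒯.T₁ u - uh) + gradNorm k 𝒯.T₂ (Qh k 𝒯.T₂ v - vh)
            ≤ C * 𝒯.size ^ (k + 1) *
              (sobolevNorm Ω₁ (k + 2) u + sobolevNorm Ω₂ (k + 2) v) ∧
        (𝒯.QuasiUniformAtGamma σ →
          edgeNorm 𝒯.gammaEdges (fun e => normalTrace 𝒯.T₁ e (flux Ω₁ d.A₁ u) - lam e)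
            ≤ C * 𝒯.size ^ ((k : ℝ) + 1 / 2) *
              (sobolevNorm Ω₁ (k + 2) u + sobolevNorm Ω₂ (k + 2) v)) := by
  obtain ⟨C₁, hC₁, hcons⟩ := exists_side_consistency k σ α B
  obtain ⟨C₂, hC₂, hlift⟩ := exists_side_lifting k σ
  set K := 2 * C₁ / α with hK
  have hK0 : 0 < K := by positivity
  set L := 2 * C₁ + 2 * (C₂ * (|B| * K + C₁) ^ 2) with hL
  have hL0 : 0 < L := by positivity
  refine ⟨K + Real.sqrt L, by positivity, ?_⟩
  intro Ω₁ Ω₂ 𝒯 hreg d hA₁ hA₂ hf₁ hf₂ u v hu hv hsol uh vh lam hwg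
  have S₁ := InterfaceMesh.side₁ hreg hA₁ hf₁ hu hsol
  have S₂ := InterfaceMesh.side₂ hreg hA₂ hf₂ hv hsol
  have hh := 𝒯.size_nonneg
  have a0 : 0 ≤ sobolevNorm Ω₁ (k + 2) u := Real.sqrt_nonneg _
  have b0 : 0 ≤ sobolevNorm Ω₂ (k + 2) v := Real.sqrt_nonneg _
  obtain ⟨h₁, hproj⟩ := hcons hh S₁
  have hmain := gradNorm_error_le hα hC₁.le S₁ S₂ hsol hwg h₁ (hcons hh S₂).1
  rw [← hK] at hmain
  set h := 𝒯.size with hdef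
  set M := sobolevNorm Ω₁ (k + 2) u + sobolevNorm Ω₂ (k + 2) v with hM
  have hM0 : 0 ≤ M := add_nonneg a0 b0
  have huM : sobolevNorm Ω₁ (k + 2) u ≤ M := le_add_of_nonneg_right b0
  have hpow : 0 ≤ h ^ (k + 1) := pow_nonneg hh _
  refine ⟨?_, fun hquasi => ?_⟩
  · have h3 : 0 ≤ Real.sqrt L * h ^ (k + 1) * M := by positivity
    linarith
  · have hEM : h ^ (k + 1) * sobolevNorm Ω₁ (k + 2) u ≤ h ^ (k + 1) * M :=
      mul_le_mul_of_nonneg_left huM hpow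
    have hsq := size_mul_edgeNorm_sq_le hC₂.le S₁ hwg (K := K) (E := h ^ (k + 1) * M)
      (fun w hw => (h₁ w hw).trans (mul_le_mul_of_nonneg_right
        (mul_le_mul_of_nonneg_left hEM hC₁.le) (gradNorm_nonneg _ _ _)))
      (fun p hp => (hproj hquasi p hp).trans (mul_le_mul_of_nonneg_left
        (pow_le_pow_left₀ (by positivity) hEM 2) hC₁.le))
      (hlift S₁ hquasi)
      ((le_add_of_nonneg_right (gradNorm_nonneg _ _ _)).trans hmain)
    have hgoal : edgeNorm 𝒯.gammaEdges
        (fun e => normalTrace 𝒯.T₁ e (flux Ω₁ d.A₁ u) - lam e)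
        ≤ Real.sqrt L * h ^ ((k : ℝ) + 1 / 2) * M := by
      rcases hh.eq_or_lt with h0 | h0
      · -- a mesh of size zero has no triangles
        have hΓ : 𝒯.gammaEdges = ∅ := by
          refine Finset.eq_empty_of_forall_notMem fun e he => ?_
          obtain ⟨t, ht, -⟩ := Finset.mem_biUnion.1 (S₁.gamma_subset he)
          obtain ⟨c, r, hd, -⟩ := S₁.disc t ht
          have h3 := (S₁.mesh.isTri t ht).diam_pos hd
          have h4 := S₁.diam_le t ht
          linarith
        rw [hΓ, edgeNorm, Finset.sum_empty, Real.sqrt_zero]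
        positivity
      · have hrpow : (h ^ ((k : ℝ) + 1 / 2)) ^ 2 = h ^ (2 * k + 1) := by
          rw [← Real.rpow_natCast, ← Real.rpow_mul hh, ← Real.rpow_natCast]
          congr 1
          push_cast
          ring
        refine le_of_sq_le_sq ?_ (by positivity)
        refine le_of_mul_le_mul_left (hsq.trans (le_of_eq ?_)) h0
        rw [mul_pow, mul_pow (Real.sqrt L * _), mul_pow (Real.sqrt L), Real.sq_sqrt hL0.le, hrpow, hL]
        ring
    have h5 : 0 ≤ K * h ^ ((k : ℝ) + 1 / 2) * M := by positivity
    linarith
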